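/- Let $C\subset\mathbb{CP}^2$ be a real nodal rational curve of degree $5$, that is, the image of a morphism $\varphi:\mathbb{P}^1\to\mathbb{P}^2$ given by three real binary quintic forms without common zero in $\mathbb{CP}^1$, such that over $\mathbb{C}$ the map $\varphi$ is an immersion whose only multiple points are transverse double points (nodes). A real node is called hyperbolic (elliptic) if its two branches are real (complex conjugate). Orient $\varphi(\mathbb{RP}^1)$ by an orientation of $\mathbb{RP}^1$. A smoothing diagram $\Delta_C=(C_\circ;\bigcup_p I_p)$ of $C$ is obtained, up to isotopy of $\mathbb{RP}^2$, from the set of real points of $C$ as follows, in small disjoint disks around the real nodes: each elliptic node is replaced by a small oval around it; each hyperbolic node $p$ is smoothed according to the orientation into two disjoint smooth arcs, and the vanishing cycle $I_p$ is a short closed embedded interval that joins these two arcs transversally and meets $C_\circ$ only in its two endpoints. So the index $p$ runs over the hyperbolic nodes, and the intervals $I_p$ are pairwise disjoint. A quasiline with respect to $\Delta_C$ is a smoothly embedded closed connected curve $L\subset\mathbb{RP}^2$, not contractible in $\mathbb{RP}^2$, such that * $L$ is transverse to $C_\circ$; * for each $p$, either $L\cap I_p=I_p$, or $|L\cap I_p|\le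 1$, $L$ is transverse to $I_p$, and $L$ contains no endpoint of $I_p$; * $L.\Delta_C:=2r+s\le 5$, where $r$ is the number of intervals $I_p$ with $L\cap I_p\neq\varnothing$ and $s$ is the cardinality of $L\cap(C_\circ\setminus\bigcup_p I_p)$. **Lemma.** Let $\Delta_C$ be a smoothing diagram of a real nodal rational curve $C$ of degree $5$ in $\mathbb{RP}^2$. 1. For any two points $p_1,p_2\in\mathbb{RP}^2$, neither of which is an endpoint of an interval $I_p$, there is a quasiline with respect to $\Delta_C$ that passes through $p_1$ and $p_2$. 2. Let finitely many pairs $(p_i,q_i)$ of points of $\mathbb{RP}^2$ be given, none of the points being an endpoint of an interval $I_p$. Assume that no two of the pairs become the same unordered pair of two different points when each interval $I_p$ is collapsed to a point. Then there are quasilines $L_i$ with respect to $\Delta_C$, with $p_i,q_i\in L_i$, such that for all $i\ne j$ the curves $L_i$ and $L_j$ either meet in a single point, transversally, or satisfy $L_i\cap L_j=I_p$ for a single interval $I_p$. -/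

import Mathlib

open Set
open scoped ContDiff LinearAlgebra.Projectivization

/-! ### The real projective plane -/

/-- The real projective plane. -/
def RP2 : Type := ℙ ℝ (Fin 3 → ℝ)

/-- The point of the projective plane with homogeneous coordinates `v`. -/
noncomputable def RP2.mk (v : Fin 3 → ℝ) (hv : v ≠ 0) : RP2 := Projectivization.mk ℝ v hv

/-- Homogeneous coordinates of a point. -/
noncomputable def RP2.coords (x : RP2) : Fin 3 → ℝ := Projectivization.rep x

/-- The quotient topology of `ℝ³ ∖ {0}`. -/
noncomputable instance : TopologicalSpace RP2 :=
  TopologicalSpace.coinduced (fun v : {v : Fin 3 → ℝ // v ≠ 0} => RP2.mk v.1 v.2) inferInstance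

/-- `ψ` is a smooth chart (more precisely, a smooth parametrization of an open subset of the
projective plane by the whole of `ℝ²`): an injective smooth immersion `ℝ² → RP²`. Since `ℝ²` is
simply connected, a smooth map `ℝ² → RP²` is the same as the projectivization of a smooth map
`F : ℝ² → ℝ³ ∖ {0}`, and it is an immersion at `z` iff `F z` and the two partial derivatives of `F`
at `z` are linearly independent. -/
def IsChart (ψ : ℝ × ℝ → RP2) : Prop :=
  Function.Injective ψ ∧
  ∃ (F : ℝ × ℝ → (Fin 3 → ℝ)) (hF : ∀ z, F z ≠ 0),
    ContDiff ℝ ∞ F ∧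
    (∀ z, ψ z = RP2.mk (F z) (hF z)) ∧
    ∀ z, LinearIndependent ℝ ![F z, fderiv ℝ F z (1, 0), fderiv ℝ F z (0, 1)]

/-- `Φ` is a diffeomorphism of the projective plane (a bijection that takes smooth charts to smooth
charts is a local diffeomorphism everywhere). -/
def IsDiffeo (Φ : RP2 → RP2) : Prop :=
  Function.Bijective Φ ∧ ∀ ψ, IsChart ψ → IsChart (Φ ∘ ψ)

/-- `X` is, near its point `x`, a smoothly embedded curve. -/
def IsSmoothCurveAt (X : Set RP2) (x : RP2) : Prop :=
  ∃ ψ, IsChart ψ ∧ ψ 0 = x ∧ ∀ z, ψ z ∈ X ↔ z.2 = 0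

/-- Near `x`, the sets `X` and `Y` are smoothly embedded curves that meet in the single point `x`
and are transverse there. -/
def TransverseAt (X Y : Set RP2) (x : RP2) : Prop :=
  ∃ ψ, IsChart ψ ∧ ψ 0 = x ∧ (∀ z, ψ z ∈ X ↔ z.2 = 0) ∧ (∀ z, ψ z ∈ Y ↔ z.1 = 0)

/-- `L` is a smoothly embedded closed connected curve that is not contractible in the projective
plane. -/
structure IsNoncontractibleCurve (L : Set RP2) : Prop where
  closed : IsClosed L
  connected : IsConnected L
  smooth : ∀ x ∈ L, IsSmoothCurveAt L x
  noncontractible :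
    ¬ ContinuousMap.Nullhomotopic (⟨Subtype.val, continuous_subtype_val⟩ : C(L, RP2))

/-! ### Diagrams and quasilines -/

/-- The underlying point sets of a smoothing diagram: a curve and a family of intervals, each of
which meets the curve exactly in its two endpoints. -/
structure Diagram (ι : Type) where
  curve : Set RP2
  interval : ι → Set RP2

namespace Diagram

variable {ι : Type} (Δ : Diagram ι)

/-- The endpoints of an interval are its points on the curve. -/
def endpoints (k : ι) : Set RP2 := Δ.interval k ∩ Δ.curve

/-- The number `2 r + s`, where `r` is the number of intervals that meet `L`, and `s` is the number
of points of `L` on the curve and off the intervals. -/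
noncomputable def intersectionNumber (L : Set RP2) : ℕ∞ :=
  2 * {k | (L ∩ Δ.interval k).Nonempty}.encard + (L ∩ (Δ.curve \ ⋃ k, Δ.interval k)).encard

/-- Quasilines with respect to a diagram. -/
structure IsQuasiline (L : Set RP2) : Prop where
  isCurve : IsNoncontractibleCurve L
  transverse_curve : ∀ x ∈ L ∩ Δ.curve, TransverseAt L Δ.curve x
  interval : ∀ k,
    ((L ∩ Δ.interval k).encard ≤ 1 ∧
      (∀ x ∈ L ∩ Δ.interval k, TransverseAt L (Δ.interval k) x) ∧
      Disjoint L (Δ.endpoints k)) ∨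
    L ∩ Δ.interval k = Δ.interval k
  bezout : Δ.intersectionNumber L ≤ 5

/-- `x` and `y` become equal after each interval of the diagram is collapsed to a point. -/
def Collapsed (x y : RP2) : Prop :=
  x = y ∨ ∃ k, x ∈ Δ.interval k ∧ y ∈ Δ.interval k

/-- The image of a diagram under a self-map of the projective plane. -/
def map (Φ : RP2 → RP2) : Diagram ι where
  curve := Φ '' Δ.curve
  interval k := Φ '' Δ.interval k

end Diagram

/-! ### Real nodal rational quintics -/

/-- A real nodal rational quintic in the projective plane, given by a parametrization
`[z₀ : z₁] ↦ [f₀(z) : f₁(z) : f₂(z)]` by real binary quintic forms without common zeros on the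
complex projective line. That the curve is nodal means that the complex parametrization is an
immersion, at most two points have the same image, and the two branches through a double point have
different tangent lines. (In particular the parametrization is generically injective, so that it is
the normalization of the curve, and the curve has degree five. As five is odd, the normalization of
any real rational quintic has real points, so that it is the real projective line.) -/
structure NodalRationalQuintic where
  form : Fin 3 → MvPolynomial (Fin 2) ℝ
  homogeneous : ∀ i, (form i).IsHomogeneous 5
  no_base_point : ∀ z : Fin 2 → ℂ, (∀ i, MvPolynomial.aeval z (form i) = 0) → z = 0
  immersed : ∀ z : Fin 2 → ℂ, z ≠ 0 →
    LinearIndependent ℂ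
      (fun (j : Fin 2) (i : Fin 3) => MvPolynomial.aeval z (MvPolynomial.pderiv j (form i)))
  no_triple_point : ∀ z : Fin 3 → Fin 2 → ℂ,
    (∀ a b, a ≠ b → LinearIndependent ℂ ![z a, z b]) →
    ∃ a b, LinearIndependent ℂ
      ![fun i => MvPolynomial.aeval (z a) (form i), fun i => MvPolynomial.aeval (z b) (form i)]
  transverse : ∀ z w : Fin 2 → ℂ, LinearIndependent ℂ ![z, w] →
    ¬ LinearIndependent ℂ
      ![fun i => MvPolynomial.aeval z (form i), fun i => MvPolynomial.aeval w (form i)] →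
    Submodule.span ℂ (range fun (j : Fin 2) (i : Fin 3) =>
        MvPolynomial.aeval z (MvPolynomial.pderiv j (form i))) ≠
      Submodule.span ℂ (range fun (j : Fin 2) (i : Fin 3) =>
        MvPolynomial.aeval w (MvPolynomial.pderiv j (form i)))

namespace NodalRationalQuintic

variable (C : NodalRationalQuintic)

/-- The parametrization sends the point of the complex projective line with homogeneous coordinates
`z` to the real point `x`. -/
def MapsTo (z : Fin 2 → ℂ) (x : RP2) : Prop :=
  z ≠ 0 ∧ ∃ c : ℂ, ∀ i, MvPolynomial.aeval z (C.form i) = c * (x.coords i : ℂ)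

/-- The set of real points of the curve (isolated ones included). -/
def realPoints : Set RP2 := {x | ∃ z, C.MapsTo z x}

/-- The point of the real projective line at angle `θ`. -/
noncomputable def circlePoint (θ : ℝ) : Fin 2 → ℂ := ![(Real.cos θ : ℂ), (Real.sin θ : ℂ)]

/-- The hyperbolic nodes: real points where two real branches cross. -/
def HyperbolicNode : Type :=
  {x : RP2 // ∃ s t : ℝ, LinearIndependent ℂ ![circlePoint s, circlePoint t] ∧
    C.MapsTo (circlePoint s) x ∧ C.MapsTo (circlePoint t) x}

/-- The elliptic nodes: real points where two complex conjugate branches cross. -/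
def EllipticNode : Type :=
  {x : RP2 // ∃ z : Fin 2 → ℂ,
    LinearIndependent ℂ ![z, fun j => (starRingEnd ℂ) (z j)] ∧ C.MapsTo z x}

/-- The position of a real node in the projective plane. -/
def nodePoint : C.HyperbolicNode ⊕ C.EllipticNode → RP2 :=
  Sum.elim Subtype.val Subtype.val

/-- Data for smoothing the real nodes of the curve according to its orientation, inside disjoint
disks around the nodes with coordinates `(u, w)`.

Around a hyperbolic node the curve is `w² = u²`. Both branches are oriented by increasing `u` (with
respect to one orientation of the real projective line that parametrizes the curve), and the
node is replaced by the two arcs `w = g(u)` and `w = -g(u)`, where `g` is a positive smooth function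
equal to `|u|` for `|u| ≥ 1`. As each of these arcs comes in along one branch and goes out along the
other one, this is the smoothing according to the orientation.

Around an elliptic node the curve is the point `u = w = 0`, which is replaced by the oval
`u² + w² = 1`. -/
structure Smoothing where
  chart : C.HyperbolicNode ⊕ C.EllipticNode → ℝ × ℝ → RP2
  isChart : ∀ p, IsChart (chart p)
  center : ∀ p, chart p 0 = C.nodePoint p
  disjoint : ∀ p q, p ≠ q → Disjoint (range (chart p)) (range (chart q))
  hyperbolic : ∀ p z, chart (Sum.inl p) z ∈ C.realPoints ↔ z.2 ^ 2 = z.1 ^ 2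
  oriented : ∀ p, ∃ a b : ℝ → ℝ,
    Continuous a ∧ StrictMono a ∧ (∀ u, C.MapsTo (circlePoint (a u)) (chart (Sum.inl p) (u, u))) ∧
    Continuous b ∧ StrictMono b ∧ (∀ u, C.MapsTo (circlePoint (b u)) (chart (Sum.inl p) (u, -u)))
  elliptic : ∀ p z, chart (Sum.inr p) z ∈ C.realPoints ↔ z = 0
  profile : C.HyperbolicNode → ℝ → ℝ
  profile_smooth : ∀ p, ContDiff ℝ ∞ (profile p)
  profile_pos : ∀ p u, 0 < profile p u
  profile_eq : ∀ p u, 1 ≤ |u| → profile p u = |u|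

/-- The smoothed curve, with the vanishing cycles of the hyperbolic nodes. -/
def Smoothing.diagram {C : NodalRationalQuintic} (S : C.Smoothing) : Diagram C.HyperbolicNode where
  curve := (C.realPoints \ ⋃ p, range (S.chart p)) ∪
    (⋃ p, S.chart (Sum.inl p) '' {z | |z.2| = S.profile p z.1}) ∪
    (⋃ p, S.chart (Sum.inr p) '' {z | z.1 ^ 2 + z.2 ^ 2 = 1})
  interval p := S.chart (Sum.inl p) '' {z | z.1 = 0 ∧ |z.2| ≤ S.profile p 0}

/-- `Δ` is a smoothing diagram of the curve `C`. It is only defined up to isotopy, that is up to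
diffeomorphism, since every diffeomorphism of the real projective plane is isotopic to the
identity. -/
def IsSmoothingDiagram (Δ : Diagram C.HyperbolicNode) : Prop :=
  ∃ (S : C.Smoothing) (Φ : RP2 → RP2), IsDiffeo Φ ∧ Δ = S.diagram.map Φ

end NodalRationalQuintic

open Filter
open Real (sin cos smoothTransition)
open scoped Topology Matrix Real ComplexConjugate

noncomputable section

abbrev R3 : Type := Fin 3 → ℝ

/-- The point of the projective plane with homogeneous coordinates `v` (junk for `v = 0`). -/
def pt (v : R3) : RP2 :=
  open Classical in if h : v ≠ 0 then RP2.mk v h else RP2.mk ![1, 0, 0] (by simp)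

lemma pt_of_ne {v : R3} (h : v ≠ 0) : pt v = RP2.mk v h := by simp [pt, h]

lemma pt_eq_iff {v w : R3} (hv : v ≠ 0) (hw : w ≠ 0) :
    pt v = pt w ↔ ∃ c : ℝ, c ≠ 0 ∧ w = c • v := by
  rw [pt_of_ne hv, pt_of_ne hw]
  refine (Projectivization.mk_eq_mk_iff ℝ v w hv hw).trans ?_
  constructor
  · rintro ⟨a, ha⟩
    refine ⟨(a⁻¹ : ℝˣ), Units.ne_zero _, ?_⟩
    rw [← ha]
    simp [Units.smul_def, smul_smul]
  · rintro ⟨c, hc, rfl⟩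
    refine ⟨(Units.mk0 c hc)⁻¹, ?_⟩
    simp [Units.smul_def, smul_smul, hc]

lemma pt_smul {c : ℝ} (hc : c ≠ 0) (v : R3) : pt (c • v) = pt v := by
  by_cases hv : v = 0
  · simp [hv]
  · exact ((pt_eq_iff hv (smul_ne_zero hc hv)).2 ⟨c, hc, rfl⟩).symm

lemma RP2.coords_ne_zero (x : RP2) : x.coords ≠ 0 := Projectivization.rep_nonzero x

@[simp] lemma pt_coords (x : RP2) : pt x.coords = x := by
  rw [pt_of_ne x.coords_ne_zero]
  exact Projectivization.mk_rep x

lemma exists_pt (x : RP2) : ∃ v : R3, v ≠ 0 ∧ pt v = x := ⟨x.coords, x.coords_ne_zero, pt_coords x⟩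

lemma cross_eq_zero_iff {v w : R3} (hv : v ≠ 0) (hw : w ≠ 0) :
    v ⨯₃ w = 0 ↔ ∃ c : ℝ, c ≠ 0 ∧ w = c • v := by
  constructor
  · intro h
    have h2 : ¬ LinearIndependent ℝ ![v, w] := fun h' =>
      (crossProduct_ne_zero_iff_linearIndependent.2 h') h
    rw [LinearIndependent.pair_iff' hv] at h2
    push Not at h2
    obtain ⟨c, hc⟩ := h2
    exact ⟨c, by rintro rfl; exact hw (by simpa using hc.symm), hc.symm⟩
  · rintro ⟨c, -, rfl⟩
    simp

lemma pt_eq_iff_cross {v w : R3} (hv : v ≠ 0) (hw : w ≠ 0) : pt v = pt w ↔ v ⨯₃ w = 0 := by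
  rw [pt_eq_iff hv hw, cross_eq_zero_iff hv hw]

lemma cross_cross_eq (u a b : R3) : u ⨯₃ (a ⨯₃ b) = (b ⬝ᵥ u) • a - (a ⬝ᵥ u) • b := by
  ext i; fin_cases i <;> simp [cross_apply, dotProduct, Fin.sum_univ_three] <;> ring

lemma cross_cross_eq_zero {u a b : R3} (ha : a ⬝ᵥ u = 0) (hb : b ⬝ᵥ u = 0) : u ⨯₃ (a ⨯₃ b) = 0 := by
  simp [cross_cross_eq, ha, hb]

lemma isOpen_RP2_iff {U : Set RP2} : IsOpen U ↔ IsOpen {v : R3 | v ≠ 0 ∧ pt v ∈ U} := by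
  have ho : IsOpen {v : R3 | v ≠ 0} := isOpen_compl_singleton
  have h1 : IsOpen U ↔ IsOpen ((fun v : {v : R3 // v ≠ 0} => RP2.mk v.1 v.2) ⁻¹' U) :=
    isOpen_coinduced
  rw [h1, ho.isOpenEmbedding_subtypeVal.isOpen_iff_image_isOpen]
  have : Subtype.val '' ((fun v : {v : R3 // v ≠ 0} => RP2.mk v.1 v.2) ⁻¹' U)
      = {v : R3 | v ≠ 0 ∧ pt v ∈ U} := by
    ext v
    constructor
    · rintro ⟨w, hw, rfl⟩
      exact ⟨w.2, by rw [pt_of_ne w.2]; exact hw⟩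
    · rintro ⟨h0, h⟩
      exact ⟨⟨v, h0⟩, by rw [pt_of_ne h0] at h; exact h, rfl⟩
  exact Iff.of_eq (congrArg _ this)

lemma isOpen_image_pt {U : Set R3} (hU : IsOpen U) (h0 : ∀ v ∈ U, v ≠ 0) : IsOpen (pt '' U) := by
  rw [isOpen_RP2_iff]
  have : {v : R3 | v ≠ 0 ∧ pt v ∈ pt '' U} = ⋃ c : {c : ℝ // c ≠ 0}, (fun v => c.1 • v) ⁻¹' U := by
    ext v
    simp only [mem_ofPred_eq, mem_image, mem_iUnion, mem_preimage]
    constructor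
    · rintro ⟨hv, w, hw, h⟩
      obtain ⟨c, hc, rfl⟩ := (pt_eq_iff hv (h0 w hw)).1 h.symm
      exact ⟨⟨c, hc⟩, hw⟩
    · rintro ⟨c, hc⟩
      refine ⟨fun h => h0 _ hc (by simp [h]), _, hc, pt_smul c.2 v⟩
  rw [this]
  exact isOpen_iUnion fun c => hU.preimage (continuous_const_smul c.1)

lemma map_pt_nhds {v : R3} (hv : v ≠ 0) : map pt (𝓝 v) = 𝓝 (pt v) := by
  apply le_antisymm
  · intro s hs
    obtain ⟨U, hUs, hU, hx⟩ := mem_nhds_iff.1 hs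
    have := (isOpen_RP2_iff.1 hU).mem_nhds (show v ∈ {v : R3 | v ≠ 0 ∧ pt v ∈ U} from ⟨hv, hx⟩)
    exact mem_map.2 (mem_of_superset this fun w hw => hUs hw.2)
  · intro s hs
    have h1 : pt ⁻¹' s ∩ {0}ᶜ ∈ 𝓝 v := inter_mem hs (isOpen_compl_singleton.mem_nhds hv)
    obtain ⟨U, hUs, hU, hx⟩ := mem_nhds_iff.1 h1
    refine mem_of_superset ((isOpen_image_pt hU fun v hv => (hUs hv).2).mem_nhds ⟨v, hx, rfl⟩) ?_
    rintro _ ⟨w, hw, rfl⟩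
    exact (hUs hw).1

lemma continuousAt_pt {v : R3} (hv : v ≠ 0) : ContinuousAt pt v := (map_pt_nhds hv).le

lemma continuous_pt_comp {X : Type*} [TopologicalSpace X] {f : X → R3} (hf : Continuous f)
    (h0 : ∀ x, f x ≠ 0) : Continuous fun x => pt (f x) :=
  continuous_iff_continuousAt.2 fun x => (continuousAt_pt (h0 x)).comp hf.continuousAt

lemma continuous_cross {X : Type*} [TopologicalSpace X] {f g : X → R3} (hf : Continuous f)
    (hg : Continuous g) : Continuous fun x => f x ⨯₃ g x := by
  simp only [cross_apply]
  apply continuous_pi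
  intro i
  fin_cases i <;> simp <;> fun_prop

instance : T2Space RP2 := by
  rw [t2Space_iff_disjoint_nhds]
  intro x y hxy
  obtain ⟨v, hv, rfl⟩ := exists_pt x
  obtain ⟨w, hw, rfl⟩ := exists_pt y
  rw [← map_pt_nhds hv, ← map_pt_nhds hw]
  have h : v ⨯₃ w ≠ 0 := fun h => hxy ((pt_eq_iff_cross hv hw).2 h)
  have h1 : ∀ᶠ p : R3 × R3 in 𝓝 (v, w), p.1 ⨯₃ p.2 ≠ 0 :=
    (continuous_cross continuous_fst continuous_snd).continuousAt.eventually_ne h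
  rw [nhds_prod_eq] at h1
  obtain ⟨P, hP, Q, hQ, hPQ⟩ := Filter.eventually_prod_iff.1 h1
  have hv' : ∀ᶠ p in 𝓝 v, p ≠ 0 := isOpen_compl_singleton.mem_nhds hv
  have hw' : ∀ᶠ p in 𝓝 w, p ≠ 0 := isOpen_compl_singleton.mem_nhds hw
  rw [Filter.disjoint_iff]
  refine ⟨_, image_mem_map (hP.and hv'), _, image_mem_map (hQ.and hw'), ?_⟩
  rw [Set.disjoint_left]
  rintro _ ⟨a, ⟨ha, ha0⟩, rfl⟩ ⟨b, ⟨hb, hb0⟩, hab⟩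
  exact hPQ ha hb ((pt_eq_iff_cross ha0 hb0).1 hab.symm)

instance : CompactSpace RP2 := by
  have h : range (fun v : Metric.sphere (0 : R3) 1 => pt v.1) = univ := by
    rw [eq_univ_iff_forall]
    intro x
    obtain ⟨v, hv, rfl⟩ := exists_pt x
    refine ⟨⟨‖v‖⁻¹ • v, ?_⟩, pt_smul (by simpa using hv) v⟩
    simp [norm_smul, hv]
  have h2 : Continuous (fun v : Metric.sphere (0 : R3) 1 => pt v.1) :=
    continuous_pt_comp continuous_subtype_val fun v => by
      intro h0
      have := v.2
      simp [h0] at this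
  exact ⟨h ▸ isCompact_range h2⟩

/-! ### Smooth inverses and local charts -/

/-- The triple product. -/
def trip (u v w : R3) : ℝ := u ⬝ᵥ (v ⨯₃ w)

lemma trip_eq (u v w : R3) : trip u v w = u 0 * (v 1 * w 2 - v 2 * w 1) +
    u 1 * (v 2 * w 0 - v 0 * w 2) + u 2 * (v 0 * w 1 - v 1 * w 0) := by
  simp [trip, cross_apply, dotProduct, Fin.sum_univ_three]

lemma linearIndependent_iff_trip {u v w : R3} : LinearIndependent ℝ ![u, v, w] ↔ trip u v w ≠ 0 := by
  rw [trip, triple_product_eq_det, ← isUnit_iff_ne_zero]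
  exact (Matrix.linearIndependent_rows_iff_isUnit (A := Matrix.of ![u, v, w])).trans
    (Matrix.isUnit_iff_isUnit_det _)

lemma trip_combination {u v w : R3} {a b c : ℝ} (h : trip u v w ≠ 0)
    (h0 : a • u + b • v + c • w = 0) : a = 0 ∧ b = 0 ∧ c = 0 := by
  rw [trip_eq] at h
  have e0 := congrFun h0 0
  have e1 := congrFun h0 1
  have e2 := congrFun h0 2
  simp only [Pi.add_apply, Pi.smul_apply, smul_eq_mul, Pi.zero_apply] at e0 e1 e2
  refine ⟨?_, ?_, ?_⟩ <;> refine (mul_eq_zero.1 ?_).resolve_right h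
  · linear_combination (v 1 * w 2 - v 2 * w 1) * e0 + (v 2 * w 0 - v 0 * w 2) * e1 +
      (v 0 * w 1 - v 1 * w 0) * e2
  · linear_combination (w 1 * u 2 - w 2 * u 1) * e0 + (w 2 * u 0 - w 0 * u 2) * e1 +
      (w 0 * u 1 - w 1 * u 0) * e2
  · linear_combination (u 1 * v 2 - u 2 * v 1) * e0 + (u 2 * v 0 - u 0 * v 2) * e1 +
      (u 0 * v 1 - u 1 * v 0) * e2

lemma exists_equiv_of_injective {E E' : Type*} [NormedAddCommGroup E] [NormedSpace ℝ E]
    [FiniteDimensional ℝ E] [NormedAddCommGroup E'] [NormedSpace ℝ E'] [FiniteDimensional ℝ E']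
    (A : E →L[ℝ] E') (hA : Function.Injective A) (hd : Module.finrank ℝ E = Module.finrank ℝ E') :
    ∃ e : E ≃L[ℝ] E', (e : E →L[ℝ] E') = A :=
  ⟨(LinearEquiv.ofInjectiveOfFinrankEq (A : E →ₗ[ℝ] E') hA hd).toContinuousLinearEquiv, by
    ext x; rfl⟩

/-- A left inverse of a smooth map with injective derivative between spaces of the same dimension
is smooth. -/
lemma contDiffAt_of_leftInverse {E E' : Type*} [NormedAddCommGroup E] [NormedSpace ℝ E]
    [FiniteDimensional ℝ E] [NormedAddCommGroup E'] [NormedSpace ℝ E'] [FiniteDimensional ℝ E']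
    {f : E → E'} {g : E' → E} {x : E} (hf : ContDiffAt ℝ ∞ f x)
    (hA : ∀ h, fderiv ℝ f x h = 0 → h = 0) (hd : Module.finrank ℝ E = Module.finrank ℝ E')
    (hg : ∀ᶠ y in 𝓝 x, g (f y) = y) : ContDiffAt ℝ ∞ g (f x) := by
  obtain ⟨e, he⟩ := exists_equiv_of_injective (fderiv ℝ f x) ((injective_iff_map_eq_zero _).2 hA) hd
  have hn : (∞ : WithTop ℕ∞) ≠ 0 := by simp
  have hf' : HasFDerivAt f (e : E →L[ℝ] E') x := by
    rw [he]; exact (hf.differentiableAt hn).hasFDerivAt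
  have h1 := hf.to_localInverse hf' hn
  refine h1.congr_of_eventuallyEq ?_
  have hs : HasStrictFDerivAt f (e : E →L[ℝ] E') x := hf.hasStrictFDerivAt' hf' hn
  have h2 : ∀ᶠ y in 𝓝 (f x), f (hs.localInverse f e x y) = y := hs.eventually_right_inverse
  have h3 : Tendsto (hs.localInverse f e x) (𝓝 (f x)) (𝓝 x) := hs.localInverse_tendsto
  filter_upwards [h2, h3.eventually hg] with y hy hy'
  rw [hy] at hy'
  exact hy'

/-- Local behaviour of a smooth map with injective derivative. -/
lemma exists_local_inverse {E E' : Type*} [NormedAddCommGroup E] [NormedSpace ℝ E]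
    [FiniteDimensional ℝ E] [NormedAddCommGroup E'] [NormedSpace ℝ E'] [FiniteDimensional ℝ E']
    {f : E → E'} {x : E} (hf : ContDiffAt ℝ ∞ f x)
    (hA : ∀ h, fderiv ℝ f x h = 0 → h = 0) (hd : Module.finrank ℝ E = Module.finrank ℝ E') :
    map f (𝓝 x) = 𝓝 (f x) ∧ ∃ g : E' → E, (∀ᶠ y in 𝓝 x, g (f y) = y) ∧
      ∀ᶠ y in 𝓝 (f x), f (g y) = y := by
  obtain ⟨e, he⟩ := exists_equiv_of_injective (fderiv ℝ f x) ((injective_iff_map_eq_zero _).2 hA) hd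
  have hn : (∞ : WithTop ℕ∞) ≠ 0 := by simp
  have hf' : HasFDerivAt f (e : E →L[ℝ] E') x := by
    rw [he]; exact (hf.differentiableAt hn).hasFDerivAt
  have hs : HasStrictFDerivAt f (e : E →L[ℝ] E') x := hf.hasStrictFDerivAt' hf' hn
  exact ⟨hs.map_nhds_eq_of_equiv, hs.localInverse f e x, hs.eventually_left_inverse,
    hs.eventually_right_inverse⟩

/-- `F` is an immersion at `z` as a map to the projective plane. -/
def ImmAt (F : ℝ × ℝ → R3) (z : ℝ × ℝ) : Prop :=
  trip (F z) (fderiv ℝ F z (1, 0)) (fderiv ℝ F z (0, 1)) ≠ 0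

lemma ImmAt.ne_zero {F : ℝ × ℝ → R3} {z : ℝ × ℝ} (h : ImmAt F z) : F z ≠ 0 := by
  intro h0
  apply h
  simp [trip, h0]

lemma clm_prod_apply {E : Type*} [NormedAddCommGroup E] [NormedSpace ℝ E] (A : ℝ × ℝ →L[ℝ] E)
    (h : ℝ × ℝ) : A h = h.1 • A (1, 0) + h.2 • A (0, 1) := by
  rw [← A.map_smul, ← A.map_smul, ← map_add]
  simp

/-- The cone over a map to the projective plane. -/
def coneMap (F : ℝ × ℝ → R3) (p : ℝ × (ℝ × ℝ)) : R3 := p.1 • F p.2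

lemma fderiv_coneMap {F : ℝ × ℝ → R3} {c : ℝ} {z : ℝ × ℝ} (hF : DifferentiableAt ℝ F z)
    (h : ℝ × (ℝ × ℝ)) : fderiv ℝ (coneMap F) (c, z) h = h.1 • F z + c • fderiv ℝ F z h.2 := by
  have h1 : HasFDerivAt (fun p : ℝ × (ℝ × ℝ) => F p.2)
      ((fderiv ℝ F z).comp (ContinuousLinearMap.snd ℝ ℝ (ℝ × ℝ))) (c, z) :=
    HasFDerivAt.comp (c, z) (g := F) hF.hasFDerivAt hasFDerivAt_snd
  have h2 := (hasFDerivAt_fst (𝕜 := ℝ) (p := (c, z))).smul h1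
  have h3 : fderiv ℝ (coneMap F) (c, z) = _ := h2.fderiv
  rw [h3]
  simp [add_comm]

lemma coneMap_injective {F : ℝ × ℝ → R3} {c : ℝ} {z : ℝ × ℝ} (hF : DifferentiableAt ℝ F z)
    (hi : ImmAt F z) (hc : c ≠ 0) (h : ℝ × (ℝ × ℝ)) (h0 : fderiv ℝ (coneMap F) (c, z) h = 0) :
    h = 0 := by
  rw [fderiv_coneMap hF, clm_prod_apply, smul_add, smul_smul, smul_smul, ← add_assoc] at h0
  obtain ⟨h1, h2, h3⟩ := trip_combination hi h0
  ext <;> simp_all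

lemma contDiffAt_coneMap {F : ℝ × ℝ → R3} {c : ℝ} {z : ℝ × ℝ} (hF : ContDiffAt ℝ ∞ F z) :
    ContDiffAt ℝ ∞ (coneMap F) (c, z) :=
  contDiffAt_fst.smul (ContDiffAt.comp (c, z) (g := F) hF contDiffAt_snd)

lemma finrank_cone : Module.finrank ℝ (ℝ × (ℝ × ℝ)) = Module.finrank ℝ R3 := by simp

lemma continuousAt_trip {X : Type*} [TopologicalSpace X] {x : X} {f g h : X → R3}
    (hf : ContinuousAt f x) (hg : ContinuousAt g x) (hh : ContinuousAt h x) :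
    ContinuousAt (fun x => trip (f x) (g x) (h x)) x := by
  have e : (fun x => trip (f x) (g x) (h x)) = (fun p : R3 × R3 × R3 => trip p.1 p.2.1 p.2.2) ∘
    fun x => (f x, g x, h x) := rfl
  rw [e]
  refine ContinuousAt.comp (Continuous.continuousAt ?_) (hf.prodMk (hg.prodMk hh))
  simp only [trip_eq]
  fun_prop

lemma ImmAt.eventually {F : ℝ × ℝ → R3} {z : ℝ × ℝ} (hF : ContDiffAt ℝ ∞ F z) (hi : ImmAt F z) :
    ∀ᶠ y in 𝓝 z, ImmAt F y := by
  have h1 : ContinuousAt (fderiv ℝ F) z := (hF.fderiv_right (m := 0) (by simp)).continuousAt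
  exact (continuousAt_trip hF.continuousAt (h1.clm_apply continuousAt_const)
    (h1.clm_apply continuousAt_const)).eventually_ne hi

/-- An immersion to the projective plane is locally injective. -/
lemma ImmAt.eventually_injective {F : ℝ × ℝ → R3} {z₀ : ℝ × ℝ} (hF : ContDiffAt ℝ ∞ F z₀)
    (hi : ImmAt F z₀) : ∃ U ∈ 𝓝 z₀, ∀ z ∈ U, ∀ w ∈ U, pt (F z) = pt (F w) → z = w := by
  have h0 := hi.ne_zero
  set N : ℝ × ℝ → ℝ := fun z => F z₀ ⬝ᵥ F z
  have hN0 : N z₀ ≠ 0 := by simpa [N] using h0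
  have hNc : ContinuousAt N z₀ := by
    have := hF.continuousAt
    simp only [N, dotProduct, Fin.sum_univ_three]
    have h := fun i : Fin 3 => (continuousAt_pi.1 this i)
    have h1 := h 0
    have h2 := h 1
    have h3 := h 2
    fun_prop
  obtain ⟨-, g, hg, -⟩ := exists_local_inverse (contDiffAt_coneMap (c := (N z₀)⁻¹) hF)
    (coneMap_injective (hF.differentiableAt (by simp)) hi (inv_ne_zero hN0)) finrank_cone
  have hm : ContinuousAt (fun z => ((N z)⁻¹, z)) z₀ := (hNc.inv₀ hN0).prodMk continuousAt_id
  refine ⟨_, (hm.eventually hg).and (hNc.eventually_ne hN0), ?_⟩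
  rintro z ⟨hz, hzN⟩ w ⟨hw, hwN⟩ h
  have hz0 : F z ≠ 0 := by rintro h; simp [N, h] at hzN
  have hw0 : F w ≠ 0 := by rintro h; simp [N, h] at hwN
  obtain ⟨c, hc, e⟩ := (pt_eq_iff hz0 hw0).1 h
  have : coneMap F ((N z)⁻¹, z) = coneMap F ((N w)⁻¹, w) := by
    simp only [coneMap, e, N, dotProduct_smul, smul_smul, smul_eq_mul]
    congr 1
    field_simp
  rw [this, hw] at hz
  exact (congrArg Prod.snd hz).symm

/-- A smooth diffeomorphism of the line onto the interval `(-1, 1)`. -/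
def squash (x : ℝ) : ℝ := x / √(1 + x ^ 2)

lemma sqrt_pos_aux (x : ℝ) : 0 < 1 + x ^ 2 := by positivity

lemma hasDerivAt_squash (x : ℝ) : HasDerivAt squash ((√(1 + x ^ 2)) ^ 3)⁻¹ x := by
  have h1 : HasDerivAt (fun x : ℝ => √(1 + x ^ 2)) ((2 * x) / (2 * √(1 + x ^ 2))) x := by
    have := ((hasDerivAt_pow 2 x).const_add 1).sqrt (sqrt_pos_aux x).ne'
    simpa using this
  have h0 : √(1 + x ^ 2) ≠ 0 := (Real.sqrt_pos.2 (sqrt_pos_aux x)).ne'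
  have h2 : HasDerivAt squash ((1 * √(1 + x ^ 2) - x * ((2 * x) / (2 * √(1 + x ^ 2)))) /
      √(1 + x ^ 2) ^ 2) x := (hasDerivAt_id x).div h1 h0
  have hs : √(1 + x ^ 2) ^ 2 = 1 + x ^ 2 := Real.sq_sqrt (sqrt_pos_aux x).le
  convert h2 using 1
  generalize √(1 + x ^ 2) = r at *
  field_simp
  linear_combination -hs

lemma contDiff_squash : ContDiff ℝ ∞ squash := by
  refine contDiff_id.div ?_ fun x => (Real.sqrt_pos.2 (sqrt_pos_aux x)).ne'
  exact ContDiff.sqrt (by fun_prop) fun x => (sqrt_pos_aux x).ne'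

lemma squash_strictMono : StrictMono squash := by
  refine strictMono_of_deriv_pos fun x => ?_
  rw [(hasDerivAt_squash x).deriv]
  have := Real.sqrt_pos.2 (sqrt_pos_aux x)
  positivity

@[simp] lemma squash_zero : squash 0 = 0 := by simp [squash]

lemma abs_squash_lt (x : ℝ) : |squash x| < 1 := by
  have h := Real.sqrt_pos.2 (sqrt_pos_aux x)
  rw [squash, abs_div, abs_of_pos h, div_lt_one h]
  exact Real.lt_sqrt_of_sq_lt (by rw [sq_abs]; linarith)

lemma squash_eq_zero {x : ℝ} : squash x = 0 ↔ x = 0 :=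
  ⟨fun h => squash_strictMono.injective (by simpa using h), fun h => by simp [h]⟩

lemma isChart_iff {ψ : ℝ × ℝ → RP2} : IsChart ψ ↔ Function.Injective ψ ∧ ∃ F : ℝ × ℝ → R3,
    ContDiff ℝ ∞ F ∧ (∀ z, ψ z = pt (F z)) ∧ ∀ z, ImmAt F z := by
  constructor
  · rintro ⟨h, F, h0, hs, hp, hl⟩
    exact ⟨h, F, hs, fun z => by rw [pt_of_ne (h0 z), hp], fun z =>
      linearIndependent_iff_trip.1 (hl z)⟩
  · rintro ⟨h, F, hs, hp, hl⟩
    exact ⟨h, F, fun z => (hl z).ne_zero, hs, fun z => by rw [hp, pt_of_ne], fun z =>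
      linearIndependent_iff_trip.2 (hl z)⟩

lemma trip_combo (u v w : R3) (a b c d : ℝ) : trip u (a • v + b • w) (c • v + d • w) =
    (a * d - b * c) * trip u v w := by
  simp only [trip_eq, Pi.add_apply, Pi.smul_apply, smul_eq_mul]; ring

lemma immAt_comp {F : ℝ × ℝ → R3} {ρ : ℝ × ℝ → ℝ × ℝ} {z : ℝ × ℝ}
    (hF : DifferentiableAt ℝ F (ρ z)) (hρ : DifferentiableAt ℝ ρ z) (hi : ImmAt F (ρ z))
    (hd : (fderiv ℝ ρ z (1, 0)).1 * (fderiv ℝ ρ z (0, 1)).2 -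
      (fderiv ℝ ρ z (1, 0)).2 * (fderiv ℝ ρ z (0, 1)).1 ≠ 0) : ImmAt (F ∘ ρ) z := by
  unfold ImmAt
  rw [fderiv_comp z hF hρ]
  simp only [ContinuousLinearMap.comp_apply, Function.comp]
  rw [clm_prod_apply (fderiv ℝ F (ρ z)) (fderiv ℝ ρ z (1, 0)),
    clm_prod_apply (fderiv ℝ F (ρ z)) (fderiv ℝ ρ z (0, 1)), trip_combo]
  exact mul_ne_zero hd hi

/-- Every germ of an immersion to the projective plane contains a chart. -/
lemma exists_chart_of_germ {F : ℝ × ℝ → R3} {z₀ : ℝ × ℝ} (hF : ∀ᶠ z in 𝓝 z₀, ContDiffAt ℝ ∞ F z)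
    (hi : ImmAt F z₀) {U : Set (ℝ × ℝ)} (hU : U ∈ 𝓝 z₀) :
    ∃ ρ : ℝ × ℝ → ℝ × ℝ, IsChart (fun z => pt (F (ρ z))) ∧ (∀ z, ρ z ∈ U) ∧ ρ 0 = z₀ ∧
      (∀ z, (ρ z).1 = z₀.1 ↔ z.1 = 0) ∧ (∀ z, (ρ z).2 = z₀.2 ↔ z.2 = 0) := by
  have hF0 := hF.self_of_nhds
  obtain ⟨W, hW, hinj⟩ := hi.eventually_injective hF0
  have h1 := (((hi.eventually hF0).and hF).and hW).and hU
  obtain ⟨δ, hδ, hball⟩ := Metric.eventually_nhds_iff.1 h1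
  set ρ : ℝ × ℝ → ℝ × ℝ := fun z => (z₀.1 + δ / 2 * squash z.1, z₀.2 + δ / 2 * squash z.2) with hρ
  have hd : ∀ z, dist (ρ z) z₀ < δ := by
    intro z
    have a1 := abs_squash_lt z.1
    have a2 := abs_squash_lt z.2
    rw [Prod.dist_eq, max_lt_iff, Real.dist_eq, Real.dist_eq]
    simp only [hρ, add_sub_cancel_left, abs_mul, abs_of_pos (half_pos hδ)]
    constructor <;> nlinarith
  have hρs : ContDiff ℝ ∞ ρ := by
    have c1 := contDiff_squash.comp (contDiff_fst (𝕜 := ℝ) (E := ℝ) (F := ℝ))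
    have c2 := contDiff_squash.comp (contDiff_snd (𝕜 := ℝ) (E := ℝ) (F := ℝ))
    exact (contDiff_const.add (contDiff_const.mul c1)).prodMk
      (contDiff_const.add (contDiff_const.mul c2))
  have hρinj : Function.Injective ρ := by
    intro z w h
    simp only [hρ, Prod.mk.injEq, add_right_inj, mul_eq_mul_left_iff] at h
    ext
    · exact squash_strictMono.injective (h.1.resolve_right (by positivity))
    · exact squash_strictMono.injective (h.2.resolve_right (by positivity))
  have hder : ∀ z, ∃ a b : ℝ, a ≠ 0 ∧ b ≠ 0 ∧ ∀ h, fderiv ℝ ρ z h = (a * h.1, b * h.2) := by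
    intro z
    have p1 : 0 < √(1 + z.1 ^ 2) := Real.sqrt_pos.2 (sqrt_pos_aux _)
    have p2 : 0 < √(1 + z.2 ^ 2) := Real.sqrt_pos.2 (sqrt_pos_aux _)
    refine ⟨δ / 2 * (√(1 + z.1 ^ 2) ^ 3)⁻¹, δ / 2 * (√(1 + z.2 ^ 2) ^ 3)⁻¹, by positivity,
      by positivity, fun h => ?_⟩
    have c1 := ((hasDerivAt_squash z.1).comp_hasFDerivAt z
      (hasFDerivAt_fst (𝕜 := ℝ) (p := z))).const_mul (δ / 2) |>.const_add z₀.1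
    have c2 := ((hasDerivAt_squash z.2).comp_hasFDerivAt z
      (hasFDerivAt_snd (𝕜 := ℝ) (p := z))).const_mul (δ / 2) |>.const_add z₀.2
    have e : HasFDerivAt ρ _ z := c1.prodMk c2
    rw [e.fderiv]
    simp [mul_assoc]
  refine ⟨ρ, isChart_iff.2 ⟨?_, F ∘ ρ, ?_, fun z => rfl, ?_⟩, fun z => (hball (hd z)).2, ?_, ?_, ?_⟩
  · intro z w h
    exact hρinj (hinj _ (hball (hd z)).1.2 _ (hball (hd w)).1.2 h)
  · rw [contDiff_iff_contDiffAt]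
    exact fun z => ContDiffAt.comp z (hball (hd z)).1.1.2 hρs.contDiffAt
  · intro z
    obtain ⟨a, b, ha, hb, h⟩ := hder z
    refine immAt_comp ((hball (hd z)).1.1.2.differentiableAt (by simp))
      (hρs.contDiffAt.differentiableAt (by simp)) (hball (hd z)).1.1.1 ?_
    simp [h, ha, hb]
  · simp [hρ]
  · intro z; simp [hρ, squash_eq_zero, hδ.ne']
  · intro z; simp [hρ, squash_eq_zero, hδ.ne']

/-- Charts adapted to a pair of transverse functions. -/
lemma exists_adapted_chart {F : ℝ × ℝ → R3} {z₀ : ℝ × ℝ} {f g : ℝ × ℝ → ℝ}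
    (hF : ∀ᶠ z in 𝓝 z₀, ContDiffAt ℝ ∞ F z) (hi : ImmAt F z₀)
    (hf : ∀ᶠ z in 𝓝 z₀, ContDiffAt ℝ ∞ f z) (hg : ∀ᶠ z in 𝓝 z₀, ContDiffAt ℝ ∞ g z)
    (hf0 : f z₀ = 0) (hg0 : g z₀ = 0)
    (hJ : fderiv ℝ g z₀ (1, 0) * fderiv ℝ f z₀ (0, 1) -
      fderiv ℝ g z₀ (0, 1) * fderiv ℝ f z₀ (1, 0) ≠ 0)
    {U : Set (ℝ × ℝ)} (hU : U ∈ 𝓝 z₀) :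
    ∃ ρ : ℝ × ℝ → ℝ × ℝ, IsChart (fun z => pt (F (ρ z))) ∧ (∀ z, ρ z ∈ U) ∧ ρ 0 = z₀ ∧
      (∀ z, f (ρ z) = 0 ↔ z.2 = 0) ∧ (∀ z, g (ρ z) = 0 ↔ z.1 = 0) := by
  set Θ : ℝ × ℝ → ℝ × ℝ := fun z => (g z, f z) with hΘ
  have hΘs : ∀ᶠ z in 𝓝 z₀, ContDiffAt ℝ ∞ Θ z := by
    filter_upwards [hf, hg] with z h1 h2 using h2.prodMk h1
  have hΘd : ∀ z, ContDiffAt ℝ ∞ f z → ContDiffAt ℝ ∞ g z → ∀ h,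
      fderiv ℝ Θ z h = (fderiv ℝ g z h, fderiv ℝ f z h) := by
    intro z h1 h2 h
    have : HasFDerivAt Θ _ z := (h2.differentiableAt (by simp)).hasFDerivAt.prodMk
      (h1.differentiableAt (by simp)).hasFDerivAt
    rw [this.fderiv]; rfl
  set J : ℝ × ℝ → ℝ := fun z => fderiv ℝ g z (1, 0) * fderiv ℝ f z (0, 1) -
      fderiv ℝ g z (0, 1) * fderiv ℝ f z (1, 0) with hJd
  have hker : ∀ z, ContDiffAt ℝ ∞ f z → ContDiffAt ℝ ∞ g z → J z ≠ 0 → ∀ h,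
      fderiv ℝ Θ z h = 0 → h = 0 := by
    intro z h1 h2 h3 h h4
    rw [hΘd z h1 h2, clm_prod_apply (fderiv ℝ g z), clm_prod_apply (fderiv ℝ f z)] at h4
    simp only [Prod.mk_eq_zero, smul_eq_mul] at h4
    simp only [hJd] at h3
    ext
    · refine (mul_eq_zero.1 ?_).resolve_right h3
      linear_combination fderiv ℝ f z (0, 1) * h4.1 - fderiv ℝ g z (0, 1) * h4.2
    · refine (mul_eq_zero.1 ?_).resolve_right h3
      linear_combination fderiv ℝ g z (1, 0) * h4.2 - fderiv ℝ f z (1, 0) * h4.1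
  have hJc : ∀ᶠ z in 𝓝 z₀, J z ≠ 0 := by
    have c1 := (hf.self_of_nhds.fderiv_right (m := 0) (by simp)).continuousAt
    have c2 := (hg.self_of_nhds.fderiv_right (m := 0) (by simp)).continuousAt
    exact ContinuousAt.eventually_ne (((c2.clm_apply continuousAt_const).mul
      (c1.clm_apply continuousAt_const)).sub ((c2.clm_apply continuousAt_const).mul
      (c1.clm_apply continuousAt_const))) hJ
  have hΘ0 : Θ z₀ = 0 := by simp [hΘ, hf0, hg0]
  obtain ⟨hmap, I, hI1, hI2⟩ := exists_local_inverse hΘs.self_of_nhds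
    (hker z₀ hf.self_of_nhds hg.self_of_nhds hJ) rfl
  rw [hΘ0] at hmap hI2
  have hI0 : I 0 = z₀ := by rw [← hΘ0]; exact hI1.self_of_nhds
  have hall : ∀ᶠ z in 𝓝 z₀, ((ContDiffAt ℝ ∞ I (Θ z) ∧ I (Θ z) = z) ∧ ContDiffAt ℝ ∞ F z) ∧
      z ∈ U := by
    filter_upwards [hf, hg, hJc, hI1.eventually_nhds, hF, hU] with z h1 h2 h3 h4 h5 h6
    exact ⟨⟨⟨contDiffAt_of_leftInverse (h2.prodMk h1) (hker z h1 h2 h3) rfl h4, h4.self_of_nhds⟩,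
      h5⟩, h6⟩
  have hall' : ∀ᶠ y in 𝓝 (0 : ℝ × ℝ), ((ContDiffAt ℝ ∞ I y ∧ Θ (I y) = y) ∧
      ContDiffAt ℝ ∞ F (I y)) ∧ I y ∈ U := by
    rw [← hmap, eventually_map]
    filter_upwards [hall] with z hz
    obtain ⟨⟨⟨h1, h2⟩, h3⟩, h4⟩ := hz
    rw [h2]
    exact ⟨⟨⟨h1, rfl⟩, h3⟩, h4⟩
  have hIs := hall'.self_of_nhds.1.1.1
  have hΘs0 := hΘs.self_of_nhds
  have hcomp : (fderiv ℝ Θ z₀).comp (fderiv ℝ I 0) = ContinuousLinearMap.id ℝ _ := by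
    have h1 : HasFDerivAt (Θ ∘ I) ((fderiv ℝ Θ z₀).comp (fderiv ℝ I 0)) 0 := by
      refine HasFDerivAt.comp 0 ?_ (hIs.differentiableAt (by simp)).hasFDerivAt
      rw [hI0]
      exact (hΘs0.differentiableAt (by simp)).hasFDerivAt
    have h2 : HasFDerivAt (Θ ∘ I) (ContinuousLinearMap.id ℝ (ℝ × ℝ)) 0 :=
      (hasFDerivAt_id 0).congr_of_eventuallyEq hI2
    exact h1.unique h2
  have hImm : ImmAt (F ∘ I) 0 := by
    refine immAt_comp (by rw [hI0]; exact hF.self_of_nhds.differentiableAt (by simp))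
      (hIs.differentiableAt (by simp)) (by rwa [hI0]) ?_
    intro hdet
    have e1 := congrArg (fun A => A (1, 0)) hcomp
    have e2 := congrArg (fun A => A (0, 1)) hcomp
    simp only [ContinuousLinearMap.comp_apply, ContinuousLinearMap.id_apply] at e1 e2
    rw [clm_prod_apply (fderiv ℝ Θ z₀)] at e1 e2
    set A := fderiv ℝ I 0 (1, 0)
    set B := fderiv ℝ I 0 (0, 1)
    set P := fderiv ℝ Θ z₀ (1, 0)
    set Q := fderiv ℝ Θ z₀ (0, 1)
    have a1 := congrArg Prod.fst e1
    have a2 := congrArg Prod.snd e1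
    have b1 := congrArg Prod.fst e2
    have b2 := congrArg Prod.snd e2
    simp at a1 a2 b1 b2
    have : (1 : ℝ) = (A.1 * B.2 - A.2 * B.1) * (P.1 * Q.2 - P.2 * Q.1) := by
      linear_combination - (B.1 * P.2 + B.2 * Q.2) * a1 - b2 + (B.1 * P.1 + B.2 * Q.1) * a2
    rw [hdet] at this
    simp at this
  obtain ⟨ρ, hρc, hρU, hρ0, hρ1, hρ2⟩ := exists_chart_of_germ (F := F ∘ I) (z₀ := 0)
    (by filter_upwards [hall'] with y hy using ContDiffAt.comp y hy.1.2 hy.1.1.1) hImm hall'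
  refine ⟨I ∘ ρ, hρc, fun z => (hρU z).2, by simp [hρ0, hI0], fun z => ?_, fun z => ?_⟩
  · have h := hρ2 z
    have := congrArg Prod.snd (hρU z).1.1.2
    simp only [hΘ] at this
    simp only [Function.comp, this]
    simpa using h
  · have h := hρ1 z
    have := congrArg Prod.fst (hρU z).1.1.2
    simp only [hΘ] at this
    simp only [Function.comp, this]
    simpa using h

/-! ### Homogeneous diffeomorphisms and transport of quasilines -/

/-- A diffeomorphism of `ℝ³ ∖ 0` that commutes with scalars. -/
structure HD where
  toFun : R3 → R3
  invFun : R3 → R3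
  smooth : ∀ v, v ≠ 0 → ContDiffAt ℝ ∞ toFun v
  smooth' : ∀ v, v ≠ 0 → ContDiffAt ℝ ∞ invFun v
  homog : ∀ (c : ℝ) v, toFun (c • v) = c • toFun v
  homog' : ∀ (c : ℝ) v, invFun (c • v) = c • invFun v
  left_inv : ∀ v, invFun (toFun v) = v
  right_inv : ∀ v, toFun (invFun v) = v

namespace HD

instance : CoeFun HD fun _ => R3 → R3 := ⟨HD.toFun⟩

def symm (Φ : HD) : HD := ⟨Φ.invFun, Φ.toFun, Φ.smooth', Φ.smooth, Φ.homog', Φ.homog, Φ.right_inv,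
  Φ.left_inv⟩

variable (Φ : HD)

lemma map_zero : Φ 0 = 0 := by simpa using Φ.homog 0 0

lemma ne_zero {v : R3} (hv : v ≠ 0) : Φ v ≠ 0 := by
  intro h
  have := Φ.left_inv v
  rw [h] at this
  exact hv (this ▸ Φ.symm.map_zero)

def trans (Φ Ψ : HD) : HD where
  toFun v := Ψ (Φ v)
  invFun v := Φ.symm (Ψ.symm v)
  smooth v hv := ContDiffAt.comp v (Ψ.smooth _ (Φ.ne_zero hv)) (Φ.smooth v hv)
  smooth' v hv := ContDiffAt.comp v (Φ.symm.smooth _ (Ψ.symm.ne_zero hv)) (Ψ.symm.smooth v hv)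
  homog c v := by rw [Φ.homog, Ψ.homog]
  homog' c v := by rw [Ψ.symm.homog, Φ.symm.homog]
  left_inv v := by
    have h1 := Ψ.left_inv (Φ v)
    have h2 := Φ.left_inv v
    simp only [symm]; rw [h1, h2]
  right_inv v := by
    have h1 := Φ.right_inv (Ψ.symm v)
    have h2 := Ψ.right_inv v
    simp only [symm] at *; rw [h1, h2]

/-- The induced self-map of the projective plane. -/
def map (x : RP2) : RP2 := pt (Φ x.coords)

lemma map_pt {v : R3} (hv : v ≠ 0) : Φ.map (pt v) = pt (Φ v) := by
  obtain ⟨c, hc, h⟩ := (pt_eq_iff hv (pt v).coords_ne_zero).1 (pt_coords (pt v)).symm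
  rw [map, h, Φ.homog, pt_smul hc]

lemma map_symm_map (x : RP2) : Φ.symm.map (Φ.map x) = x := by
  obtain ⟨v, hv, rfl⟩ := exists_pt x
  rw [Φ.map_pt hv, Φ.symm.map_pt (Φ.ne_zero hv)]
  exact congrArg pt (Φ.left_inv v)

lemma map_map_symm (x : RP2) : Φ.map (Φ.symm.map x) = x := Φ.symm.map_symm_map x

lemma map_bijective : Function.Bijective Φ.map :=
  Function.bijective_iff_has_inverse.2 ⟨Φ.symm.map, Φ.map_symm_map, Φ.map_map_symm⟩

lemma differentiableAt {v : R3} (hv : v ≠ 0) : DifferentiableAt ℝ Φ v :=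
  (Φ.smooth v hv).differentiableAt (by simp)

lemma fderiv_self {v : R3} (hv : v ≠ 0) : fderiv ℝ Φ v v = Φ v := by
  have h1 : HasDerivAt (fun t : ℝ => Φ (t • v)) (fderiv ℝ Φ v ((1 : ℝ) • v)) 1 := by
    have h2 : HasDerivAt (fun t : ℝ => t • v) ((1 : ℝ) • v) 1 := (hasDerivAt_id 1).smul_const v
    have h3 : HasFDerivAt Φ (fderiv ℝ Φ v) ((1 : ℝ) • v) := by
      rw [one_smul]; exact (Φ.differentiableAt hv).hasFDerivAt
    exact h3.comp_hasDerivAt 1 h2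
  have h4 : HasDerivAt (fun t : ℝ => Φ (t • v)) ((1 : ℝ) • Φ v) 1 := by
    simp only [Φ.homog]
    exact (hasDerivAt_id 1).smul_const (Φ v)
  simpa using h1.unique h4

lemma fderiv_injective {v : R3} (hv : v ≠ 0) (h : R3) (h0 : fderiv ℝ Φ v h = 0) : h = 0 := by
  have h1 : HasFDerivAt (fun w => Φ.symm (Φ w)) ((fderiv ℝ Φ.symm (Φ v)).comp (fderiv ℝ Φ v)) v :=
    (Φ.symm.differentiableAt (Φ.ne_zero hv)).hasFDerivAt.comp v (Φ.differentiableAt hv).hasFDerivAt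
  have h2 : (fun w => Φ.symm (Φ w)) = id := funext Φ.left_inv
  rw [h2] at h1
  have h3 := congrArg (fun A => A h) (h1.unique (hasFDerivAt_id v))
  simp only [ContinuousLinearMap.comp_apply, h0] at h3
  simpa using h3.symm

lemma trip_fderiv_ne_zero {u v w : R3} (h : trip u v w ≠ 0) :
    trip (Φ u) (fderiv ℝ Φ u v) (fderiv ℝ Φ u w) ≠ 0 := by
  have hu : u ≠ 0 := by rintro rfl; simp [trip] at h
  rw [← linearIndependent_iff_trip] at h ⊢
  have := h.map' (fderiv ℝ Φ u : R3 →ₗ[ℝ] R3) (LinearMap.ker_eq_bot'.2 (Φ.fderiv_injective hu))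
  have e : ![Φ u, fderiv ℝ Φ u v, fderiv ℝ Φ u w] = (fderiv ℝ Φ u : R3 →ₗ[ℝ] R3) ∘ ![u, v, w] := by
    funext i
    fin_cases i <;> simp [Φ.fderiv_self hu]
  rw [e]
  exact this

lemma immAt_comp {F : ℝ × ℝ → R3} {z : ℝ × ℝ} (hF : DifferentiableAt ℝ F z) (h : ImmAt F z) :
    ImmAt (fun z => Φ (F z)) z := by
  have h1 : HasFDerivAt (fun z => Φ (F z)) ((fderiv ℝ Φ (F z)).comp (fderiv ℝ F z)) z :=
    (Φ.differentiableAt h.ne_zero).hasFDerivAt.comp z hF.hasFDerivAt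
  unfold ImmAt
  rw [h1.fderiv]
  exact Φ.trip_fderiv_ne_zero h

lemma isDiffeo : IsDiffeo Φ.map := by
  refine ⟨Φ.map_bijective, fun ψ hψ => ?_⟩
  obtain ⟨hi, F, hF, hp, hI⟩ := isChart_iff.1 hψ
  refine isChart_iff.2 ⟨Φ.map_bijective.1.comp hi, fun z => Φ (F z), ?_, fun z => ?_, fun z => ?_⟩
  · rw [contDiff_iff_contDiffAt]
    exact fun z => ContDiffAt.comp z (Φ.smooth _ (hI z).ne_zero) hF.contDiffAt
  · simp [hp, Φ.map_pt (hI z).ne_zero]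
  · exact Φ.immAt_comp (hF.contDiffAt.differentiableAt (by simp)) (hI z)

end HD

lemma map_nhds_of_immAt {F : ℝ × ℝ → R3} {z : ℝ × ℝ} (hF : ContDiffAt ℝ ∞ F z) (hi : ImmAt F z) :
    map (fun z => pt (F z)) (𝓝 z) = 𝓝 (pt (F z)) := by
  have h1 := (exists_local_inverse (contDiffAt_coneMap (c := 1) hF)
    (coneMap_injective (hF.differentiableAt (by simp)) hi one_ne_zero) finrank_cone).1
  have h2 : coneMap F (1, z) = F z := by simp [coneMap]
  rw [h2] at h1
  rw [← map_pt_nhds hi.ne_zero, ← h1, map_map]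
  have h3 : map Prod.snd (𝓝 ((1 : ℝ), z)) = 𝓝 z := map_snd_nhds _
  conv_lhs => rw [← h3, map_map]
  refine Filter.map_congr ?_
  have h4 : ∀ᶠ p : ℝ × (ℝ × ℝ) in 𝓝 (1, z), p.1 ≠ 0 := continuousAt_fst.eventually_ne one_ne_zero
  filter_upwards [h4] with p hp
  simp [coneMap, pt_smul hp]

lemma IsChart.map_nhds {ψ : ℝ × ℝ → RP2} (h : IsChart ψ) (z : ℝ × ℝ) : map ψ (𝓝 z) = 𝓝 (ψ z) := by
  obtain ⟨-, F, hF, hp, hI⟩ := isChart_iff.1 h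
  obtain rfl : ψ = fun z => pt (F z) := funext hp
  exact map_nhds_of_immAt hF.contDiffAt (hI z)

lemma IsChart.continuous {ψ : ℝ × ℝ → RP2} (h : IsChart ψ) : Continuous ψ :=
  continuous_iff_continuousAt.2 fun z => (h.map_nhds z).le

lemma hasFDerivAt_affine (v b d : R3) (z : ℝ × ℝ) :
    HasFDerivAt (fun z : ℝ × ℝ => v + (z.1 • b + z.2 • d))
      ((ContinuousLinearMap.fst ℝ ℝ ℝ).smulRight b + (ContinuousLinearMap.snd ℝ ℝ ℝ).smulRight d)
      z :=
  ((hasFDerivAt_fst.smul_const b).add (hasFDerivAt_snd.smul_const d)).const_add v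

lemma immAt_affine {v b d : R3} (h : trip v b d ≠ 0) :
    ImmAt (fun z : ℝ × ℝ => v + (z.1 • b + z.2 • d)) 0 := by
  unfold ImmAt
  rw [(hasFDerivAt_affine v b d 0).fderiv]
  simpa using h

lemma exists_trip_ne_zero {v : R3} (hv : v ≠ 0) : ∃ b d : R3, trip v b d ≠ 0 := by
  by_contra! h
  apply hv
  have h0 := h ![0, 1, 0] ![0, 0, 1]
  have h1 := h ![0, 0, 1] ![1, 0, 0]
  have h2 := h ![1, 0, 0] ![0, 1, 0]
  simp [trip_eq] at h0 h1 h2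
  ext i; fin_cases i <;> simp [h0, h1, h2]

lemma exists_chart_at (x : RP2) : ∃ ψ, IsChart ψ ∧ ψ 0 = x := by
  obtain ⟨v, hv, rfl⟩ := exists_pt x
  obtain ⟨b, d, h⟩ := exists_trip_ne_zero hv
  obtain ⟨ρ, h1, -, h2, -⟩ := exists_chart_of_germ (F := fun z : ℝ × ℝ => v + (z.1 • b + z.2 • d))
    (z₀ := 0) (.of_forall fun z => by fun_prop) (immAt_affine h) univ_mem
  exact ⟨_, h1, by simp [h2]⟩

lemma IsDiffeo.continuous {Φ : RP2 → RP2} (h : IsDiffeo Φ) : Continuous Φ := by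
  refine continuous_iff_continuousAt.2 fun x => ?_
  obtain ⟨ψ, hψ, rfl⟩ := exists_chart_at x
  rw [ContinuousAt, ← hψ.map_nhds, tendsto_map'_iff]
  exact (h.2 ψ hψ).continuous.continuousAt

lemma TransverseAt.image {Φ : RP2 → RP2} (h : IsDiffeo Φ) {X Y : Set RP2} {x : RP2}
    (ht : TransverseAt X Y x) : TransverseAt (Φ '' X) (Φ '' Y) (Φ x) := by
  obtain ⟨ψ, h1, h2, h3, h4⟩ := ht
  refine ⟨Φ ∘ ψ, h.2 ψ h1, by simp [h2], fun z => ?_, fun z => ?_⟩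
  · rw [← h3]; exact h.1.1.mem_set_image
  · rw [← h4]; exact h.1.1.mem_set_image

lemma IsNoncontractibleCurve.image {Φ : RP2 → RP2} (h : IsDiffeo Φ) {L : Set RP2}
    (hL : IsNoncontractibleCurve L) : IsNoncontractibleCurve (Φ '' L) where
  closed := (hL.closed.isCompact.image h.continuous).isClosed
  connected := hL.connected.image _ h.continuous.continuousOn
  smooth := by
    rintro _ ⟨x, hx, rfl⟩
    obtain ⟨ψ, h1, h2, h3⟩ := hL.smooth x hx
    exact ⟨Φ ∘ ψ, h.2 ψ h1, by simp [h2], fun z => by rw [← h3]; exact h.1.1.mem_set_image⟩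
  noncontractible := by
    intro hn
    apply hL.noncontractible
    let e : RP2 ≃ₜ RP2 := Continuous.homeoOfEquivCompactToT2 (f := Equiv.ofBijective Φ h.1)
      h.continuous
    let j : C(L, Φ '' L) := ⟨fun x => ⟨Φ x.1, mem_image_of_mem Φ x.2⟩,
      (h.continuous.comp continuous_subtype_val).subtype_mk _⟩
    have h1 := (hn.comp_left j).comp_right (⟨e.symm, e.symm.continuous⟩ : C(RP2, RP2))
    convert h1 using 1
    ext x
    exact (e.symm_apply_apply x.1).symm

namespace Diagram

variable {ι : Type} {Δ : Diagram ι} {Φ : RP2 → RP2}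

lemma map_endpoints (h : IsDiffeo Φ) (k : ι) : (Δ.map Φ).endpoints k = Φ '' Δ.endpoints k :=
  (image_inter h.1.1).symm

lemma IsQuasiline.image (h : IsDiffeo Φ) {L : Set RP2} (hL : Δ.IsQuasiline L) :
    (Δ.map Φ).IsQuasiline (Φ '' L) where
  isCurve := hL.isCurve.image h
  transverse_curve := by
    rintro _ ⟨⟨x, hx, rfl⟩, hc⟩
    exact (hL.transverse_curve x ⟨hx, h.1.1.mem_set_image.1 hc⟩).image h
  interval k := by
    simp only [map_endpoints h]
    simp only [Diagram.map, ← image_inter h.1.1]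
    rcases hL.interval k with ⟨h1, h2, h3⟩ | h1
    · refine Or.inl ⟨by rwa [h.1.1.encard_image], ?_, (disjoint_image_iff h.1.1).2 h3⟩
      rintro _ ⟨x, hx, rfl⟩
      exact (h2 x hx).image h
    · exact Or.inr (by rw [h1])
  bezout := by
    refine le_trans (le_of_eq ?_) hL.bezout
    unfold intersectionNumber
    simp only [Diagram.map, ← image_inter h.1.1, ← image_iUnion, ← image_sdiff h.1.1,
      h.1.1.encard_image, image_nonempty]

lemma map_collapsed (h : IsDiffeo Φ) {x y : RP2} : (Δ.map Φ).Collapsed (Φ x) (Φ y) ↔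
    Δ.Collapsed x y := by
  simp [Collapsed, Diagram.map, h.1.1.eq_iff]

/-- The existence of systems of quasilines through given pairs of points. -/
def HasQuasilines (Δ : Diagram ι) : Prop := ∀ (n : ℕ) (p q : Fin n → RP2),
      (∀ i k, p i ∉ Δ.endpoints k) → (∀ i k, q i ∉ Δ.endpoints k) →
      (∀ i j, i ≠ j → ¬ Δ.Collapsed (p i) (q i) →
        ¬ (Δ.Collapsed (p i) (p j) ∧ Δ.Collapsed (q i) (q j)) ∧
        ¬ (Δ.Collapsed (p i) (q j) ∧ Δ.Collapsed (q i) (p j))) →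
      ∃ L : Fin n → Set RP2, (∀ i, Δ.IsQuasiline (L i) ∧ p i ∈ L i ∧ q i ∈ L i) ∧ ∀ i j, i ≠ j →
          (∃ x, L i ∩ L j = {x} ∧ TransverseAt (L i) (L j) x) ∨
          (∃ k, L i ∩ L j = Δ.interval k)

lemma HasQuasilines.map (h : IsDiffeo Φ) (hΔ : Δ.HasQuasilines) : (Δ.map Φ).HasQuasilines := by
  intro n p q hp hq hpq
  choose p' hp' using fun i => h.1.2 (p i)
  choose q' hq' using fun i => h.1.2 (q i)
  obtain rfl : p = fun i => Φ (p' i) := funext fun i => (hp' i).symm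
  obtain rfl : q = fun i => Φ (q' i) := funext fun i => (hq' i).symm
  simp only [map_endpoints h, h.1.1.mem_set_image, map_collapsed h] at hp hq hpq
  obtain ⟨L, h1, h2⟩ := hΔ n p' q' hp hq hpq
  refine ⟨fun i => Φ '' L i, fun i => ⟨(h1 i).1.image h, mem_image_of_mem Φ (h1 i).2.1,
    mem_image_of_mem Φ (h1 i).2.2⟩, fun i j hij => ?_⟩
  rcases h2 i j hij with ⟨x, hx, ht⟩ | ⟨k, hk⟩
  · exact Or.inl ⟨Φ x, by rw [← image_inter h.1.1, hx, image_singleton], ht.image h⟩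
  · exact Or.inr ⟨k, by rw [← image_inter h.1.1, hk]; rfl⟩

end Diagram

/-! ### Families of disjoint charts -/

/-- A family of charts with disjoint ranges, given by their lifts. -/
structure ChartFamily (ι : Type) where
  F : ι → ℝ × ℝ → R3
  smooth : ∀ k, ContDiff ℝ ∞ (F k)
  imm : ∀ k z, ImmAt (F k) z
  inj : ∀ k l z w, pt (F k z) = pt (F l w) → k = l ∧ z = w

namespace ChartFamily

variable {ι : Type} (Ch : ChartFamily ι)

lemma ne_zero (k : ι) (z : ℝ × ℝ) : Ch.F k z ≠ 0 := (Ch.imm k z).ne_zero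

lemma inj' {k : ι} {z w : ℝ × ℝ} (h : pt (Ch.F k z) = pt (Ch.F k w)) : z = w := (Ch.inj _ _ _ _ h).2

lemma map_nhds (k : ι) (z : ℝ × ℝ) : Filter.map (fun z => pt (Ch.F k z)) (𝓝 z) = 𝓝 (pt (Ch.F k z)) :=
  map_nhds_of_immAt (Ch.smooth k).contDiffAt (Ch.imm k z)

lemma continuous (k : ι) : Continuous fun z => pt (Ch.F k z) :=
  continuous_pt_comp (Ch.smooth k).continuous (Ch.ne_zero k)

lemma isOpen_image (k : ι) {U : Set (ℝ × ℝ)} (hU : IsOpen U) :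
    IsOpen ((fun z => pt (Ch.F k z)) '' U) := by
  rw [isOpen_iff_mem_nhds]
  rintro _ ⟨z, hz, rfl⟩
  rw [← Ch.map_nhds]
  exact image_mem_map (hU.mem_nhds hz)

/-- Inverse of the cone over the charts. -/
def conv (k : ι) : R3 → ℝ × (ℝ × ℝ) :=
  Function.invFunOn (coneMap (Ch.F k)) {p | p.1 ≠ 0}

lemma cone_injOn (k : ι) : InjOn (coneMap (Ch.F k)) {p | p.1 ≠ 0} := by
  rintro ⟨c, z⟩ hc ⟨d, w⟩ hd h
  simp only [coneMap, mem_ofPred_eq] at *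
  have h1 : pt (Ch.F k z) = pt (Ch.F k w) := by rw [← pt_smul hc, h, pt_smul hd]
  obtain rfl := Ch.inj' h1
  rw [smul_left_injective ℝ (Ch.ne_zero k z) h]

lemma conv_smul (k : ι) {c : ℝ} (hc : c ≠ 0) (z : ℝ × ℝ) : Ch.conv k (c • Ch.F k z) = (c, z) :=
  (Ch.cone_injOn k).leftInvOn_invFunOn (show (c, z) ∈ {p : ℝ × (ℝ × ℝ) | p.1 ≠ 0} from hc)

lemma contDiffAt_conv (k : ι) {c : ℝ} (hc : c ≠ 0) (z : ℝ × ℝ) :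
    ContDiffAt ℝ ∞ (Ch.conv k) (c • Ch.F k z) := by
  have h1 : ∀ᶠ p : ℝ × (ℝ × ℝ) in 𝓝 (c, z), Ch.conv k (coneMap (Ch.F k) p) = p := by
    filter_upwards [continuousAt_fst.eventually_ne (show (c, z).1 ≠ 0 from hc)] with p hp
      using Ch.conv_smul k hp p.2
  exact contDiffAt_of_leftInverse (f := coneMap (Ch.F k)) (x := (c, z))
    (contDiffAt_coneMap (Ch.smooth k).contDiffAt)
    (coneMap_injective ((Ch.smooth k).contDiffAt.differentiableAt (by simp)) (Ch.imm k z) hc)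
    finrank_cone h1

lemma eventually_cone (k : ι) {c : ℝ} (hc : c ≠ 0) (z : ℝ × ℝ) {P : ℝ → ℝ × ℝ → Prop}
    (hP : ∀ᶠ p : ℝ × (ℝ × ℝ) in 𝓝 (c, z), P p.1 p.2) :
    ∀ᶠ v in 𝓝 (c • Ch.F k z), ∃ d w, d ≠ 0 ∧ v = d • Ch.F k w ∧ P d w := by
  have h1 := (exists_local_inverse (contDiffAt_coneMap (c := c) (Ch.smooth k).contDiffAt)
    (coneMap_injective ((Ch.smooth k).contDiffAt.differentiableAt (by simp)) (Ch.imm k z) hc)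
    finrank_cone).1
  have h2 : coneMap (Ch.F k) (c, z) = c • Ch.F k z := rfl
  rw [← h2, ← h1, eventually_map]
  filter_upwards [hP, continuousAt_fst.eventually_ne (show (c, z).1 ≠ 0 from hc)] with p hp h0
  exact ⟨p.1, p.2, h0, rfl, hp⟩

open Classical in
/-- The map that moves the points in the ranges of the charts by self-maps of the plane. -/
def move (η : ι → ℝ × ℝ → ℝ × ℝ) (v : R3) : R3 :=
  if h : ∃ p : ι × ℝ × (ℝ × ℝ), p.2.1 ≠ 0 ∧ v = p.2.1 • Ch.F p.1 p.2.2 then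
    h.choose.2.1 • Ch.F h.choose.1 (η h.choose.1 h.choose.2.2) else v

lemma move_smul (η : ι → ℝ × ℝ → ℝ × ℝ) (k : ι) {c : ℝ} (hc : c ≠ 0) (z : ℝ × ℝ) :
    Ch.move η (c • Ch.F k z) = c • Ch.F k (η k z) := by
  have h : ∃ p : ι × ℝ × (ℝ × ℝ), p.2.1 ≠ 0 ∧ c • Ch.F k z = p.2.1 • Ch.F p.1 p.2.2 :=
    ⟨(k, c, z), hc, rfl⟩
  rw [move, dif_pos h]
  obtain ⟨h1, h2⟩ := h.choose_spec
  generalize h.choose = p at *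
  obtain ⟨l, d, w⟩ := p
  simp only at h1 h2 ⊢
  have h3 : pt (Ch.F k z) = pt (Ch.F l w) := by rw [← pt_smul hc, h2, pt_smul h1]
  obtain ⟨rfl, rfl⟩ := Ch.inj _ _ _ _ h3
  rw [smul_left_injective ℝ (Ch.ne_zero k z) h2]

lemma move_of_not (η : ι → ℝ × ℝ → ℝ × ℝ) {v : R3} (h : ∀ k (c : ℝ) z, c ≠ 0 → v ≠ c • Ch.F k z) :
    Ch.move η v = v := by
  rw [move, dif_neg]
  rintro ⟨⟨k, c, z⟩, hc, hv⟩
  exact h k c z hc hv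

lemma move_eq_self {η : ι → ℝ × ℝ → ℝ × ℝ} {K : ι → Set (ℝ × ℝ)} (hK : ∀ k, ∀ z ∉ K k, η k z = z)
    {v : R3} (h : ∀ k, pt v ∉ (fun z => pt (Ch.F k z)) '' K k) : Ch.move η v = v := by
  by_cases h1 : ∃ k, ∃ c : ℝ, ∃ z, c ≠ 0 ∧ v = c • Ch.F k z
  · obtain ⟨k, c, z, hc, rfl⟩ := h1
    rw [Ch.move_smul η k hc, hK]
    intro hz
    exact h k ⟨z, hz, (pt_smul hc _).symm⟩
  · push Not at h1
    exact Ch.move_of_not η h1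

lemma move_homog (η : ι → ℝ × ℝ → ℝ × ℝ) (d : ℝ) (v : R3) : Ch.move η (d • v) = d • Ch.move η v := by
  by_cases hd : d = 0
  · subst hd
    simp only [zero_smul]
    exact Ch.move_of_not η fun k c z hc h => smul_ne_zero hc (Ch.ne_zero k z) h.symm
  by_cases h1 : ∃ k, ∃ c : ℝ, ∃ z, c ≠ 0 ∧ v = c • Ch.F k z
  · obtain ⟨k, c, z, hc, rfl⟩ := h1
    rw [smul_smul, Ch.move_smul η k (mul_ne_zero hd hc), Ch.move_smul η k hc, smul_smul]
  · push Not at h1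
    rw [Ch.move_of_not η h1, Ch.move_of_not η]
    intro k c z hc h
    refine h1 k (d⁻¹ * c) z (mul_ne_zero (inv_ne_zero hd) hc) ?_
    rw [mul_smul, ← h, smul_smul, inv_mul_cancel₀ hd, one_smul]

lemma move_move {η ζ : ι → ℝ × ℝ → ℝ × ℝ} (h : ∀ k z, ζ k (η k z) = z) (v : R3) :
    Ch.move ζ (Ch.move η v) = v := by
  by_cases h1 : ∃ k, ∃ c : ℝ, ∃ z, c ≠ 0 ∧ v = c • Ch.F k z
  · obtain ⟨k, c, z, hc, rfl⟩ := h1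
    rw [Ch.move_smul η k hc, Ch.move_smul ζ k hc, h]
  · push Not at h1
    rw [Ch.move_of_not η h1, Ch.move_of_not ζ h1]

lemma contDiffAt_move [Finite ι] {η : ι → ℝ × ℝ → ℝ × ℝ} {K : ι → Set (ℝ × ℝ)}
    (hη : ∀ k, ContDiff ℝ ∞ (η k)) (hKc : ∀ k, IsCompact (K k))
    (hK : ∀ k, ∀ z ∉ K k, η k z = z) {v : R3} (hv : v ≠ 0) : ContDiffAt ℝ ∞ (Ch.move η) v := by
  by_cases h1 : ∃ k, ∃ c : ℝ, ∃ z, c ≠ 0 ∧ v = c • Ch.F k z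
  · obtain ⟨k, c, z, hc, rfl⟩ := h1
    have h2 : ContDiffAt ℝ ∞ (fun v => (Ch.conv k v).1 • Ch.F k (η k (Ch.conv k v).2))
        (c • Ch.F k z) := by
      have := Ch.contDiffAt_conv k hc z
      exact this.fst.smul (ContDiffAt.comp _ (g := Ch.F k ∘ η k) ((Ch.smooth k).comp (hη k)).contDiffAt
        this.snd)
    refine h2.congr_of_eventuallyEq ?_
    filter_upwards [Ch.eventually_cone k hc z (P := fun _ _ => True) (by simp)] with v hv
    obtain ⟨d, w, hd, rfl, -⟩ := hv
    rw [Ch.move_smul η k hd, Ch.conv_smul k hd]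
  · push Not at h1
    have h2 : ∀ᶠ w in 𝓝 v, ∀ k, pt w ∉ (fun z => pt (Ch.F k z)) '' K k := by
      rw [eventually_all]
      intro k
      have hc : IsClosed ((fun z => pt (Ch.F k z)) '' K k) := ((hKc k).image (Ch.continuous k)).isClosed
      refine (continuousAt_pt hv).eventually (hc.isOpen_compl.mem_nhds ?_)
      rintro ⟨z, -, hz⟩
      obtain ⟨c, hc, h⟩ := (pt_eq_iff (Ch.ne_zero k z) hv).1 hz
      exact h1 k c z hc h
    refine contDiffAt_id.congr_of_eventuallyEq ?_
    filter_upwards [h2] with w hw using Ch.move_eq_self hK hw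

/-- The diffeomorphism of the projective plane that acts in the given charts by diffeomorphisms of
the plane with compact support. -/
def hd [Finite ι] (η ζ : ι → ℝ × ℝ → ℝ × ℝ) (K : ι → Set (ℝ × ℝ))
    (hη : ∀ k, ContDiff ℝ ∞ (η k)) (hζ : ∀ k, ContDiff ℝ ∞ (ζ k)) (hKc : ∀ k, IsCompact (K k))
    (hK : ∀ k, ∀ z ∉ K k, η k z = z) (h1 : ∀ k z, ζ k (η k z) = z) (h2 : ∀ k z, η k (ζ k z) = z) :
    HD where
  toFun := Ch.move η
  invFun := Ch.move ζ
  smooth _ hv := Ch.contDiffAt_move hη hKc hK hv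
  smooth' _ hv := Ch.contDiffAt_move hζ hKc (fun k z hz => by
    conv_lhs => rw [← hK k z hz]
    exact h1 k z) hv
  homog := Ch.move_homog η
  homog' := Ch.move_homog ζ
  left_inv := Ch.move_move h1
  right_inv := Ch.move_move h2

end ChartFamily

/-! ### The double cover of the projective plane -/

/-- The unit sphere for the supremum norm. -/
abbrev Sph : Type := {v : R3 // ‖v‖ = 1}

lemma unit_cast_eq (u : ℤˣ) : ((u : ℤ) : ℝ) = 1 ∨ ((u : ℤ) : ℝ) = -1 := by
  rcases Int.units_eq_one_or u with rfl | rfl <;> simp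

instance : MulAction ℤˣ Sph where
  smul u v := ⟨((u : ℤ) : ℝ) • v.1, by rcases unit_cast_eq u with h | h <;> simp [h, v.2]⟩
  one_smul v := Subtype.ext (by change (((1 : ℤˣ) : ℤ) : ℝ) • v.1 = v.1; simp)
  mul_smul u w v := Subtype.ext (by
    change (((u * w : ℤˣ) : ℤ) : ℝ) • v.1 = ((u : ℤ) : ℝ) • ((w : ℤ) : ℝ) • v.1
    rw [smul_smul]; push_cast; rfl)

lemma Sph.smul_val (u : ℤˣ) (v : Sph) : (u • v).1 = ((u : ℤ) : ℝ) • v.1 := rfl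

lemma Sph.ne_zero (v : Sph) : v.1 ≠ 0 := by
  intro h
  have := v.2
  simp [h] at this

lemma pt_sph_eq_iff {v w : Sph} : pt v.1 = pt w.1 ↔ v ∈ MulAction.orbit ℤˣ w := by
  constructor
  · intro h
    obtain ⟨c, hc, e⟩ := (pt_eq_iff w.ne_zero v.ne_zero).1 h.symm
    have h1 : |c| = 1 := by
      have := congrArg norm e
      rw [norm_smul, v.2, w.2, mul_one] at this
      exact this.symm
    rcases eq_or_eq_neg_of_abs_eq h1 with rfl | rfl
    · exact ⟨1, Subtype.ext (by simp [e])⟩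
    · exact ⟨-1, Subtype.ext (by rw [e]; simp [Sph.smul_val])⟩
  · rintro ⟨u, rfl⟩
    simp only [Sph.smul_val]
    exact pt_smul (by rcases unit_cast_eq u with h | h <;> simp [h]) _

lemma isQuotientCoveringMap_sph : IsQuotientCoveringMap (fun v : Sph => pt v.1) ℤˣ where
  toIsQuotientMap := by
    have hc : Continuous (fun v : Sph => pt v.1) :=
      continuous_pt_comp continuous_subtype_val fun v => v.ne_zero
    have : CompactSpace Sph := by
      have h : {v : R3 | ‖v‖ = 1} = Metric.sphere 0 1 := by ext; simp
      have h' := isCompact_sphere (0 : R3) 1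
      rw [← h] at h'
      exact isCompact_iff_compactSpace.1 h'
    refine hc.isClosedMap.isQuotientMap hc fun x => ?_
    obtain ⟨v, hv, rfl⟩ := exists_pt x
    exact ⟨⟨‖v‖⁻¹ • v, by simp [norm_smul, hv]⟩, pt_smul (by simpa using hv) v⟩
  continuous_const_smul u := (continuous_subtype_val.const_smul ((u : ℤ) : ℝ)).subtype_mk _
  apply_eq_iff_mem_orbit := pt_sph_eq_iff
  disjoint e := by
    refine ⟨{v | ‖v.1 - e.1‖ < 1}, ?_, fun g => ?_⟩
    · exact (isOpen_lt (by fun_prop) continuous_const).mem_nhds (by simp)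
    · rintro ⟨_, ⟨v, hv, rfl⟩, hw⟩
      rcases Int.units_eq_one_or g with rfl | rfl
      · rfl
      · exfalso
        simp only [mem_ofPred_eq, Sph.smul_val] at hv hw
        have h1 : ‖(2 : ℝ) • e.1‖ = 2 := by rw [norm_smul, e.2]; norm_num
        have h2 : (2 : ℝ) • e.1 = -((v.1 - e.1) + (((-1 : ℤˣ) : ℤ) : ℝ) • v.1 - e.1) := by
          simp [two_smul]
          abel
        have h3 := norm_add_le (v.1 - e.1) ((((-1 : ℤˣ) : ℤ) : ℝ) • v.1 - e.1)
        rw [h2, norm_neg, add_sub_assoc] at h1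
        linarith

open scoped unitInterval

/-- A closed curve that changes the sign of the homogeneous coordinates is not contractible. -/
lemma not_nullhomotopic_of_path {L : Set RP2} {c : I → R3} (hc : Continuous c) (h0 : ∀ t, c t ≠ 0)
    (hL : ∀ t, pt (c t) ∈ L) (h1 : c 1 = - c 0) :
    ¬ ContinuousMap.Nullhomotopic (⟨Subtype.val, continuous_subtype_val⟩ : C(L, RP2)) := by
  rintro ⟨y, ⟨H₀⟩⟩
  have cov := isQuotientCoveringMap_sph.isCoveringMap
  obtain ⟨e, rfl⟩ := isQuotientCoveringMap_sph.surjective y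
  let H := H₀.symm
  let j : I → L := fun t => ⟨pt (c t), hL t⟩
  have hj : Continuous j := (continuous_pt_comp hc h0).subtype_mk _
  let H' : C(I × I, RP2) := ⟨fun p => H (p.1, j p.2), by fun_prop⟩
  have hH0 : ∀ a, H' (0, a) = (fun v : Sph => pt v.1) (ContinuousMap.const I e a) := fun a => by
    simp [H', H]
  set Γ := cov.liftHomotopy H' (ContinuousMap.const I e) hH0
  have hΓ := cov.liftHomotopy_lifts H' (ContinuousMap.const I e) hH0
  have hΓ' : ∀ p, pt (Γ p).1 = H' p := fun p => congrFun hΓ p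
  have hj01 : j 0 = j 1 := Subtype.ext (by
    simp only [j]; rw [h1, ← neg_one_smul ℝ, pt_smul (by norm_num)])
  have e1 : (fun s => Γ (s, 0)) = fun s => Γ (s, 1) := by
    refine cov.eq_of_comp_eq (by fun_prop) (by fun_prop) ?_ 0 ?_
    · funext s
      simp only [Function.comp, hΓ', H', ContinuousMap.coe_mk, hj01]
    · rw [cov.liftHomotopy_zero H' _ hH0, cov.liftHomotopy_zero H' _ hH0]; rfl
  let d : I → Sph := fun t => ⟨‖c t‖⁻¹ • c t, by simp [norm_smul, h0]⟩
  have hd : Continuous d := ((hc.norm.inv₀ fun t => by simpa using h0 t).smul hc).subtype_mk _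
  have hpd : ∀ t, pt (d t).1 = pt (c t) := fun t => pt_smul (by simpa using h0 t) _
  have hΓ1 : ∀ t, pt (Γ (1, t)).1 = pt (c t) := fun t => by rw [hΓ']; simp [H', H, j]
  obtain ⟨u, hu⟩ := pt_sph_eq_iff.1 ((hpd 0).trans (hΓ1 0).symm)
  have e2 : d = fun t => u • Γ (1, t) := by
    refine cov.eq_of_comp_eq hd
      ((isQuotientCoveringMap_sph.continuous_const_smul u).comp (by fun_prop)) ?_ 0 hu.symm
    funext t
    simp only [Function.comp, hpd]
    rw [← hΓ1]
    exact (isQuotientCoveringMap_sph.map_smul u).symm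
  have e3 : d 1 = d 0 := by
    rw [e2]
    simp only
    rw [show Γ (1, 1) = Γ (1, 0) from (congrFun e1 1).symm]
  have e4 := congrArg Subtype.val e3
  simp only [d, h1, norm_neg, smul_neg] at e4
  have h5 := self_eq_neg.1 e4.symm
  exact smul_ne_zero (inv_ne_zero (norm_ne_zero_iff.2 (h0 0))) (h0 0) h5

lemma isNoncontractibleCurve_of_path {L : Set RP2} {c : I → R3} (hc : Continuous c)
    (h0 : ∀ t, c t ≠ 0) (hL : L = range fun t => pt (c t)) (h1 : c 1 = - c 0)
    (hs : ∀ x ∈ L, IsSmoothCurveAt L x) : IsNoncontractibleCurve L where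
  closed := by rw [hL]; exact (isCompact_range (continuous_pt_comp hc h0)).isClosed
  connected := by rw [hL]; exact isConnected_range (continuous_pt_comp hc h0)
  smooth := hs
  noncontractible := not_nullhomotopic_of_path hc h0 (fun t => by rw [hL]; exact ⟨t, rfl⟩) h1

/-! ### Counting zeros of functions on the line -/

lemma exists_zeros_deriv {f : ℝ → ℝ} (hf : Differentiable ℝ f) {k : ℕ} {T : Finset ℝ}
    (hT : T.card = k + 1) (h0 : ∀ x ∈ T, f x = 0) : ∃ T' : Finset ℝ, T'.card = k ∧
      ∀ y ∈ T', deriv f y = 0 ∧ ∃ a ∈ T, ∃ b ∈ T, y ∈ Ioo a b := by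
  set x := T.orderEmbOfFin hT
  have hx : ∀ i, x i ∈ T := fun i => T.orderEmbOfFin_mem hT i
  have h1 : ∀ i : Fin k, ∃ c ∈ Ioo (x i.castSucc) (x i.succ), deriv f c = 0 := fun i =>
    exists_deriv_eq_zero (x.strictMono Fin.castSucc_lt_succ) hf.continuous.continuousOn
      (by rw [h0 _ (hx _), h0 _ (hx _)])
  choose ξ hξ hξ0 using h1
  have hmono : StrictMono ξ := by
    intro i j hij
    have h2 : x i.succ ≤ x j.castSucc := x.monotone (by rw [Fin.le_def]; simpa using hij)
    exact (hξ i).2.trans_le (h2.trans (hξ j).1.le)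
  refine ⟨Finset.univ.image ξ, ?_, ?_⟩
  · rw [Finset.card_image_of_injective _ hmono.injective]; simp
  · intro y hy
    obtain ⟨i, -, rfl⟩ := Finset.mem_image.1 hy
    exact ⟨hξ0 i, _, hx _, _, hx _, hξ i⟩

/-- **Rolle's theorem** for several zeros. -/
lemma card_zeros_le {m : ℕ} : ∀ {f : ℝ → ℝ} (_ : ContDiff ℝ ∞ f) {U : Set ℝ} (_ : U.OrdConnected)
    (_ : ∀ x ∈ U, iteratedDeriv m f x ≠ 0) {T : Finset ℝ} (_ : ∀ x ∈ T, x ∈ U ∧ f x = 0),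
    T.card ≤ m := by
  induction m with
  | zero =>
    intro f hf U hU hm T hT
    simp only [Nat.le_zero, Finset.card_eq_zero]
    by_contra h
    obtain ⟨x, hx⟩ := Finset.nonempty_iff_ne_empty.2 h
    exact hm x (hT x hx).1 (by simpa using (hT x hx).2)
  | succ m ih =>
    intro f hf U hU hm T hT
    rcases Nat.eq_zero_or_pos T.card with h | h
    · omega
    obtain ⟨T', h1, h2⟩ := exists_zeros_deriv (hf.differentiable (by simp))
      (Nat.succ_pred_eq_of_pos h).symm fun x hx => (hT x hx).2
    have h3 : T'.card ≤ m := by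
      refine ih (f := deriv f) (contDiff_infty_iff_deriv.1 hf).2 hU ?_ fun y hy => ?_
      · intro x hx
        rw [← iteratedDeriv_succ']
        exact hm x hx
      · obtain ⟨h4, a, ha, b, hb, hab⟩ := h2 y hy
        exact ⟨hU.out (hT a ha).1 (hT b hb).1 (Ioo_subset_Icc_self hab), h4⟩
    simp only [Nat.pred_eq_sub_one] at h1
    omega

lemma exists_pos_le_abs {K : Set ℝ} (hK : IsCompact K) {g : ℝ → ℝ} (hg : Continuous g)
    (h : ∀ x ∈ K, g x ≠ 0) : ∃ η > 0, ∀ x ∈ K, η ≤ |g x| :=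
  hK.exists_forall_le' (f := fun x => |g x|) hg.abs.continuousOn fun x hx => abs_pos.2 (h x hx)

/-- `f` and `f₀` are close on `[a, b]`, with their derivatives up to order `N`. -/
def CloseOn (f f₀ : ℝ → ℝ) (a b : ℝ) (N : ℕ) (η : ℝ) : Prop :=
  ∀ j ≤ N, ∀ x ∈ Icc a b, |iteratedDeriv j f x - iteratedDeriv j f₀ x| < η

open Classical in
/-- Zeros of a perturbed function: upper semicontinuity of the number of zeros. -/
lemma exists_zeros_le {f₀ : ℝ → ℝ} (hf₀ : ContDiff ℝ ∞ f₀) {a b : ℝ} (Z : Finset ℝ) (m : ℝ → ℕ)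
    (hZ : ∀ x ∈ Icc a b, f₀ x = 0 → x ∈ Z) (hm : ∀ z ∈ Z, iteratedDeriv (m z) f₀ z ≠ 0)
    {K : Set ℝ} (hK : IsClosed K) :
    ∃ η > 0, ∃ N : ℕ, ∀ f, ContDiff ℝ ∞ f → CloseOn f f₀ a b N η →
      ∀ T : Finset ℝ, (∀ x ∈ T, x ∈ Icc a b ∧ x ∈ K ∧ f x = 0) →
        T.card ≤ ∑ z ∈ Z.filter (· ∈ K), m z := by
  have hcont : ∀ j, Continuous (iteratedDeriv j f₀) := fun j =>
    hf₀.continuous_iteratedDeriv j (by exact_mod_cast le_top)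
  have hloc : ∀ z : Z, ∃ ρ > 0, (∀ x ∈ Icc (z.1 - ρ) (z.1 + ρ), iteratedDeriv (m z.1) f₀ x ≠ 0) ∧
      (z.1 ∉ K → ∀ x ∈ Icc (z.1 - ρ) (z.1 + ρ), x ∉ K) := by
    intro z
    have h1 := (hcont (m z.1)).continuousAt.eventually_ne (hm z.1 z.2)
    have h2 : ∀ᶠ x in 𝓝 z.1, z.1 ∉ K → x ∉ K := by
      by_cases hz : z.1 ∈ K
      · exact .of_forall fun x h => absurd hz h
      · filter_upwards [hK.isOpen_compl.mem_nhds hz] with x hx _ using hx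
    obtain ⟨ρ, hρ, hb⟩ := Metric.eventually_nhds_iff.1 (h1.and h2)
    refine ⟨ρ / 2, by positivity, fun x hx => (hb ?_).1, fun hz x hx => (hb ?_).2 hz⟩ <;>
    · rw [Real.dist_eq, abs_lt]
      constructor <;> linarith [hx.1, hx.2]
  choose ρ hρ hρ1 hρ2 using hloc
  have hη : ∀ z : Z, ∃ η > 0, ∀ x ∈ Icc (z.1 - ρ z) (z.1 + ρ z), η ≤ |iteratedDeriv (m z.1) f₀ x| :=
    fun z => exists_pos_le_abs isCompact_Icc (hcont _) (hρ1 z)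
  choose η hη0 hη1 using hη
  have hC : IsCompact (Icc a b \ ⋃ z : Z, Ioo (z.1 - ρ z) (z.1 + ρ z)) :=
    isCompact_Icc.diff (isOpen_iUnion fun _ => isOpen_Ioo)
  obtain ⟨η', hη', hη'1⟩ := exists_pos_le_abs hC hf₀.continuous fun x hx h0 => by
    have hz := hZ x hx.1 h0
    refine hx.2 (mem_iUnion.2 ⟨⟨x, hz⟩, ?_⟩)
    have := hρ ⟨x, hz⟩
    constructor <;> simp <;> linarith
  obtain ⟨η'', hη'', hle⟩ : ∃ e > 0, ∀ z, e ≤ η z := by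
    rcases isEmpty_or_nonempty Z with h | h
    · exact ⟨1, one_pos, fun z => h.elim z⟩
    · obtain ⟨z, hz⟩ := Finite.exists_min η
      exact ⟨η z, hη0 z, hz⟩
  refine ⟨min η' η'', lt_min hη' hη'', Z.sup m, fun f hf hclose T hT => ?_⟩
  have hcover : T ⊆ (Z.filter (· ∈ K)).attach.biUnion fun z => T.filter fun x =>
      x ∈ Icc (z.1 - ρ ⟨z.1, (Finset.mem_filter.1 z.2).1⟩)
        (z.1 + ρ ⟨z.1, (Finset.mem_filter.1 z.2).1⟩) := by
    intro x hx
    obtain ⟨hx1, hx2, hx3⟩ := hT x hx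
    have h1 : x ∈ ⋃ z : Z, Ioo (z.1 - ρ z) (z.1 + ρ z) := by
      by_contra h
      have h2 := hη'1 x ⟨hx1, h⟩
      have h3 := hclose 0 (Nat.zero_le _) x hx1
      simp only [iteratedDeriv_zero, hx3, zero_sub, abs_neg] at h3
      exact absurd (h2.trans_lt h3) (not_lt.2 (min_le_left _ _))
    obtain ⟨z, hz⟩ := mem_iUnion.1 h1
    have hzK : z.1 ∈ K := by
      by_contra h
      exact hρ2 z h x (Ioo_subset_Icc_self hz) hx2
    exact Finset.mem_biUnion.2 ⟨⟨z.1, Finset.mem_filter.2 ⟨z.2, hzK⟩⟩, Finset.mem_attach _ _,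
      Finset.mem_filter.2 ⟨hx, Ioo_subset_Icc_self hz⟩⟩
  refine (Finset.card_le_card hcover).trans (Finset.card_biUnion_le.trans ?_)
  rw [← Finset.sum_attach (Z.filter (· ∈ K)) m]
  refine Finset.sum_le_sum fun z _ => ?_
  have hzZ := (Finset.mem_filter.1 z.2).1
  refine card_zeros_le hf (U := Icc (z.1 - ρ ⟨z.1, hzZ⟩) (z.1 + ρ ⟨z.1, hzZ⟩) ∩ Icc a b)
    (ordConnected_Icc.inter ordConnected_Icc) ?_ fun x hx => ?_
  · intro x hx h0
    have h1 := hclose (m z.1) (Finset.le_sup hzZ) x hx.2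
    have h2 := hη1 ⟨z.1, hzZ⟩ x hx.1
    rw [h0, zero_sub, abs_neg] at h1
    exact absurd (h2.trans_lt h1) (not_lt.2 ((min_le_right _ _).trans (hle _)))
  · obtain ⟨h1, h2⟩ := Finset.mem_filter.1 hx
    exact ⟨⟨h2, (hT x h1).1⟩, (hT x h1).2.2⟩

lemma CloseOn.add {f g h : ℝ → ℝ} {a b : ℝ} {N : ℕ} {η η' : ℝ} (hf : CloseOn f g a b N η)
    (hg : CloseOn g h a b N η') : CloseOn f h a b N (η + η') := fun j hj x hx => by
  have := abs_add_le (iteratedDeriv j f x - iteratedDeriv j g x)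
    (iteratedDeriv j g x - iteratedDeriv j h x)
  rw [sub_add_sub_cancel] at this
  exact this.trans_lt (add_lt_add (hf j hj x hx) (hg j hj x hx))

lemma iteratedDeriv_sum_mul {ι : Type*} [Fintype ι] {g : ι → ℝ → ℝ} (hg : ∀ i, ContDiff ℝ ∞ (g i))
    (c : ι → ℝ) (j : ℕ) (x : ℝ) : iteratedDeriv j (fun x => ∑ i, c i * g i x) x =
      ∑ i, c i * iteratedDeriv j (g i) x := by
  have h : ∀ i, ContDiff ℝ j (g i) := fun i => (hg i).of_le (by exact_mod_cast le_top)
  rw [iteratedDeriv_fun_sum fun i _ => (contDiff_const.mul (h i)).contDiffAt]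
  refine Finset.sum_congr rfl fun i _ => ?_
  exact iteratedDeriv_const_mul_field (c i) (g i)

/-- Linear combinations of smooth functions depend continuously on the coefficients. -/
lemma eventually_closeOn {ι : Type*} [Fintype ι] {g : ι → ℝ → ℝ} (hg : ∀ i, ContDiff ℝ ∞ (g i))
    (c₀ : ι → ℝ) (a b : ℝ) (N : ℕ) {η : ℝ} (hη : 0 < η) :
    ∀ᶠ c in 𝓝 c₀, CloseOn (fun x => ∑ i, c i * g i x) (fun x => ∑ i, c₀ i * g i x) a b N η := by
  have h1 : ∀ j : Fin (N + 1), ∀ᶠ c in 𝓝 c₀, ∀ x ∈ Icc a b,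
      |∑ i, c i * iteratedDeriv j (g i) x - ∑ i, c₀ i * iteratedDeriv j (g i) x| < η := by
    intro j
    have hc : ∀ i, Continuous (iteratedDeriv j (g i)) := fun i =>
      (hg i).continuous_iteratedDeriv j (by exact_mod_cast le_top)
    refine isCompact_Icc.eventually_forall_of_forall_eventually fun x _ => ?_
    have h2 : Continuous fun p : (ι → ℝ) × ℝ =>
        |∑ i, p.1 i * iteratedDeriv j (g i) p.2 - ∑ i, c₀ i * iteratedDeriv j (g i) p.2| := by
      fun_prop
    exact h2.continuousAt.eventually_lt continuousAt_const (by simpa using hη)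
  filter_upwards [eventually_all.2 h1] with c hc j hj x hx
  rw [iteratedDeriv_sum_mul hg, iteratedDeriv_sum_mul hg]
  exact hc ⟨j, by omega⟩ x hx

/-- For almost all parameters, a member of a pencil of functions has only simple zeros. -/
lemma ae_simple_zeros {f g : ℝ → ℝ} (hf : ContDiff ℝ ∞ f) (hg : ContDiff ℝ ∞ g)
    (hZ : {x | f x = 0}.Countable) (h : ∀ x, f x = 0 → deriv f x = 0 → g x ≠ 0 ∨ deriv g x ≠ 0) :
    ∀ᵐ s : ℝ, ∀ x, f x + s * g x = 0 → deriv f x + s * deriv g x ≠ 0 := by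
  have hn : (∞ : WithTop ℕ∞) ≠ 0 := by simp
  set q : ℝ → ℝ := fun x => - f x / g x
  have hq : ∀ x, g x ≠ 0 → HasDerivAt q ((-deriv f x * g x - (- f x) * deriv g x) / g x ^ 2) x :=
    fun x hx => (hf.differentiable hn x).hasDerivAt.neg.div (hg.differentiable hn x).hasDerivAt hx
  set S : Set ℝ := {x | g x ≠ 0 ∧ deriv q x = 0}
  have h1 : MeasureTheory.volume (q '' S) = 0 := by
    refine MeasureTheory.addHaar_image_eq_zero_of_det_fderivWithin_eq_zero MeasureTheory.volume
      (f' := fun _ => ContinuousLinearMap.toSpanSingleton ℝ 0) (fun x hx => ?_) fun x _ => by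
        simp [ContinuousLinearMap.det]
    have h2 := (hq x hx.1)
    have h3 := h2.deriv
    rw [hx.2] at h3
    rw [← h3] at h2
    exact h2.hasFDerivAt.hasFDerivWithinAt
  have h2 : ((fun x => - deriv f x / deriv g x) '' {x | f x = 0}).Countable := hZ.image _
  rw [MeasureTheory.ae_iff]
  refine MeasureTheory.measure_mono_null (t := q '' S ∪
    (fun x => - deriv f x / deriv g x) '' {x | f x = 0}) ?_
    (MeasureTheory.measure_union_null h1 (h2.measure_zero _))
  intro s hs
  simp only [mem_ofPred_eq, not_forall, not_not] at hs
  obtain ⟨x, hx1, hx2⟩ := hs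
  by_cases hgx : g x = 0
  · right
    have hf0 : f x = 0 := by simpa [hgx] using hx1
    refine ⟨x, hf0, ?_⟩
    have hg' : deriv g x ≠ 0 := by
      intro h0
      have hf' : deriv f x = 0 := by simpa [h0] using hx2
      rcases h x hf0 hf' with h | h
      · exact h hgx
      · exact h h0
    simp only
    field_simp
    linarith
  · left
    have e : q x = s := by simp only [q]; field_simp; linarith
    refine ⟨x, ⟨hgx, ?_⟩, e⟩
    rw [(hq x hgx).deriv]
    have hfx : f x = - s * g x := by linarith
    have hf' : deriv f x = - s * deriv g x := by linarith
    rw [hfx, hf']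
    ring_nf

/-- At most `N` zeros in each period of length `π`. -/
def ZerosLE (f : ℝ → ℝ) (N : ℕ) : Prop :=
  ∀ c, ∀ T : Finset ℝ, (∀ x ∈ T, x ∈ Ico c (c + π) ∧ f x = 0) → T.card ≤ N

lemma zero_add_zsmul {f : ℝ → ℝ} {ς : ℝ} (hς : ς ≠ 0) (hf : ∀ x, f (x + π) = ς * f x) (n : ℤ)
    (x : ℝ) : f (x + n * π) = 0 ↔ f x = 0 := by
  induction n with
  | zero => simp
  | succ n ih =>
    rw [← ih]; push_cast
    rw [show x + ((n : ℝ) + 1) * π = (x + n * π) + π by ring, hf]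
    simp [hς]
  | pred n ih =>
    rw [← ih]; push_cast
    rw [show x + -(n : ℝ) * π = (x + (-(n : ℝ) - 1) * π) + π by ring, hf]
    simp [hς]

lemma zerosLE_of_window {f : ℝ → ℝ} {ς : ℝ} (hς : ς ≠ 0) (hf : ∀ x, f (x + π) = ς * f x)
    {N : ℕ} (c : ℝ) (h : ∀ T : Finset ℝ, (∀ x ∈ T, x ∈ Ico c (c + π) ∧ f x = 0) → T.card ≤ N) :
    ZerosLE f N := by
  intro d T hT
  have hinj : InjOn (toIcoMod Real.pi_pos c) T := by
    intro x hx y hy hxy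
    have h1 := (hT x hx).1
    have h2 := (hT y hy).1
    have := congrArg (toIcoMod Real.pi_pos d) hxy
    rw [toIcoMod_toIcoMod, toIcoMod_toIcoMod] at this
    rwa [(toIcoMod_eq_self Real.pi_pos).2 h1, (toIcoMod_eq_self Real.pi_pos).2 h2] at this
  classical
  rw [← Finset.card_image_of_injOn hinj]
  refine h _ fun y hy => ?_
  obtain ⟨x, hx, rfl⟩ := Finset.mem_image.1 hy
  refine ⟨toIcoMod_mem_Ico _ _ _, ?_⟩
  have := zero_add_zsmul hς hf (-toIcoDiv Real.pi_pos c x) x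
  rw [← (hT x hx).2, toIcoMod, zsmul_eq_mul, sub_eq_add_neg, ← neg_mul]
  push_cast at this ⊢
  rw [(hT x hx).2, this]
  exact (hT x hx).2

/-- **Rolle's theorem** for periodic functions. -/
lemma ZerosLE.of_deriv {f : ℝ → ℝ} (hd : Differentiable ℝ f) {ς : ℝ}
    (hf : ∀ x, f (x + π) = ς * f x) {N : ℕ} (h : ZerosLE (deriv f) N) : ZerosLE f N := by
  intro c T hT
  rcases T.eq_empty_or_nonempty with rfl | hne
  · simp
  set x₁ := T.min' hne
  have hx₁ : x₁ ∈ T := T.min'_mem hne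
  have hlt : ∀ x ∈ T, x < x₁ + π := fun x hx => by
    have h1 := (hT x hx).1.2
    have h2 := (hT x₁ hx₁).1.1
    linarith
  classical
  have hnot : x₁ + π ∉ T := fun hm => lt_irrefl _ (hlt _ hm)
  obtain ⟨T', h1, h2⟩ := exists_zeros_deriv hd (T := insert (x₁ + π) T) (k := T.card)
    (Finset.card_insert_of_notMem hnot) fun x hx => by
      rcases Finset.mem_insert.1 hx with rfl | hx
      · rw [hf, (hT _ hx₁).2, mul_zero]
      · exact (hT x hx).2
  rw [← h1]
  refine h x₁ T' fun y hy => ?_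
  obtain ⟨h3, a, ha, b, hb, hab⟩ := h2 y hy
  refine ⟨⟨?_, ?_⟩, h3⟩
  · rcases Finset.mem_insert.1 ha with rfl | ha
    · have := Real.pi_pos
      linarith [hab.1]
    · exact (T.min'_le a ha).trans hab.1.le
  · rcases Finset.mem_insert.1 hb with rfl | hb
    · exact hab.2
    · exact hab.2.trans (hlt b hb)

/-! ### Lines -/

lemma dot_coords_iff {a v : R3} (hv : v ≠ 0) : a ⬝ᵥ (pt v).coords = 0 ↔ a ⬝ᵥ v = 0 := by
  obtain ⟨c, hc, h⟩ := (pt_eq_iff hv (pt v).coords_ne_zero).1 (pt_coords (pt v)).symm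
  rw [h, dotProduct_smul]
  simp [hc]

lemma dot_cross_left (p q : R3) : (p ⨯₃ q) ⬝ᵥ p = 0 := by
  simp [cross_apply, dotProduct, Fin.sum_univ_three]; ring

lemma dot_cross_right (p q : R3) : (p ⨯₃ q) ⬝ᵥ q = 0 := by
  simp [cross_apply, dotProduct, Fin.sum_univ_three]; ring

lemma dot_self_pos {a : R3} (ha : a ≠ 0) : 0 < a ⬝ᵥ a := by
  have h : a ⬝ᵥ a ≠ 0 := fun h => ha (dotProduct_self_eq_zero.1 h)
  have h2 : 0 ≤ a ⬝ᵥ a := by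
    simp only [dotProduct, Fin.sum_univ_three]
    nlinarith [mul_self_nonneg (a 0), mul_self_nonneg (a 1), mul_self_nonneg (a 2)]
  exact lt_of_le_of_ne h2 h.symm

lemma exists_combination {p q v : R3} (h : p ⨯₃ q ≠ 0) (hv : (p ⨯₃ q) ⬝ᵥ v = 0) :
    ∃ x y : ℝ, v = x • p + y • q := by
  have hA := (dot_self_pos h).ne'
  refine ⟨((v ⨯₃ q) ⬝ᵥ (p ⨯₃ q)) / ((p ⨯₃ q) ⬝ᵥ (p ⨯₃ q)),
    ((p ⨯₃ v) ⬝ᵥ (p ⨯₃ q)) / ((p ⨯₃ q) ⬝ᵥ (p ⨯₃ q)), ?_⟩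
  have key : ((p ⨯₃ q) ⬝ᵥ (p ⨯₃ q)) • v = ((v ⨯₃ q) ⬝ᵥ (p ⨯₃ q)) • p +
      ((p ⨯₃ v) ⬝ᵥ (p ⨯₃ q)) • q := by
    have h0 : ((p ⨯₃ q) ⬝ᵥ (p ⨯₃ q)) • v - (((v ⨯₃ q) ⬝ᵥ (p ⨯₃ q)) • p +
      ((p ⨯₃ v) ⬝ᵥ (p ⨯₃ q)) • q) = ((p ⨯₃ q) ⬝ᵥ v) • (p ⨯₃ q) := by
      ext i
      fin_cases i <;> simp [cross_apply, dotProduct, Fin.sum_univ_three] <;> ring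
    rw [hv, zero_smul] at h0
    exact sub_eq_zero.1 h0
  rw [div_eq_inv_mul, div_eq_inv_mul, mul_smul, mul_smul, ← smul_add, ← key, smul_smul,
    inv_mul_cancel₀ hA, one_smul]

/-- A parametrization of the line through two points. -/
def linePath (p q : R3) (t : I) : R3 := cos (π * t) • p + sin (π * t) • q

lemma continuous_linePath (p q : R3) : Continuous (linePath p q) := by unfold linePath; fun_prop

lemma linePath_one (p q : R3) : linePath p q 1 = - linePath p q 0 := by simp [linePath]

lemma dot_linePath (p q : R3) (t : I) : (p ⨯₃ q) ⬝ᵥ linePath p q t = 0 := by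
  simp [linePath, dot_cross_left, dot_cross_right]

lemma linePath_ne_zero {p q : R3} (h : p ⨯₃ q ≠ 0) (t : I) : linePath p q t ≠ 0 := by
  intro h0
  have h1 : cos (π * t) • (p ⨯₃ q) = 0 := by
    have : (linePath p q t) ⨯₃ q = 0 := by rw [h0]; simp
    simpa [linePath] using this
  have h2 : sin (π * t) • (p ⨯₃ q) = 0 := by
    have : p ⨯₃ (linePath p q t) = 0 := by rw [h0]; simp
    simpa [linePath] using this
  have h3 := (smul_eq_zero.1 h1).resolve_right h
  have h4 := (smul_eq_zero.1 h2).resolve_right h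
  have := Real.sin_sq_add_cos_sq (π * t)
  rw [h3, h4] at this
  norm_num at this

lemma exists_linePath {p q v : R3} (h : p ⨯₃ q ≠ 0) (hv : (p ⨯₃ q) ⬝ᵥ v = 0) (h0 : v ≠ 0) :
    ∃ t : I, ∃ d : ℝ, d ≠ 0 ∧ v = d • linePath p q t := by
  obtain ⟨x, y, rfl⟩ := exists_combination h hv
  set z : ℂ := ⟨x, y⟩ with hz
  have hz0 : z ≠ 0 := by
    intro hz0
    have h1 : x = 0 := congrArg Complex.re hz0
    have h2 : y = 0 := congrArg Complex.im hz0
    simp [h1, h2] at h0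
  have hn : ‖z‖ ≠ 0 := by simpa using hz0
  have e1 : x = ‖z‖ * cos z.arg := by rw [Complex.norm_mul_cos_arg]
  have e2 : y = ‖z‖ * sin z.arg := by rw [Complex.norm_mul_sin_arg]
  have hpi := Real.pi_pos
  rcases le_or_gt 0 z.arg with ha | ha
  · refine ⟨⟨z.arg / π, div_nonneg ha hpi.le, (div_le_one hpi).2 (Complex.arg_le_pi z)⟩,
      ‖z‖, hn, ?_⟩
    simp only [linePath, mul_div_cancel₀ _ hpi.ne', smul_add, smul_smul]
    rw [← e1, ← e2]
  · have h1 := Complex.neg_pi_lt_arg z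
    refine ⟨⟨(z.arg + π) / π, div_nonneg (by linarith) hpi.le,
      (div_le_one hpi).2 (by linarith)⟩, -‖z‖, neg_ne_zero.2 hn, ?_⟩
    simp only [linePath, mul_div_cancel₀ _ hpi.ne', smul_add, smul_smul, Real.cos_add_pi,
      Real.sin_add_pi, neg_mul_neg]
    rw [← e1, ← e2]

/-! ### Local criteria for transversality -/

lemma transverseAt_of_functions {X Y : Set RP2} {F : ℝ × ℝ → R3} {z₀ : ℝ × ℝ} {f g : ℝ × ℝ → ℝ}
    (hF : ∀ᶠ z in 𝓝 z₀, ContDiffAt ℝ ∞ F z) (hi : ImmAt F z₀)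
    (hf : ∀ᶠ z in 𝓝 z₀, ContDiffAt ℝ ∞ f z) (hg : ∀ᶠ z in 𝓝 z₀, ContDiffAt ℝ ∞ g z)
    (hf0 : f z₀ = 0) (hg0 : g z₀ = 0)
    (hJ : fderiv ℝ g z₀ (1, 0) * fderiv ℝ f z₀ (0, 1) -
      fderiv ℝ g z₀ (0, 1) * fderiv ℝ f z₀ (1, 0) ≠ 0)
    (hX : ∀ᶠ z in 𝓝 z₀, pt (F z) ∈ X ↔ f z = 0) (hY : ∀ᶠ z in 𝓝 z₀, pt (F z) ∈ Y ↔ g z = 0) :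
    TransverseAt X Y (pt (F z₀)) := by
  obtain ⟨ρ, h1, h2, h3, h4, h5⟩ := exists_adapted_chart hF hi hf hg hf0 hg0 hJ (hX.and hY)
  exact ⟨_, h1, by rw [h3], fun z => (h2 z).1.trans (h4 z), fun z => (h2 z).2.trans (h5 z)⟩

lemma isSmoothCurveAt_of_functions {X : Set RP2} {F : ℝ × ℝ → R3} {z₀ : ℝ × ℝ} {f g : ℝ × ℝ → ℝ}
    (hF : ∀ᶠ z in 𝓝 z₀, ContDiffAt ℝ ∞ F z) (hi : ImmAt F z₀)
    (hf : ∀ᶠ z in 𝓝 z₀, ContDiffAt ℝ ∞ f z) (hg : ∀ᶠ z in 𝓝 z₀, ContDiffAt ℝ ∞ g z)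
    (hf0 : f z₀ = 0) (hg0 : g z₀ = 0)
    (hJ : fderiv ℝ g z₀ (1, 0) * fderiv ℝ f z₀ (0, 1) -
      fderiv ℝ g z₀ (0, 1) * fderiv ℝ f z₀ (1, 0) ≠ 0)
    (hX : ∀ᶠ z in 𝓝 z₀, pt (F z) ∈ X ↔ f z = 0) :
    IsSmoothCurveAt X (pt (F z₀)) := by
  obtain ⟨ρ, h1, h2, h3, h4, h5⟩ := exists_adapted_chart hF hi hf hg hf0 hg0 hJ hX
  exact ⟨_, h1, by rw [h3], fun z => (h2 z).trans (h4 z)⟩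

lemma contDiff_dot (a : R3) : ContDiff ℝ ∞ fun v : R3 => a ⬝ᵥ v := by
  simp only [dotProduct, Fin.sum_univ_three]; fun_prop

lemma fderiv_dot_comp {E : Type*} [NormedAddCommGroup E] [NormedSpace ℝ E] {F : E → R3} {z : E}
    (a : R3) (hF : DifferentiableAt ℝ F z) (h : E) :
    fderiv ℝ (fun z => a ⬝ᵥ F z) z h = a ⬝ᵥ fderiv ℝ F z h := by
  have h1 : ∀ i, HasFDerivAt (fun z => F z i) ((ContinuousLinearMap.proj i).comp (fderiv ℝ F z)) z :=
    fun i => (hasFDerivAt_pi'.1 hF.hasFDerivAt i)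
  have h2 : HasFDerivAt (fun z => a ⬝ᵥ F z) (∑ i, a i • (ContinuousLinearMap.proj (R := ℝ)
      (φ := fun _ : Fin 3 => ℝ) i).comp (fderiv ℝ F z)) z :=
    HasFDerivAt.fun_sum fun i _ => (h1 i).const_mul (a i)
  rw [h2.fderiv]
  simp [dotProduct, Fin.sum_univ_three]

lemma continuousAt_affine {v b d : R3} :
    Tendsto (fun z : ℝ × ℝ => v + (z.1 • b + z.2 • d)) (𝓝 0) (𝓝 v) := by
  have h : Continuous fun z : ℝ × ℝ => v + (z.1 • b + z.2 • d) := by fun_prop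
  simpa using h.tendsto 0

/-- Two different lines are transverse, also after modifications elsewhere. -/
lemma transverseAt_lines {X Y : Set RP2} {a b v : R3} (hv : v ≠ 0) (hab : a ⨯₃ b ≠ 0)
    (ha : a ⬝ᵥ v = 0) (hb : b ⬝ᵥ v = 0) (hX : ∀ᶠ w in 𝓝 v, pt w ∈ X ↔ a ⬝ᵥ w = 0)
    (hY : ∀ᶠ w in 𝓝 v, pt w ∈ Y ↔ b ⬝ᵥ w = 0) : TransverseAt X Y (pt v) := by
  have hd : trip v b a ≠ 0 := by
    have h1 : v ⨯₃ (a ⨯₃ b) = 0 := cross_cross_eq_zero ha hb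
    obtain ⟨c, hc, h2⟩ := (cross_eq_zero_iff hv hab).1 h1
    have h3 : trip v b a = - (v ⬝ᵥ (a ⨯₃ b)) := by rw [trip, ← cross_anticomm, dotProduct_neg]
    rw [h3, h2, dotProduct_smul, smul_eq_mul]
    exact neg_ne_zero.2 (mul_ne_zero hc (dot_self_pos hv).ne')
  set F : ℝ × ℝ → R3 := fun z => v + (z.1 • b + z.2 • a) with hF
  have hFs : ContDiff ℝ ∞ F := by fun_prop
  have hF0 : F 0 = v := by simp [hF]
  have hder : ∀ h, fderiv ℝ F 0 h = h.1 • b + h.2 • a := fun h => by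
    rw [(hasFDerivAt_affine v b a 0).fderiv]; simp
  rw [← hF0]
  refine transverseAt_of_functions (f := fun z => a ⬝ᵥ F z) (g := fun z => b ⬝ᵥ F z)
    (.of_forall fun z => hFs.contDiffAt) (immAt_affine hd)
    (.of_forall fun z => ((contDiff_dot a).comp hFs).contDiffAt)
    (.of_forall fun z => ((contDiff_dot b).comp hFs).contDiffAt)
    (by simpa [hF0]) (by simpa [hF0]) ?_ (continuousAt_affine.eventually hX)
    (continuousAt_affine.eventually hY)
  have hFd : DifferentiableAt ℝ F 0 := hFs.contDiffAt.differentiableAt (by simp)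
  rw [fderiv_dot_comp _ hFd, fderiv_dot_comp _ hFd, fderiv_dot_comp _ hFd, fderiv_dot_comp _ hFd,
    hder, hder]
  simp only [one_smul, zero_smul, add_zero, zero_add]
  have h4 : b ⬝ᵥ b * a ⬝ᵥ a - b ⬝ᵥ a * a ⬝ᵥ b = (a ⨯₃ b) ⬝ᵥ (a ⨯₃ b) := by
    simp [cross_apply, dotProduct, Fin.sum_univ_three]; ring
  rw [h4]
  exact (dot_self_pos hab).ne'

lemma isSmoothCurveAt_line {X : Set RP2} {a v : R3} (hv : v ≠ 0) (ha0 : a ≠ 0)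
    (ha : a ⬝ᵥ v = 0) (hX : ∀ᶠ w in 𝓝 v, pt w ∈ X ↔ a ⬝ᵥ w = 0) : IsSmoothCurveAt X (pt v) := by
  have hav : a ⨯₃ (v ⨯₃ a) ≠ 0 := by
    rw [cross_cross_eq, dotProduct_comm v a, ha, zero_smul, sub_zero]
    exact smul_ne_zero (dot_self_pos ha0).ne' hv
  have hb : (v ⨯₃ a) ⬝ᵥ v = 0 := dot_cross_left v a
  obtain ⟨ψ, h1, h2, h3, -⟩ := transverseAt_lines (Y := {x | (v ⨯₃ a) ⬝ᵥ x.coords = 0}) hv hav ha hb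
    hX (by filter_upwards [isOpen_compl_singleton.mem_nhds hv] with w hw using dot_coords_iff hw)
  exact ⟨ψ, h1, h2, h3⟩

/-! ### Lines bent inside boxes -/

/-- The open box of radius `r`. -/
def box (r : ℝ) : Set (ℝ × ℝ) := {z | |z.1| < r ∧ |z.2| < r}

lemma isOpen_box (r : ℝ) : IsOpen (box r) :=
  (isOpen_lt (continuous_abs.comp continuous_fst) continuous_const).inter
    (isOpen_lt (continuous_abs.comp continuous_snd) continuous_const)

/-- The closed box of radius `r`. -/
def cbox (r : ℝ) : Set (ℝ × ℝ) := {z | |z.1| ≤ r ∧ |z.2| ≤ r}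

lemma cbox_eq (r : ℝ) : cbox r = Icc (-r) r ×ˢ Icc (-r) r := by
  ext z; simp only [cbox, abs_le, mem_ofPred_eq, mem_prod, mem_Icc]

lemma isCompact_cbox (r : ℝ) : IsCompact (cbox r) := by
  rw [cbox_eq]; exact isCompact_Icc.prod isCompact_Icc

lemma box_subset_cbox {r s : ℝ} (h : r ≤ s) : box r ⊆ cbox s :=
  fun _ hz => ⟨hz.1.le.trans h, hz.2.le.trans h⟩

lemma cbox_subset_box {r s : ℝ} (h : r < s) : cbox r ⊆ box s :=
  fun _ hz => ⟨hz.1.trans_lt h, hz.2.trans_lt h⟩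

/-- A line together with modifications inside the boxes of radius `r` of a family of charts. -/
structure BentLine {ι : Type} (Ch : ChartFamily ι) (r : ℝ) where
  p : R3
  q : R3
  indep : p ⨯₃ q ≠ 0
  E : ι → ℝ × ℝ → ℝ
  E_smooth : ∀ k, ContDiff ℝ ∞ (E k)
  E_eq : ∀ k, ∀ z ∈ box r, z ∉ cbox (r / 2) → (E k z = 0 ↔ (p ⨯₃ q) ⬝ᵥ Ch.F k z = 0)
  E_grad : ∀ k, ∀ z ∈ box r, E k z = 0 → fderiv ℝ (E k) z (1, 0) ≠ 0 ∨ fderiv ℝ (E k) z (0, 1) ≠ 0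
  slide : ι → ℝ × ℝ → ℝ × ℝ
  slide_cont : ∀ k, ContinuousOn (slide k) (box r)
  slide_mem : ∀ k, ∀ z ∈ box r, (p ⨯₃ q) ⬝ᵥ Ch.F k z = 0 → slide k z ∈ box r ∧ E k (slide k z) = 0
  slide_surj : ∀ k, ∀ z ∈ box r, E k z = 0 → ∃ z' ∈ box r, (p ⨯₃ q) ⬝ᵥ Ch.F k z' = 0 ∧ slide k z' = z
  slide_eq : ∀ k, ∀ z ∈ box r, z ∉ cbox (r / 2) → (p ⨯₃ q) ⬝ᵥ Ch.F k z = 0 → slide k z = z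

namespace BentLine

variable {ι : Type} {Ch : ChartFamily ι} {r : ℝ} (B : BentLine Ch r)

/-- The covector of the line. -/
def A : R3 := B.p ⨯₃ B.q

lemma A_ne : B.A ≠ 0 := B.indep

/-- The bent line as a set. -/
def set : Set RP2 := {x | (∃ k z, z ∈ box r ∧ x = pt (Ch.F k z) ∧ B.E k z = 0) ∨
  ((∀ k z, z ∈ box r → x ≠ pt (Ch.F k z)) ∧ B.A ⬝ᵥ x.coords = 0)}

lemma mem_set_box {k : ι} {z : ℝ × ℝ} (hz : z ∈ box r) : pt (Ch.F k z) ∈ B.set ↔ B.E k z = 0 := by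
  constructor
  · rintro (⟨l, w, hw, h1, h2⟩ | ⟨h1, -⟩)
    · obtain ⟨rfl, rfl⟩ := Ch.inj _ _ _ _ h1
      exact h2
    · exact absurd rfl (h1 k z hz)
  · exact fun h => Or.inl ⟨k, z, hz, rfl, h⟩

lemma mem_set_off {v : R3} (hv : v ≠ 0) (h : ∀ k z, pt v = pt (Ch.F k z) → z ∉ cbox (r / 2)) :
    pt v ∈ B.set ↔ B.A ⬝ᵥ v = 0 := by
  by_cases h1 : ∃ k z, z ∈ box r ∧ pt v = pt (Ch.F k z)
  · obtain ⟨k, z, hz, h1⟩ := h1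
    rw [h1, B.mem_set_box hz, B.E_eq k z hz (h k z h1)]
    obtain ⟨c, hc, rfl⟩ := (pt_eq_iff (Ch.ne_zero k z) hv).1 h1.symm
    rw [dotProduct_smul]
    simp [A, hc]
  · push Not at h1
    rw [← dot_coords_iff hv]
    constructor
    · rintro (⟨l, w, hw, h2, -⟩ | ⟨-, h2⟩)
      · exact absurd h2 (h1 l w hw)
      · exact h2
    · exact fun h2 => Or.inr ⟨h1, h2⟩

lemma dot_smul_F {k : ι} {c : ℝ} {z : ℝ × ℝ} (hc : c ≠ 0) {a : R3} (h : a ⬝ᵥ (c • Ch.F k z) = 0) :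
    a ⬝ᵥ Ch.F k z = 0 := by
  rw [dotProduct_smul] at h
  simpa [hc] using h

lemma path_eq {v : R3} (h : ∀ k z, pt v = pt (Ch.F k z) → z ∉ cbox (r / 2))
    (η : ι → ℝ × ℝ → ℝ × ℝ) (hη : ∀ k z, z ∉ cbox (r / 2) → η k z = z) : Ch.move η v = v := by
  refine Ch.move_eq_self (K := fun _ => cbox (r / 2)) hη fun k => ?_
  rintro ⟨z, hz, hzv⟩
  exact h k z hzv.symm hz

lemma isSmoothCurveAt_box {k : ι} {z : ℝ × ℝ} (hz : z ∈ box r) (h : B.E k z = 0) :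
    IsSmoothCurveAt B.set (pt (Ch.F k z)) := by
  have h1 : ∀ᶠ w in 𝓝 z, pt (Ch.F k w) ∈ B.set ↔ B.E k w = 0 := by
    filter_upwards [(isOpen_box r).mem_nhds hz] with w hw using B.mem_set_box hw
  rcases B.E_grad k z hz h with h2 | h2
  · refine isSmoothCurveAt_of_functions (g := fun w => w.2 - z.2)
      (.of_forall fun z => (Ch.smooth k).contDiffAt) (Ch.imm k z)
      (.of_forall fun z => (B.E_smooth k).contDiffAt)
      (.of_forall fun z => by fun_prop) h (by simp) ?_ h1
    simp [fderiv_sub_const, fderiv_snd, h2]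
  · refine isSmoothCurveAt_of_functions (g := fun w => w.1 - z.1)
      (.of_forall fun z => (Ch.smooth k).contDiffAt) (Ch.imm k z)
      (.of_forall fun z => (B.E_smooth k).contDiffAt)
      (.of_forall fun z => by fun_prop) h (by simp) ?_ h1
    simp [fderiv_sub_const, fderiv_fst, h2]

open Classical in
/-- A parametrization of the bent line. -/
def path (t : I) : R3 :=
  Ch.move (fun k z => if z ∈ box r ∧ (B.p ⨯₃ B.q) ⬝ᵥ Ch.F k z = 0 then B.slide k z else z) (linePath B.p B.q t)

lemma path_one : B.path 1 = - B.path 0 := by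
  rw [path, path, linePath_one, ← neg_one_smul ℝ (linePath _ _ _), Ch.move_homog, neg_one_smul]

lemma path_cases (hr : 0 < r) (t : I) :
    (∃ k, ∃ c : ℝ, ∃ z, c ≠ 0 ∧ z ∈ box r ∧ linePath B.p B.q t = c • Ch.F k z ∧
      B.path t = c • Ch.F k (B.slide k z)) ∨
    ((∀ k z, z ∈ box r → pt (linePath B.p B.q t) ≠ pt (Ch.F k z)) ∧
      B.path t = linePath B.p B.q t) := by
  classical
  have hv0 := linePath_ne_zero B.indep t
  by_cases h1 : ∃ k z, pt (linePath B.p B.q t) = pt (Ch.F k z) ∧ z ∈ box r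
  · obtain ⟨k, z, h2, hz⟩ := h1
    obtain ⟨c, hc, h3⟩ := (pt_eq_iff (Ch.ne_zero k z) hv0).1 h2.symm
    have h4 := dot_linePath B.p B.q t
    rw [h3] at h4
    refine Or.inl ⟨k, c, z, hc, hz, h3, ?_⟩
    rw [path, h3, Ch.move_smul _ k hc, if_pos ⟨hz, dot_smul_F hc h4⟩]
  · push Not at h1
    refine Or.inr ⟨fun k z hz h => h1 k z h hz, path_eq (r := r) (fun k z h hz =>
      h1 k z h (cbox_subset_box (by linarith) hz)) _ fun k z hz => ?_⟩
    split_ifs with h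
    · exact B.slide_eq k z h.1 hz h.2
    · rfl

lemma path_ne_zero (hr : 0 < r) (t : I) : B.path t ≠ 0 := by
  rcases B.path_cases hr t with ⟨k, c, z, hc, -, -, h⟩ | ⟨-, h⟩
  · rw [h]; exact smul_ne_zero hc (Ch.ne_zero k _)
  · rw [h]; exact linePath_ne_zero B.indep t

lemma range_path (hr : 0 < r) : B.set = range fun t => pt (B.path t) := by
  apply Subset.antisymm
  · rintro x (⟨k, z, hz, rfl, h⟩ | ⟨h1, h2⟩)
    · obtain ⟨z', hz', h3, rfl⟩ := B.slide_surj k z hz h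
      obtain ⟨t, d, hd, h4⟩ := exists_linePath B.indep h3 (Ch.ne_zero k z')
      refine ⟨t, ?_⟩
      have h5 : linePath B.p B.q t = d⁻¹ • Ch.F k z' := by rw [h4, smul_smul, inv_mul_cancel₀ hd, one_smul]
      show pt (B.path t) = _
      rw [path, h5, Ch.move_smul _ k (inv_ne_zero hd), if_pos ⟨hz', h3⟩, pt_smul (inv_ne_zero hd)]
    · obtain ⟨v, hv, rfl⟩ := exists_pt x
      obtain ⟨t, d, hd, h4⟩ := exists_linePath B.indep ((dot_coords_iff hv).1 h2) hv
      refine ⟨t, ?_⟩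
      have h5 : pt v = pt (linePath B.p B.q t) := by rw [h4, pt_smul hd]
      rcases B.path_cases hr t with ⟨k, c, z, hc, hz, h6, -⟩ | ⟨-, h⟩
      · exact absurd (by rw [h5, h6, pt_smul hc]) (h1 k z hz)
      · show pt (B.path t) = _
        rw [h, h5]
  · rintro _ ⟨t, rfl⟩
    show pt (B.path t) ∈ _
    rcases B.path_cases hr t with ⟨k, c, z, hc, hz, h1, h⟩ | ⟨h1, h⟩
    · have h2 := dot_linePath B.p B.q t
      rw [h1] at h2
      obtain ⟨h3, h4⟩ := B.slide_mem k z hz (dot_smul_F hc h2)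
      rw [h, pt_smul hc]
      exact Or.inl ⟨k, _, h3, rfl, h4⟩
    · rw [h]
      exact Or.inr ⟨h1, (dot_coords_iff (linePath_ne_zero B.indep t)).2 (dot_linePath B.p B.q t)⟩

variable [Finite ι]

lemma isClosed_iUnion_cbox (Ch : ChartFamily ι) (s : ℝ) :
    IsClosed (⋃ k, (fun z => pt (Ch.F k z)) '' cbox s) :=
  isClosed_iUnion_of_finite fun k => ((isCompact_cbox s).image (Ch.continuous k)).isClosed

lemma eventually_off {v : R3} (hv : v ≠ 0) {s : ℝ} (h : ∀ k z, pt v = pt (Ch.F k z) → z ∉ cbox s) :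
    ∀ᶠ w in 𝓝 v, w ≠ 0 ∧ ∀ k z, pt w = pt (Ch.F k z) → z ∉ cbox s := by
  have h1 : ∀ᶠ w in 𝓝 v, pt w ∉ ⋃ k, (fun z => pt (Ch.F k z)) '' cbox s := by
    refine (continuousAt_pt hv).eventually ((isClosed_iUnion_cbox Ch s).isOpen_compl.mem_nhds ?_)
    simp only [mem_compl_iff, mem_iUnion, not_exists]
    rintro k ⟨z, hz, hzv⟩
    exact h k z hzv.symm hz
  filter_upwards [h1, isOpen_compl_singleton.mem_nhds hv] with w hw hw0
  refine ⟨hw0, fun k z hz hzs => hw ?_⟩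
  rw [hz]
  exact mem_iUnion.2 ⟨k, z, hzs, rfl⟩

lemma eventually_mem_set {v : R3} (hv : v ≠ 0) (h : ∀ k z, pt v = pt (Ch.F k z) → z ∉ cbox (r / 2)) :
    ∀ᶠ w in 𝓝 v, pt w ∈ B.set ↔ B.A ⬝ᵥ w = 0 := by
  filter_upwards [eventually_off hv h] with w hw using B.mem_set_off hw.1 hw.2

lemma continuous_path (hr : 0 < r) : Continuous B.path := by
  classical
  refine continuous_iff_continuousAt.2 fun t => ?_
  have hv0 := linePath_ne_zero B.indep t
  by_cases h1 : ∃ k z, pt (linePath B.p B.q t) = pt (Ch.F k z) ∧ z ∈ box r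
  · obtain ⟨k, z, h2, hz⟩ := h1
    obtain ⟨c, hc, h3⟩ := (pt_eq_iff (Ch.ne_zero k z) hv0).1 h2.symm
    have h4 : ContinuousAt (fun v => (Ch.conv k v).1 • Ch.F k (B.slide k (Ch.conv k v).2))
        (linePath B.p B.q t) := by
      have h5 := (Ch.contDiffAt_conv k hc z).continuousAt
      rw [← h3] at h5
      have h6 : (Ch.conv k (linePath B.p B.q t)).2 = z := by rw [h3, Ch.conv_smul k hc]
      have h7 : ContinuousAt (B.slide k) (Ch.conv k (linePath B.p B.q t)).2 := by
        rw [h6]; exact (B.slide_cont k).continuousAt ((isOpen_box r).mem_nhds hz)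
      exact h5.fst.smul (ContinuousAt.comp (Ch.smooth k).continuous.continuousAt
        (ContinuousAt.comp (f := fun v => (Ch.conv k v).2) h7 h5.snd))
    refine (h4.comp_of_eq (continuous_linePath B.p B.q).continuousAt rfl).congr ?_
    have h8 : ∀ᶠ v in 𝓝 (linePath B.p B.q t), ∃ d : ℝ, ∃ w, d ≠ 0 ∧ v = d • Ch.F k w ∧ w ∈ box r := by
      rw [h3]
      exact Ch.eventually_cone k hc z (P := fun _ w => w ∈ box r)
        (continuousAt_snd.eventually ((isOpen_box r).mem_nhds hz))
    filter_upwards [(continuous_linePath B.p B.q).continuousAt.eventually h8] with s hs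
    obtain ⟨d, w, hd, h9, hw⟩ := hs
    have h10 := dot_linePath B.p B.q s
    rw [h9] at h10
    replace h10 := dot_smul_F hd h10
    simp only [Function.comp, path]
    rw [h9, Ch.conv_smul k hd, Ch.move_smul _ k hd, if_pos ⟨hw, h10⟩]
  · push Not at h1
    have h2 := eventually_off (s := r / 2) hv0 fun k z hz hzb =>
      h1 k z hz (cbox_subset_box (by linarith) hzb)
    refine (continuous_linePath B.p B.q).continuousAt.congr ?_
    filter_upwards [(continuous_linePath B.p B.q).continuousAt.eventually h2] with s hs
    refine (path_eq hs.2 _ fun k z hz => ?_).symm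
    split_ifs with h
    · exact B.slide_eq k z h.1 hz h.2
    · rfl

lemma isNoncontractibleCurve (hr : 0 < r) : IsNoncontractibleCurve B.set := by
  refine isNoncontractibleCurve_of_path (B.continuous_path hr) (B.path_ne_zero hr)
    (B.range_path hr) (B.path_one) fun x hx => ?_
  by_cases h1 : ∃ k z, x = pt (Ch.F k z) ∧ z ∈ box r
  · obtain ⟨k, z, rfl, hz⟩ := h1
    exact B.isSmoothCurveAt_box hz ((B.mem_set_box hz).1 hx)
  · push Not at h1
    obtain ⟨v, hv, rfl⟩ := exists_pt x
    have h2 : ∀ k z, pt v = pt (Ch.F k z) → z ∉ cbox (r / 2) := fun k z h hz =>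
      h1 k z h (cbox_subset_box (by linarith) hz)
    exact isSmoothCurveAt_line hv B.A_ne ((B.mem_set_off hv h2).1 hx) (B.eventually_mem_set hv h2)

end BentLine

/-! ### Nodal curves in the projective plane -/

/-- A finite family of closed curves in the projective plane whose only singularities are transverse
double points, with charts around the double points. -/
structure NodalCurve (ι κ : Type) extends ChartFamily ι where
  γ : κ → ℝ → R3
  γ_smooth : ∀ c, ContDiff ℝ ∞ (γ c)
  period : κ → ℝ
  period_ne : ∀ c, period c ≠ 0
  γ_add_pi : ∀ c θ, γ c (θ + π) = period c • γ c θ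
  γ_imm : ∀ c θ, γ c θ ⨯₃ deriv (γ c) θ ≠ 0
  cross : ∀ k z, (∃ c θ, pt (γ c θ) = pt (F k z)) ↔ z.2 ^ 2 = z.1 ^ 2
  γ_inj : ∀ c θ c' θ', pt (γ c θ) = pt (γ c' θ') →
    (c = c' ∧ ∃ n : ℤ, θ' = θ + n * π) ∨ ∃ k, pt (γ c θ) = pt (F k 0)
  diag : ∀ k, ∃ c θ, pt (γ c θ) = pt (F k 0) ∧ ∀ᶠ t in 𝓝 θ, ∃ u : ℝ, pt (γ c t) = pt (F k (u, u))
  antidiag : ∀ k, ∃ c θ, pt (γ c θ) = pt (F k 0) ∧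
    ∀ᶠ t in 𝓝 θ, ∃ u : ℝ, pt (γ c t) = pt (F k (u, -u))

namespace NodalCurve

variable {ι κ : Type} (W : NodalCurve ι κ)

/-- The points of the curve. -/
def points : Set RP2 := {x | ∃ c θ, pt (W.γ c θ) = x}

/-- The curve with smoothed double points and vanishing cycles. -/
def smoothed (G : ι → ℝ → ℝ) : Diagram ι where
  curve := (W.points \ ⋃ k, range fun z => pt (W.F k z)) ∪
    ⋃ k, (fun z => pt (W.F k z)) '' {z | |z.2| = G k z.1}
  interval k := (fun z => pt (W.F k z)) '' {z | z.1 = 0 ∧ |z.2| ≤ G k 0}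

lemma γ_ne (c : κ) (θ : ℝ) : W.γ c θ ≠ 0 := by
  intro h
  apply W.γ_imm c θ
  rw [h]; simp

lemma γ_add_int (c : κ) (θ : ℝ) (n : ℤ) : W.γ c (θ + n * π) = (W.period c) ^ n • W.γ c θ := by
  have hp := W.period_ne c
  induction n with
  | zero => simp
  | succ n ih =>
    have : θ + ((n : ℤ) + 1 : ℤ) * π = (θ + (n : ℤ) * π) + π := by push_cast; ring
    rw [this, W.γ_add_pi, ih, smul_smul, zpow_add_one₀ hp, mul_comm]
  | pred n ih =>
    have h1 : θ + (-(n : ℤ) : ℤ) * π = (θ + (-(n : ℤ) - 1 : ℤ) * π) + π := by push_cast; ring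
    rw [h1, W.γ_add_pi] at ih
    rw [zpow_sub_one₀ hp, mul_comm (_ ^ _), mul_smul, ← ih, smul_smul, inv_mul_cancel₀ hp, one_smul]

lemma pt_γ_add_int (c : κ) (θ : ℝ) (n : ℤ) : pt (W.γ c (θ + n * π)) = pt (W.γ c θ) := by
  rw [W.γ_add_int, pt_smul (zpow_ne_zero _ (W.period_ne c))]

lemma continuous_pt_γ (c : κ) : Continuous fun θ => pt (W.γ c θ) :=
  continuous_pt_comp (W.γ_smooth c).continuous (W.γ_ne c)

lemma exists_int_add_mem (θ₀ θ : ℝ) : ∃ n : ℤ, θ + n * π ∈ Ico θ₀ (θ₀ + π) := by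
  obtain ⟨n, hn, -⟩ := existsUnique_add_zsmul_mem_Ico Real.pi_pos θ θ₀
  exact ⟨n, by simpa using hn⟩

lemma isClosed_branches [Finite κ] (s : Set κ) : IsClosed {x | ∃ c ∈ s, ∃ θ, pt (W.γ c θ) = x} := by
  have h : {x | ∃ c ∈ s, ∃ θ, pt (W.γ c θ) = x} =
      ⋃ c : s, (fun θ => pt (W.γ c θ)) '' Icc 0 (0 + π) := by
    ext x
    simp only [mem_ofPred_eq, mem_iUnion, mem_image, Subtype.exists, exists_prop]
    refine exists_congr fun c => and_congr_right fun _ => ⟨?_, fun ⟨θ, _, h⟩ => ⟨θ, h⟩⟩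
    rintro ⟨θ, rfl⟩
    obtain ⟨n, hn⟩ := exists_int_add_mem 0 θ
    exact ⟨_, Ico_subset_Icc_self hn, W.pt_γ_add_int c θ n⟩
  rw [h]
  exact isClosed_iUnion_of_finite fun c => (isCompact_Icc.image (W.continuous_pt_γ c)).isClosed

/-- A germ of a chart along the curve. -/
def germ (c : κ) (θ : ℝ) (z : ℝ × ℝ) : R3 :=
  W.γ c (θ + z.2) + z.1 • (W.γ c θ ⨯₃ deriv (W.γ c) θ)

lemma germ_smooth (c : κ) (θ : ℝ) : ContDiff ℝ ∞ (W.germ c θ) := by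
  have := (W.γ_smooth c).comp (f := fun z : ℝ × ℝ => θ + z.2) (by fun_prop)
  unfold germ
  exact this.add (by fun_prop)

lemma hasFDerivAt_germ (c : κ) (θ : ℝ) (h : ℝ × ℝ) : fderiv ℝ (W.germ c θ) 0 h =
      h.2 • deriv (W.γ c) θ + h.1 • (W.γ c θ ⨯₃ deriv (W.γ c) θ) := by
  have h1 : HasDerivAt (W.γ c) (deriv (W.γ c) θ) (θ + (0 : ℝ × ℝ).2) := by
    simpa using ((W.γ_smooth c).differentiable (by simp) θ).hasDerivAt
  have h2 : HasFDerivAt (fun z : ℝ × ℝ => θ + z.2) (ContinuousLinearMap.snd ℝ ℝ ℝ) 0 :=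
    hasFDerivAt_snd.const_add θ
  have h3 := h1.hasFDerivAt.comp (0 : ℝ × ℝ) h2
  have h4 : HasFDerivAt (fun z : ℝ × ℝ => z.1 • (W.γ c θ ⨯₃ deriv (W.γ c) θ))
    ((ContinuousLinearMap.fst ℝ ℝ ℝ).smulRight (W.γ c θ ⨯₃ deriv (W.γ c) θ)) 0 :=
    hasFDerivAt_fst.smul_const _
  have h5 := (h3.add h4).fderiv
  have h6 : (W.germ c θ) = (W.γ c ∘ fun z : ℝ × ℝ => θ + z.2) + fun z : ℝ × ℝ =>
    z.1 • (W.γ c θ ⨯₃ deriv (W.γ c) θ) := rfl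
  rw [h6, h5]
  simp

lemma germ_zero (c : κ) (θ : ℝ) : W.germ c θ 0 = W.γ c θ := by simp [germ]

lemma immAt_germ (c : κ) (θ : ℝ) : ImmAt (W.germ c θ) 0 := by
  unfold ImmAt
  rw [hasFDerivAt_germ, hasFDerivAt_germ, germ_zero]
  simp only [zero_smul, one_smul, zero_add, add_zero]
  have h : trip (W.γ c θ) (W.γ c θ ⨯₃ deriv (W.γ c) θ) (deriv (W.γ c) θ) =
      - ((W.γ c θ ⨯₃ deriv (W.γ c) θ) ⬝ᵥ (W.γ c θ ⨯₃ deriv (W.γ c) θ)) := by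
    simp [trip, cross_apply, dotProduct, Fin.sum_univ_three]; ring
  rw [h]
  exact neg_ne_zero.2 (dot_self_pos (W.γ_imm c θ)).ne'

lemma eventually_germ_mem [Finite κ] {c : κ} {θ : ℝ} (h : ∀ k, pt (W.γ c θ) ≠ pt (W.F k 0)) :
    ∀ᶠ z in 𝓝 0, pt (W.germ c θ z) ∈ W.points ↔ z.1 = 0 := by
  obtain ⟨U, hU, hinj⟩ := ImmAt.eventually_injective (W.germ_smooth c θ).contDiffAt
    (W.immAt_germ c θ)
  obtain ⟨ε, hε, hball⟩ := Metric.nhds_basis_closedBall.mem_iff.1 hU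
  have hseg : ∀ s : ℝ, |s| ≤ ε → ((0 : ℝ), s) ∈ U := fun s hs => hball (by
    simp [Metric.mem_closedBall, hs])
  set Z : Set RP2 := {x | ∃ c' ∈ ({c}ᶜ : Set κ), ∃ θ, pt (W.γ c' θ) = x} ∪
    (fun θ => pt (W.γ c θ)) '' Icc (θ + ε) (θ + π - ε) with hZ
  have hZc : IsClosed Z := (W.isClosed_branches _).union
    (isCompact_Icc.image (W.continuous_pt_γ c)).isClosed
  have hx : pt (W.germ c θ 0) ∉ Z := by
    rw [W.germ_zero]
    rintro (⟨c', hc', θ', h1⟩ | ⟨θ', h1, h2⟩)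
    · rcases W.γ_inj c θ c' θ' h1.symm with h2 | ⟨k, h2⟩
      · exact hc' h2.1.symm
      · exact h k h2
    · rcases W.γ_inj c θ c θ' h2.symm with ⟨-, n, h3⟩ | ⟨k, h3⟩
      · rw [h3] at h1
        have hp := Real.pi_pos
        have h4 : (0 : ℝ) < n := by
          by_contra h5
          nlinarith [h1.1, not_lt.1 h5]
        have h6 : (n : ℝ) < 1 := by
          by_contra h5
          nlinarith [h1.2, not_lt.1 h5]
        have h4' : (0 : ℤ) < n := by exact_mod_cast h4
        have h6' : n < (1 : ℤ) := by exact_mod_cast h6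
        omega
      · exact h k h3
  have hne : W.germ c θ 0 ≠ 0 := by rw [W.germ_zero]; exact W.γ_ne c θ
  have h1 : ∀ᶠ z in 𝓝 0, pt (W.germ c θ z) ∉ Z :=
    ((continuousAt_pt hne).comp_of_eq (W.germ_smooth c θ).continuous.continuousAt rfl).eventually
      (hZc.isOpen_compl.mem_nhds hx)
  filter_upwards [h1, hU] with z hz hzU
  constructor
  · rintro ⟨c', θ', h2⟩
    have hc : c' = c := by
      by_contra hc
      exact hz (Or.inl ⟨c', hc, θ', h2⟩)
    subst hc
    obtain ⟨n, hn⟩ := exists_int_add_mem (θ - ε) θ'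
    set t := θ' + n * π with ht
    have h3 : pt (W.γ c' t) = pt (W.germ c' θ z) := by rw [ht, W.pt_γ_add_int, h2]
    have h4 : t < θ + ε := by
      by_contra h5
      exact hz (Or.inr ⟨t, ⟨not_lt.1 h5, by linarith [hn.2]⟩, h3⟩)
    have h5 : pt (W.germ c' θ (0, t - θ)) = pt (W.germ c' θ z) := by rw [← h3]; simp [germ]
    rw [← hinj _ (hseg _ (abs_le.2 ⟨by linarith [hn.1], by linarith⟩)) z hzU h5]
  · intro h2
    exact ⟨c, θ + z.2, by simp [germ, h2]⟩

/-- A line that is transverse to a branch of the curve. -/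
lemma transverseAt_branch [Finite κ] {c : κ} {θ : ℝ} (h : ∀ k, pt (W.γ c θ) ≠ pt (W.F k 0))
    {X Y : Set RP2} {a : R3} (ha : a ⬝ᵥ W.γ c θ = 0) (ha' : a ⬝ᵥ deriv (W.γ c) θ ≠ 0)
    (hX : ∀ᶠ w in 𝓝 (W.γ c θ), pt w ∈ X ↔ a ⬝ᵥ w = 0)
    (hY : ∀ᶠ w in 𝓝 (W.γ c θ), pt w ∈ Y ↔ pt w ∈ W.points) : TransverseAt X Y (pt (W.γ c θ)) := by
  have hs := W.germ_smooth c θ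
  have h0 := W.germ_zero c θ
  have hd : DifferentiableAt ℝ (W.germ c θ) 0 := hs.contDiffAt.differentiableAt (by simp)
  have ht : Tendsto (W.germ c θ) (𝓝 0) (𝓝 (W.γ c θ)) := by
    rw [← h0]; exact hs.continuous.continuousAt
  rw [← h0]
  refine transverseAt_of_functions (f := fun z => a ⬝ᵥ W.germ c θ z) (g := fun z => z.1)
    (.of_forall fun z => hs.contDiffAt) (W.immAt_germ c θ)
    (.of_forall fun z => ((contDiff_dot a).comp hs).contDiffAt)
    (.of_forall fun z => by fun_prop) (by rw [h0, ha]) rfl ?_ (ht.eventually hX) ?_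
  · rw [fderiv_dot_comp _ hd, fderiv_dot_comp _ hd, hasFDerivAt_germ, hasFDerivAt_germ]
    simp [fderiv_fst, ha']
  · filter_upwards [ht.eventually hY, W.eventually_germ_mem h] with z h1 h2
    rw [h1, h2]

end NodalCurve

namespace NodalCurve

variable {ι κ : Type} (W : NodalCurve ι κ)

/-- Smoothing profiles that smooth inside the boxes of radius `r / 2`. -/
structure IsProfile (G : ℝ → ℝ) (r : ℝ) : Prop where
  smooth : ContDiff ℝ ∞ G
  pos : ∀ u, 0 < G u
  eq : ∀ u, r / 2 ≤ |u| → G u = |u|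
  le : ∀ u, |u| ≤ r / 2 → G u ≤ r / 2

lemma IsProfile.abs_eq_iff {G : ℝ → ℝ} {r : ℝ} (h : IsProfile G r) {z : ℝ × ℝ}
    (hz : z ∉ cbox (r / 2)) : |z.2| = G z.1 ↔ z.2 ^ 2 = z.1 ^ 2 := by
  rw [sq_eq_sq_iff_abs_eq_abs]
  rcases le_total (r / 2) |z.1| with h1 | h1
  · rw [h.eq _ h1]
  · have h2 : r / 2 < |z.2| := by
      by_contra h3
      exact hz ⟨h1, not_lt.1 h3⟩
    have h3 := h.le _ h1
    constructor <;> intro h4 <;> linarith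

variable {W} {G : ι → ℝ → ℝ} {r : ℝ}

lemma mem_smoothed_chart {k : ι} {z : ℝ × ℝ} :
    pt (W.F k z) ∈ (W.smoothed G).curve ↔ |z.2| = G k z.1 := by
  constructor
  · rintro (⟨-, h⟩ | h)
    · exact absurd (mem_iUnion.2 ⟨k, mem_range_self z⟩) h
    · obtain ⟨l, w, hw, h⟩ := mem_iUnion.1 h
      obtain ⟨rfl, rfl⟩ := W.inj _ _ _ _ h
      exact hw
  · exact fun h => Or.inr (mem_iUnion.2 ⟨k, mem_image_of_mem (fun z => pt (W.F k z)) h⟩)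

lemma mem_interval_chart {k l : ι} {z : ℝ × ℝ} :
    pt (W.F k z) ∈ (W.smoothed G).interval l ↔ k = l ∧ z.1 = 0 ∧ |z.2| ≤ G k 0 := by
  constructor
  · rintro ⟨w, hw, h⟩
    obtain ⟨rfl, rfl⟩ := W.inj _ _ _ _ h
    exact ⟨rfl, hw⟩
  · rintro ⟨rfl, h⟩
    exact ⟨z, h, rfl⟩

lemma mem_points_chart {k : ι} {z : ℝ × ℝ} : pt (W.F k z) ∈ W.points ↔ z.2 ^ 2 = z.1 ^ 2 :=
  W.cross k z

lemma mem_smoothed_off (hG : ∀ k, IsProfile (G k) r) {v : R3}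
    (h : ∀ k z, pt v = pt (W.F k z) → z ∉ cbox (r / 2)) :
    pt v ∈ (W.smoothed G).curve ↔ pt v ∈ W.points := by
  by_cases h1 : ∃ k z, pt v = pt (W.F k z)
  · obtain ⟨k, z, h1⟩ := h1
    rw [h1, mem_smoothed_chart, mem_points_chart, (hG k).abs_eq_iff (h k z h1)]
  · push Not at h1
    constructor
    · rintro (⟨h2, -⟩ | h2)
      · exact h2
      · obtain ⟨l, w, hw, h⟩ := mem_iUnion.1 h2
        exact absurd h.symm (h1 l w)
    · refine fun h2 => Or.inl ⟨h2, fun h3 => ?_⟩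
      obtain ⟨l, w, h⟩ := mem_iUnion.1 h3
      exact absurd h.symm (h1 l w)

/-- A bent line has a good position with respect to a nodal curve and smoothing profiles. -/
structure Fits (W : NodalCurve ι κ) (G : ι → ℝ → ℝ) (B : BentLine W.toChartFamily r)
    (node vert : Set ι) : Prop where
  miss : ∀ k ∉ node, ∀ z ∈ box r, B.E k z ≠ 0
  vert_sub : vert ⊆ node
  hor : ∀ k ∈ node, k ∉ vert → ∃ x, |x| < G k 0 ∧ B.E k (0, x) = 0 ∧
    fderiv ℝ (B.E k) (0, x) (0, 1) ≠ 0 ∧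
    ∀ z ∈ box r, B.E k z = 0 → |z.2| < G k z.1 ∧ (z.1 = 0 → z.2 = x)
  vert_interval : ∀ k ∈ vert, ∀ w, |w| ≤ G k 0 → B.E k (0, w) = 0
  vert_curve : ∀ k ∈ vert, ∀ z ∈ box r, B.E k z = 0 → (z.1 = 0 ∧ |z.2| ≤ G k 0) ∨ G k z.1 < |z.2|
  vert_end : ∀ k ∈ vert, ∀ w, |w| = G k 0 → fderiv ℝ (B.E k) (0, w) (0, 1) = 0
  simple : ∀ c θ, B.A ⬝ᵥ W.γ c θ = 0 → B.A ⬝ᵥ deriv (W.γ c) θ ≠ 0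
  count : 2 * node.encard + {x | x ∈ W.points ∧ (∀ k, ∀ z ∈ box r, x ≠ pt (W.F k z)) ∧
    B.A ⬝ᵥ x.coords = 0}.encard ≤ 5

lemma IsProfile.zero_mem_box {G : ℝ → ℝ} {r : ℝ} (h : IsProfile G r) (hr : 0 < r) {w : ℝ}
    (hw : |w| ≤ G 0) : ((0 : ℝ), w) ∈ box r := by
  have := h.le 0 (by simp; linarith)
  exact ⟨by simpa using hr, by simp only; linarith⟩

namespace Fits

variable {B : BentLine W.toChartFamily r} {node vert : Set ι}

lemma transverse_curve_box (h : Fits W G B node vert) (hG : ∀ k, IsProfile (G k) r) {k : ι}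
    {z : ℝ × ℝ} (hz : z ∈ box r) (h1 : B.E k z = 0) (h2 : |z.2| = G k z.1) :
    TransverseAt B.set (W.smoothed G).curve (pt (W.F k z)) := by
  have hk : k ∈ node := by
    by_contra hk
    exact h.miss k hk z hz h1
  by_cases hv : k ∈ vert
  swap
  · obtain ⟨x, -, -, -, hx⟩ := h.hor k hk hv
    exact absurd h2 (hx z hz h1).1.ne
  rcases h.vert_curve k hv z hz h1 with ⟨h3, -⟩ | h3
  swap
  · exact absurd h2 h3.ne'
  obtain ⟨u, w⟩ := z
  simp only at h2 h3
  subst h3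
  have hE := h.vert_end k hv w h2
  have hE1 : fderiv ℝ (B.E k) (0, w) (1, 0) ≠ 0 := by
    rcases B.E_grad k _ hz h1 with h3 | h3
    · exact h3
    · exact absurd hE h3
  have hX : ∀ᶠ w' in 𝓝 ((0 : ℝ), w), pt (W.F k w') ∈ B.set ↔ B.E k w' = 0 := by
    filter_upwards [(isOpen_box r).mem_nhds hz] with w' hw' using B.mem_set_box hw'
  have hGp := (hG k).pos 0
  have hw0 : w ≠ 0 := by rintro rfl; simp at h2; linarith
  have hGd : DifferentiableAt ℝ (fun z : ℝ × ℝ => G k z.1) (0, w) :=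
    (((hG k).smooth.comp contDiff_fst).contDiffAt (x := ((0 : ℝ), w))).differentiableAt (by simp)
  have hGd2 : fderiv ℝ (fun z : ℝ × ℝ => G k z.1) (0, w) (0, 1) = 0 := by
    have h4 : HasFDerivAt (G k) (fderiv ℝ (G k) 0) ((0 : ℝ), w).1 :=
      ((hG k).smooth.differentiable (by simp) 0).hasFDerivAt
    have := (h4.comp ((0 : ℝ), w) hasFDerivAt_fst).fderiv
    have e : (fun z : ℝ × ℝ => G k z.1) = G k ∘ Prod.fst := rfl
    rw [e, this]
    simp
  have hsm : ∀ s : ℝ, ∀ z : ℝ × ℝ, ContDiffAt ℝ ∞ (fun z : ℝ × ℝ => s * z.2 - G k z.1) z :=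
    fun s z => ((contDiff_const.mul contDiff_snd).sub ((hG k).smooth.comp contDiff_fst)).contDiffAt
  have key : ∀ s : ℝ, s ≠ 0 → s * w = G k 0 → (∀ᶠ z in 𝓝 ((0 : ℝ), w), |z.2| = s * z.2) →
      TransverseAt B.set (W.smoothed G).curve (pt (W.F k (0, w))) := by
    intro s hs hsw hab
    refine transverseAt_of_functions (f := B.E k) (g := fun z => s * z.2 - G k z.1)
      (.of_forall fun z => (W.smooth k).contDiffAt) (W.imm k _)
      (.of_forall fun z => (B.E_smooth k).contDiffAt)
      (.of_forall (hsm s)) h1 (by simp [hsw]) ?_ hX ?_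
    · rw [hE]
      have h5 : fderiv ℝ (fun z : ℝ × ℝ => s * z.2 - G k z.1) (0, w) (0, 1) = s := by
        have h6 : HasFDerivAt (fun z : ℝ × ℝ => s * z.2) (s • ContinuousLinearMap.snd ℝ ℝ ℝ)
          ((0 : ℝ), w) := hasFDerivAt_snd.const_mul s
        rw [(h6.fun_sub hGd.hasFDerivAt).fderiv, sub_apply, hGd2]
        simp
      rw [h5]
      simp [hs, hE1]
    · filter_upwards [hab] with z hz
      rw [mem_smoothed_chart, hz, sub_eq_zero]
  rcases hw0.lt_or_gt with hw | hw
  · refine key (-1) (by norm_num) (by rw [← h2, abs_of_neg hw]; ring) ?_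
    filter_upwards [continuousAt_snd.eventually (isOpen_Iio.mem_nhds hw)] with z hz
    rw [abs_of_neg (mem_Iio.1 hz)]; ring
  · refine key 1 (by norm_num) (by rw [← h2, abs_of_pos hw]; ring) ?_
    filter_upwards [continuousAt_snd.eventually (isOpen_Ioi.mem_nhds hw)] with z hz
    rw [abs_of_pos (mem_Ioi.1 hz)]; ring

lemma transverse_curve [Finite ι] [Finite κ] (h : Fits W G B node vert)
    (hG : ∀ k, IsProfile (G k) r) (hr : 0 < r) {x : RP2} (hx : x ∈ B.set ∩ (W.smoothed G).curve) :
    TransverseAt B.set (W.smoothed G).curve x := by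
  by_cases h1 : ∃ k z, x = pt (W.F k z) ∧ z ∈ box r
  · obtain ⟨k, z, rfl, hz⟩ := h1
    exact h.transverse_curve_box hG hz ((B.mem_set_box hz).1 hx.1) (mem_smoothed_chart.1 hx.2)
  · push Not at h1
    obtain ⟨v, hv, rfl⟩ := exists_pt x
    have h2 : ∀ k z, pt v = pt (W.F k z) → z ∉ cbox (r / 2) := fun k z h hz =>
      h1 k z h (cbox_subset_box (by linarith) hz)
    obtain ⟨c, θ, h3⟩ := (mem_smoothed_off hG h2).1 hx.2
    rw [← h3] at hx ⊢
    have h4 : ∀ k z, pt (W.γ c θ) = pt (W.F k z) → z ∉ cbox (r / 2) := by rwa [h3]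
    have h5 := (B.mem_set_off (W.γ_ne c θ) h4).1 hx.1
    refine W.transverseAt_branch (fun k hk => ?_) h5 (h.simple c θ h5)
      (B.eventually_mem_set (W.γ_ne c θ) h4) ?_
    · exact h4 k 0 hk ⟨by simp; linarith, by simp; linarith⟩
    · filter_upwards [BentLine.eventually_off (W.γ_ne c θ) h4] with w hw
      exact mem_smoothed_off hG hw.2

lemma interval_subset (h : Fits W G B node vert) (hG : ∀ k, IsProfile (G k) r) (hr : 0 < r) {k : ι}
    (hk : k ∈ vert) : (W.smoothed G).interval k ⊆ B.set := by
  rintro _ ⟨⟨u, w⟩, ⟨h1, h2⟩, rfl⟩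
  simp only at h1 h2
  subst h1
  exact (B.mem_set_box ((hG k).zero_mem_box hr h2)).2 (h.vert_interval k hk w h2)

lemma inter_interval_hor (hG : ∀ k, IsProfile (G k) r) (hr : 0 < r)
    {k : ι} {x : ℝ} (hx : |x| < G k 0) (hx0 : B.E k (0, x) = 0)
    (hx1 : ∀ z ∈ box r, B.E k z = 0 → |z.2| < G k z.1 ∧ (z.1 = 0 → z.2 = x)) :
    B.set ∩ (W.smoothed G).interval k = {pt (W.F k (0, x))} := by
  apply Subset.antisymm
  · rintro _ ⟨h1, ⟨⟨u, w⟩, ⟨h2, h3⟩, rfl⟩⟩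
    simp only at h2 h3
    subst h2
    have hz := (hG k).zero_mem_box hr h3
    have := (hx1 _ hz ((B.mem_set_box hz).1 h1)).2 rfl
    simp only at this
    simp [this]
  · rintro _ rfl
    exact ⟨(B.mem_set_box ((hG k).zero_mem_box hr hx.le)).2 hx0, mem_interval_chart.2
      ⟨rfl, rfl, hx.le⟩⟩

lemma inter_interval (h : Fits W G B node vert) (hG : ∀ k, IsProfile (G k) r) (hr : 0 < r) {k : ι}
    (hk : k ∉ node) : B.set ∩ (W.smoothed G).interval k = ∅ := by
  rw [eq_empty_iff_forall_notMem]
  rintro _ ⟨h1, ⟨⟨u, w⟩, ⟨h2, h3⟩, rfl⟩⟩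
  simp only at h2 h3
  subst h2
  have hz := (hG k).zero_mem_box hr h3
  exact h.miss k hk _ hz ((B.mem_set_box hz).1 h1)

lemma isQuasiline [Finite ι] [Finite κ] (h : Fits W G B node vert) (hG : ∀ k, IsProfile (G k) r)
    (hr : 0 < r) : (W.smoothed G).IsQuasiline B.set where
  isCurve := B.isNoncontractibleCurve hr
  transverse_curve x hx := h.transverse_curve hG hr hx
  interval k := by
    by_cases hv : k ∈ vert
    · exact Or.inr (inter_eq_right.2 (h.interval_subset hG hr hv))
    left
    by_cases hk : k ∈ node
    · obtain ⟨x, h1, h2, h3, h4⟩ := h.hor k hk hv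
      have h5 := inter_interval_hor hG hr h1 h2 h4
      have hz := (hG k).zero_mem_box hr h1.le
      refine ⟨by rw [h5]; simp, ?_, ?_⟩
      · rw [h5]
        rintro _ rfl
        refine transverseAt_of_functions (f := B.E k) (g := fun z => z.1)
          (.of_forall fun z => (W.smooth k).contDiffAt) (W.imm k _)
          (.of_forall fun z => (B.E_smooth k).contDiffAt)
          (.of_forall fun z => by fun_prop) h2 rfl (by simp [fderiv_fst, h3]) ?_ ?_
        · filter_upwards [(isOpen_box r).mem_nhds hz] with w' hw' using B.mem_set_box hw'
        · have h6 : ∀ᶠ z : ℝ × ℝ in 𝓝 (0, x), |z.2| < G k 0 :=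
            (isOpen_lt (continuous_abs.comp continuous_snd) continuous_const).mem_nhds h1
          filter_upwards [h6] with z hz
          rw [mem_interval_chart]
          exact ⟨fun h => h.2.1, fun h => ⟨rfl, h, hz.le⟩⟩
      · rw [Set.disjoint_left]
        rintro y hy ⟨h6, h7⟩
        have h8 : y ∈ B.set ∩ (W.smoothed G).interval k := ⟨hy, h6⟩
        rw [h5] at h8
        rw [mem_singleton_iff.1 h8] at h7
        exact h1.ne (mem_smoothed_chart.1 h7)
    · rw [h.inter_interval hG hr hk]
      refine ⟨by simp, by simp, ?_⟩
      rw [Set.disjoint_left]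
      rintro y hy ⟨h6, -⟩
      have h8 : y ∈ B.set ∩ (W.smoothed G).interval k := ⟨hy, h6⟩
      rw [h.inter_interval hG hr hk] at h8
      exact h8
  bezout := by
    refine le_trans (add_le_add (mul_le_mul_right (encard_le_encard ?_) 2) (encard_le_encard ?_))
      h.count
    · intro k hk
      by_contra hn
      rw [mem_ofPred_eq, h.inter_interval hG hr hn] at hk
      exact not_nonempty_empty hk
    · rintro x ⟨hx, hc, hi⟩
      have hbox : ∀ k, ∀ z ∈ box r, x ≠ pt (W.F k z) := by
        rintro k z hz rfl
        have h1 := (B.mem_set_box hz).1 hx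
        have h2 := mem_smoothed_chart.1 hc
        have hk : k ∈ node := by
          by_contra hk
          exact h.miss k hk z hz h1
        by_cases hv : k ∈ vert
        · rcases h.vert_curve k hv z hz h1 with h3 | h3
          · exact hi (mem_iUnion.2 ⟨k, mem_interval_chart.2 ⟨rfl, h3⟩⟩)
          · exact h3.ne' h2
        · obtain ⟨x, -, -, -, h4⟩ := h.hor k hk hv
          exact (h4 z hz h1).1.ne h2
      obtain ⟨v, hv, rfl⟩ := exists_pt x
      have h2 : ∀ k z, pt v = pt (W.F k z) → z ∉ cbox (r / 2) := fun k z h hz =>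
        hbox k z (cbox_subset_box (by linarith) hz) h
      exact ⟨(mem_smoothed_off hG h2).1 hc, hbox,
        (dot_coords_iff hv).2 ((B.mem_set_off hv h2).1 hx)⟩

end Fits

end NodalCurve

/-- A smooth function with values in the unit interval. -/
structure IsBlend (φ : ℝ → ℝ) : Prop where
  smooth : ContDiff ℝ ∞ φ
  nonneg : ∀ w, 0 ≤ φ w
  le_one : ∀ w, φ w ≤ 1

lemma isBlend_one : IsBlend fun _ => 1 := ⟨contDiff_const, fun _ => zero_le_one, fun _ => le_rfl⟩

/-- A cutoff function for bending lines. -/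
structure IsCutoff (φ : ℝ → ℝ) (a r lam : ℝ) : Prop extends IsBlend φ where
  eq_zero_iff : ∀ w, φ w = 0 ↔ |w| ≤ a
  eq_one : ∀ w, r / 2 ≤ |w| → φ w = 1
  lt : ∀ w, a < |w| → φ w * lam * |w| < |w| - a

/-- A line with linear estimates in the boxes around the double points on it. -/
structure LineData {ι : Type} (Ch : ChartFamily ι) (r lam : ℝ) where
  p : R3
  q : R3
  indep : p ⨯₃ q ≠ 0
  node : Set ι
  vert : Set ι
  vert_sub : vert ⊆ node
  α : ι → ℝ
  β : ι → ℝ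
  κ : ι → ℝ
  κ_nonneg : ∀ k, 0 ≤ κ k
  miss : ∀ k ∉ node, ∀ z ∈ box r, (p ⨯₃ q) ⬝ᵥ Ch.F k z ≠ 0
  est : ∀ k ∈ node, ∀ z ∈ box r, ∀ z' ∈ box r,
    |(p ⨯₃ q) ⬝ᵥ Ch.F k z - (p ⨯₃ q) ⬝ᵥ Ch.F k z' - α k * (z.1 - z'.1) - β k * (z.2 - z'.2)| ≤
      κ k * (|z.1 - z'.1| + |z.2 - z'.2|)
  vert_lt : ∀ k ∈ vert, κ k < |α k| ∧ |β k| + κ k ≤ lam * (|α k| - κ k)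
  vert_zero : ∀ k ∈ vert, (p ⨯₃ q) ⬝ᵥ Ch.F k 0 = 0
  hor_lt : ∀ k ∈ node, k ∉ vert → κ k < |β k| ∧ |α k| + κ k ≤ lam * (|β k| - κ k)

namespace LineData

variable {ι : Type} {Ch : ChartFamily ι} {r lam : ℝ} (D : LineData Ch r lam)

/-- The covector of the line. -/
def A : R3 := D.p ⨯₃ D.q

/-- The equation of the line in a chart. -/
def e (k : ι) (z : ℝ × ℝ) : ℝ := D.A ⬝ᵥ Ch.F k z

open Classical in
/-- The equation of the bent line in a chart. -/
def E (φ : ℝ → ℝ) (k : ι) (z : ℝ × ℝ) : ℝ :=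
  if k ∈ D.vert then (1 - φ z.2) * (D.α k * z.1) + φ z.2 * D.e k z else D.e k z

lemma E_vert {φ : ℝ → ℝ} {k : ι} (hk : k ∈ D.vert) (z : ℝ × ℝ) :
    D.E φ k z = (1 - φ z.2) * (D.α k * z.1) + φ z.2 * D.e k z := by simp [E, hk]

lemma E_not_vert {φ : ℝ → ℝ} {k : ι} (hk : k ∉ D.vert) : D.E φ k = D.e k := by
  funext z; simp [E, hk]

lemma e_smooth (k : ι) : ContDiff ℝ ∞ (D.e k) := (contDiff_dot D.A).comp (Ch.smooth k)

lemma E_smooth {φ : ℝ → ℝ} (hφ : ContDiff ℝ ∞ φ) (k : ι) : ContDiff ℝ ∞ (D.E φ k) := by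
  by_cases hk : k ∈ D.vert
  · have h1 := D.e_smooth k
    have h2 : ContDiff ℝ ∞ fun z : ℝ × ℝ => φ z.2 := hφ.comp contDiff_snd
    have : D.E φ k = fun z => (1 - φ z.2) * (D.α k * z.1) + φ z.2 * D.e k z :=
      funext fun z => D.E_vert hk z
    rw [this]
    fun_prop
  · rw [D.E_not_vert hk]; exact D.e_smooth k

lemma E_one (k : ι) : D.E (fun _ => 1) k = D.e k := by funext z; simp [E]

variable {D} {φ : ℝ → ℝ} {a : ℝ} {k : ι}

lemma est' (hk : k ∈ D.node) {z z' : ℝ × ℝ} (hz : z ∈ box r) (hz' : z' ∈ box r) :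
    |D.e k z - D.e k z' - D.α k * (z.1 - z'.1) - D.β k * (z.2 - z'.2)| ≤
      D.κ k * (|z.1 - z'.1| + |z.2 - z'.2|) := D.est k hk z hz z' hz'

lemma abs_fderiv_e_one (hk : k ∈ D.node) {z : ℝ × ℝ} (hz : z ∈ box r) :
    |fderiv ℝ (D.e k) z (1, 0) - D.α k| ≤ D.κ k := by
  have h1 : HasDerivAt (fun t : ℝ => (t, z.2)) ((1 : ℝ), (0 : ℝ)) z.1 :=
    (hasDerivAt_id _).prodMk (hasDerivAt_const _ _)
  have h2 : HasFDerivAt (D.e k) (fderiv ℝ (D.e k) z) (z.1, z.2) :=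
    ((D.e_smooth k).differentiable (by simp) z).hasFDerivAt
  have h3 : HasDerivAt (fun t : ℝ => D.e k (t, z.2) - D.α k * t)
      (fderiv ℝ (D.e k) z (1, 0) - D.α k * 1) z.1 :=
    (h2.comp_hasDerivAt z.1 h1).sub ((hasDerivAt_id _).const_mul _)
  have h4 := h3.le_of_lip' (C := D.κ k) (D.κ_nonneg k) ?_
  · simpa using h4
  have h5 : ∀ᶠ t : ℝ in 𝓝 z.1, |t| < r := (isOpen_lt continuous_abs continuous_const).mem_nhds hz.1
  filter_upwards [h5] with t ht
  have := est' hk (z := (t, z.2)) (z' := z) ⟨ht, hz.2⟩ hz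
  simp only [sub_self, abs_zero, add_zero, mul_zero, sub_zero] at this
  rw [Real.norm_eq_abs, Real.norm_eq_abs]
  refine le_trans (le_of_eq ?_) this
  congr 1
  show D.e k (t, z.2) - D.α k * t - (D.e k z - D.α k * z.1) = _
  ring

lemma abs_fderiv_e_two (hk : k ∈ D.node) {z : ℝ × ℝ} (hz : z ∈ box r) :
    |fderiv ℝ (D.e k) z (0, 1) - D.β k| ≤ D.κ k := by
  have h1 : HasDerivAt (fun t : ℝ => (z.1, t)) ((0 : ℝ), (1 : ℝ)) z.2 :=
    (hasDerivAt_const _ _).prodMk (hasDerivAt_id _)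
  have h2 : HasFDerivAt (D.e k) (fderiv ℝ (D.e k) z) (z.1, z.2) :=
    ((D.e_smooth k).differentiable (by simp) z).hasFDerivAt
  have h3 : HasDerivAt (fun t : ℝ => D.e k (z.1, t) - D.β k * t)
      (fderiv ℝ (D.e k) z (0, 1) - D.β k * 1) z.2 :=
    (h2.comp_hasDerivAt z.2 h1).sub ((hasDerivAt_id _).const_mul _)
  have h4 := h3.le_of_lip' (C := D.κ k) (D.κ_nonneg k) ?_
  · simpa using h4
  have h5 : ∀ᶠ t : ℝ in 𝓝 z.2, |t| < r := (isOpen_lt continuous_abs continuous_const).mem_nhds hz.2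
  filter_upwards [h5] with t ht
  have := est' hk (z := (z.1, t)) (z' := z) ⟨hz.1, ht⟩ hz
  simp only [sub_self, abs_zero, zero_add, mul_zero, sub_zero] at this
  rw [Real.norm_eq_abs, Real.norm_eq_abs]
  refine le_trans (le_of_eq ?_) this
  congr 1
  show D.e k (z.1, t) - D.β k * t - (D.e k z - D.β k * z.2) = _
  ring

/-- In a box around a double point at which the line is not steep. -/
lemma hor_le (hk : k ∈ D.node) (hv : k ∉ D.vert) {z z' : ℝ × ℝ} (hz : z ∈ box r) (hz' : z' ∈ box r)
    (h : D.e k z = 0) (h' : D.e k z' = 0) : |z.2 - z'.2| ≤ lam * |z.1 - z'.1| := by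
  have h1 := est' hk hz hz'
  obtain ⟨h2, h3⟩ := D.hor_lt k hk hv
  rw [h, h'] at h1
  have h4 : |D.β k * (z.2 - z'.2)| ≤ |D.α k * (z.1 - z'.1)| +
      D.κ k * (|z.1 - z'.1| + |z.2 - z'.2|) := by
    calc |D.β k * (z.2 - z'.2)| = |(D.α k * (z.1 - z'.1)) +
          (0 - 0 - D.α k * (z.1 - z'.1) - D.β k * (z.2 - z'.2))| := by rw [← abs_neg]; congr 1; ring
      _ ≤ _ := (abs_add_le _ _).trans (by linarith)
  rw [abs_mul, abs_mul] at h4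
  have h5 : (|D.β k| - D.κ k) * |z.2 - z'.2| ≤ (|D.β k| - D.κ k) * (lam * |z.1 - z'.1|) := by
    nlinarith [mul_le_mul_of_nonneg_right h3 (abs_nonneg (z.1 - z'.1))]
  exact le_of_mul_le_mul_left h5 (by linarith)

lemma hor_fderiv (hk : k ∈ D.node) (hv : k ∉ D.vert) {z : ℝ × ℝ} (hz : z ∈ box r) :
    fderiv ℝ (D.e k) z (0, 1) ≠ 0 := by
  intro h
  have h1 := abs_fderiv_e_two hk hz
  rw [h, zero_sub, abs_neg] at h1
  linarith [(D.hor_lt k hk hv).1]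

section vert

lemma fderiv_E_one (hφ : IsBlend φ) (hv : k ∈ D.vert) {z : ℝ × ℝ} (hz : z ∈ box r) :
    fderiv ℝ (D.E φ k) z (1, 0) ≠ 0 := by
  have h1 : HasDerivAt (fun t : ℝ => (t, z.2)) ((1 : ℝ), (0 : ℝ)) z.1 :=
    (hasDerivAt_id _).prodMk (hasDerivAt_const _ _)
  have h2 : HasFDerivAt (D.e k) (fderiv ℝ (D.e k) z) (z.1, z.2) :=
    ((D.e_smooth k).differentiable (by simp) z).hasFDerivAt
  have h2' : HasFDerivAt (D.E φ k) (fderiv ℝ (D.E φ k) z) (z.1, z.2) :=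
    ((D.E_smooth hφ.smooth k).differentiable (by simp) z).hasFDerivAt
  have h3 : HasDerivAt (fun t : ℝ => (1 - φ z.2) * (D.α k * t) + φ z.2 * D.e k (t, z.2))
      ((1 - φ z.2) * (D.α k * 1) + φ z.2 * fderiv ℝ (D.e k) z (1, 0)) z.1 :=
    (((hasDerivAt_id _).const_mul _).const_mul _).add ((h2.comp_hasDerivAt z.1 h1).const_mul _)
  have h4 : HasDerivAt (fun t : ℝ => D.E φ k (t, z.2)) (fderiv ℝ (D.E φ k) z (1, 0)) z.1 :=
    HasFDerivAt.comp_hasDerivAt (l := D.E φ k) z.1 h2' h1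
  have h5 : (fun t : ℝ => D.E φ k (t, z.2)) =
      fun t : ℝ => (1 - φ z.2) * (D.α k * t) + φ z.2 * D.e k (t, z.2) :=
    funext fun t => D.E_vert hv _
  rw [h5] at h4
  rw [h4.unique h3]
  intro h0
  have h6 := abs_fderiv_e_one (D.vert_sub hv) hz
  have h7 : D.α k = -(φ z.2 * (fderiv ℝ (D.e k) z (1, 0) - D.α k)) := by linarith
  have h8 := congrArg abs h7
  rw [abs_neg, abs_mul, abs_of_nonneg (hφ.nonneg _)] at h8
  have := hφ.le_one z.2
  nlinarith [(D.vert_lt k hv).1, abs_nonneg (fderiv ℝ (D.e k) z (1, 0) - D.α k), hφ.nonneg z.2]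

lemma est_E (hφ : IsBlend φ) (hv : k ∈ D.vert) {u u' w : ℝ} (hz : (u, w) ∈ box r)
    (hz' : (u', w) ∈ box r) :
    |D.E φ k (u, w) - D.E φ k (u', w) - D.α k * (u - u')| ≤ D.κ k * |u - u'| := by
  have h1 := est' (D.vert_sub hv) hz hz'
  simp only [sub_self, abs_zero, add_zero, mul_zero, sub_zero] at h1
  rw [D.E_vert hv, D.E_vert hv]
  simp only
  calc _ = |φ w * (D.e k (u, w) - D.e k (u', w) - D.α k * (u - u'))| := by congr 1; ring
    _ = φ w * |D.e k (u, w) - D.e k (u', w) - D.α k * (u - u')| := by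
        rw [abs_mul, abs_of_nonneg (hφ.nonneg w)]
    _ ≤ 1 * |D.e k (u, w) - D.e k (u', w) - D.α k * (u - u')| :=
        mul_le_mul_of_nonneg_right (hφ.le_one w) (abs_nonneg _)
    _ ≤ _ := by rw [one_mul]; exact h1

/-- In a box around a double point at which the line is steep. -/
lemma vert_mul_pos (hφ : IsBlend φ) (hv : k ∈ D.vert) {u u' w : ℝ} (hz : (u, w) ∈ box r)
    (hz' : (u', w) ∈ box r) (h : u' < u) :
    0 < D.α k * (D.E φ k (u, w) - D.E φ k (u', w)) := by
  have h1 := est_E hφ hv hz hz'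
  have h2 := (D.vert_lt k hv).1
  rw [abs_of_pos (sub_pos.2 h)] at h1
  obtain ⟨h3, h4⟩ := abs_le.1 h1
  rcases lt_trichotomy (D.α k) 0 with h5 | h5 | h5
  · rw [abs_of_neg h5] at h2
    have : D.E φ k (u, w) - D.E φ k (u', w) < 0 := by nlinarith [sub_pos.2 h]
    exact mul_pos_of_neg_of_neg h5 this
  · rw [h5, abs_zero] at h2
    linarith [D.κ_nonneg k]
  · rw [abs_of_pos h5] at h2
    have : 0 < D.E φ k (u, w) - D.E φ k (u', w) := by nlinarith [sub_pos.2 h]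
    exact mul_pos h5 this

lemma vert_unique (hφ : IsBlend φ) (hv : k ∈ D.vert) {u u' w : ℝ} (hz : (u, w) ∈ box r)
    (hz' : (u', w) ∈ box r) (h : D.E φ k (u, w) = 0) (h' : D.E φ k (u', w) = 0) : u = u' := by
  rcases lt_trichotomy u u' with h1 | h1 | h1
  · have := vert_mul_pos hφ hv hz' hz h1
    simp [h, h'] at this
  · exact h1
  · have := vert_mul_pos hφ hv hz hz' h1
    simp [h, h'] at this

lemma abs_E_zero_le (hφ : IsBlend φ) (hv : k ∈ D.vert) {w : ℝ}
    (hz : ((0 : ℝ), w) ∈ box r) : |D.E φ k (0, w)| ≤ φ w * ((|D.β k| + D.κ k) * |w|) := by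
  have hr : 0 < r := (abs_nonneg _).trans_lt hz.1
  have h1 := est' (D.vert_sub hv) hz (z' := 0) ⟨by simpa, by simpa⟩
  rw [show D.e k 0 = 0 from D.vert_zero k hv] at h1
  simp only [sub_zero, Prod.fst_zero, Prod.snd_zero, abs_zero, mul_zero, zero_add] at h1
  rw [D.E_vert hv]
  simp only [mul_zero, zero_add]
  rw [abs_mul, abs_of_nonneg (hφ.nonneg w)]
  refine mul_le_mul_of_nonneg_left ?_ (hφ.nonneg w)
  calc |D.e k (0, w)| = |(D.e k (0, w) - D.β k * w) + D.β k * w| := by congr 1; ring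
    _ ≤ _ := (abs_add_le _ _).trans (by rw [abs_mul]; nlinarith)

lemma vert_abs_le (hφ : IsBlend φ) (hv : k ∈ D.vert) {u w : ℝ} (hz : (u, w) ∈ box r)
    (h : D.E φ k (u, w) = 0) : |u| ≤ φ w * lam * |w| := by
  have hr : 0 < r := (abs_nonneg _).trans_lt hz.1
  have hz0 : ((0 : ℝ), w) ∈ box r := ⟨by simpa, hz.2⟩
  have h1 := est_E hφ hv hz hz0
  rw [h, sub_zero] at h1
  have h2 := abs_E_zero_le hφ hv hz0
  obtain ⟨h3, h4⟩ := D.vert_lt k hv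
  have h5 : |D.α k * u| ≤ D.κ k * |u| + φ w * ((|D.β k| + D.κ k) * |w|) := by
    calc |D.α k * u| = |-(0 - D.E φ k (0, w) - D.α k * u) + -D.E φ k (0, w)| := by congr 1; ring
      _ ≤ _ := (abs_add_le _ _).trans (by rw [abs_neg, abs_neg]; linarith)
  rw [abs_mul] at h5
  have h6 : (|D.α k| - D.κ k) * |u| ≤ (|D.α k| - D.κ k) * (φ w * lam * |w|) := by
    have := mul_le_mul_of_nonneg_right h4 (mul_nonneg (hφ.nonneg w) (abs_nonneg w))
    nlinarith
  exact le_of_mul_le_mul_left h6 (by linarith)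

lemma vert_exists (hφ : IsBlend φ) (hl : 0 ≤ lam) (hl1 : lam < 1) (hv : k ∈ D.vert) {w : ℝ}
    (hw : |w| < r) : ∃ u, (u, w) ∈ box r ∧ D.E φ k (u, w) = 0 := by
  have hr : 0 < r := (abs_nonneg _).trans_lt hw
  have hz0 : ((0 : ℝ), w) ∈ box r := ⟨by simpa, hw⟩
  set c := lam * |w| with hc
  have hc0 : 0 ≤ c := mul_nonneg hl (abs_nonneg w)
  have hcr : c < r := by nlinarith [abs_nonneg w]
  have hzc : ∀ u, |u| ≤ c → (u, w) ∈ box r := fun u hu => ⟨lt_of_le_of_lt hu hcr, hw⟩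
  obtain ⟨h3, h4⟩ := D.vert_lt k hv
  have hE0 : |D.E φ k (0, w)| ≤ (|D.α k| - D.κ k) * c := by
    refine (abs_E_zero_le hφ hv hz0).trans ?_
    have h5 := mul_le_mul_of_nonneg_right h4 (abs_nonneg w)
    have h6 : 0 ≤ (|D.β k| + D.κ k) * |w| :=
      mul_nonneg (add_nonneg (abs_nonneg _) (D.κ_nonneg k)) (abs_nonneg w)
    nlinarith [hφ.le_one w]
  have hp : |D.E φ k (c, w) - D.E φ k (0, w) - D.α k * (c - 0)| ≤ D.κ k * |c - 0| :=
    est_E hφ hv (hzc c (by rw [abs_of_nonneg hc0])) hz0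
  have hm : |D.E φ k (-c, w) - D.E φ k (0, w) - D.α k * (-c - 0)| ≤ D.κ k * |-c - 0| :=
    est_E hφ hv (hzc (-c) (by rw [abs_neg, abs_of_nonneg hc0])) hz0
  rw [sub_zero, abs_of_nonneg hc0] at hp
  rw [sub_zero, abs_neg, abs_of_nonneg hc0] at hm
  rw [abs_le] at hp hm hE0
  have hcont : ContinuousOn (fun u => D.E φ k (u, w)) (Icc (-c) c) :=
    ((D.E_smooth hφ.smooth k).continuous.comp (by fun_prop : Continuous fun u : ℝ => (u, w))).continuousOn
  have hle : -c ≤ c := by linarith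
  have : (0 : ℝ) ∈ (fun u => D.E φ k (u, w)) '' Icc (-c) c := by
    rcases le_total 0 (D.α k) with h5 | h5
    · rw [abs_of_nonneg h5] at hE0
      exact intermediate_value_Icc hle hcont ⟨by linarith, by linarith⟩
    · rw [abs_of_nonpos h5] at hE0
      exact intermediate_value_Icc' hle hcont ⟨by linarith, by linarith⟩
  obtain ⟨u, hu, h0⟩ := this
  exact ⟨u, hzc u (abs_le.2 hu), h0⟩

open Classical in
/-- The bent line as a graph over the vertical axis. -/
def graph (D : LineData Ch r lam) (φ : ℝ → ℝ) (k : ι) (w : ℝ) : ℝ :=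
  if h : ∃ u, (u, w) ∈ box r ∧ D.E φ k (u, w) = 0 then h.choose else 0

lemma graph_spec (hφ : IsBlend φ) (hl : 0 ≤ lam) (hl1 : lam < 1) (hv : k ∈ D.vert) {w : ℝ}
    (hw : |w| < r) : (D.graph φ k w, w) ∈ box r ∧ D.E φ k (D.graph φ k w, w) = 0 := by
  have h := vert_exists hφ hl hl1 hv hw
  rw [graph, dif_pos h]
  exact h.choose_spec

lemma graph_eq (hφ : IsBlend φ) (hl : 0 ≤ lam) (hl1 : lam < 1) (hv : k ∈ D.vert) {u w : ℝ}
    (hz : (u, w) ∈ box r) (h : D.E φ k (u, w) = 0) : D.graph φ k w = u := by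
  obtain ⟨h1, h2⟩ := graph_spec hφ hl hl1 hv hz.2
  exact vert_unique hφ hv h1 hz h2 h

lemma continuousAt_graph (hφ : IsBlend φ) (hl : 0 ≤ lam) (hl1 : lam < 1) (hv : k ∈ D.vert)
    {w : ℝ} (hw : |w| < r) : ContinuousAt (D.graph φ k) w := by
  obtain ⟨h1, h2⟩ := graph_spec hφ hl hl1 hv hw
  set u := D.graph φ k w with hu
  have hru : ∀ᶠ x in 𝓝 u, |x| < r := (isOpen_lt continuous_abs continuous_const).mem_nhds h1.1
  have hrw : ∀ᶠ x in 𝓝 w, |x| < r := (isOpen_lt continuous_abs continuous_const).mem_nhds h1.2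
  rw [Metric.continuousAt_iff']
  intro ε hε
  obtain ⟨ε', hε', hball⟩ := Metric.eventually_nhds_iff.1 hru
  set d := min ε ε' / 2 with hd
  have hd0 : 0 < d := by positivity
  have hdε : d < ε := by have := min_le_left ε ε'; linarith
  have hdε' : d < ε' := by have := min_le_right ε ε'; linarith
  have hup : |u + d| < r := hball (by simpa [abs_of_pos hd0] using hdε')
  have hum : |u - d| < r := hball (by simpa [Real.dist_eq, abs_of_pos hd0] using hdε')
  have hcont : ∀ x, Continuous fun w => D.α k * D.E φ k (x, w) := fun x =>
    continuous_const.mul ((D.E_smooth hφ.smooth k).continuous.comp (by fun_prop))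
  have e1 : ∀ᶠ w' in 𝓝 w, 0 < D.α k * D.E φ k (u + d, w') := by
    refine (hcont _).continuousAt.eventually (isOpen_Ioi.mem_nhds ?_)
    have := vert_mul_pos hφ hv (u := u + d) (u' := u) ⟨hup, h1.2⟩ h1 (by linarith)
    simpa [h2] using this
  have e2 : ∀ᶠ w' in 𝓝 w, D.α k * D.E φ k (u - d, w') < 0 := by
    refine (hcont _).continuousAt.eventually (isOpen_Iio.mem_nhds ?_)
    have := vert_mul_pos hφ hv (u := u) (u' := u - d) h1 ⟨hum, h1.2⟩ (by linarith)
    simpa [h2] using this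
  filter_upwards [e1, e2, hrw] with w' h3 h4 h5
  obtain ⟨h6, h7⟩ := graph_spec hφ hl hl1 hv h5
  have h8 : D.graph φ k w' < u + d := by
    by_contra h8
    rcases (not_lt.1 h8).lt_or_eq with h9 | h9
    · have := vert_mul_pos hφ hv h6 (u' := u + d) ⟨hup, h5⟩ h9
      rw [h7] at this; linarith
    · rw [h9, h7] at h3; simp at h3
  have h9 : u - d < D.graph φ k w' := by
    by_contra h9
    rcases (not_lt.1 h9).lt_or_eq with h10 | h10
    · have := vert_mul_pos hφ hv (u := u - d) ⟨hum, h5⟩ h6 h10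
      rw [h7] at this; linarith
    · rw [← h10, h7] at h4; simp at h4
  rw [Real.dist_eq, abs_lt]
  constructor <;> linarith

end vert

end LineData

namespace LineData

variable {ι : Type} {Ch : ChartFamily ι} {r lam : ℝ} (D : LineData Ch r lam)

variable {D} {φ : ℝ → ℝ} {a : ℝ} {k : ι}

lemma E_eq_zero_iff (hφ : IsCutoff φ a r lam) (hl1 : lam < 1)
    {z : ℝ × ℝ} (hz : z ∈ box r) (hz' : z ∉ cbox (r / 2)) : D.E φ k z = 0 ↔ D.e k z = 0 := by
  by_cases hv : k ∈ D.vert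
  swap
  · rw [D.E_not_vert hv]
  rcases le_or_gt (r / 2) |z.2| with h | h
  · rw [D.E_vert hv, hφ.eq_one _ h]; simp
  have hu : r / 2 < |z.1| := by
    by_contra h2
    exact hz' ⟨not_lt.1 h2, h.le⟩
  have key : ∀ ψ : ℝ → ℝ, IsBlend ψ → D.E ψ k z ≠ 0 := by
    intro ψ hψ h0
    have h1 : |z.1| ≤ ψ z.2 * lam * |z.2| := vert_abs_le hψ hv (u := z.1) (w := z.2) hz h0
    have h2 : ψ z.2 * lam ≤ 1 := by nlinarith [hψ.nonneg z.2, hψ.le_one z.2]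
    nlinarith [abs_nonneg z.2]
  constructor
  · exact fun h0 => absurd h0 (key φ hφ.toIsBlend)
  · rw [← D.E_one]
    exact fun h0 => absurd h0 (key _ isBlend_one)

open Classical in
/-- The bent line. -/
def bend (D : LineData Ch r lam) (hφ : IsCutoff φ a r lam) (hl : 0 ≤ lam) (hl1 : lam < 1) :
    BentLine Ch r where
  p := D.p
  q := D.q
  indep := D.indep
  E := D.E φ
  E_smooth := D.E_smooth hφ.smooth
  E_eq k z hz hz' := E_eq_zero_iff hφ hl1 hz hz'
  E_grad k z hz h0 := by
    by_cases hv : k ∈ D.vert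
    · exact Or.inl (fderiv_E_one hφ.toIsBlend hv hz)
    · rw [D.E_not_vert hv] at h0 ⊢
      have hk : k ∈ D.node := by
        by_contra hk
        exact D.miss k hk z hz h0
      exact Or.inr (hor_fderiv hk hv hz)
  slide k z := if k ∈ D.vert then (D.graph φ k z.2, z.2) else z
  slide_cont k := by
    by_cases hv : k ∈ D.vert
    · simp only [hv, if_true]
      intro z hz
      have h1 := continuousAt_graph hφ.toIsBlend hl hl1 hv hz.2
      have h2 : ContinuousAt (fun z : ℝ × ℝ => D.graph φ k z.2) z :=
        ContinuousAt.comp (f := fun z : ℝ × ℝ => z.2) h1 continuousAt_snd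
      exact (h2.prodMk continuousAt_snd).continuousWithinAt
    · simp only [hv, if_false]
      exact continuousOn_id
  slide_mem k z hz h0 := by
    by_cases hv : k ∈ D.vert
    · simp only [hv, if_true]
      exact graph_spec hφ.toIsBlend hl hl1 hv hz.2
    · simp only [hv, if_false]
      refine ⟨hz, ?_⟩
      rw [D.E_not_vert hv]
      exact h0
  slide_surj k z hz h0 := by
    by_cases hv : k ∈ D.vert
    · obtain ⟨u, h1, h2⟩ := vert_exists isBlend_one hl hl1 hv hz.2
      rw [D.E_one] at h2
      refine ⟨(u, z.2), h1, h2, ?_⟩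
      simp only [hv, if_true]
      rw [graph_eq hφ.toIsBlend hl hl1 hv (u := z.1) hz h0]
    · rw [D.E_not_vert hv] at h0
      exact ⟨z, hz, h0, by simp [hv]⟩
  slide_eq k z hz hz' h0 := by
    by_cases hv : k ∈ D.vert
    · simp only [hv, if_true]
      rw [graph_eq hφ.toIsBlend hl hl1 hv (u := z.1) hz ((E_eq_zero_iff hφ hl1 hz hz').2 h0)]
    · simp [hv]

variable {κ : Type} {W : NodalCurve ι κ} {D : LineData W.toChartFamily r lam}

/-- Position of a line with respect to a nodal curve and smoothing profiles. -/
structure Good (W : NodalCurve ι κ) (D : LineData W.toChartFamily r lam) (G : ι → ℝ → ℝ) (a : ℝ) :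
    Prop where
  profile : ∀ k, G k 0 = a
  le : ∀ k u, G k u ≤ a + |u|
  hor : ∀ k ∈ D.node, k ∉ D.vert → ∃ x, |x| < a ∧ D.e k (0, x) = 0 ∧ ∀ u, |x| + lam * |u| < G k u
  simple : ∀ c θ, D.A ⬝ᵥ W.γ c θ = 0 → D.A ⬝ᵥ deriv (W.γ c) θ ≠ 0
  count : 2 * D.node.encard + {x | x ∈ W.points ∧ (∀ k, ∀ z ∈ box r, x ≠ pt (W.F k z)) ∧
    D.A ⬝ᵥ x.coords = 0}.encard ≤ 5

lemma vert_zero_iff {G : ι → ℝ → ℝ} (hφ : IsCutoff φ a r lam) (hg : Good W D G a)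
    (hv : k ∈ D.vert) {z : ℝ × ℝ} (hz : z ∈ box r) (h0 : D.E φ k z = 0) :
    (φ z.2 = 0 ∧ z.1 = 0 ∧ |z.2| ≤ a) ∨ (0 < φ z.2 ∧ G k z.1 < |z.2|) := by
  have h1 : |z.1| ≤ φ z.2 * lam * |z.2| := vert_abs_le hφ.toIsBlend hv (u := z.1) (w := z.2) hz h0
  rcases (hφ.nonneg z.2).eq_or_lt with h | h
  · rw [← h, zero_mul, zero_mul] at h1
    exact Or.inl ⟨h.symm, abs_eq_zero.1 (le_antisymm h1 (abs_nonneg _)), (hφ.eq_zero_iff _).1 h.symm⟩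
  · have h2 : a < |z.2| := by
      by_contra h3
      exact h.ne' ((hφ.eq_zero_iff _).2 (not_lt.1 h3))
    have := hφ.lt _ h2
    exact Or.inr ⟨h, lt_of_le_of_lt (hg.le k z.1) (by linarith)⟩

lemma cutoff_deriv (hφ : IsCutoff φ a r lam) {w : ℝ} (hw : φ w = 0) : deriv φ w = 0 := by
  have : IsLocalMin φ w := .of_forall fun x => by rw [hw]; exact hφ.nonneg x
  exact this.deriv_eq_zero

lemma fderiv_E_two (hφ : IsCutoff φ a r lam) (hv : k ∈ D.vert) {w : ℝ} (hw : φ w = 0) :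
    fderiv ℝ (D.E φ k) (0, w) (0, 1) = 0 := by
  have h1 : HasDerivAt (fun t : ℝ => ((0 : ℝ), t)) ((0 : ℝ), (1 : ℝ)) w :=
    (hasDerivAt_const _ _).prodMk (hasDerivAt_id _)
  have h2' : HasFDerivAt (D.E φ k) (fderiv ℝ (D.E φ k) (0, w)) (0, w) :=
    ((D.E_smooth hφ.smooth k).differentiable (by simp) _).hasFDerivAt
  have h2 : HasFDerivAt (D.e k) (fderiv ℝ (D.e k) (0, w)) (0, w) :=
    ((D.e_smooth k).differentiable (by simp) _).hasFDerivAt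
  have h4 := HasFDerivAt.comp_hasDerivAt (l := D.E φ k) w h2' h1
  have h5 := HasFDerivAt.comp_hasDerivAt (l := D.e k) w h2 h1
  have h3 : HasDerivAt φ 0 w := by
    rw [← cutoff_deriv hφ hw]
    exact (hφ.smooth.differentiable (by simp) w).hasDerivAt
  have h6 := h3.mul h5
  have h7 : (D.E φ k ∘ fun t : ℝ => ((0 : ℝ), t)) = φ * (D.e k ∘ fun t : ℝ => ((0 : ℝ), t)) := by
    funext t
    simp [D.E_vert hv]
  rw [h7] at h4
  rw [h4.unique h6, hw]
  simp

lemma fits {G : ι → ℝ → ℝ} (hφ : IsCutoff φ a r lam) (hl : 0 ≤ lam) (hl1 : lam < 1)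
    (hG : ∀ k, NodalCurve.IsProfile (G k) r) (hr : 0 < r) (hg : Good W D G a) :
    NodalCurve.Fits W G (D.bend hφ hl hl1) D.node D.vert where
  miss k hk z hz h0 := by
    have hv : k ∉ D.vert := fun hv => hk (D.vert_sub hv)
    change D.E φ k z = 0 at h0
    rw [D.E_not_vert hv] at h0
    exact D.miss k hk z hz h0
  vert_sub := D.vert_sub
  hor k hk hv := by
    obtain ⟨x, h1, h2, h3⟩ := hg.hor k hk hv
    have hx : ((0 : ℝ), x) ∈ box r := (hG k).zero_mem_box hr (by rw [hg.profile]; exact h1.le)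
    change ∃ x, |x| < G k 0 ∧ D.E φ k (0, x) = 0 ∧ fderiv ℝ (D.E φ k) (0, x) (0, 1) ≠ 0 ∧
      ∀ z ∈ box r, D.E φ k z = 0 → _
    rw [D.E_not_vert hv]
    refine ⟨x, by rwa [hg.profile], h2, hor_fderiv hk hv hx, fun z hz h0 => ?_⟩
    have h4 := hor_le hk hv hz hx h0 h2
    simp only [sub_zero] at h4
    refine ⟨lt_of_le_of_lt ?_ (h3 z.1), fun hz1 => ?_⟩
    · have := abs_sub_abs_le_abs_sub z.2 x
      linarith
    · rw [hz1, abs_zero, mul_zero] at h4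
      exact sub_eq_zero.1 (abs_eq_zero.1 (le_antisymm h4 (abs_nonneg _)))
  vert_interval k hv w hw := by
    change D.E φ k (0, w) = 0
    rw [hg.profile] at hw
    rw [D.E_vert hv]
    simp [(hφ.eq_zero_iff w).2 hw]
  vert_curve k hv z hz h0 := by
    rcases vert_zero_iff hφ hg hv hz h0 with h | h
    · exact Or.inl ⟨h.2.1, by rw [hg.profile]; exact h.2.2⟩
    · exact Or.inr h.2
  vert_end k hv w hw := by
    rw [hg.profile] at hw
    exact fderiv_E_two hφ hv ((hφ.eq_zero_iff w).2 hw.le)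
  simple := hg.simple
  count := hg.count

variable {D' : LineData W.toChartFamily r lam}

lemma box_of_two_lines {l : ι} {z : ℝ × ℝ}
    (h1 : D.e l z = 0) (h2 : D'.e l z = 0) (hA : D.A ⨯₃ D'.A ≠ 0) :
    pt (W.F l z) = pt (D.A ⨯₃ D'.A) :=
  (pt_eq_iff_cross (W.ne_zero l z) hA).2 (cross_cross_eq_zero h1 h2)

lemma pt_of_two_lines {v : R3} (hv : v ≠ 0) (h1 : D.A ⬝ᵥ v = 0) (h2 : D'.A ⬝ᵥ v = 0)
    (hA : D.A ⨯₃ D'.A ≠ 0) : pt v = pt (D.A ⨯₃ D'.A) :=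
  (pt_eq_iff_cross hv hA).2 (cross_cross_eq_zero h1 h2)

/-- Conditions on two lines under which the bent lines meet as required. -/
structure GoodPair (D D' : LineData W.toChartFamily r lam) : Prop where
  indep : D.A ⨯₃ D'.A ≠ 0
  inbox : ∀ k ∈ D.node, k ∈ D'.node → ∃ z ∈ box r, pt (D.A ⨯₃ D'.A) = pt (W.F k z)
  vert : ∀ k ∈ D.vert, k ∈ D'.vert → ∀ z ∈ box r, D.e k z * D'.α k = D'.e k z * D.α k →
    |z.1| ≤ |z.2| → z = 0

lemma GoodPair.symm (h : GoodPair D D') : GoodPair D' D where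
  indep := by rw [← cross_anticomm]; exact neg_ne_zero.2 h.indep
  inbox k h1 h2 := by
    obtain ⟨z, hz, h3⟩ := h.inbox k h2 h1
    refine ⟨z, hz, ?_⟩
    rw [← h3, ← cross_anticomm, ← neg_one_smul ℝ, pt_smul (by norm_num)]
  vert k h1 h2 z hz h3 h4 := h.vert k h2 h1 z hz h3.symm h4

lemma GoodPair.node_unique (h : GoodPair D D') {k l : ι} (h1 : k ∈ D.node) (h2 : k ∈ D'.node)
    (h3 : l ∈ D.node) (h4 : l ∈ D'.node) : k = l := by
  obtain ⟨z, hz, h5⟩ := h.inbox k h1 h2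
  obtain ⟨w, hw, h6⟩ := h.inbox l h3 h4
  exact (W.inj _ _ _ _ (h5.symm.trans h6)).1

lemma E_zero_node {z : ℝ × ℝ} (hz : z ∈ box r) (h : D.E φ k z = 0) : k ∈ D.node := by
  by_contra hk
  have hv : k ∉ D.vert := fun hv => hk (D.vert_sub hv)
  rw [D.E_not_vert hv] at h
  exact D.miss k hk z hz h

variable {G : ι → ℝ → ℝ}

/-- A point of two bent lines outside the box around a common double point. -/
lemma GoodPair.off (h : GoodPair D D') (hφ : IsCutoff φ a r lam) (hl : 0 ≤ lam) (hl1 : lam < 1)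
    (hr : 0 < r) {k : ι} (h1 : k ∈ D.node) (h2 : k ∈ D'.node) {x : RP2}
    (hx : x ∈ (D.bend hφ hl hl1).set) (hx' : x ∈ (D'.bend hφ hl hl1).set) :
    ∃ z ∈ box r, x = pt (W.F k z) ∧ D.E φ k z = 0 ∧ D'.E φ k z = 0 := by
  by_cases h3 : ∃ l z, x = pt (W.F l z) ∧ z ∈ box r
  · obtain ⟨l, z, rfl, hz⟩ := h3
    have h4 := (BentLine.mem_set_box _ hz).1 hx
    have h5 := (BentLine.mem_set_box _ hz).1 hx'
    obtain rfl := h.node_unique h1 h2 (E_zero_node hz h4) (E_zero_node hz h5)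
    exact ⟨z, hz, rfl, h4, h5⟩
  · push Not at h3
    obtain ⟨v, hv, rfl⟩ := exists_pt x
    have h2' : ∀ k z, pt v = pt (W.F k z) → z ∉ cbox (r / 2) := fun k z h hz =>
      h3 k z h (cbox_subset_box (by linarith) hz)
    have h4 := (BentLine.mem_set_off _ hv h2').1 hx
    have h5 := (BentLine.mem_set_off _ hv h2').1 hx'
    obtain ⟨z, hz, h6⟩ := h.inbox k h1 h2
    exact absurd hz (h3 k z ((pt_of_two_lines hv h4 h5 h.indep).trans h6))

lemma GoodPair.inter_vert (h : GoodPair D D') (hφ : IsCutoff φ a r lam) (hl : 0 ≤ lam)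
    (hl1 : lam < 1) (hG : ∀ k, NodalCurve.IsProfile (G k) r) (hr : 0 < r) (hg : Good W D G a)
    (hg' : Good W D' G a) (h1 : k ∈ D.vert) (h2 : k ∈ D'.vert) :
    (D.bend hφ hl hl1).set ∩ (D'.bend hφ hl hl1).set = (W.smoothed G).interval k := by
  apply Subset.antisymm
  · rintro x ⟨hx, hx'⟩
    obtain ⟨z, hz, rfl, h3, h4⟩ := h.off hφ hl hl1 hr (D.vert_sub h1) (D'.vert_sub h2) hx hx'
    rw [NodalCurve.mem_interval_chart, hg.profile]
    rcases vert_zero_iff hφ hg h1 hz h3 with h5 | h5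
    · exact ⟨rfl, h5.2⟩
    have h6 : |z.1| ≤ φ z.2 * lam * |z.2| := vert_abs_le hφ.toIsBlend h1 (u := z.1) (w := z.2) hz h3
    rw [D.E_vert h1] at h3
    rw [D'.E_vert h2] at h4
    have h7 := h.vert k h1 h2 z hz (mul_left_cancel₀ h5.1.ne' (by
      linear_combination D'.α k * h3 - D.α k * h4)) (by
        have h8 : φ z.2 * lam ≤ 1 := by nlinarith [hφ.nonneg z.2, hφ.le_one z.2]
        nlinarith [abs_nonneg z.2])
    have h9 := (hG k).pos z.1
    rw [h7] at h5 h9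
    simp at h5 h9
    linarith [h5.2]
  · exact subset_inter ((fits hφ hl hl1 hG hr hg).interval_subset hG hr h1)
      ((fits hφ hl hl1 hG hr hg').interval_subset hG hr h2)

lemma GoodPair.inter_vert_hor (h : GoodPair D D') (hφ : IsCutoff φ a r lam) (hl : 0 ≤ lam)
    (hl1 : lam < 1) (hG : ∀ k, NodalCurve.IsProfile (G k) r) (hr : 0 < r) (hg : Good W D G a)
    (hg' : Good W D' G a) (h1 : k ∈ D.vert) (h2 : k ∈ D'.node) (h2' : k ∉ D'.vert) :
    ∃ x, (D.bend hφ hl hl1).set ∩ (D'.bend hφ hl hl1).set = {x} ∧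
      TransverseAt (D.bend hφ hl hl1).set (D'.bend hφ hl hl1).set x := by
  obtain ⟨x, h3, h4, h5, h6⟩ := (fits hφ hl hl1 hG hr hg').hor k h2 h2'
  change D'.E φ k (0, x) = 0 at h4
  change fderiv ℝ (D'.E φ k) (0, x) (0, 1) ≠ 0 at h5
  have hx := (hG k).zero_mem_box hr h3.le
  have hφx : φ x = 0 := (hφ.eq_zero_iff x).2 (by rw [← hg.profile k]; exact h3.le)
  have hE : D.E φ k (0, x) = 0 := by rw [D.E_vert h1]; simp [hφx]
  refine ⟨pt (W.F k (0, x)), Subset.antisymm ?_ ?_, ?_⟩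
  · rintro y ⟨hy, hy'⟩
    obtain ⟨z, hz, rfl, h7, h8⟩ := h.off hφ hl hl1 hr (D.vert_sub h1) h2 hy hy'
    obtain ⟨h9, h10⟩ := h6 z hz h8
    rcases vert_zero_iff hφ hg h1 hz h7 with h11 | h11
    · have : z = (0, x) := Prod.ext h11.2.1 (h10 h11.2.1)
      rw [this]; rfl
    · linarith [h11.2]
  · rintro _ rfl
    exact ⟨(BentLine.mem_set_box _ hx).2 hE, (BentLine.mem_set_box _ hx).2 h4⟩
  · refine transverseAt_of_functions (f := D.E φ k) (g := D'.E φ k)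
      (.of_forall fun z => (W.smooth k).contDiffAt) (W.imm k _)
      (.of_forall fun z => (D.E_smooth hφ.smooth k).contDiffAt)
      (.of_forall fun z => (D'.E_smooth hφ.smooth k).contDiffAt) hE h4 ?_ ?_ ?_
    · rw [fderiv_E_two hφ h1 hφx]
      simp [h5, fderiv_E_one hφ.toIsBlend h1 hx]
    · filter_upwards [(isOpen_box r).mem_nhds hx] with w hw using BentLine.mem_set_box _ hw
    · filter_upwards [(isOpen_box r).mem_nhds hx] with w hw using BentLine.mem_set_box _ hw

lemma eventually_straight [Finite ι] (hφ : IsCutoff φ a r lam) (hl : 0 ≤ lam) (hl1 : lam < 1)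
    (hr : 0 < r) {v : R3} (hv : v ≠ 0) (h : ∀ k ∈ D.vert, ∀ z ∈ box r, pt v ≠ pt (W.F k z)) :
    ∀ᶠ w in 𝓝 v, pt w ∈ (D.bend hφ hl hl1).set ↔ D.A ⬝ᵥ w = 0 := by
  by_cases h1 : ∃ l z, pt v = pt (W.F l z) ∧ z ∈ box r
  · obtain ⟨l, z, h2, hz⟩ := h1
    have hl' : l ∉ D.vert := fun hl' => h l hl' z hz h2
    obtain ⟨c, hc, h3⟩ := (pt_eq_iff (W.ne_zero l z) hv).1 h2.symm
    have h4 : ∀ᶠ w in 𝓝 v, ∃ d : ℝ, ∃ z, d ≠ 0 ∧ w = d • W.F l z ∧ z ∈ box r := by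
      rw [h3]
      exact W.eventually_cone l hc z (P := fun _ z => z ∈ box r)
        (continuousAt_snd.eventually ((isOpen_box r).mem_nhds hz))
    filter_upwards [h4] with w hw
    obtain ⟨d, z', hd, rfl, hz'⟩ := hw
    rw [pt_smul hd, BentLine.mem_set_box _ hz', dotProduct_smul]
    change D.E φ l z' = 0 ↔ _
    rw [D.E_not_vert hl']
    simp [hd, e]
  · push Not at h1
    exact BentLine.eventually_mem_set _ hv fun k z hk hz =>
      h1 k z hk (cbox_subset_box (by linarith) hz)

lemma GoodPair.inter_straight [Finite ι] (h : GoodPair D D') (hφ : IsCutoff φ a r lam) (hl : 0 ≤ lam)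
    (hl1 : lam < 1) (hr : 0 < r)
    (h1 : ∀ k ∈ D.node, k ∈ D'.node → k ∉ D.vert ∧ k ∉ D'.vert) :
    ∃ x, (D.bend hφ hl hl1).set ∩ (D'.bend hφ hl hl1).set = {x} ∧
      TransverseAt (D.bend hφ hl hl1).set (D'.bend hφ hl hl1).set x := by
  have hA := h.indep
  set v := D.A ⨯₃ D'.A with hv
  have hv1 : D.A ⬝ᵥ v = 0 := by rw [dotProduct_comm]; exact dot_cross_left _ _
  have hv2 : D'.A ⬝ᵥ v = 0 := by rw [dotProduct_comm]; exact dot_cross_right _ _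
  have hbox : ∀ k, ∀ z ∈ box r, pt v = pt (W.F k z) → k ∈ D.node ∧ k ∈ D'.node := by
    intro k z hz h2
    obtain ⟨c, hc, h3⟩ := (pt_eq_iff (W.ne_zero k z) hA).1 h2.symm
    rw [h3] at hv1 hv2
    constructor
    · by_contra hk
      exact D.miss k hk z hz (BentLine.dot_smul_F hc hv1)
    · by_contra hk
      exact D'.miss k hk z hz (BentLine.dot_smul_F hc hv2)
  have e1 := eventually_straight (D := D) hφ hl hl1 hr hA fun k hk z hz h2 =>
    (h1 k (hbox k z hz h2).1 (hbox k z hz h2).2).1 hk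
  have e2 := eventually_straight (D := D') hφ hl hl1 hr hA fun k hk z hz h2 =>
    (h1 k (hbox k z hz h2).1 (hbox k z hz h2).2).2 hk
  refine ⟨pt v, Subset.antisymm ?_ ?_, transverseAt_lines hA hA hv1 hv2 e1 e2⟩
  · rintro x ⟨hx, hx'⟩
    by_cases h3 : ∃ l z, x = pt (W.F l z) ∧ z ∈ box r
    · obtain ⟨l, z, rfl, hz⟩ := h3
      have h4 : D.E φ l z = 0 := (BentLine.mem_set_box _ hz).1 hx
      have h5 : D'.E φ l z = 0 := (BentLine.mem_set_box _ hz).1 hx'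
      obtain ⟨h6, h7⟩ := h1 l (E_zero_node hz h4) (E_zero_node hz h5)
      rw [D.E_not_vert h6] at h4
      rw [D'.E_not_vert h7] at h5
      exact box_of_two_lines h4 h5 hA
    · push Not at h3
      obtain ⟨v', hv', rfl⟩ := exists_pt x
      have h2' : ∀ k z, pt v' = pt (W.F k z) → z ∉ cbox (r / 2) := fun k z h hz =>
        h3 k z h (cbox_subset_box (by linarith) hz)
      have h4 := (BentLine.mem_set_off _ hv' h2').1 hx
      have h5 := (BentLine.mem_set_off _ hv' h2').1 hx'
      exact pt_of_two_lines hv' h4 h5 h.indep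
  · rintro _ rfl
    exact ⟨e1.self_of_nhds.2 hv1, e2.self_of_nhds.2 hv2⟩

lemma _root_.TransverseAt.symm {X Y : Set RP2} {x : RP2} (h : TransverseAt X Y x) :
    TransverseAt Y X x := by
  obtain ⟨ψ, ⟨hi, F, hF0, hF, hp, hl⟩, h2, h3, h4⟩ := h
  refine ⟨ψ ∘ Prod.swap, ⟨hi.comp Prod.swap_injective, F ∘ Prod.swap, fun z => hF0 _, ?_,
    fun z => hp _, fun z => ?_⟩, h2, fun z => h4 _, fun z => h3 _⟩
  · exact hF.comp (contDiff_snd.prodMk contDiff_fst)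
  · have h5 : HasFDerivAt (F ∘ Prod.swap) ((fderiv ℝ F z.swap).comp
        ((ContinuousLinearMap.snd ℝ ℝ ℝ).prod (ContinuousLinearMap.fst ℝ ℝ ℝ))) z :=
      HasFDerivAt.comp (g := F) z ((hF.differentiable (by simp) z.swap).hasFDerivAt)
        (hasFDerivAt_snd.prodMk hasFDerivAt_fst)
    rw [h5.fderiv, linearIndependent_iff_trip]
    have h6 := linearIndependent_iff_trip.1 (hl z.swap)
    intro h7
    apply h6
    simp only [ContinuousLinearMap.comp_apply, ContinuousLinearMap.prod_apply,
      ContinuousLinearMap.coe_snd', ContinuousLinearMap.coe_fst', Function.comp, trip_eq] at h7 ⊢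
    linarith

lemma GoodPair.inter [Finite ι] (h : GoodPair D D') (hφ : IsCutoff φ a r lam) (hl : 0 ≤ lam)
    (hl1 : lam < 1) (hG : ∀ k, NodalCurve.IsProfile (G k) r) (hr : 0 < r) (hg : Good W D G a)
    (hg' : Good W D' G a) :
    (∃ x, (D.bend hφ hl hl1).set ∩ (D'.bend hφ hl hl1).set = {x} ∧
      TransverseAt (D.bend hφ hl hl1).set (D'.bend hφ hl hl1).set x) ∨
    ∃ k, (D.bend hφ hl hl1).set ∩ (D'.bend hφ hl hl1).set = (W.smoothed G).interval k := by
  by_cases h1 : ∀ k ∈ D.node, k ∈ D'.node → k ∉ D.vert ∧ k ∉ D'.vert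
  · exact Or.inl (h.inter_straight hφ hl hl1 hr h1)
  push Not at h1
  obtain ⟨k, hk, hk', h2⟩ := h1
  by_cases hv : k ∈ D.vert
  · by_cases hv' : k ∈ D'.vert
    · exact Or.inr ⟨k, h.inter_vert hφ hl hl1 hG hr hg hg' hv hv'⟩
    · exact Or.inl (h.inter_vert_hor hφ hl hl1 hG hr hg hg' hv hk' hv')
  · obtain ⟨x, h3, h4⟩ := h.symm.inter_vert_hor hφ hl hl1 hG hr hg' hg (h2 hv) hk hv
    exact Or.inl ⟨x, by rw [inter_comm, h3], h4.symm⟩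

end LineData

/-! ### Cutoff functions and smoothing profiles -/

lemma exists_smoothTransition_le : ∃ C : ℝ, 1 ≤ C ∧ ∀ x, 0 ≤ x → smoothTransition x ≤ C * x := by
  have hc : Continuous (deriv smoothTransition) :=
    (Real.smoothTransition.contDiff (n := 1)).continuous_deriv le_rfl
  obtain ⟨M, hM⟩ := isCompact_Icc.exists_bound_of_continuousOn (s := Icc (0 : ℝ) 1) hc.continuousOn
  refine ⟨max M 1, le_max_right _ _, fun x hx => ?_⟩
  rcases le_total x 1 with h1 | h1
  · have h2 := (convex_Icc (0 : ℝ) 1).norm_image_sub_le_of_norm_deriv_le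
      (f := smoothTransition) (C := M)
      (fun y _ => (Real.smoothTransition.contDiff (n := 1)).differentiable (by simp) y)
      hM ⟨le_rfl, zero_le_one⟩ ⟨hx, h1⟩
    rw [Real.smoothTransition.zero, sub_zero, sub_zero, Real.norm_eq_abs, Real.norm_eq_abs,
      abs_of_nonneg hx] at h2
    exact (le_abs_self _).trans (h2.trans (mul_le_mul_of_nonneg_right (le_max_left _ _) hx))
  · refine (Real.smoothTransition.le_one x).trans ?_
    nlinarith [le_max_right M 1]

lemma eventually_exists_cutoff {r lam : ℝ} (hr : 0 < r) (hl : 0 ≤ lam) (hl1 : lam < 1) :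
    ∀ᶠ a in 𝓝[>] (0 : ℝ), ∃ φ, IsCutoff φ a r lam := by
  obtain ⟨C, hC, hS⟩ := exists_smoothTransition_le
  set B := r / 4 with hB
  have hB0 : 0 < B := by positivity
  set η := 1 - lam with hη
  have hη0 : 0 < η := by linarith
  have e1 : ∀ᶠ a in 𝓝[>] (0 : ℝ), a < B := nhdsWithin_le_nhds (Iio_mem_nhds hB0)
  have e2 : ∀ᶠ a in 𝓝[>] (0 : ℝ), a < η ^ 2 * B ^ 2 / (4 * C) :=
    nhdsWithin_le_nhds (Iio_mem_nhds (by positivity))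
  have e3 : ∀ᶠ a in 𝓝[>] (0 : ℝ), a < 1 / 2 := nhdsWithin_le_nhds (Iio_mem_nhds (by norm_num))
  filter_upwards [e1, e2, e3, self_mem_nhdsWithin] with a h1 h2 h3 h0
  rw [mem_Ioi] at h0
  refine ⟨fun w => smoothTransition ((w ^ 2 - a ^ 2) / B ^ 2), ⟨⟨?_, fun w =>
    Real.smoothTransition.nonneg _, fun w => Real.smoothTransition.le_one _⟩, fun w => ?_,
    fun w hw => ?_, fun w hw => ?_⟩⟩
  · exact Real.smoothTransition.contDiff.comp (by fun_prop)
  · rw [Real.smoothTransition.zero_iff_nonpos, div_nonpos_iff]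
    have : (0 : ℝ) < B ^ 2 := by positivity
    constructor
    · rintro (h | h)
      · linarith [h.2]
      · exact abs_le_of_sq_le_sq (by linarith [h.1]) h0.le
    · intro h
      right
      exact ⟨by linarith [sq_le_sq' (abs_le.1 h).1 (abs_le.1 h).2], this.le⟩
  · apply Real.smoothTransition.one_of_one_le
    rw [one_le_div (by positivity), ← sq_abs w]
    have : r / 2 = 2 * B := by rw [hB]; ring
    nlinarith [abs_nonneg w]
  · set x := |w| with hx
    have hwx : w ^ 2 = x ^ 2 := (sq_abs w).symm
    simp only [hwx]
    have hx0 : 0 < x := h0.trans hw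
    set s := smoothTransition ((x ^ 2 - a ^ 2) / B ^ 2) with hs
    have hs0 : 0 ≤ s := Real.smoothTransition.nonneg _
    have hs1 : s ≤ 1 := Real.smoothTransition.le_one _
    rcases le_or_gt (η * x) a with h4 | h4
    · have h5 : s ≤ C * ((x ^ 2 - a ^ 2) / B ^ 2) := hS _ (div_nonneg (by nlinarith) (by positivity))
      have h6 : s * B ^ 2 ≤ C * ((x - a) * (x + a)) := by
        have : C * ((x ^ 2 - a ^ 2) / B ^ 2) * B ^ 2 = C * ((x - a) * (x + a)) := by
          field_simp; ring
        rw [← this]; exact mul_le_mul_of_nonneg_right h5 (by positivity)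
      have h7 : a * (4 * C) < η ^ 2 * B ^ 2 := (lt_div_iff₀ (by positivity)).1 h2
      have h8 : η ^ 2 * (s * B ^ 2 * x) < η ^ 2 * (B ^ 2 * (x - a)) := by
        have h9 : η ^ 2 * (s * B ^ 2 * x) ≤ C * ((x - a) * (2 * (η * x) * (η * x))) := by
          calc η ^ 2 * (s * B ^ 2 * x) ≤ η ^ 2 * (C * ((x - a) * (x + a)) * x) := by gcongr
            _ ≤ η ^ 2 * (C * ((x - a) * (2 * x)) * x) := by
                have : 0 ≤ x - a := by linarith
                gcongr; linarith
            _ = _ := by ring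
        have h10 : C * ((x - a) * (2 * (η * x) * (η * x))) ≤ C * ((x - a) * (2 * a * a)) := by
          have : 0 ≤ x - a := by linarith
          gcongr
        have h11 : C * ((x - a) * (2 * a * a)) ≤ (x - a) * (a * (4 * C)) := by
          have : 0 ≤ x - a := by linarith
          have h12 : 2 * a * a ≤ 4 * a := by nlinarith
          nlinarith [mul_le_mul_of_nonneg_left h12 (mul_nonneg this (by linarith : 0 ≤ C))]
        have h13 := mul_lt_mul_of_pos_left h7 (by linarith : 0 < x - a)
        calc _ ≤ _ := h9.trans (h10.trans h11)
          _ < _ := h13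
          _ = _ := by ring
      have h14 : s * B ^ 2 * x < B ^ 2 * (x - a) := lt_of_mul_lt_mul_left h8 (by positivity)
      have h15 : s * x < x - a := by
        have : B ^ 2 * (s * x) < B ^ 2 * (x - a) := by linarith
        exact lt_of_mul_lt_mul_left this (by positivity)
      nlinarith [mul_nonneg hs0 hx0.le]
    · have : s * lam * x ≤ lam * x := by nlinarith [mul_nonneg hl hx0.le]
      have h5 : lam = 1 - η := by rw [hη]; ring
      rw [h5] at this ⊢
      linarith

/-- A profile of a smoothed corner. -/
def corner (c u : ℝ) : ℝ := √(u ^ 2 + c ^ 2 * (1 - smoothTransition (u ^ 2)))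

lemma exists_corner : ∃ c : ℝ, 0 < c ∧ ContDiff ℝ ∞ (corner c) ∧ (∀ u, c ≤ corner c u) ∧
    (∀ u, |u| ≤ corner c u) ∧ (∀ u, corner c u ≤ |u| + c) ∧ corner c 0 = c ∧
    ∀ u, 1 ≤ |u| → corner c u = |u| := by
  obtain ⟨C, hC, hS⟩ := exists_smoothTransition_le
  have hC0 : 0 < C := by linarith
  obtain ⟨c, hc⟩ : ∃ c, c = 1 / C := ⟨_, rfl⟩
  have hc0 : 0 < c := by rw [hc]; positivity
  have hcC : c * C = 1 := by rw [hc]; field_simp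
  have h1 : ∀ u : ℝ, c ^ 2 ≤ u ^ 2 + c ^ 2 * (1 - smoothTransition (u ^ 2)) := by
    intro u
    have h2 := hS (u ^ 2) (sq_nonneg u)
    have h3 : c ^ 2 * smoothTransition (u ^ 2) ≤ u ^ 2 := by
      calc c ^ 2 * smoothTransition (u ^ 2) ≤ c ^ 2 * (C * u ^ 2) := by gcongr
        _ = (c * C) * c * u ^ 2 := by ring
        _ ≤ 1 * u ^ 2 := by
          rw [hcC, one_mul]
          have : c ≤ 1 := by nlinarith
          gcongr
        _ = _ := one_mul _
    nlinarith
  have hle := fun u : ℝ => Real.smoothTransition.le_one (u ^ 2)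
  have hnn := fun u : ℝ => Real.smoothTransition.nonneg (u ^ 2)
  refine ⟨c, hc0, ?_, fun u => ?_, fun u => ?_, fun u => ?_, ?_, fun u hu => ?_⟩
  · unfold corner
    refine ContDiff.sqrt ?_ fun u => ?_
    · have : ContDiff ℝ ∞ fun u : ℝ => smoothTransition (u ^ 2) :=
        Real.smoothTransition.contDiff.comp (by fun_prop)
      fun_prop
    · exact ne_of_gt (lt_of_lt_of_le (by positivity) (h1 u))
  · exact Real.le_sqrt_of_sq_le (h1 u)
  · refine Real.le_sqrt_of_sq_le ?_
    rw [sq_abs]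
    nlinarith [mul_nonneg (sq_nonneg c) (sub_nonneg.2 (hle u))]
  · refine Real.sqrt_le_left (by positivity) |>.2 ?_
    rw [add_sq, sq_abs]
    nlinarith [mul_nonneg (sq_nonneg c) (hnn u), mul_nonneg (abs_nonneg u) hc0.le]
  · simp [corner, Real.smoothTransition.zero, Real.sqrt_sq hc0.le]
  · have h2 : smoothTransition (u ^ 2) = 1 := by
      apply Real.smoothTransition.one_of_one_le
      rw [← sq_abs]; nlinarith
    simp [corner, h2, Real.sqrt_sq_eq_abs]

lemma exists_profiles {lam : ℝ} (hl : 0 < lam) (hl1 : lam < 1) : ∃ G : ℝ → ℝ → ℝ,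
    (∀ δ, 0 < δ → δ < 1 → ContDiff ℝ ∞ (G δ) ∧ (∀ u, 0 < G δ u) ∧
      (∀ u, δ ≤ |u| → G δ u = |u|) ∧ ∀ u, G δ u ≤ G δ 0 + |u|) ∧
    Tendsto (fun δ => G δ 0) (𝓝[>] 0) (𝓝 0) ∧
    ∀ τ, τ < 1 → ∀ᶠ δ in 𝓝[>] 0, ∀ u, τ * G δ 0 + lam * |u| < G δ u := by
  obtain ⟨c, hc, hs, h1, h2, h3, h4, h5⟩ := exists_corner
  set g : ℝ → ℝ → ℝ := fun r u => r * corner c (u / r) with hg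
  have habs : ∀ r u : ℝ, 0 < r → r * |u / r| = |u| := fun r u hr => by
    rw [abs_div, abs_of_pos hr]; field_simp
  have g1 : ∀ r u, 0 < r → r * c ≤ g r u := fun r u hr => mul_le_mul_of_nonneg_left (h1 _) hr.le
  have g2 : ∀ r u, 0 < r → |u| ≤ g r u := fun r u hr => by
    rw [← habs r u hr]; exact mul_le_mul_of_nonneg_left (h2 _) hr.le
  have g3 : ∀ r u, 0 < r → g r u ≤ |u| + r * c := fun r u hr => by
    have := mul_le_mul_of_nonneg_left (h3 (u / r)) hr.le
    rwa [mul_add, habs r u hr] at this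
  have g4 : ∀ r, g r 0 = r * c := fun r => by simp [hg, h4]
  have g5 : ∀ r u, 0 < r → r ≤ |u| → g r u = |u| := fun r u hr hu => by
    have : 1 ≤ |u / r| := by rwa [abs_div, abs_of_pos hr, one_le_div hr]
    simp only [hg]
    rw [h5 _ this, habs r u hr]
  have gs : ∀ r, ContDiff ℝ ∞ (g r) := fun r =>
    contDiff_const.mul (hs.comp (contDiff_id.div_const r))
  have hG0 : ∀ δ, lam * g (δ ^ 2) 0 + (1 - lam) * g δ 0 = (lam * δ ^ 2 + (1 - lam) * δ) * c :=
    fun δ => by rw [g4, g4]; ring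
  refine ⟨fun δ u => lam * g (δ ^ 2) u + (1 - lam) * g δ u, fun δ h0 hd1 => ⟨?_, fun u => ?_,
    fun u hu => ?_, fun u => ?_⟩, ?_, fun τ hτ => ?_⟩
  · have a1 := gs (δ ^ 2)
    have a2 := gs δ
    fun_prop
  · have a1 := g1 (δ ^ 2) u (by positivity)
    have a2 := g1 δ u h0
    have a3 : 0 < g (δ ^ 2) u := lt_of_lt_of_le (by positivity) a1
    have a4 : 0 < g δ u := lt_of_lt_of_le (by positivity) a2
    have : 0 < 1 - lam := by linarith
    positivity
  · simp only
    rw [g5 _ _ (by positivity) (by nlinarith), g5 _ _ h0 hu]; ring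
  · simp only [hG0]
    have a1 := g3 (δ ^ 2) u (by positivity)
    have a2 := g3 δ u h0
    nlinarith
  · simp only [hG0]
    have : Continuous fun δ : ℝ => (lam * δ ^ 2 + (1 - lam) * δ) * c := by fun_prop
    have := this.tendsto 0
    simp only [ne_eq, OfNat.ofNat_ne_zero, not_false_eq_true, zero_pow, mul_zero, add_zero,
      zero_mul] at this
    exact this.mono_left nhdsWithin_le_nhds
  · simp only [hG0]
    have e1 : ∀ᶠ δ in 𝓝[>] (0 : ℝ), τ * (lam * δ + (1 - lam)) < 1 - lam := by
      have : Continuous fun δ : ℝ => τ * (lam * δ + (1 - lam)) := by fun_prop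
      refine nhdsWithin_le_nhds (this.continuousAt.eventually (isOpen_Iio.mem_nhds ?_))
      simp only [mul_zero, zero_add, mem_Iio]
      nlinarith
    filter_upwards [e1, self_mem_nhdsWithin] with δ hδ h0 u
    rw [mem_Ioi] at h0
    have a1 := g2 (δ ^ 2) u (by positivity)
    have a2 := g1 δ u h0
    have a3 : τ * ((lam * δ ^ 2 + (1 - lam) * δ) * c) < (1 - lam) * (δ * c) := by
      have := mul_lt_mul_of_pos_right hδ (mul_pos h0 hc)
      linarith
    nlinarith

lemma hasDerivAt_dot {γ : ℝ → R3} {v : R3} {t : ℝ} (a : R3) (h : HasDerivAt γ v t) :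
    HasDerivAt (fun t => a ⬝ᵥ γ t) (a ⬝ᵥ v) t := by
  have h1 : ∀ i, HasDerivAt (fun t => γ t i) (v i) t := fun i => hasDerivAt_pi.1 h i
  simp only [dotProduct, Fin.sum_univ_three]
  exact (((h1 0).const_mul _).add ((h1 1).const_mul _)).add ((h1 2).const_mul _)

namespace NodalCurve

variable {ι κ : Type} (W : NodalCurve ι κ)

/-- The composition of a smooth lift of a curve in a chart with the inverse of the chart. -/
lemma exists_chart_lift {c : κ} {θ : ℝ} {k : ι} (h : pt (W.γ c θ) = pt (W.F k 0)) :
    ∃ (s : ℝ) (A : ℝ → ℝ) (B : ℝ → ℝ × ℝ), s ≠ 0 ∧ A θ = s ∧ B θ = 0 ∧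
      DifferentiableAt ℝ A θ ∧ DifferentiableAt ℝ B θ ∧
      ∀ᶠ t in 𝓝 θ, W.γ c t = A t • W.F k (B t) := by
  obtain ⟨s, hs, h1⟩ := (pt_eq_iff (W.ne_zero k 0) (W.γ_ne c θ)).1 h.symm
  have h2 : ContDiffAt ℝ ∞ (fun t => W.conv k (W.γ c t)) θ := by
    refine ContDiffAt.comp (g := W.conv k) θ ?_ (W.γ_smooth c).contDiffAt
    rw [h1]
    exact W.contDiffAt_conv k hs 0
  have h3 := h2.differentiableAt (by simp)
  have h4 : W.conv k (W.γ c θ) = (s, 0) := by rw [h1, W.conv_smul k hs]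
  refine ⟨s, fun t => (W.conv k (W.γ c t)).1, fun t => (W.conv k (W.γ c t)).2, hs, by simp [h4],
    by simp [h4], h3.fst, h3.snd, ?_⟩
  have h5 : ∀ᶠ v in 𝓝 (W.γ c θ), ∃ d : ℝ, ∃ w, d ≠ 0 ∧ v = d • W.F k w ∧ True := by
    rw [h1]
    exact W.eventually_cone k hs 0 (P := fun _ _ => True) (by simp)
  filter_upwards [(W.γ_smooth c).continuous.continuousAt.eventually h5] with t ht
  obtain ⟨d, w, hd, h6, -⟩ := ht
  rw [h6, W.conv_smul k hd]

/-- The slope of a line in a chart when it is transverse to a branch of the curve. -/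
lemma slope_ne {a : R3} (ha : ∀ c θ, a ⬝ᵥ W.γ c θ = 0 → a ⬝ᵥ deriv (W.γ c) θ ≠ 0) {k : ι}
    (h0 : a ⬝ᵥ W.F k 0 = 0) {s : ℝ} {c : κ} {θ : ℝ} (h : pt (W.γ c θ) = pt (W.F k 0))
    (hs : ∀ᶠ t in 𝓝 θ, ∃ u : ℝ, pt (W.γ c t) = pt (W.F k (u, s * u))) :
    a ⬝ᵥ fderiv ℝ (W.F k) 0 (1, s) ≠ 0 := by
  intro h1
  obtain ⟨d, A, B, hd, hA, hB, hAd, hBd, hev⟩ := W.exists_chart_lift h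
  have h2 : ∀ᶠ t in 𝓝 θ, (B t).2 = s * (B t).1 := by
    filter_upwards [hs, hev] with t ht h3
    obtain ⟨u, hu⟩ := ht
    have hAt : A t ≠ 0 := by
      intro h4
      exact W.γ_ne c t (by rw [h3, h4, zero_smul])
    rw [h3, pt_smul hAt] at hu
    rw [W.inj' hu]
  obtain ⟨A', hA'⟩ : ∃ A', HasDerivAt A A' θ := ⟨_, hAd.hasDerivAt⟩
  obtain ⟨B', hB'⟩ : ∃ B', HasDerivAt B B' θ := ⟨_, hBd.hasDerivAt⟩
  have h3 : B'.2 = s * B'.1 := by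
    have e1 : HasDerivAt (fun t => (B t).2) B'.2 θ := (hasFDerivAt_snd (𝕜 := ℝ) (E := ℝ) (F := ℝ) (p := B θ)).comp_hasDerivAt θ hB'
    have e0 : HasDerivAt (fun t => (B t).1) B'.1 θ := (hasFDerivAt_fst (𝕜 := ℝ) (E := ℝ) (F := ℝ) (p := B θ)).comp_hasDerivAt θ hB'
    have e2 := e0.const_mul s
    exact e1.unique (e2.congr_of_eventuallyEq h2)
  have h4 : HasFDerivAt (W.F k) (fderiv ℝ (W.F k) 0) (B θ) := by
    rw [hB]; exact ((W.smooth k).differentiable (by simp) 0).hasFDerivAt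
  have h5 : HasDerivAt (W.γ c) (A θ • fderiv ℝ (W.F k) 0 B' + A' • W.F k (B θ)) θ :=
    (hA'.smul (h4.comp_hasDerivAt θ hB')).congr_of_eventuallyEq hev
  have h6 : B' = B'.1 • ((1 : ℝ), s) := by ext <;> simp [h3, mul_comm]
  have h7 : a ⬝ᵥ deriv (W.γ c) θ = 0 := by
    rw [h5.deriv, dotProduct_add, dotProduct_smul, dotProduct_smul, hB, h0, h6, map_smul,
      dotProduct_smul, h1]
    simp
  refine ha c θ ?_ h7
  rw [hev.self_of_nhds, hB, dotProduct_smul, h0, smul_zero]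

/-- The covectors of the partial derivatives at a double point. -/
def slopeU (a : R3) (k : ι) : ℝ := a ⬝ᵥ fderiv ℝ (W.F k) 0 (1, 0)

def slopeW (a : R3) (k : ι) : ℝ := a ⬝ᵥ fderiv ℝ (W.F k) 0 (0, 1)

lemma dot_fderiv (a : R3) (k : ι) (h : ℝ × ℝ) :
    a ⬝ᵥ fderiv ℝ (W.F k) 0 h = W.slopeU a k * h.1 + W.slopeW a k * h.2 := by
  have : h = h.1 • ((1 : ℝ), (0 : ℝ)) + h.2 • ((0 : ℝ), (1 : ℝ)) := by ext <;> simp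
  conv_lhs => rw [this]
  rw [map_add, map_smul, map_smul, dotProduct_add, dotProduct_smul, dotProduct_smul, slopeU, slopeW]
  simp [mul_comm]

lemma abs_slope_ne {a : R3} (ha : ∀ c θ, a ⬝ᵥ W.γ c θ = 0 → a ⬝ᵥ deriv (W.γ c) θ ≠ 0) {k : ι}
    (h0 : a ⬝ᵥ W.F k 0 = 0) : |W.slopeU a k| ≠ |W.slopeW a k| := by
  intro h
  obtain ⟨c, θ, h1, h2⟩ := W.diag k
  obtain ⟨c', θ', h1', h2'⟩ := W.antidiag k
  have h3 := W.slope_ne ha h0 (s := 1) h1 (by simpa using h2)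
  have h4 := W.slope_ne ha h0 (s := -1) h1' (by simpa using h2')
  rw [dot_fderiv] at h3 h4
  rcases abs_eq_abs.1 h with h5 | h5
  · apply h4; simp only; linarith
  · apply h3; simp only; linarith

lemma not_eventually_const (c : κ) (θ : ℝ) (x : RP2) : ¬ ∀ᶠ t in 𝓝 θ, pt (W.γ c t) = x := by
  intro h
  apply W.γ_imm c θ
  have h1 : ∀ᶠ t in 𝓝 θ, W.γ c θ ⨯₃ W.γ c t = 0 := by
    filter_upwards [h] with t ht
    rw [← pt_eq_iff_cross (W.γ_ne c θ) (W.γ_ne c t), ht, h.self_of_nhds]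
  have h2 : HasDerivAt (W.γ c) (deriv (W.γ c) θ) θ :=
    ((W.γ_smooth c).differentiable (by simp) θ).hasDerivAt
  have h3 : HasDerivAt (fun t => W.γ c θ ⨯₃ W.γ c t) (W.γ c θ ⨯₃ deriv (W.γ c) θ) θ :=
    (LinearMap.toContinuousLinearMap (crossProduct (W.γ c θ))).hasFDerivAt.comp_hasDerivAt θ h2
  have h4 : HasDerivAt (fun t => W.γ c θ ⨯₃ W.γ c t) 0 θ :=
    (hasDerivAt_const θ (0 : R3)).congr_of_eventuallyEq h1
  exact h3.unique h4

/-- The two parameters of a double point. -/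
lemma exists_params (s : κ → ℝ) (k : ι) : ∃ d : Bool → κ × ℝ, d false ≠ d true ∧
    ∀ b, (d b).2 ∈ Ico (s (d b).1) (s (d b).1 + π) ∧ pt (W.γ (d b).1 (d b).2) = pt (W.F k 0) := by
  obtain ⟨c, θ, h1, h2⟩ := W.diag k
  obtain ⟨c', θ', h1', h2'⟩ := W.antidiag k
  obtain ⟨n, hn⟩ := exists_int_add_mem (s c) θ
  obtain ⟨n', hn'⟩ := exists_int_add_mem (s c') θ'
  refine ⟨fun b => if b then (c', θ' + n' * π) else (c, θ + n * π), ?_, fun b => ?_⟩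
  · simp only [Bool.false_eq_true, if_false, if_true]
    intro h
    obtain ⟨rfl, h3⟩ := Prod.mk.inj h
    apply W.not_eventually_const c θ (pt (W.F k 0))
    set d : ℝ := (n - n') * π with hd
    have h4 : Tendsto (fun t => t + d) (𝓝 θ) (𝓝 θ') := by
      have : θ' = θ + d := by rw [hd]; linarith
      rw [this]
      exact (continuous_add_const d).continuousAt
    filter_upwards [h2, h4.eventually h2'] with t ht ht'
    obtain ⟨u, hu⟩ := ht
    obtain ⟨u', hu'⟩ := ht'
    have h5 : pt (W.γ c (t + d)) = pt (W.γ c t) := by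
      have := W.pt_γ_add_int c t (n - n')
      push_cast at this
      rw [hd, this]
    rw [hu', hu] at h5
    have h6 := W.inj' h5
    simp only [Prod.mk.injEq] at h6
    have : u = 0 := by linarith
    rw [hu, this]; rfl
  · cases b
    · simp only [Bool.false_eq_true, if_false]
      exact ⟨hn, by rw [W.pt_γ_add_int, h1]⟩
    · simp only [if_true]
      exact ⟨hn', by rw [W.pt_γ_add_int, h1']⟩

lemma ZerosLE_finite {f : ℝ → ℝ} {N : ℕ} (h : ZerosLE f N) (s : ℝ) :
    ({x | x ∈ Ico s (s + π) ∧ f x = 0} : Set ℝ).Finite := by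
  by_contra hf
  obtain ⟨T, hT, hc⟩ := (show ({x | x ∈ Ico s (s + π) ∧ f x = 0} : Set ℝ).Infinite from
    hf).exists_subset_card_eq (N + 1)
  have := h s T fun x hx => hT hx
  omega

lemma ZerosLE_exists_ne {f : ℝ → ℝ} {N : ℕ} (h : ZerosLE f N) : ∃ s, f s ≠ 0 := by
  by_contra! hf
  have := ZerosLE_finite h 0
  simp only [hf, and_true, zero_add] at this
  exact (Ico_infinite Real.pi_pos) this

/-- The parameters of the points of the curve on a line. -/
def Crossings (a : R3) (n : ℕ) [Fintype κ] : Prop :=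
  ∃ N : κ → ℕ, ∑ c, N c ≤ n ∧ ∀ c, ZerosLE (fun θ => a ⬝ᵥ W.γ c θ) (N c)

set_option maxHeartbeats 800000 in
lemma eventually_count [Finite ι] [Fintype κ] {a : R3} {n : ℕ}
    (ha : ∀ c θ, a ⬝ᵥ W.γ c θ = 0 → a ⬝ᵥ deriv (W.γ c) θ ≠ 0) (hN : W.Crossings a n) {r : ℝ}
    (hr : 0 < r) : ∀ᶠ A in 𝓝 a, 2 * {k | a ⬝ᵥ W.F k 0 = 0}.encard +
      {x | x ∈ W.points ∧ (∀ k, ∀ z ∈ box r, x ≠ pt (W.F k z)) ∧ A ⬝ᵥ x.coords = 0}.encard ≤ n := by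
  classical
  have := Fintype.ofFinite ι
  obtain ⟨N, hN, hZ⟩ := hN
  choose s hs using fun c => ZerosLE_exists_ne (hZ c)
  set Z : κ → Finset ℝ := fun c => (ZerosLE_finite (hZ c) (s c)).toFinset with hZdef
  have hZm : ∀ c x, x ∈ Z c ↔ x ∈ Ico (s c) (s c + π) ∧ a ⬝ᵥ W.γ c x = 0 := fun c x => by
    simp [hZdef]
  have hZN : ∀ c, (Z c).card ≤ N c := fun c => hZ c (s c) (Z c) fun x hx => (hZm c x).1 hx
  set U : Set RP2 := ⋃ k, (fun z => pt (W.F k z)) '' box r with hU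
  have hUo : IsOpen U := isOpen_iUnion fun k => W.isOpen_image k (isOpen_box r)
  set K : κ → Set ℝ := fun c => {θ | pt (W.γ c θ) ∉ U} with hK
  have hKc : ∀ c, IsClosed (K c) := fun c => (hUo.preimage (W.continuous_pt_γ c)).isClosed_compl
  have hsm : ∀ c (A : R3), ContDiff ℝ ∞ fun θ => A ⬝ᵥ W.γ c θ := fun c A =>
    (contDiff_dot A).comp (W.γ_smooth c)
  have h1 : ∀ c, ∃ η > 0, ∃ M : ℕ, ∀ f, ContDiff ℝ ∞ f →
      CloseOn f (fun θ => a ⬝ᵥ W.γ c θ) (s c) (s c + π) M η →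
      ∀ T : Finset ℝ, (∀ x ∈ T, x ∈ Icc (s c) (s c + π) ∧ x ∈ K c ∧ f x = 0) →
        T.card ≤ ((Z c).filter (· ∈ K c)).card := by
    intro c
    have hend : a ⬝ᵥ W.γ c (s c + π) ≠ 0 := by
      rw [W.γ_add_pi, dotProduct_smul]
      exact smul_ne_zero (W.period_ne c) (hs c)
    have hm : ∀ z ∈ Z c, iteratedDeriv 1 (fun θ => a ⬝ᵥ W.γ c θ) z ≠ 0 := by
      intro z hz
      rw [iteratedDeriv_one]
      have hd := hasDerivAt_dot a ((W.γ_smooth c).differentiable (by simp) z).hasDerivAt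
      rw [hd.deriv]
      exact ha c z ((hZm c z).1 hz).2
    obtain ⟨η, hη, M, h⟩ := exists_zeros_le (hsm c a) (a := s c) (b := s c + π) (Z c)
      (fun _ => 1) (fun x hx h0 => (hZm c x).2 ⟨⟨hx.1, lt_of_le_of_ne hx.2 fun h => hend (h ▸ h0)⟩, h0⟩)
      hm (hKc c)
    refine ⟨η, hη, M, fun f hf hcl T hT => (h f hf hcl T hT).trans (le_of_eq ?_)⟩
    rw [Finset.sum_const, smul_eq_mul, mul_one]
    congr
  choose η hη M hcount using h1
  have h2 : ∀ᶠ A in 𝓝 a, ∀ c, CloseOn (fun θ => A ⬝ᵥ W.γ c θ) (fun θ => a ⬝ᵥ W.γ c θ) (s c)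
      (s c + π) (M c) (η c) :=
    eventually_all.2 fun c => eventually_closeOn (g := fun i θ => W.γ c θ i)
      (fun i => contDiff_pi.1 (W.γ_smooth c) i) a _ _ _ (hη c)
  filter_upwards [h2] with A hA
  set T : κ → Set ℝ := fun c => {θ | θ ∈ Ico (s c) (s c + π) ∧ θ ∈ K c ∧ A ⬝ᵥ W.γ c θ = 0} with hT
  have h3 : ∀ c, (T c).encard ≤ ((Z c).filter (· ∈ K c)).card := by
    intro c
    by_contra h4
    have h5 : ((((Z c).filter (· ∈ K c)).card + 1 : ℕ) : ℕ∞) ≤ (T c).encard := by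
      push_cast; exact Order.add_one_le_of_lt (not_le.1 h4)
    obtain ⟨t, ht, htc⟩ := exists_subset_encard_eq h5
    have htf : t.Finite := finite_of_encard_eq_coe htc
    have h6 := hcount c _ (hsm c A) (hA c) htf.toFinset fun x hx => by
      have := ht (htf.mem_toFinset.1 hx)
      exact ⟨Ico_subset_Icc_self this.1, this.2⟩
    rw [htf.encard_eq_coe_toFinset_card] at htc
    have : htf.toFinset.card = ((Z c).filter (· ∈ K c)).card + 1 := by exact_mod_cast htc
    omega
  have h4 : {x | x ∈ W.points ∧ (∀ k, ∀ z ∈ box r, x ≠ pt (W.F k z)) ∧ A ⬝ᵥ x.coords = 0}.encard ≤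
      ((∑ c, ((Z c).filter (· ∈ K c)).card : ℕ) : ℕ∞) := by
    have h5 : {x | x ∈ W.points ∧ (∀ k, ∀ z ∈ box r, x ≠ pt (W.F k z)) ∧ A ⬝ᵥ x.coords = 0} ⊆
        ⋃ c ∈ (Finset.univ : Finset κ), (fun θ => pt (W.γ c θ)) '' T c := by
      rintro x ⟨⟨c, θ, rfl⟩, h6, h7⟩
      obtain ⟨m, hm⟩ := exists_int_add_mem (s c) θ
      refine mem_biUnion (Finset.mem_coe.2 (Finset.mem_univ c)) ⟨_, ⟨hm, ?_, ?_⟩, W.pt_γ_add_int c θ m⟩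
      · simp only [hK, hU, mem_ofPred_eq, W.pt_γ_add_int]
        intro h8
        obtain ⟨k, z, hz, h9⟩ := mem_iUnion.1 h8
        exact h6 k z hz h9.symm
      · rw [W.γ_add_int, dotProduct_smul, (dot_coords_iff (W.γ_ne c θ)).1 h7, smul_zero]
    refine (encard_le_encard h5).trans ?_
    refine (Finset.univ.set_encard_biUnion_le _).trans ?_
    rw [Nat.cast_sum]
    exact Finset.sum_le_sum fun c _ => (encard_image_le _ _).trans (h3 c)
  have h5 : 2 * {k | a ⬝ᵥ W.F k 0 = 0}.encard ≤
      ((∑ c, ((Z c).filter (· ∉ K c)).card : ℕ) : ℕ∞) := by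
    choose d hd1 hd2 using W.exists_params s
    set nodes : Finset ι := Finset.univ.filter fun k => a ⬝ᵥ W.F k 0 = 0 with hnodes
    have h6 : (nodes ×ˢ (Finset.univ : Finset Bool)).card ≤
        (Finset.univ.sigma fun c => (Z c).filter (· ∉ K c)).card := by
      refine Finset.card_le_card_of_injOn (fun p => ⟨(d p.1 p.2).1, (d p.1 p.2).2⟩) ?_ ?_
      · rintro ⟨k, b⟩ hk
        simp only [Finset.coe_product, mem_prod, Finset.mem_coe, hnodes, Finset.mem_filter,
          Finset.mem_univ, true_and, and_true] at hk
        simp only [Finset.coe_sigma, Set.mem_sigma_iff, Finset.mem_coe, Finset.mem_univ,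
          Finset.mem_filter, true_and, hZm]
        obtain ⟨h7, h8⟩ := hd2 k b
        refine ⟨⟨h7, ?_⟩, ?_⟩
        · obtain ⟨x, hx, h9⟩ := (pt_eq_iff (W.ne_zero k 0) (W.γ_ne _ _)).1 h8.symm
          rw [h9, dotProduct_smul, hk, smul_zero]
        · simp only [hK, mem_ofPred_eq, not_not, h8]
          exact mem_iUnion.2 ⟨k, 0, ⟨by simpa, by simpa⟩, rfl⟩
      · rintro ⟨k, b⟩ - ⟨k', b'⟩ - h
        have h7 : d k b = d k' b' := by
          simp only [Sigma.mk.injEq, heq_eq_eq] at h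
          exact Prod.ext h.1 h.2
        have h8 : k = k' := by
          have e1 := (hd2 k b).2
          rw [h7, (hd2 k' b').2] at e1
          exact (W.inj _ _ _ _ e1).1.symm
        subst h8
        have h9 := hd1 k
        cases b <;> cases b'
        · rfl
        · exact absurd h7 h9
        · exact absurd h7.symm h9
        · rfl
    rw [Finset.card_product, Finset.card_sigma, Finset.card_univ, Fintype.card_bool] at h6
    have h7 : {k | a ⬝ᵥ W.F k 0 = 0}.encard = (nodes.card : ℕ∞) := by
      rw [← encard_coe_eq_coe_finsetCard]; simp [hnodes]
    rw [h7]
    have : 2 * nodes.card ≤ ∑ c, ((Z c).filter (· ∉ K c)).card := by omega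
    exact_mod_cast this
  calc _ ≤ ((∑ c, ((Z c).filter (· ∉ K c)).card : ℕ) : ℕ∞) +
        ((∑ c, ((Z c).filter (· ∈ K c)).card : ℕ) : ℕ∞) := add_le_add h5 h4
    _ = ((∑ c, (Z c).card : ℕ) : ℕ∞) := by
        rw [← Nat.cast_add, ← Finset.sum_add_distrib]
        congr 2
        funext c
        rw [add_comm]
        exact Finset.card_filter_add_card_filter_not _
    _ ≤ n := by exact_mod_cast (Finset.sum_le_sum fun c _ => hZN c).trans hN

end NodalCurve

lemma eventually_box {X : Type*} {l : Filter X} {Q : X → ℝ × ℝ → Prop}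
    (h : ∀ᶠ p in l ×ˢ 𝓝 (0 : ℝ × ℝ), Q p.1 p.2) :
    ∀ᶠ r in 𝓝[>] (0 : ℝ), ∀ᶠ x in l, ∀ z ∈ box r, Q x z := by
  obtain ⟨p, hp, q, hq, h1⟩ := eventually_prod_iff.1 h
  obtain ⟨ε, hε, h2⟩ := Metric.eventually_nhds_iff.1 hq
  filter_upwards [nhdsWithin_le_nhds (Iio_mem_nhds hε)] with r hr
  filter_upwards [hp] with x hx z hz
  refine h1 hx (h2 ?_)
  rw [Prod.dist_eq, max_lt_iff]
  simp only [Prod.fst_zero, Prod.snd_zero, dist_zero_right, Real.norm_eq_abs]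
  exact ⟨hz.1.trans hr, hz.2.trans hr⟩

lemma eventually_box_pair {X : Type*} {l : Filter X} {Q : X → ℝ × ℝ → ℝ × ℝ → Prop}
    (h : ∀ᶠ p in l ×ˢ (𝓝 (0 : ℝ × ℝ) ×ˢ 𝓝 (0 : ℝ × ℝ)), Q p.1 p.2.1 p.2.2) :
    ∀ᶠ r in 𝓝[>] (0 : ℝ), ∀ᶠ x in l, ∀ z ∈ box r, ∀ z' ∈ box r, Q x z z' := by
  obtain ⟨p, hp, q, hq, h1⟩ := eventually_prod_iff.1 h
  obtain ⟨s, hs, s', hs', h2⟩ := eventually_prod_iff.1 hq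
  have e1 := eventually_box (l := l) (Q := fun _ z => s z ∧ s' z)
    (Eventually.prod_inr (hs.and hs') _)
  filter_upwards [e1] with r hr
  filter_upwards [hr, hp] with x hx hpx z hz z' hz'
  exact h1 hpx (h2 (hx z hz).1 (hx z' hz').2)

namespace NodalCurve

variable {ι κ : Type} (W : NodalCurve ι κ)

lemma eventually_est (a : R3) (k : ι) {ε : ℝ} (hε : 0 < ε) :
    ∀ᶠ r in 𝓝[>] (0 : ℝ), ∀ᶠ A in 𝓝 a, ∀ z ∈ box r, ∀ z' ∈ box r,
      |A ⬝ᵥ W.F k z - A ⬝ᵥ W.F k z' - W.slopeU a k * (z.1 - z'.1) - W.slopeW a k * (z.2 - z'.2)| ≤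
        ε * (|z.1 - z'.1| + |z.2 - z'.2|) := by
  apply eventually_box_pair
  set Ψ : R3 × (ℝ × ℝ) → ℝ := fun p => p.1 ⬝ᵥ W.F k p.2 with hΨ
  have hΨs : ContDiff ℝ ∞ Ψ := by
    have h1 : ∀ i, ContDiff ℝ ∞ fun p : R3 × (ℝ × ℝ) => W.F k p.2 i := fun i =>
      (contDiff_pi.1 (W.smooth k) i).comp contDiff_snd
    have h2 := h1 0
    have h3 := h1 1
    have h4 := h1 2
    simp only [hΨ, dotProduct, Fin.sum_univ_three]
    fun_prop
  have h1 := (hΨs.contDiffAt (x := (a, 0))).hasStrictFDerivAt (by simp)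
  have h2 : ∀ h : ℝ × ℝ, fderiv ℝ Ψ (a, 0) (0, h) = W.slopeU a k * h.1 + W.slopeW a k * h.2 := by
    intro h
    rw [← W.dot_fderiv]
    have e1 : HasFDerivAt (fun z : ℝ × ℝ => (a, z)) ((0 : ℝ × ℝ →L[ℝ] R3).prod (.id ℝ _)) 0 :=
      (hasFDerivAt_const a 0).prodMk (hasFDerivAt_id 0)
    have e2 : HasFDerivAt Ψ (fderiv ℝ Ψ (a, 0)) ((fun z : ℝ × ℝ => (a, z)) 0) := h1.hasFDerivAt
    have e3 := (e2.comp (0 : ℝ × ℝ) e1).fderiv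
    have e4 := fderiv_dot_comp a ((W.smooth k).differentiable (by simp) 0) h
    have e5 : (Ψ ∘ fun z : ℝ × ℝ => (a, z)) = fun z => a ⬝ᵥ W.F k z := rfl
    rw [e5] at e3
    rw [← e4, e3]
    simp
  have h3 := hasStrictFDerivAt_iff_isLittleO.1 h1
  have h4 := (Asymptotics.isLittleO_iff.1 h3) hε
  rw [nhds_prod_eq, nhds_prod_eq] at h4
  have h5 : Tendsto (fun p : R3 × ((ℝ × ℝ) × (ℝ × ℝ)) => ((p.1, p.2.1), (p.1, p.2.2)))
      (𝓝 a ×ˢ (𝓝 (0 : ℝ × ℝ) ×ˢ 𝓝 (0 : ℝ × ℝ)))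
      ((𝓝 a ×ˢ 𝓝 (0 : ℝ × ℝ)) ×ˢ (𝓝 a ×ˢ 𝓝 (0 : ℝ × ℝ))) :=
    (tendsto_fst.prodMk (tendsto_fst.comp tendsto_snd)).prodMk
      (tendsto_fst.prodMk (tendsto_snd.comp tendsto_snd))
  filter_upwards [h5.eventually h4] with p hp
  have h6 : ((p.1, p.2.1) : R3 × (ℝ × ℝ)) - (p.1, p.2.2) = (0, p.2.1 - p.2.2) := by simp
  rw [h6, h2, Real.norm_eq_abs, Prod.norm_mk, norm_zero, Prod.norm_def] at hp
  simp only [Prod.fst_sub, Prod.snd_sub, Real.norm_eq_abs] at hp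
  refine le_trans (le_of_eq ?_) (hp.trans (mul_le_mul_of_nonneg_left ?_ hε.le))
  · simp only [hΨ]; congr 1; ring
  · refine max_le (by positivity) (max_le ?_ ?_)
    · linarith [abs_nonneg (p.2.1.2 - p.2.2.2)]
    · linarith [abs_nonneg (p.2.1.1 - p.2.2.1)]

lemma eventually_miss {a : R3} {k : ι} (h : a ⬝ᵥ W.F k 0 ≠ 0) :
    ∀ᶠ r in 𝓝[>] (0 : ℝ), ∀ᶠ A in 𝓝 a, ∀ z ∈ box r, A ⬝ᵥ W.F k z ≠ 0 := by
  apply eventually_box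
  rw [← nhds_prod_eq]
  have h1 : Continuous fun p : R3 × (ℝ × ℝ) => p.1 ⬝ᵥ W.F k p.2 :=
    continuous_fst.dotProduct ((W.smooth k).continuous.comp continuous_snd)
  exact h1.continuousAt.eventually_ne h

lemma eventually_off_box {X : Type*} {l : Filter X} {p : X → R3} {v : R3} (hv : v ≠ 0) {k : ι}
    (hp : Tendsto p l (𝓝 v)) (h : pt v ≠ pt (W.F k 0)) :
    ∀ᶠ r in 𝓝[>] (0 : ℝ), ∀ᶠ x in l, ∀ z ∈ box r, pt (p x) ≠ pt (W.F k z) := by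
  have h1 : ∀ᶠ r in 𝓝[>] (0 : ℝ), pt v ∉ (fun z => pt (W.F k z)) '' cbox r := by
    by_cases h2 : ∃ z, pt v = pt (W.F k z)
    · obtain ⟨z, hz⟩ := h2
      have hz0 : 0 < max |z.1| |z.2| := by
        by_contra h3
        obtain ⟨h4, h5⟩ := max_le_iff.1 (not_lt.1 h3)
        exact h (by rw [hz, show z = 0 from Prod.ext (abs_nonpos_iff.1 h4) (abs_nonpos_iff.1 h5)])
      filter_upwards [nhdsWithin_le_nhds (Iio_mem_nhds hz0)] with r hr
      rintro ⟨w, hw, hwv⟩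
      obtain rfl := W.inj' (hwv.trans hz)
      exact absurd (max_le hw.1 hw.2) (not_le.2 hr)
    · push Not at h2
      exact .of_forall fun r ⟨w, _, hw⟩ => h2 w hw.symm
  filter_upwards [h1] with r hr
  have h2 : IsClosed ((fun z => pt (W.F k z)) '' cbox r) :=
    ((isCompact_cbox r).image (W.continuous k)).isClosed
  filter_upwards [hp.eventually ((continuousAt_pt hv).eventually (h2.isOpen_compl.mem_nhds hr))]
    with x hx z hz hxz
  exact hx ⟨z, box_subset_cbox le_rfl hz, hxz.symm⟩

lemma eventually_inbox {X : Type*} {l : Filter X} {p q : X → R3} {a b : R3} (hab : a ⨯₃ b ≠ 0)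
    (hp : Tendsto p l (𝓝 a)) (hq : Tendsto q l (𝓝 b)) {k : ι} (h1 : a ⬝ᵥ W.F k 0 = 0)
    (h2 : b ⬝ᵥ W.F k 0 = 0) {r : ℝ} (hr : 0 < r) :
    ∀ᶠ x in l, ∃ z ∈ box r, pt (p x ⨯₃ q x) = pt (W.F k z) := by
  have h3 : pt (a ⨯₃ b) = pt (W.F k 0) := by
    refine (pt_eq_iff_cross hab (W.ne_zero k 0)).2 ?_
    rw [← cross_anticomm]
    rw [cross_cross_eq_zero h1 h2, neg_zero]
  have h4 : Tendsto (fun x => p x ⨯₃ q x) l (𝓝 (a ⨯₃ b)) := by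
    exact ((continuous_cross continuous_fst continuous_snd).tendsto (a, b)).comp (hp.prodMk_nhds hq)
  have h5 := W.isOpen_image k (isOpen_box r)
  have h6 : pt (a ⨯₃ b) ∈ (fun z => pt (W.F k z)) '' box r := by
    rw [h3]; exact ⟨0, ⟨by simpa, by simpa⟩, rfl⟩
  filter_upwards [h4.eventually ((continuousAt_pt hab).eventually (h5.mem_nhds h6))] with x hx
  obtain ⟨z, hz, h7⟩ := hx
  exact ⟨z, hz, h7.symm⟩

/-- The double points on a line. -/
def nodesOn (a : R3) : Set ι := {k | a ⬝ᵥ W.F k 0 = 0}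

/-- The double points on a line at which the line is steep. -/
def steepOn (a : R3) : Set ι := {k | a ⬝ᵥ W.F k 0 = 0 ∧ |W.slopeW a k| < |W.slopeU a k|}

/-- Bounds on the slopes of a line at the double points. -/
structure SlopeBound (a : R3) (lam ε : ℝ) : Prop where
  steep : ∀ k ∈ W.steepOn a, ε < |W.slopeU a k| ∧
    |W.slopeW a k| + ε ≤ lam * (|W.slopeU a k| - ε)
  flat : ∀ k ∈ W.nodesOn a, k ∉ W.steepOn a → ε < |W.slopeW a k| ∧
    |W.slopeU a k| + ε ≤ lam * (|W.slopeW a k| - ε)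

lemma exists_slopeBound [Finite ι] {J : Type} [Finite J] {a : J → R3}
    (ha : ∀ i c θ, a i ⬝ᵥ W.γ c θ = 0 → a i ⬝ᵥ deriv (W.γ c) θ ≠ 0) :
    ∃ lam, 0 < lam ∧ lam < 1 ∧ ∀ᶠ ε in 𝓝[>] (0 : ℝ), ∀ i, W.SlopeBound (a i) lam ε := by
  have key : ∀ x y : ℝ, x < y → ∀ᶠ lam in 𝓝[<] (1 : ℝ), x < lam * y := by
    intro x y h
    have : Continuous fun lam : ℝ => lam * y := by fun_prop
    exact nhdsWithin_le_nhds (this.continuousAt.eventually (isOpen_Ioi.mem_nhds (by simpa)))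
  have key2 : ∀ x y lam : ℝ, 0 ≤ x → lam < 1 → 0 < lam → x < lam * y → ∀ᶠ ε in 𝓝[>] (0 : ℝ),
      ε < y ∧ x + ε ≤ lam * (y - ε) := by
    intro x y lam hx hl hl0 h
    have hy : 0 < y := by nlinarith
    have : Continuous fun ε : ℝ => lam * (y - ε) - (x + ε) := by fun_prop
    have h1 : ∀ᶠ ε in 𝓝 (0 : ℝ), lam * (y - ε) - (x + ε) ∈ Ioi (0 : ℝ) :=
      this.continuousAt.eventually (isOpen_Ioi.mem_nhds (by simpa))
    filter_upwards [nhdsWithin_le_nhds h1, nhdsWithin_le_nhds (Iio_mem_nhds hy)] with ε h2 h3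
    exact ⟨h3, by linarith [mem_Ioi.1 h2]⟩
  have e1 : ∀ᶠ lam in 𝓝[<] (1 : ℝ), ∀ i k, a i ⬝ᵥ W.F k 0 = 0 →
      (|W.slopeW (a i) k| < |W.slopeU (a i) k| → |W.slopeW (a i) k| < lam * |W.slopeU (a i) k|) ∧
      (|W.slopeU (a i) k| < |W.slopeW (a i) k| → |W.slopeU (a i) k| < lam * |W.slopeW (a i) k|) := by
    refine eventually_all.2 fun i => eventually_all.2 fun k => ?_
    by_cases h : |W.slopeW (a i) k| < |W.slopeU (a i) k|
    · filter_upwards [key _ _ h] with lam hl _ using ⟨fun _ => hl, fun h' => absurd h h'.not_gt⟩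
    by_cases h' : |W.slopeU (a i) k| < |W.slopeW (a i) k|
    · filter_upwards [key _ _ h'] with lam hl _ using ⟨fun h'' => absurd h'' h, fun _ => hl⟩
    · exact .of_forall fun _ _ => ⟨fun h'' => absurd h'' h, fun h'' => absurd h'' h'⟩
  have e2 : ∀ᶠ lam in 𝓝[<] (1 : ℝ), 0 < lam :=
    nhdsWithin_le_nhds (isOpen_Ioi.mem_nhds (by norm_num))
  obtain ⟨lam, hl, hl0, hl1⟩ := (e1.and (e2.and self_mem_nhdsWithin)).exists
  refine ⟨lam, hl0, hl1, eventually_all.2 fun i => ?_⟩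
  have e3 : ∀ᶠ ε in 𝓝[>] (0 : ℝ), ∀ k, (k ∈ W.steepOn (a i) → ε < |W.slopeU (a i) k| ∧
      |W.slopeW (a i) k| + ε ≤ lam * (|W.slopeU (a i) k| - ε)) ∧
      (k ∈ W.nodesOn (a i) → k ∉ W.steepOn (a i) → ε < |W.slopeW (a i) k| ∧
      |W.slopeU (a i) k| + ε ≤ lam * (|W.slopeW (a i) k| - ε)) := by
    refine eventually_all.2 fun k => ?_
    by_cases hk : a i ⬝ᵥ W.F k 0 = 0
    · by_cases hs : |W.slopeW (a i) k| < |W.slopeU (a i) k|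
      · filter_upwards [key2 _ _ _ (abs_nonneg _) hl1 hl0 ((hl i k hk).1 hs)] with ε hε
        exact ⟨fun _ => hε, fun _ h => absurd ⟨hk, hs⟩ h⟩
      · have hs' := lt_of_le_of_ne (not_lt.1 hs) (W.abs_slope_ne (ha i) hk)
        filter_upwards [key2 _ _ _ (abs_nonneg _) hl1 hl0 ((hl i k hk).2 hs')] with ε hε
        exact ⟨fun h => absurd h.2 hs, fun _ _ => hε⟩
    · exact .of_forall fun ε => ⟨fun h => absurd h.1 hk, fun h => absurd h hk⟩
  filter_upwards [e3] with ε hε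
  exact ⟨fun k => (hε k).1, fun k => (hε k).2⟩

/-- The slopes of two lines through a double point are different. -/
lemma slope_indep {a b : R3} (hab : a ⨯₃ b ≠ 0) {k : ι} (h1 : a ⬝ᵥ W.F k 0 = 0)
    (h2 : b ⬝ᵥ W.F k 0 = 0) :
    W.slopeW a k * W.slopeU b k - W.slopeW b k * W.slopeU a k ≠ 0 := by
  have hi := W.imm k 0
  unfold ImmAt at hi
  set f := W.F k 0
  set u := fderiv ℝ (W.F k) 0 (1, 0) with hu
  set w := fderiv ℝ (W.F k) 0 (0, 1) with hw
  have e1 : W.slopeW a k * W.slopeU b k - W.slopeW b k * W.slopeU a k = (a ⨯₃ b) ⬝ᵥ (w ⨯₃ u) := by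
    rw [cross_dot_cross]
    simp only [slopeU, slopeW, ← hu, ← hw]; ring
  have h3 : f ⨯₃ (a ⨯₃ b) = 0 := cross_cross_eq_zero h1 h2
  obtain ⟨c, hc, h4⟩ := (cross_eq_zero_iff (W.ne_zero k 0) hab).1 h3
  rw [e1, h4, smul_dotProduct]
  refine mul_ne_zero hc fun h5 => hi ?_
  rw [trip, ← cross_anticomm, dotProduct_neg, h5, neg_zero]

lemma deriv_γ_add_int (c : κ) (θ : ℝ) (n : ℤ) :
    deriv (W.γ c) (θ + n * π) = (W.period c) ^ n • deriv (W.γ c) θ := by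
  have h : (fun x => W.γ c (x + n * π)) = fun x => (W.period c) ^ n • W.γ c x :=
    funext fun x => W.γ_add_int c x n
  rw [← deriv_comp_add_const, h, deriv_fun_const_smul _ ((W.γ_smooth c).differentiable (by simp) θ)]

lemma eventually_simple [Finite κ] {a : R3}
    (ha : ∀ c θ, a ⬝ᵥ W.γ c θ = 0 → a ⬝ᵥ deriv (W.γ c) θ ≠ 0) :
    ∀ᶠ A in 𝓝 a, ∀ c θ, A ⬝ᵥ W.γ c θ = 0 → A ⬝ᵥ deriv (W.γ c) θ ≠ 0 := by
  refine eventually_all.2 fun c => ?_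
  have h1 : ∀ᶠ A in 𝓝 a, ∀ θ ∈ Icc 0 π, A ⬝ᵥ W.γ c θ = 0 → A ⬝ᵥ deriv (W.γ c) θ ≠ 0 := by
    refine isCompact_Icc.eventually_forall_of_forall_eventually fun θ _ => ?_
    have c1 : Continuous fun p : R3 × ℝ => p.1 ⬝ᵥ W.γ c p.2 :=
      continuous_fst.dotProduct ((W.γ_smooth c).continuous.comp continuous_snd)
    have c2 : Continuous fun p : R3 × ℝ => p.1 ⬝ᵥ deriv (W.γ c) p.2 :=
      continuous_fst.dotProduct (((W.γ_smooth c).continuous_deriv (by simp)).comp continuous_snd)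
    by_cases h : a ⬝ᵥ W.γ c θ = 0
    · filter_upwards [c2.continuousAt.eventually_ne (x := (a, θ)) (ha c θ h)] with p hp _ using hp
    · filter_upwards [c1.continuousAt.eventually_ne (x := (a, θ)) h] with p hp h' using absurd h' hp
  filter_upwards [h1] with A hA θ h0
  obtain ⟨n, hn⟩ := exists_int_add_mem 0 θ
  rw [zero_add] at hn
  have hp := zpow_ne_zero n (W.period_ne c)
  have h2 := hA _ (Ico_subset_Icc_self hn) (by rw [W.γ_add_int, dotProduct_smul, h0, smul_zero])
  rw [W.deriv_γ_add_int, dotProduct_smul] at h2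
  exact fun h3 => h2 (by rw [h3, smul_zero])

/-- The line with its estimates in boxes. -/
def lineData {a x y : R3} {r lam ε : ℝ} (hε : 0 ≤ ε) (hb : W.SlopeBound a lam ε) (h1 : x ⨯₃ y ≠ 0)
    (h2 : ∀ k, a ⬝ᵥ W.F k 0 ≠ 0 → ∀ z ∈ box r, (x ⨯₃ y) ⬝ᵥ W.F k z ≠ 0)
    (h3 : ∀ k, ∀ z ∈ box r, ∀ z' ∈ box r, |(x ⨯₃ y) ⬝ᵥ W.F k z - (x ⨯₃ y) ⬝ᵥ W.F k z' -
      W.slopeU a k * (z.1 - z'.1) - W.slopeW a k * (z.2 - z'.2)| ≤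
        ε * (|z.1 - z'.1| + |z.2 - z'.2|))
    (h4 : ∀ k ∈ W.steepOn a, (x ⨯₃ y) ⬝ᵥ W.F k 0 = 0) : LineData W.toChartFamily r lam where
  p := x
  q := y
  indep := h1
  node := W.nodesOn a
  vert := W.steepOn a
  vert_sub _ hk := hk.1
  α := W.slopeU a
  β := W.slopeW a
  κ _ := ε
  κ_nonneg _ := hε
  miss k hk := h2 k hk
  est k _ := h3 k
  vert_lt := hb.steep
  vert_zero := h4
  hor_lt := hb.flat

/-- Pairs of points that span lines in general position with respect to the curve. -/
structure LinePosition [Fintype κ] {J : Type} (P : J → Bool → R3) : Prop where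
  ne : ∀ i, P i false ⨯₃ P i true ≠ 0
  simple : ∀ i c θ, (P i false ⨯₃ P i true) ⬝ᵥ W.γ c θ = 0 →
    (P i false ⨯₃ P i true) ⬝ᵥ deriv (W.γ c) θ ≠ 0
  crossings : ∀ i, W.Crossings (P i false ⨯₃ P i true) 5
  indep : ∀ i j, i ≠ j → (P i false ⨯₃ P i true) ⨯₃ (P j false ⨯₃ P j true) ≠ 0
  forced : ∀ i k, (P i false ⨯₃ P i true) ⬝ᵥ W.F k 0 = 0 → ∃ b, pt (P i b) = pt (W.F k 0)
  lift : ∀ i b k, pt (P i b) = pt (W.F k 0) → P i b = W.F k 0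

set_option maxHeartbeats 1000000 in
lemma LinePosition.eventually_quasilines [Finite ι] [Fintype κ] {J : Type} [Finite J]
    {P : J → Bool → R3} (h : W.LinePosition P) : ∃ lam, 0 < lam ∧ lam < 1 ∧
    ∀ (G : ℝ → ℝ → ℝ) (t : J → Bool → ℝ) (p : J → Bool → ℝ → R3),
      (∀ δ, 0 < δ → δ < 1 → ContDiff ℝ ∞ (G δ) ∧ (∀ u, 0 < G δ u) ∧
        (∀ u, δ ≤ |u| → G δ u = |u|) ∧ ∀ u, G δ u ≤ G δ 0 + |u|) →
      Tendsto (fun δ => G δ 0) (𝓝[>] 0) (𝓝 0) →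
      (∀ τ, τ < 1 → ∀ᶠ δ in 𝓝[>] 0, ∀ u, τ * G δ 0 + lam * |u| < G δ u) →
      (∀ i b, |t i b| < 1) →
      (∀ i b k, P i b = W.F k 0 → ∀ δ, p i b δ = W.F k (0, t i b * G δ 0)) →
      (∀ i b, Tendsto (p i b) (𝓝[>] 0) (𝓝 (P i b))) →
      ∀ᶠ δ in 𝓝[>] 0, ∃ L : J → Set RP2,
        (∀ i, (W.smoothed fun _ => G δ).IsQuasiline (L i) ∧ ∀ b, pt (p i b δ) ∈ L i) ∧
        (∀ i, ∀ k ∈ W.steepOn (P i false ⨯₃ P i true), (W.smoothed fun _ => G δ).interval k ⊆ L i) ∧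
        ∀ i j, i ≠ j → (∃ x, L i ∩ L j = {x} ∧ TransverseAt (L i) (L j) x) ∨
          ∃ k, L i ∩ L j = (W.smoothed fun _ => G δ).interval k := by
  classical
  set a : J → R3 := fun i => P i false ⨯₃ P i true with ha
  obtain ⟨lam, hl, hl1, hε⟩ := W.exists_slopeBound (a := a) h.simple
  refine ⟨lam, hl, hl1, fun G t p hG hG0 hGτ ht hp hpt => ?_⟩
  have hPne : ∀ i b, P i b ≠ 0 := fun i b h0 => by
    apply h.ne i
    cases b <;> simp [h0]
  -- the size of the errors of the linear approximations
  have hε2 : ∀ᶠ ε in 𝓝[>] (0 : ℝ), ∀ i j k, i ≠ j → k ∈ W.steepOn (a i) → k ∈ W.steepOn (a j) →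
      2 * ε * (|W.slopeU (a i) k| + |W.slopeU (a j) k|) <
      |W.slopeW (a i) k * W.slopeU (a j) k - W.slopeW (a j) k * W.slopeU (a i) k| := by
    refine eventually_all.2 fun i => eventually_all.2 fun j => eventually_all.2 fun k => ?_
    by_cases hij : i ≠ j ∧ k ∈ W.steepOn (a i) ∧ k ∈ W.steepOn (a j)
    · have h1 := abs_pos.2 (W.slope_indep (h.indep i j hij.1) hij.2.1.1 hij.2.2.1)
      have h2 : Continuous fun ε : ℝ => 2 * ε * (|W.slopeU (a i) k| + |W.slopeU (a j) k|) := by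
        fun_prop
      have h3 : ∀ᶠ ε in 𝓝 (0 : ℝ), 2 * ε * (|W.slopeU (a i) k| + |W.slopeU (a j) k|) ∈ Iio _ :=
        h2.continuousAt.eventually (isOpen_Iio.mem_nhds (by
          show 2 * 0 * (|W.slopeU (a i) k| + |W.slopeU (a j) k|) < _
          rwa [mul_zero, zero_mul]))
      filter_upwards [nhdsWithin_le_nhds h3] with ε hε _ _ _ using hε
    · exact .of_forall fun ε h1 h2 h3 => absurd ⟨h1, h2, h3⟩ hij
  obtain ⟨ε, ⟨hb, hε2⟩, hε0⟩ := ((hε.and hε2).and self_mem_nhdsWithin).exists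
  -- points and lines
  set x : J → Bool → ℝ → R3 := fun i b δ =>
    if ∃ k ∈ W.steepOn (a i), P i b = W.F k 0 then P i b else p i b δ with hx
  have hxt : ∀ i b, Tendsto (x i b) (𝓝[>] 0) (𝓝 (P i b)) := fun i b => by
    simp only [hx]
    split_ifs
    · exact tendsto_const_nhds
    · exact hpt i b
  have hA : ∀ i, Tendsto (fun δ => x i false δ ⨯₃ x i true δ) (𝓝[>] 0) (𝓝 (a i)) := fun i =>
    ((continuous_cross continuous_fst continuous_snd).tendsto (P i false, P i true)).comp
      ((hxt i false).prodMk_nhds (hxt i true))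
  -- the size of the boxes
  have r1 : ∀ᶠ r in 𝓝[>] (0 : ℝ), ∀ i k, ∀ᶠ A in 𝓝 (a i), ∀ z ∈ box r, ∀ z' ∈ box r,
      |A ⬝ᵥ W.F k z - A ⬝ᵥ W.F k z' - W.slopeU (a i) k * (z.1 - z'.1) -
        W.slopeW (a i) k * (z.2 - z'.2)| ≤ ε * (|z.1 - z'.1| + |z.2 - z'.2|) :=
    eventually_all.2 fun i => eventually_all.2 fun k => W.eventually_est (a i) k hε0
  have r2 : ∀ᶠ r in 𝓝[>] (0 : ℝ), ∀ i k, a i ⬝ᵥ W.F k 0 ≠ 0 → ∀ᶠ A in 𝓝 (a i), ∀ z ∈ box r,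
      A ⬝ᵥ W.F k z ≠ 0 := by
    refine eventually_all.2 fun i => eventually_all.2 fun k => ?_
    by_cases hk : a i ⬝ᵥ W.F k 0 = 0
    · exact .of_forall fun r h => absurd hk h
    · filter_upwards [W.eventually_miss hk] with r hr _ using hr
  have r3 : ∀ᶠ r in 𝓝[>] (0 : ℝ), ∀ i b k, pt (P i b) ≠ pt (W.F k 0) →
      ∀ᶠ δ in 𝓝[>] (0 : ℝ), ∀ z ∈ box r, pt (p i b δ) ≠ pt (W.F k z) := by
    refine eventually_all.2 fun i => eventually_all.2 fun b => eventually_all.2 fun k => ?_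
    by_cases hk : pt (P i b) = pt (W.F k 0)
    · exact .of_forall fun r h => absurd hk h
    · filter_upwards [W.eventually_off_box (hPne i b) (hpt i b) hk] with r hr _ using hr
  obtain ⟨r, ⟨r1, r2, r3⟩, hr⟩ := ((r1.and (r2.and r3)).and self_mem_nhdsWithin).exists
  -- conditions on the parameter
  have d1 : ∀ᶠ δ in 𝓝[>] (0 : ℝ), ∀ i, x i false δ ⨯₃ x i true δ ≠ 0 :=
    eventually_all.2 fun i => (hA i).eventually_ne (h.ne i)
  have d2 : ∀ᶠ δ in 𝓝[>] (0 : ℝ), ∀ i k, ∀ z ∈ box r, ∀ z' ∈ box r,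
      |(x i false δ ⨯₃ x i true δ) ⬝ᵥ W.F k z - (x i false δ ⨯₃ x i true δ) ⬝ᵥ W.F k z' -
        W.slopeU (a i) k * (z.1 - z'.1) - W.slopeW (a i) k * (z.2 - z'.2)| ≤
        ε * (|z.1 - z'.1| + |z.2 - z'.2|) :=
    eventually_all.2 fun i => eventually_all.2 fun k => (hA i).eventually (r1 i k)
  have d3 : ∀ᶠ δ in 𝓝[>] (0 : ℝ), ∀ i k, a i ⬝ᵥ W.F k 0 ≠ 0 → ∀ z ∈ box r,
      (x i false δ ⨯₃ x i true δ) ⬝ᵥ W.F k z ≠ 0 := by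
    refine eventually_all.2 fun i => eventually_all.2 fun k => ?_
    by_cases hk : a i ⬝ᵥ W.F k 0 = 0
    · exact .of_forall fun r h => absurd hk h
    · filter_upwards [(hA i).eventually (r2 i k hk)] with δ hδ _ using hδ
  have d4 : ∀ᶠ δ in 𝓝[>] (0 : ℝ), ∀ i b k, pt (P i b) ≠ pt (W.F k 0) →
      ∀ z ∈ box r, pt (p i b δ) ≠ pt (W.F k z) := by
    refine eventually_all.2 fun i => eventually_all.2 fun b => eventually_all.2 fun k => ?_
    by_cases hk : pt (P i b) = pt (W.F k 0)
    · exact .of_forall fun r h => absurd hk h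
    · filter_upwards [r3 i b k hk] with δ hδ _ using hδ
  have d5 : ∀ᶠ δ in 𝓝[>] (0 : ℝ), ∀ i j k, i ≠ j → a i ⬝ᵥ W.F k 0 = 0 → a j ⬝ᵥ W.F k 0 = 0 →
      ∃ z ∈ box r, pt ((x i false δ ⨯₃ x i true δ) ⨯₃ (x j false δ ⨯₃ x j true δ)) =
        pt (W.F k z) := by
    refine eventually_all.2 fun i => eventually_all.2 fun j => eventually_all.2 fun k => ?_
    by_cases hk : i ≠ j ∧ a i ⬝ᵥ W.F k 0 = 0 ∧ a j ⬝ᵥ W.F k 0 = 0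
    · filter_upwards [W.eventually_inbox (h.indep i j hk.1) (hA i) (hA j) hk.2.1 hk.2.2 hr] with
        δ hδ _ _ _ using hδ
    · exact .of_forall fun δ h1 h2 h3 => absurd ⟨h1, h2, h3⟩ hk
  have d6 : ∀ᶠ δ in 𝓝[>] (0 : ℝ), ∀ i j, i ≠ j →
      (x i false δ ⨯₃ x i true δ) ⨯₃ (x j false δ ⨯₃ x j true δ) ≠ 0 := by
    refine eventually_all.2 fun i => eventually_all.2 fun j => ?_
    by_cases hij : i = j
    · exact .of_forall fun δ h => absurd hij h
    · have := ((continuous_cross continuous_fst continuous_snd).tendsto (a i, a j)).comp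
        ((hA i).prodMk_nhds (hA j))
      filter_upwards [this.eventually_ne (h.indep i j hij)] with δ hδ _ using hδ
  have d7 : ∀ᶠ δ in 𝓝[>] (0 : ℝ), ∀ i, 2 * {k | a i ⬝ᵥ W.F k 0 = 0}.encard +
      {y | y ∈ W.points ∧ (∀ k, ∀ z ∈ box r, y ≠ pt (W.F k z)) ∧
        (x i false δ ⨯₃ x i true δ) ⬝ᵥ y.coords = 0}.encard ≤ (5 : ℕ) :=
    eventually_all.2 fun i => (hA i).eventually (W.eventually_count (h.simple i) (h.crossings i) hr)
  have d8 : ∀ᶠ δ in 𝓝[>] (0 : ℝ), ∀ i b, ∀ u, |t i b| * G δ 0 + lam * |u| < G δ u :=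
    eventually_all.2 fun i => eventually_all.2 fun b => hGτ _ (ht i b)
  have dpos : ∀ᶠ δ in 𝓝[>] (0 : ℝ), 0 < δ ∧ δ < 1 := (by
    filter_upwards [self_mem_nhdsWithin, nhdsWithin_le_nhds (Iio_mem_nhds one_pos)] with δ h1 h2
    exact ⟨h1, h2⟩)
  have d9 : ∀ᶠ δ in 𝓝[>] (0 : ℝ), ∃ φ, IsCutoff φ (G δ 0) r lam := by
    have h1 : Tendsto (fun δ => G δ 0) (𝓝[>] 0) (𝓝[>] 0) :=
      tendsto_nhdsWithin_iff.2 ⟨hG0, by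
        filter_upwards [dpos] with δ hδ using (hG δ hδ.1 hδ.2).2.1 0⟩
    exact h1.eventually (eventually_exists_cutoff hr hl.le hl1)
  have d10 : ∀ᶠ δ in 𝓝[>] (0 : ℝ), G δ 0 + δ < r / 2 := by
    have h1 : Tendsto (fun δ => G δ 0 + δ) (𝓝[>] 0) (𝓝 (0 + 0)) :=
      hG0.add (tendsto_id.mono_left nhdsWithin_le_nhds)
    exact h1.eventually (isOpen_Iio.mem_nhds (by simpa using hr))
  have d11 : ∀ᶠ δ in 𝓝[>] (0 : ℝ), ∀ i, ∀ c θ, (x i false δ ⨯₃ x i true δ) ⬝ᵥ W.γ c θ = 0 →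
      (x i false δ ⨯₃ x i true δ) ⬝ᵥ deriv (W.γ c) θ ≠ 0 :=
    eventually_all.2 fun i => (hA i).eventually (W.eventually_simple (h.simple i))
  filter_upwards [d1, d2, d3, d4, d5, d6, d7, d8, d9, d10, d11, dpos] with δ d1 d2 d3 d4 d5 d6 d7 d8
    d9 d10 d11 hδ
  obtain ⟨φ, hφ⟩ := d9
  obtain ⟨hGs, hGp, hGe, hGl⟩ := hG δ hδ.1 hδ.2
  have hG' : ∀ k : ι, IsProfile ((fun _ => G δ) k) r := fun k => ⟨hGs, hGp, fun u hu => hGe u (by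
    linarith [hGp 0]), fun u hu => by
      rcases le_total δ |u| with h1 | h1
      · simp only [hGe u h1]; exact hu
      · exact (hGl u).trans (by linarith)⟩
  have hv : ∀ i, ∀ k ∈ W.steepOn (a i), (x i false δ ⨯₃ x i true δ) ⬝ᵥ W.F k 0 = 0 := by
    intro i k hk
    obtain ⟨b, hb⟩ := h.forced i k hk.1
    have hb' := h.lift i b k hb
    have h1 : x i b δ = W.F k 0 := by
      simp only [hx]
      rw [if_pos ⟨k, hk, hb'⟩, hb']
    rw [← h1]
    cases b
    · exact dot_cross_left _ _
    · exact dot_cross_right _ _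
  set D : J → LineData W.toChartFamily r lam := fun i =>
    W.lineData hε0.le (hb i) (d1 i) (d3 i) (d2 i) (hv i) with hD
  have hxA : ∀ i b, (x i false δ ⨯₃ x i true δ) ⬝ᵥ x i b δ = 0 := fun i b => by
    cases b
    · exact dot_cross_left _ _
    · exact dot_cross_right _ _
  have hg : ∀ i, (D i).Good W (fun _ => G δ) (G δ 0) := fun i => by
    refine ⟨fun _ => rfl, fun _ => hGl, fun k hk hk' => ?_, fun c θ => ?_, by exact_mod_cast d7 i⟩
    · obtain ⟨b, hb⟩ := h.forced i k hk
      have hb' := h.lift i b k hb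
      refine ⟨t i b * G δ 0, ?_, ?_, ?_⟩
      · rw [abs_mul, abs_of_pos (hGp 0)]
        nlinarith [ht i b, hGp 0]
      · have h1 : x i b δ = W.F k (0, t i b * G δ 0) := by
          simp only [hx]
          rw [if_neg, hp i b k hb']
          rintro ⟨l, hl, hl'⟩
          obtain rfl := (W.inj l k 0 0 (by rw [← hl', hb'])).1
          exact hk' hl
        have h2 := hxA i b
        rwa [h1] at h2
      · intro u
        rw [abs_mul, abs_of_pos (hGp 0)]
        exact d8 i b u
    · exact d11 i c θ
  have hfit := fun i => LineData.fits hφ hl.le hl1 hG' hr (hg i)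
  have hpair : ∀ i j, i ≠ j → LineData.GoodPair (D i) (D j) := fun i j hij => by
    refine ⟨d6 i j hij, fun k hk hk' => d5 i j k hij hk hk', fun k hk hk' z hz h1 h2 => ?_⟩
    have h0 : (0 : ℝ × ℝ) ∈ box r := ⟨by simpa, by simpa⟩
    have e1 := d2 i k z hz 0 h0
    have e2 := d2 j k z hz 0 h0
    rw [hv i k hk] at e1
    rw [hv j k hk'] at e2
    have e3 := hε2 i j k hij hk hk'
    change ((x i false δ ⨯₃ x i true δ) ⬝ᵥ W.F k z) * W.slopeU (a j) k =
      ((x j false δ ⨯₃ x j true δ) ⬝ᵥ W.F k z) * W.slopeU (a i) k at h1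
    generalize (x i false δ ⨯₃ x i true δ) ⬝ᵥ W.F k z = ei at *
    generalize (x j false δ ⨯₃ x j true δ) ⬝ᵥ W.F k z = ej at *
    generalize W.slopeU (a i) k = αi at *
    generalize W.slopeU (a j) k = αj at *
    generalize W.slopeW (a i) k = βi at *
    generalize W.slopeW (a j) k = βj at *
    simp only [Prod.fst_zero, Prod.snd_zero, sub_zero] at e1 e2
    have e4 : |(βi * αj - βj * αi) * z.2| ≤ ε * (|z.1| + |z.2|) * |αj| +
        ε * (|z.1| + |z.2|) * |αi| := by
      have e5 : (βi * αj - βj * αi) * z.2 = -((ei - αi * z.1 - βi * z.2) * αj) +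
          (ej - αj * z.1 - βj * z.2) * αi := by linear_combination h1
      rw [e5]
      refine (abs_add_le _ _).trans (add_le_add ?_ ?_)
      · rw [abs_neg, abs_mul]
        exact mul_le_mul_of_nonneg_right e1 (abs_nonneg _)
      · rw [abs_mul]
        exact mul_le_mul_of_nonneg_right e2 (abs_nonneg _)
    rw [abs_mul] at e4
    have hz2 : |z.2| = 0 := by
      by_contra h3
      have h4 : 0 < |z.2| := lt_of_le_of_ne (abs_nonneg _) (Ne.symm h3)
      have h5 := mul_lt_mul_of_pos_right e3 h4
      have h6 : ε * (|z.1| + |z.2|) * (|αj| + |αi|) ≤ ε * (2 * |z.2|) * (|αj| + |αi|) := by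
        gcongr; linarith
      nlinarith
    have hz1 : |z.1| = 0 := le_antisymm (by rw [← hz2]; exact h2) (abs_nonneg _)
    exact Prod.ext (abs_eq_zero.1 hz1) (abs_eq_zero.1 hz2)
  refine ⟨fun i => ((D i).bend hφ hl.le hl1).set, fun i => ⟨(hfit i).isQuasiline hG' hr,
    fun b => ?_⟩, fun i k hk => (hfit i).interval_subset hG' hr hk, fun i j hij =>
    (hpair i j hij).inter hφ hl.le hl1 hG' hr (hg i) (hg j)⟩
  by_cases hk : ∃ k, pt (P i b) = pt (W.F k 0)
  · obtain ⟨k, hk⟩ := hk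
    have hk' := h.lift i b k hk
    have hz : ((0 : ℝ), t i b * G δ 0) ∈ box r := (hG' k).zero_mem_box hr (by
      rw [abs_mul, abs_of_pos (hGp 0)]
      nlinarith [ht i b, hGp 0])
    rw [hp i b k hk' δ, BentLine.mem_set_box _ hz]
    change (D i).E φ k _ = 0
    by_cases hs : k ∈ W.steepOn (a i)
    · rw [(D i).E_vert hs]
      have : φ (t i b * G δ 0) = 0 := (hφ.eq_zero_iff _).2 (by
        rw [abs_mul, abs_of_pos (hGp 0)]
        nlinarith [ht i b, hGp 0])
      simp [this]
    · rw [(D i).E_not_vert hs]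
      have h1 : x i b δ = W.F k (0, t i b * G δ 0) := by
        simp only [hx]
        rw [if_neg, hp i b k hk']
        rintro ⟨l, hl, hl'⟩
        obtain rfl := (W.inj l k 0 0 (by rw [← hl', hk'])).1
        exact hs hl
      have h2 := hxA i b
      rwa [h1] at h2
  · push Not at hk
    have h1 : x i b δ = p i b δ := by
      simp only [hx]
      rw [if_neg]
      rintro ⟨l, -, hl'⟩
      exact hk l (by rw [hl'])
    have h2 := hxA i b
    have hne : p i b δ ≠ 0 := by
      rw [← h1]
      intro h3
      apply d1 i
      cases b <;> simp [h3]
    rw [h1] at h2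
    refine (BentLine.mem_set_off _ hne fun k z hz hzb => ?_).2 h2
    exact d4 i b k (hk k) z (cbox_subset_box (by linarith) hzb) hz

end NodalCurve

/-! ### Shears of the projective plane -/

/-- Functions that are homogeneous of degree one and smooth away from the origin. -/
def homogFun : Submodule ℝ (R3 → ℝ) where
  carrier := {y | (∀ v, v ≠ 0 → ContDiffAt ℝ ∞ y v) ∧ ∀ (c : ℝ) v, y (c • v) = c * y v}
  add_mem' := fun ⟨h1, h2⟩ ⟨h3, h4⟩ => ⟨fun v hv => (h1 v hv).add (h3 v hv), fun c v => by
    simp only [Pi.add_apply, h2, h4]; ring⟩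
  zero_mem' := ⟨fun _ _ => contDiffAt_const, fun _ _ => by simp⟩
  smul_mem' := fun d _ ⟨h1, h2⟩ => ⟨fun v hv => contDiffAt_const.smul (h1 v hv), fun c v => by
    simp only [Pi.smul_apply, h2, smul_eq_mul]; ring⟩

lemma homogFun_differentiableAt {y : R3 → ℝ} (hy : y ∈ homogFun) {v : R3} (hv : v ≠ 0) :
    DifferentiableAt ℝ y v := (hy.1 v hv).differentiableAt (by simp)

lemma homogFun_fderiv_smul {y : R3 → ℝ} (hy : y ∈ homogFun) {v : R3} (hv : v ≠ 0) {c : ℝ}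
    (hc : c ≠ 0) : fderiv ℝ y (c • v) = fderiv ℝ y v := by
  have h1 : (fun w => y (c • w)) = fun w => c • y w := funext fun w => hy.2 c w
  have h2 : HasFDerivAt (fun w => y (c • w)) (c • fderiv ℝ y (c • v)) v := by
    have := (homogFun_differentiableAt hy (smul_ne_zero hc hv)).hasFDerivAt.comp v
      ((hasFDerivAt_id v).const_smul c)
    refine this.congr_fderiv ?_
    ext w; simp
  rw [h1] at h2
  have h3 := h2.unique ((homogFun_differentiableAt hy hv).hasFDerivAt.const_smul c)
  exact smul_right_injective _ hc h3

lemma homogFun_fderiv_self {y : R3 → ℝ} (hy : y ∈ homogFun) {v : R3} (hv : v ≠ 0) :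
    fderiv ℝ y v v = y v := by
  have h1 : HasDerivAt (fun t : ℝ => y (t • v)) (fderiv ℝ y v ((1 : ℝ) • v)) 1 := by
    have h2 : HasDerivAt (fun t : ℝ => t • v) ((1 : ℝ) • v) 1 := (hasDerivAt_id 1).smul_const v
    have h3 : HasFDerivAt y (fderiv ℝ y v) ((1 : ℝ) • v) := by
      rw [one_smul]; exact (homogFun_differentiableAt hy hv).hasFDerivAt
    exact h3.comp_hasDerivAt 1 h2
  have h4 : HasDerivAt (fun t : ℝ => y (t • v)) ((1 : ℝ) * y v) 1 := by
    simp only [hy.2]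
    exact (hasDerivAt_id 1).mul_const (y v)
  simpa using h1.unique h4

lemma homogFun_lipschitz {y : R3 → ℝ} (hy : y ∈ homogFun) :
    ∃ K : NNReal, ∀ v w, ‖y v - y w‖ ≤ K * ‖v - w‖ := by
  have h1 : ContinuousOn (fun v => fderiv ℝ y v) (Metric.sphere 0 1) := fun v hv => by
    have hv0 : v ≠ 0 := by rintro rfl; simp at hv
    exact ((hy.1 v hv0).continuousAt_fderiv (by simp)).continuousWithinAt
  obtain ⟨M, hM⟩ := (isCompact_sphere (0 : R3) 1).exists_bound_of_continuousOn h1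
  have h2 : ∀ v, v ≠ 0 → ‖fderiv ℝ y v‖ ≤ M := fun v hv => by
    have hn : ‖v‖⁻¹ ≠ 0 := inv_ne_zero (norm_ne_zero_iff.2 hv)
    rw [← homogFun_fderiv_smul hy hv hn]
    apply hM
    simp [norm_smul, hv]
  have hM0 : 0 ≤ M := (norm_nonneg _).trans (h2 (fun _ => 1) (fun h => by simpa using congrFun h 0))
  have h3 : ∀ v, ‖y v‖ ≤ M * ‖v‖ := fun v => by
    by_cases hv : v = 0
    · have := hy.2 0 v
      simp only [zero_smul, zero_mul] at this
      rw [hv, this]; simp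
    · rw [← homogFun_fderiv_self hy hv]
      exact (ContinuousLinearMap.le_opNorm _ _).trans
        (mul_le_mul_of_nonneg_right (h2 v hv) (norm_nonneg v))
  refine ⟨M.toNNReal, fun v w => ?_⟩
  rw [Real.coe_toNNReal M hM0]
  by_cases h4 : (0 : R3) ∈ segment ℝ w v
  · obtain ⟨a, b, ha, hb, hab, h5⟩ := h4
    have e1 : y v = (a + b) * y v := by rw [hab, one_mul]
    have e2 : y w = (a + b) * y w := by rw [hab, one_mul]
    have e3 : a * y w + b * y v = 0 := by
      have : a • w = (-b) • v := by rw [neg_smul]; exact eq_neg_of_add_eq_zero_left h5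
      rw [← hy.2, this, hy.2]; ring
    rcases eq_or_ne b 0 with rfl | hb0
    · rw [add_zero] at hab
      subst hab
      simp only [one_smul, zero_smul, add_zero] at h5
      subst h5
      have := h3 v
      have h0 : y 0 = 0 := by have := hy.2 0 0; simpa using this
      simpa [h0] using this
    · have h6 : v = (-(a / b)) • w := by
        have : b • v = (-a) • w := by rw [neg_smul]; exact eq_neg_of_add_eq_zero_right h5
        rw [← smul_right_injective _ hb0 |>.eq_iff, this, smul_smul]
        congr 1
        field_simp
      have h7 : y v - y w = (-(1 + a / b)) * y w := by rw [h6, hy.2]; ring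
      have h8 : v - w = (-(1 + a / b)) • w := by
        conv_lhs => rw [h6]
        module
      rw [h7, h8, norm_mul, norm_smul]
      have := mul_le_mul_of_nonneg_left (h3 w) (norm_nonneg (-(1 + a / b)))
      calc _ ≤ _ := this
        _ = _ := by ring
  · exact (convex_segment w v).norm_image_sub_le_of_norm_fderiv_le (𝕜 := ℝ)
      (fun x hx => homogFun_differentiableAt hy fun h => h4 (h ▸ hx))
      (fun x hx => h2 x fun h => h4 (h ▸ hx)) (left_mem_segment ℝ w v) (right_mem_segment ℝ w v)

/-- Small shears in the direction of a vector are diffeomorphisms. -/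
lemma eventually_exists_shear {y : R3 → ℝ} (hy : y ∈ homogFun) (n : R3) :
    ∀ᶠ s in 𝓝 (0 : ℝ), ∃ Φ : HD, ∀ v, Φ v = v + (s * y v) • n := by
  obtain ⟨K, hK⟩ := homogFun_lipschitz hy
  have h1 : ∀ᶠ s in 𝓝 (0 : ℝ), |s| * (K * ‖n‖) < 1 / 2 := by
    have : Continuous fun s : ℝ => |s| * (K * ‖n‖) := by fun_prop
    exact this.continuousAt.eventually (isOpen_Iio.mem_nhds (by simp))
  filter_upwards [h1] with s hs
  set f : R3 → R3 := fun v => v + (s * y v) • n with hf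
  have hlip : ∀ v w, ‖f v - f w - (v - w)‖ ≤ 1 / 2 * ‖v - w‖ := by
    intro v w
    have e : f v - f w - (v - w) = (s * (y v - y w)) • n := by simp only [hf]; module
    rw [e, norm_smul, norm_mul, Real.norm_eq_abs]
    calc |s| * ‖y v - y w‖ * ‖n‖ ≤ |s| * (K * ‖v - w‖) * ‖n‖ := by gcongr; exact hK v w
      _ = (|s| * (K * ‖n‖)) * ‖v - w‖ := by ring
      _ ≤ _ := by gcongr
  have happ : ApproximatesLinearOn f ((ContinuousLinearEquiv.refl ℝ R3 : R3 ≃L[ℝ] R3) : R3 →L[ℝ] R3)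
      univ (1 / 2 : NNReal) := fun v _ w _ => by simpa using hlip v w
  have hc : (1 / 2 : NNReal) < ‖(((ContinuousLinearEquiv.refl ℝ R3).symm : R3 ≃L[ℝ] R3) :
      R3 →L[ℝ] R3)‖₊⁻¹ := by
    have : ‖(((ContinuousLinearEquiv.refl ℝ R3).symm : R3 ≃L[ℝ] R3) : R3 →L[ℝ] R3)‖₊ = 1 := by
      have : (((ContinuousLinearEquiv.refl ℝ R3).symm : R3 ≃L[ℝ] R3) : R3 →L[ℝ] R3) = .id ℝ R3 := by
        ext; simp
      rw [this]
      exact NNReal.eq (ContinuousLinearMap.norm_id)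
    rw [this, inv_one]
    exact NNReal.half_lt_self one_ne_zero
  have hinj : Function.Injective f := by
    have := happ.injOn (Or.inr hc)
    exact injOn_univ.1 this
  have hsurj : Function.Surjective f := happ.surjective (Or.inr hc)
  obtain ⟨g, hg1, hg2⟩ := Function.bijective_iff_has_inverse.1 ⟨hinj, hsurj⟩
  have hhom : ∀ (c : ℝ) v, f (c • v) = c • f v := fun c v => by
    simp only [hf, hy.2, smul_add, smul_smul]
    congr 2; ring
  have hsm : ∀ v, v ≠ 0 → ContDiffAt ℝ ∞ f v := fun v hv =>
    contDiffAt_id.add ((contDiffAt_const.mul (hy.1 v hv)).smul contDiffAt_const)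
  have hf0 : f 0 = 0 := by have := hhom 0 0; simpa using this
  refine ⟨⟨f, g, hsm, fun w hw => ?_, hhom, fun c w => ?_, hg1, hg2⟩, fun v => rfl⟩
  · obtain ⟨v, rfl⟩ := hsurj w
    have hv : v ≠ 0 := by rintro rfl; exact hw hf0
    refine contDiffAt_of_leftInverse (hsm v hv) (fun h h0 => ?_) rfl (.of_forall hg1)
    have h2 : HasFDerivAt (fun w => f w - w) (fderiv ℝ f v - .id ℝ R3) v :=
      ((hsm v hv).differentiableAt (by simp)).hasFDerivAt.sub (hasFDerivAt_id v)
    have h3 := h2.le_of_lip' (C := 1 / 2) (by norm_num) (.of_forall fun w => by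
      have := hlip w v
      rwa [show f w - f v - (w - v) = f w - w - (f v - v) by abel] at this)
    have h4 := (fderiv ℝ f v - .id ℝ R3).le_opNorm h
    have h5 : (fderiv ℝ f v - .id ℝ R3) h = -h := by rw [sub_apply, h0]; simp
    rw [h5, norm_neg] at h4
    have h6 : ‖h‖ ≤ 1 / 2 * ‖h‖ := h4.trans (mul_le_mul_of_nonneg_right h3 (norm_nonneg h))
    have : ‖h‖ ≤ 0 := by linarith
    exact norm_le_zero_iff.1 this
  · apply hinj
    rw [hg2, hhom, hg2]

/-! ### Test functions -/

lemma mem_homogFun_of_quintic {N : R3 → ℝ} (h1 : ContDiff ℝ ∞ N)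
    (h2 : ∀ (c : ℝ) v, N (c • v) = c ^ 5 * N v) :
    (fun v => N v / (v ⬝ᵥ v) ^ 2) ∈ homogFun := by
  have h3 : ContDiff ℝ ∞ fun v : R3 => (v ⬝ᵥ v) ^ 2 := by
    simp only [dotProduct, Fin.sum_univ_three]; fun_prop
  refine ⟨fun v hv => h1.contDiffAt.div h3.contDiffAt (pow_ne_zero 2 (dot_self_pos hv).ne'),
    fun c v => ?_⟩
  rcases eq_or_ne c 0 with rfl | hc
  · have := h2 0 v
    simp only [zero_smul] at this ⊢
    rw [this]; simp
  by_cases hv : v = 0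
  · subst hv; simp
  · have := (dot_self_pos hv).ne'
    simp only [h2, smul_dotProduct, dotProduct_smul, smul_eq_mul]
    field_simp

/-- The square of the area spanned by two vectors. -/
def areaSq (p v : R3) : ℝ := (p ⨯₃ v) ⬝ᵥ (p ⨯₃ v)

lemma contDiff_areaSq (p : R3) : ContDiff ℝ ∞ (areaSq p) := by
  unfold areaSq
  simp only [cross_apply, dotProduct, Fin.sum_univ_three]
  simp
  fun_prop

lemma areaSq_smul (p : R3) (c : ℝ) (v : R3) : areaSq p (c • v) = c ^ 2 * areaSq p v := by
  simp only [areaSq, map_smul, smul_dotProduct, dotProduct_smul, smul_eq_mul]; ring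

lemma areaSq_self (p : R3) : areaSq p p = 0 := by simp [areaSq, cross_self]

lemma exists_homogFun_ne {p q x : R3} (hp : p ⨯₃ x ≠ 0) (hq : q ⨯₃ x ≠ 0) :
    ∃ y ∈ homogFun, y p = 0 ∧ y q = 0 ∧ y x ≠ 0 := by
  refine ⟨_, mem_homogFun_of_quintic (N := fun v => areaSq p v * areaSq q v * (x ⬝ᵥ v))
    (((contDiff_areaSq p).mul (contDiff_areaSq q)).mul (contDiff_dot x)) (fun c v => ?_),
    by simp [areaSq_self], by simp [areaSq_self], ?_⟩
  · rw [areaSq_smul, areaSq_smul, dotProduct_smul, smul_eq_mul]; ring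
  · have hx : x ≠ 0 := by rintro rfl; simp at hp
    have h1 := (dot_self_pos hx).ne'
    have h2 := (dot_self_pos hp).ne'
    have h3 := (dot_self_pos hq).ne'
    exact div_ne_zero (mul_ne_zero (mul_ne_zero h2 h3) h1) (pow_ne_zero 2 h1)

lemma exists_homogFun_fderiv_ne {p q x : R3} (hq : q ⨯₃ p ≠ 0) (hx : p ⨯₃ x ≠ 0) :
    ∃ y ∈ homogFun, y p = 0 ∧ y q = 0 ∧ fderiv ℝ y p x ≠ 0 := by
  set b := (p ⨯₃ x) ⨯₃ p with hb
  have hbp : b ⬝ᵥ p = 0 := dot_cross_right _ _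
  have hp : p ≠ 0 := by rintro rfl; simp at hx
  have hpp := (dot_self_pos hp).ne'
  have hbx : b ⬝ᵥ x = (p ⨯₃ x) ⬝ᵥ (p ⨯₃ x) := by
    simp [hb, cross_apply, dotProduct, Fin.sum_univ_three]; ring
  set M : R3 → ℝ := fun v => (p ⬝ᵥ v) ^ 2 * areaSq q v / (v ⬝ᵥ v) ^ 2 with hM
  have hden : ContDiff ℝ ∞ fun v : R3 => (v ⬝ᵥ v) ^ 2 := by
    simp only [dotProduct, Fin.sum_univ_three]; fun_prop
  have hMs : ContDiffAt ℝ ∞ M p :=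
    ((((contDiff_dot p).pow 2).mul (contDiff_areaSq q)).contDiffAt).div hden.contDiffAt
      (pow_ne_zero 2 hpp)
  have hMp : M p ≠ 0 :=
    div_ne_zero (mul_ne_zero (pow_ne_zero 2 hpp) (dot_self_pos hq).ne') (pow_ne_zero 2 hpp)
  refine ⟨_, mem_homogFun_of_quintic (N := fun v => (b ⬝ᵥ v) * ((p ⬝ᵥ v) ^ 2 * areaSq q v))
    ((contDiff_dot b).mul (((contDiff_dot p).pow 2).mul (contDiff_areaSq q))) (fun c v => ?_),
    by simp [hbp], by simp [areaSq_self], ?_⟩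
  · rw [areaSq_smul, dotProduct_smul, dotProduct_smul, smul_eq_mul, smul_eq_mul]; ring
  · have e : (fun v => (b ⬝ᵥ v) * ((p ⬝ᵥ v) ^ 2 * areaSq q v) / (v ⬝ᵥ v) ^ 2) =
        fun v => (b ⬝ᵥ v) * M v := by funext v; rw [hM]; ring
    rw [e]
    have h1 : HasFDerivAt (fun v : R3 => b ⬝ᵥ v) (fderiv ℝ (fun v : R3 => b ⬝ᵥ v) p) p :=
      ((contDiff_dot b).differentiable (by simp) p).hasFDerivAt
    have h2 := (hMs.differentiableAt (by simp)).hasFDerivAt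
    rw [(h1.fun_mul h2).fderiv]
    have h3 := fderiv_dot_comp (F := fun v : R3 => v) b (z := p) differentiableAt_fun_id x
    rw [fderiv_fun_id] at h3
    simp only [ContinuousLinearMap.coe_id', id] at h3
    simp only [_root_.smul_apply, hbp, zero_smul, zero_add, smul_eq_mul, h3]
    rw [hbx]
    exact mul_ne_zero hMp (dot_self_pos hx).ne'

/-! ### Putting lines into general position by a shear -/

lemma exists_notMem_of_ne_top {E : Type*} [AddCommGroup E] [Module ℝ E] {S : Set (Submodule ℝ E)}
    (hS : S.Finite) (h : ∀ p ∈ S, p ≠ ⊤) : ∃ x, ∀ p ∈ S, x ∉ p := by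
  have h1 := Subspace.biUnion_ne_univ_of_top_notMem (s := hS.toFinset)
    fun ht => h ⊤ (hS.mem_toFinset.1 ht) rfl
  obtain ⟨x, hx⟩ := (ne_univ_iff_exists_notMem _).1 h1
  exact ⟨x, fun p hp hxp => hx (mem_biUnion (hS.mem_toFinset.2 hp) hxp)⟩

lemma ker_ne_top {E : Type*} [AddCommGroup E] [Module ℝ E] {f : E →ₗ[ℝ] ℝ} {x : E} (h : f x ≠ 0) :
    LinearMap.ker f ≠ ⊤ := fun ht => h (LinearMap.mem_ker.1 (ht ▸ Submodule.mem_top))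

/-- The coefficient of the first order variation of a triple product under shears. -/
def shearVar (p q n : R3) (y : R3 → ℝ) (x : R3) : ℝ :=
  y p * ((n ⨯₃ q) ⬝ᵥ x) + y q * ((p ⨯₃ n) ⬝ᵥ x) + y x * ((p ⨯₃ q) ⬝ᵥ n)

lemma cross_dot_shear (p q n x : R3) (y : R3 → ℝ) (s : ℝ) :
    ((p + (s * y p) • n) ⨯₃ (q + (s * y q) • n)) ⬝ᵥ (x + (s * y x) • n) =
      (p ⨯₃ q) ⬝ᵥ x + s * shearVar p q n y x := by
  simp [shearVar, cross_apply, dotProduct, Fin.sum_univ_three]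
  ring

/-- The variation as a linear functional. -/
def shearVarₗ (p q n x : R3) : homogFun →ₗ[ℝ] ℝ where
  toFun y := shearVar p q n y.1 x
  map_add' y z := by simp [shearVar]; ring
  map_smul' c y := by simp [shearVar]; ring

/-- The derivative of the variation along a curve. -/
def shearVarDeriv (p q n : R3) (y : R3 → ℝ) (x x' : R3) : ℝ :=
  y p * ((n ⨯₃ q) ⬝ᵥ x') + y q * ((p ⨯₃ n) ⬝ᵥ x') + fderiv ℝ y x x' * ((p ⨯₃ q) ⬝ᵥ n)

/-- The derivative of the variation as a linear functional. -/
def shearVarDerivₗ (p q n : R3) {x : R3} (hx : x ≠ 0) (x' : R3) :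
    homogFun →ₗ[ℝ] ℝ where
  toFun y := shearVarDeriv p q n y.1 x x'
  map_add' y z := by
    have := fderiv_add (homogFun_differentiableAt y.2 hx) (homogFun_differentiableAt z.2 hx)
    simp only [shearVarDeriv, Submodule.coe_add, this, Pi.add_apply, _root_.add_apply]; ring
  map_smul' c y := by
    have := fderiv_const_smul (homogFun_differentiableAt y.2 hx) c
    simp only [shearVarDeriv, Submodule.coe_smul, this, Pi.smul_apply, _root_.smul_apply,
      smul_eq_mul, RingHom.id_apply]
    ring

lemma shearVarₗ_ker_ne_top {p q n x : R3} (hn : (p ⨯₃ q) ⬝ᵥ n ≠ 0) (hp : p ⨯₃ x ≠ 0)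
    (hq : q ⨯₃ x ≠ 0) : LinearMap.ker (shearVarₗ p q n x) ≠ ⊤ := by
  obtain ⟨y, hy, h1, h2, h3⟩ := exists_homogFun_ne hp hq
  refine ker_ne_top (x := ⟨y, hy⟩) ?_
  show shearVar p q n y x ≠ 0
  simp [shearVar, h1, h2, h3, hn]

lemma exists_shearVarDerivₗ_ne {p q n x x' : R3} (hn : (p ⨯₃ q) ⬝ᵥ n ≠ 0) (hx : x ≠ 0)
    (hpx : p ⨯₃ x = 0 ∨ q ⨯₃ x = 0) (hx' : x ⨯₃ x' ≠ 0) :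
    LinearMap.ker (shearVarDerivₗ p q n hx x') ≠ ⊤ := by
  have hpq : p ⨯₃ q ≠ 0 := by rintro h; simp [h] at hn
  have hp : p ≠ 0 := by rintro rfl; simp at hpq
  have hq : q ≠ 0 := by rintro rfl; simp at hpq
  have key : ∃ y ∈ homogFun, y p = 0 ∧ y q = 0 ∧ fderiv ℝ y x x' ≠ 0 := by
    rcases hpx with h | h
    · obtain ⟨c, hc, rfl⟩ := (pt_eq_iff hp hx).1 ((pt_eq_iff_cross hp hx).2 h)
      have h1 : p ⨯₃ x' ≠ 0 := by
        rintro h0; apply hx'; rw [map_smul, LinearMap.smul_apply, h0, smul_zero]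
      have h2 : q ⨯₃ p ≠ 0 := by rw [← cross_anticomm]; exact neg_ne_zero.2 hpq
      obtain ⟨y, hy, h3, h4, h5⟩ := exists_homogFun_fderiv_ne h2 h1
      exact ⟨y, hy, h3, h4, by rwa [homogFun_fderiv_smul hy hp hc]⟩
    · obtain ⟨c, hc, rfl⟩ := (pt_eq_iff hq hx).1 ((pt_eq_iff_cross hq hx).2 h)
      have h1 : q ⨯₃ x' ≠ 0 := by
        rintro h0; apply hx'; rw [map_smul, LinearMap.smul_apply, h0, smul_zero]
      obtain ⟨y, hy, h3, h4, h5⟩ := exists_homogFun_fderiv_ne hpq h1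
      exact ⟨y, hy, h4, h3, by rwa [homogFun_fderiv_smul hy hq hc]⟩
  obtain ⟨y, hy, h1, h2, h3⟩ := key
  refine ker_ne_top (x := ⟨y, hy⟩) ?_
  show shearVarDeriv p q n y x x' ≠ 0
  simp [shearVarDeriv, h1, h2, h3, hn]

lemma contDiff_comp_curve {y : R3 → ℝ} (hy : y ∈ homogFun) {γ : ℝ → R3} (hγ : ContDiff ℝ ∞ γ)
    (h0 : ∀ t, γ t ≠ 0) : ContDiff ℝ ∞ fun t => y (γ t) :=
  contDiff_iff_contDiffAt.2 fun t => ContDiffAt.comp t (hy.1 _ (h0 t)) hγ.contDiffAt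

lemma contDiff_shearVar {y : R3 → ℝ} (hy : y ∈ homogFun) {γ : ℝ → R3} (hγ : ContDiff ℝ ∞ γ)
    (h0 : ∀ t, γ t ≠ 0) (p q n : R3) : ContDiff ℝ ∞ fun t => shearVar p q n y (γ t) :=
  ((contDiff_const.mul ((contDiff_dot _).comp hγ)).add
    (contDiff_const.mul ((contDiff_dot _).comp hγ))).add
    ((contDiff_comp_curve hy hγ h0).mul contDiff_const)

lemma hasDerivAt_shearVar {y : R3 → ℝ} (hy : y ∈ homogFun) {γ : ℝ → R3} {v : R3} {t : ℝ}
    (hγ : HasDerivAt γ v t) (h0 : γ t ≠ 0) (p q n : R3) :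
    HasDerivAt (fun t => shearVar p q n y (γ t)) (shearVarDeriv p q n y (γ t) v) t :=
  (((hasDerivAt_dot _ hγ).const_mul _).add ((hasDerivAt_dot _ hγ).const_mul _)).add
    (((homogFun_differentiableAt hy h0).hasFDerivAt.comp_hasDerivAt (l := y) t hγ).mul_const _)

lemma shearVar_smul {y : R3 → ℝ} (hy : y ∈ homogFun) (p q n : R3) (c : ℝ) (x : R3) :
    shearVar p q n y (c • x) = c * shearVar p q n y x := by
  simp only [shearVar, hy.2, dotProduct_smul, smul_eq_mul]; ring

namespace HD

variable (Φ : HD)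

lemma pt_eq_iff {v w : R3} (hv : v ≠ 0) (hw : w ≠ 0) : pt (Φ v) = pt (Φ w) ↔ pt v = pt w := by
  rw [← Φ.map_pt hv, ← Φ.map_pt hw, Φ.map_bijective.1.eq_iff]

end HD

/-- The zeros of `f` are at most `N`, also after small quasi-periodic perturbations. -/
def StableZeros (f : ℝ → ℝ) (N : ℕ) : Prop :=
  ∃ η > 0, ∃ (M : ℕ) (a b : ℝ), ∀ g : ℝ → ℝ, ContDiff ℝ ∞ g →
    (∃ ς : ℝ, ς ≠ 0 ∧ ∀ x, g (x + π) = ς * g x) → CloseOn g f a b M η → ZerosLE g N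

lemma StableZeros.zerosLE {f : ℝ → ℝ} {N : ℕ} (h : StableZeros f N) (hf : ContDiff ℝ ∞ f) {ς : ℝ}
    (hς : ς ≠ 0) (h1 : ∀ x, f (x + π) = ς * f x) : ZerosLE f N := by
  obtain ⟨η, hη, M, a, b, h⟩ := h
  exact h f hf ⟨ς, hς, h1⟩ fun j _ x _ => by simpa

lemma ZerosLE.countable {f : ℝ → ℝ} {N : ℕ} (h : ZerosLE f N) : {x | f x = 0}.Countable := by
  have h1 : {x | f x = 0} ⊆ ⋃ n : ℤ, {x | x ∈ Ico (n * π) (n * π + π) ∧ f x = 0} := by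
    intro x hx
    obtain ⟨n, hn⟩ := NodalCurve.exists_int_add_mem 0 x
    refine mem_iUnion.2 ⟨-n, ⟨?_, ?_⟩, hx⟩
    · push_cast; linarith [hn.1]
    · push_cast; linarith [hn.2]
  exact (countable_iUnion fun n : ℤ => (NodalCurve.ZerosLE_finite h _).countable).mono h1

namespace NodalCurve

variable {ι κ : Type} (W : NodalCurve ι κ)

/-- The image of a nodal curve under a diffeomorphism. -/
def mapHD (Φ : HD) : NodalCurve ι κ where
  F k z := Φ (W.F k z)
  smooth k := contDiff_iff_contDiffAt.2 fun z =>
    ContDiffAt.comp z (Φ.smooth _ (W.ne_zero k z)) (W.smooth k).contDiffAt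
  imm k z := Φ.immAt_comp ((W.smooth k).differentiable (by simp) z) (W.imm k z)
  inj k l z w h := W.inj k l z w ((Φ.pt_eq_iff (W.ne_zero k z) (W.ne_zero l w)).1 h)
  γ c θ := Φ (W.γ c θ)
  γ_smooth c := contDiff_iff_contDiffAt.2 fun z =>
    ContDiffAt.comp z (Φ.smooth _ (W.γ_ne c z)) (W.γ_smooth c).contDiffAt
  period := W.period
  period_ne := W.period_ne
  γ_add_pi c θ := by rw [W.γ_add_pi, Φ.homog]
  γ_imm c θ := by
    have hne := W.γ_ne c θ
    have h1 := (Φ.differentiableAt hne).hasFDerivAt.comp_hasDerivAt (l := Φ) θ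
      ((W.γ_smooth c).differentiable (by simp) θ).hasDerivAt
    have h2 : deriv (fun θ => Φ (W.γ c θ)) θ = fderiv ℝ Φ (W.γ c θ) (deriv (W.γ c) θ) := h1.deriv
    rw [h2]
    intro h3
    have h4 : trip (W.γ c θ) (deriv (W.γ c) θ) (W.γ c θ ⨯₃ deriv (W.γ c) θ) ≠ 0 := by
      rw [trip, triple_product_permutation, triple_product_permutation]
      exact (dot_self_pos (W.γ_imm c θ)).ne'
    have h5 := Φ.trip_fderiv_ne_zero h4
    rw [trip, triple_product_permutation, triple_product_permutation, h3, dotProduct_zero] at h5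
    exact h5 rfl
  cross k z := by
    rw [← W.cross k z]
    exact exists_congr fun c => exists_congr fun θ => Φ.pt_eq_iff (W.γ_ne c θ) (W.ne_zero k z)
  γ_inj c θ c' θ' h := by
    rcases W.γ_inj c θ c' θ' ((Φ.pt_eq_iff (W.γ_ne _ _) (W.γ_ne _ _)).1 h) with h | ⟨k, h⟩
    · exact Or.inl h
    · exact Or.inr ⟨k, (Φ.pt_eq_iff (W.γ_ne _ _) (W.ne_zero _ _)).2 h⟩
  diag k := by
    obtain ⟨c, θ, h1, h2⟩ := W.diag k
    exact ⟨c, θ, (Φ.pt_eq_iff (W.γ_ne _ _) (W.ne_zero _ _)).2 h1, h2.mono fun t ⟨u, hu⟩ =>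
      ⟨u, (Φ.pt_eq_iff (W.γ_ne _ _) (W.ne_zero _ _)).2 hu⟩⟩
  antidiag k := by
    obtain ⟨c, θ, h1, h2⟩ := W.antidiag k
    exact ⟨c, θ, (Φ.pt_eq_iff (W.γ_ne _ _) (W.ne_zero _ _)).2 h1, h2.mono fun t ⟨u, hu⟩ =>
      ⟨u, (Φ.pt_eq_iff (W.γ_ne _ _) (W.ne_zero _ _)).2 hu⟩⟩

lemma smoothed_mapHD (Φ : HD) (G : ι → ℝ → ℝ) :
    (W.mapHD Φ).smoothed G = (W.smoothed G).map Φ.map := by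
  have hp : (W.mapHD Φ).points = Φ.map '' W.points := by
    ext x
    constructor
    · rintro ⟨c, θ, rfl⟩
      exact ⟨_, ⟨c, θ, rfl⟩, Φ.map_pt (W.γ_ne c θ)⟩
    · rintro ⟨_, ⟨c, θ, rfl⟩, rfl⟩
      exact ⟨c, θ, (Φ.map_pt (W.γ_ne c θ)).symm⟩
  have hF : ∀ k, (fun z => pt ((W.mapHD Φ).F k z)) = Φ.map ∘ fun z => pt (W.F k z) := fun k =>
    funext fun z => (Φ.map_pt (W.ne_zero k z)).symm
  simp only [smoothed, Diagram.map, hF, hp, image_union, image_sdiff Φ.map_bijective.1,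
    image_iUnion, range_comp, image_comp]

/-- Pairs of points that span different lines which meet the curve in at most five points. -/
structure PairPosition [Fintype κ] {J : Type} (P : J → Bool → R3) : Prop where
  ne : ∀ i, P i false ⨯₃ P i true ≠ 0
  distinct : ∀ i j, i ≠ j → ∃ b, ∀ b', pt (P j b) ≠ pt (P i b')
  crossings : ∀ i, ∃ N : κ → ℕ, ∑ c, N c ≤ 5 ∧
    ∀ c, StableZeros (fun θ => (P i false ⨯₃ P i true) ⬝ᵥ W.γ c θ) (N c)
  lift : ∀ i b k, pt (P i b) = pt (W.F k 0) → P i b = W.F k 0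

variable {W} in
set_option maxHeartbeats 1000000 in
/-- A small shear puts lines into general position. -/
lemma PairPosition.exists_linePosition [Finite ι] [Fintype κ] {J : Type} [Finite J]
    {P : J → Bool → R3} (h : W.PairPosition P) :
    ∃ Φ : HD, (W.mapHD Φ).LinePosition (fun i b => Φ (P i b)) ∧
      ∀ i k, k ∈ W.steepOn (P i false ⨯₃ P i true) → (∃ b, P i b = W.F k 0) →
        k ∈ (W.mapHD Φ).steepOn (Φ (P i false) ⨯₃ Φ (P i true)) := by
  classical
  set a : J → R3 := fun i => P i false ⨯₃ P i true with ha
  have hP0 : ∀ i b, P i b ≠ 0 := fun i b h0 => by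
    apply h.ne i
    cases b <;> simp [h0]
  choose N hN hst using h.crossings
  have hfs : ∀ i c, ContDiff ℝ ∞ fun θ => a i ⬝ᵥ W.γ c θ := fun i c =>
    (contDiff_dot (a i)).comp (W.γ_smooth c)
  have hfp : ∀ i c θ, a i ⬝ᵥ W.γ c (θ + π) = W.period c * (a i ⬝ᵥ W.γ c θ) := fun i c θ => by
    rw [W.γ_add_pi, dotProduct_smul, smul_eq_mul]
  have hfz : ∀ i c, ZerosLE (fun θ => a i ⬝ᵥ W.γ c θ) (N i c) := fun i c =>
    (hst i c).zerosLE (hfs i c) (W.period_ne c) (hfp i c)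
  have hfd : ∀ i c θ, deriv (fun θ => a i ⬝ᵥ W.γ c θ) θ = a i ⬝ᵥ deriv (W.γ c) θ := fun i c θ =>
    (hasDerivAt_dot _ ((W.γ_smooth c).differentiable (by simp) θ).hasDerivAt).deriv
  -- the direction of the shear
  obtain ⟨n, hn⟩ : ∃ n : R3, ∀ i, a i ⬝ᵥ n ≠ 0 := by
    obtain ⟨n, hn⟩ := exists_notMem_of_ne_top
      (S := range fun i => LinearMap.ker (dotProductBilin ℝ ℝ (a i))) (finite_range _) (by
        rintro _ ⟨i, rfl⟩
        exact ker_ne_top (x := a i) (dot_self_pos (h.ne i)).ne')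
    exact ⟨n, fun i h0 => hn _ (mem_range_self i) (LinearMap.mem_ker.2 h0)⟩
  -- the generic function
  set S₁ : Set (Submodule ℝ homogFun) := ⋃ i, ⋃ c,
    (fun θ => LinearMap.ker (shearVarₗ (P i false) (P i true) n (W.γ c θ)) ⊓
      LinearMap.ker (shearVarDerivₗ (P i false) (P i true) n (W.γ_ne c θ) (deriv (W.γ c) θ))) ''
      {θ | θ ∈ Ico 0 (0 + π) ∧ a i ⬝ᵥ W.γ c θ = 0} with hS₁
  set S₂ : Set (Submodule ℝ homogFun) :=
    (fun p : J × ι => LinearMap.ker (shearVarₗ (P p.1 false) (P p.1 true) n (W.F p.2 0))) ''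
      {p | ∀ b, pt (P p.1 b) ≠ pt (W.F p.2 0)} with hS₂
  set S₃ : Set (Submodule ℝ homogFun) := (fun p : J × J × Bool =>
      LinearMap.ker (shearVarₗ (P p.1 false) (P p.1 true) n (P p.2.1 p.2.2))) ''
      {p | ∀ b, pt (P p.2.1 p.2.2) ≠ pt (P p.1 b)} with hS₃
  have hcr : ∀ i b x, x ≠ 0 → pt (P i b) ≠ pt x → P i b ⨯₃ x ≠ 0 := fun i b x hx hne h0 =>
    hne ((pt_eq_iff_cross (hP0 i b) hx).2 h0)
  obtain ⟨⟨y, hy⟩, hyS⟩ : ∃ y : homogFun, ∀ p ∈ S₁ ∪ S₂ ∪ S₃, y ∉ p := by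
    refine exists_notMem_of_ne_top (((finite_iUnion fun i => finite_iUnion fun c =>
      (ZerosLE_finite (hfz i c) 0).image _).union ((Set.toFinite _).image _)).union
      ((Set.toFinite _).image _)) ?_
    rintro p ((hp | ⟨⟨i, k⟩, hik, rfl⟩) | ⟨⟨i, j, b⟩, hij, rfl⟩)
    · obtain ⟨i, hp⟩ := mem_iUnion.1 hp
      obtain ⟨c, θ, ⟨-, hθ⟩, rfl⟩ := mem_iUnion.1 hp
      by_cases hpq : P i false ⨯₃ W.γ c θ = 0 ∨ P i true ⨯₃ W.γ c θ = 0
      · have := exists_shearVarDerivₗ_ne (hn i) (W.γ_ne c θ) hpq (W.γ_imm c θ)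
        exact fun ht => this (top_unique (ht ▸ inf_le_right))
      · push Not at hpq
        have := shearVarₗ_ker_ne_top (hn i) hpq.1 hpq.2
        exact fun ht => this (top_unique (ht ▸ inf_le_left))
    · exact shearVarₗ_ker_ne_top (hn i) (hcr i false _ (W.ne_zero k 0) (hik false))
        (hcr i true _ (W.ne_zero k 0) (hik true))
    · exact shearVarₗ_ker_ne_top (hn i) (hcr i false _ (hP0 j b) (hij false).symm)
        (hcr i true _ (hP0 j b) (hij true).symm)
  set H : J → R3 → ℝ := fun i => shearVar (P i false) (P i true) n y with hH
  have hHs : ∀ i c, ContDiff ℝ ∞ fun θ => H i (W.γ c θ) := fun i c =>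
    contDiff_shearVar hy (W.γ_smooth c) (W.γ_ne c) _ _ _
  have hHd : ∀ i c θ, HasDerivAt (fun θ => H i (W.γ c θ))
      (shearVarDeriv (P i false) (P i true) n y (W.γ c θ) (deriv (W.γ c) θ)) θ := fun i c θ =>
    hasDerivAt_shearVar hy ((W.γ_smooth c).differentiable (by simp) θ).hasDerivAt (W.γ_ne c θ) _ _ _
  have hHtan : ∀ i c θ, a i ⬝ᵥ W.γ c θ = 0 →
      H i (W.γ c θ) ≠ 0 ∨ deriv (fun θ => H i (W.γ c θ)) θ ≠ 0 := by
    intro i c θ hθ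
    obtain ⟨m, hm⟩ := exists_int_add_mem 0 θ
    have h0 : a i ⬝ᵥ W.γ c (θ + m * π) = 0 := by rw [W.γ_add_int, dotProduct_smul, hθ, smul_zero]
    have h1 := hyS _ (Or.inl (Or.inl (mem_iUnion.2 ⟨i, mem_iUnion.2 ⟨c, _, ⟨hm, h0⟩, rfl⟩⟩)))
    by_contra! h2
    apply h1
    have e : (fun θ => H i (W.γ c (θ + m * π))) = fun θ => W.period c ^ m * H i (W.γ c θ) :=
      funext fun θ => by rw [W.γ_add_int]; exact shearVar_smul hy _ _ _ _ _
    refine ⟨LinearMap.mem_ker.2 ?_, LinearMap.mem_ker.2 ?_⟩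
    · have := congrFun e θ
      simp only [h2.1, mul_zero] at this
      exact this
    · have h3 := (hHd i c (θ + m * π)).comp_add_const θ (m * π)
      rw [e] at h3
      have h4 := h3.unique ((hHd i c θ).const_mul _)
      rw [← (hHd i c θ).deriv, h2.2, mul_zero] at h4
      exact h4
  -- conditions on the size of the shear
  have hae : ∀ᵐ s : ℝ, ∀ i c θ, a i ⬝ᵥ W.γ c θ + s * H i (W.γ c θ) = 0 →
      deriv (fun θ => a i ⬝ᵥ W.γ c θ) θ + s * deriv (fun θ => H i (W.γ c θ)) θ ≠ 0 := by
    have := Finite.to_countable (α := J)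
    refine MeasureTheory.ae_all_iff.2 fun i => MeasureTheory.ae_all_iff.2 fun c => ?_
    exact ae_simple_zeros (hfs i c) (hHs i c) (hfz i c).countable fun θ hθ _ => hHtan i c θ hθ
  have hclose : ∀ᶠ s : ℝ in 𝓝 0, ∀ i c, ZerosLE (fun θ => a i ⬝ᵥ W.γ c θ + s * H i (W.γ c θ)) (N i c) := by
    refine eventually_all.2 fun i => eventually_all.2 fun c => ?_
    obtain ⟨η, hη, M, u, v, hs⟩ := hst i c
    have h1 := eventually_closeOn (g := ![fun θ => a i ⬝ᵥ W.γ c θ, fun θ => H i (W.γ c θ)])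
      (fun j => by fin_cases j; exacts [hfs i c, hHs i c]) ![1, 0] u v M hη
    have h2 : Tendsto (fun s : ℝ => ![1, s]) (𝓝 0) (𝓝 ![1, 0]) := by
      have : Continuous fun s : ℝ => ![1, s] := by fun_prop
      exact this.tendsto 0
    filter_upwards [h2.eventually h1] with s h3
    simp only [Fin.sum_univ_two, Matrix.cons_val_zero, Matrix.cons_val_one, one_mul, zero_mul,
      add_zero] at h3
    refine hs _ ((hfs i c).add (contDiff_const.mul (hHs i c))) ⟨W.period c, W.period_ne c, fun θ => ?_⟩ h3
    have := shearVar_smul hy (P i false) (P i true) n (W.period c) (W.γ c θ)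
    rw [hfp, W.γ_add_pi]
    simp only [hH, this]; ring
  set g : ℝ → R3 → R3 := fun s v => v + (s * y v) • n with hg
  have hgc : ∀ v, Continuous fun s => g s v := fun v => by simp only [hg]; fun_prop
  have hg0 : ∀ v, g 0 v = v := fun v => by simp [hg]
  set A : ℝ → J → R3 := fun s i => g s (P i false) ⨯₃ g s (P i true) with hA
  have hAc : ∀ i, Continuous fun s => A s i := fun i => continuous_cross (hgc _) (hgc _)
  have hA0 : ∀ i, A 0 i = a i := fun i => by simp [hA, hg0, ha]
  have hdot : ∀ s i x, A s i ⬝ᵥ g s x = a i ⬝ᵥ x + s * H i x := fun s i x =>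
    cross_dot_shear _ _ _ _ _ _
  have hcc : ∀ {f : ℝ → R3} {g : ℝ → R3}, Continuous f → Continuous g →
      Continuous fun s => f s ⬝ᵥ g s := fun hf hg => by
    simp only [dotProduct]
    exact continuous_finsetSum _ fun i _ =>
      ((continuous_apply i).comp hf).mul ((continuous_apply i).comp hg)
  have hne : ∀ᶠ s in 𝓝 0, ∀ i, A s i ≠ 0 := eventually_all.2 fun i =>
    (hAc i).continuousAt.eventually_ne (by rw [hA0]; exact h.ne i)
  have hnode : ∀ᶠ s in 𝓝 0, ∀ i k, a i ⬝ᵥ W.F k 0 ≠ 0 → A s i ⬝ᵥ g s (W.F k 0) ≠ 0 := by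
    refine eventually_all.2 fun i => eventually_all.2 fun k => ?_
    by_cases h0 : a i ⬝ᵥ W.F k 0 ≠ 0
    · have := (hcc (hAc i) (hgc (W.F k 0))).continuousAt.eventually_ne (x := 0)
        (by rw [hA0, hg0]; exact h0)
      exact this.mono fun s hs _ => hs
    · exact .of_forall fun s h1 => absurd h1 h0
  have hind : ∀ᶠ s in 𝓝 0, ∀ i j, a i ⨯₃ a j ≠ 0 → A s i ⨯₃ A s j ≠ 0 := by
    refine eventually_all.2 fun i => eventually_all.2 fun j => ?_
    by_cases h0 : a i ⨯₃ a j ≠ 0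
    · have := (continuous_cross (hAc i) (hAc j)).continuousAt.eventually_ne (x := 0)
        (by rw [hA0, hA0]; exact h0)
      exact this.mono fun s hs _ => hs
    · exact .of_forall fun s h1 => absurd h1 h0
  set dF : ℝ → ι → ℝ × ℝ → R3 := fun s k z =>
    fderiv ℝ (W.F k) 0 z + (s * fderiv ℝ y (W.F k 0) (fderiv ℝ (W.F k) 0 z)) • n with hdF
  have hdFc : ∀ k z, Continuous fun s => dF s k z := fun k z => by simp only [hdF]; fun_prop
  have hsteep : ∀ᶠ s in 𝓝 0, ∀ i k, |W.slopeW (a i) k| < |W.slopeU (a i) k| →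
      |A s i ⬝ᵥ dF s k (0, 1)| < |A s i ⬝ᵥ dF s k (1, 0)| := by
    refine eventually_all.2 fun i => eventually_all.2 fun k => ?_
    by_cases h0 : |W.slopeW (a i) k| < |W.slopeU (a i) k|
    · have h1 := (hcc (hAc i) (hdFc k (0, 1))).abs.continuousAt (x := 0)
      have h2 := (hcc (hAc i) (hdFc k (1, 0))).abs.continuousAt (x := 0)
      have h3 := ContinuousAt.eventually_lt h1 h2 (by
        simp only [hA0, hdF, zero_mul, zero_smul, add_zero]; exact h0)
      exact h3.mono fun s hs _ => hs
    · exact .of_forall fun s h1 => absurd h1 h0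
  -- choice of the shear
  have hall := ((((hclose.and hne).and hnode).and hind).and hsteep).and (eventually_exists_shear hy n)
  obtain ⟨ρ, hρ, hball⟩ := Metric.eventually_nhds_iff.1 hall
  obtain ⟨s, ⟨hs0, hsρ⟩, hsae⟩ : ∃ s ∈ Ioo 0 ρ, ∀ i c θ, a i ⬝ᵥ W.γ c θ + s * H i (W.γ c θ) = 0 →
      deriv (fun θ => a i ⬝ᵥ W.γ c θ) θ + s * deriv (fun θ => H i (W.γ c θ)) θ ≠ 0 := by
    by_contra! hcon
    have h1 : Ioo 0 ρ ⊆ {s | ¬ ∀ i c θ, a i ⬝ᵥ W.γ c θ + s * H i (W.γ c θ) = 0 →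
      deriv (fun θ => a i ⬝ᵥ W.γ c θ) θ + s * deriv (fun θ => H i (W.γ c θ)) θ ≠ 0} := by
      intro s hs hs2
      obtain ⟨i, c, θ, h3, h4⟩ := hcon s hs
      exact hs2 i c θ h3 h4
    have h2 := MeasureTheory.measure_mono_null h1 hae
    rw [Real.volume_Ioo, sub_zero, ENNReal.ofReal_eq_zero] at h2
    linarith
  obtain ⟨⟨⟨⟨⟨hclose, hne⟩, hnode⟩, hind⟩, hsteep⟩, Φ, hΦ⟩ := hball (y := s) (by
    rw [Real.dist_eq, sub_zero, abs_of_pos hs0]; exact hsρ)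
  have hΦg : ∀ v, Φ v = g s v := hΦ
  have hΦA : ∀ i, Φ (P i false) ⨯₃ Φ (P i true) = A s i := fun i => by rw [hΦg, hΦg]
  have hdotΦ : ∀ i x, A s i ⬝ᵥ Φ x = a i ⬝ᵥ x + s * H i x := fun i x => by rw [hΦg]; exact hdot s i x
  have hdotγ : ∀ i c, (fun θ => A s i ⬝ᵥ Φ (W.γ c θ)) =
      fun θ => a i ⬝ᵥ W.γ c θ + s * H i (W.γ c θ) := fun i c => funext fun θ => hdotΦ i _
  have hforced : ∀ i k, A s i ⬝ᵥ Φ (W.F k 0) = 0 → ∃ b, pt (P i b) = pt (W.F k 0) := by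
    intro i k h0
    by_contra! h1
    have h2 := hyS _ (Or.inl (Or.inr ⟨(i, k), h1, rfl⟩))
    by_cases h3 : a i ⬝ᵥ W.F k 0 = 0
    · rw [hdotΦ, h3, zero_add] at h0
      exact h2 (LinearMap.mem_ker.2 ((mul_eq_zero.1 h0).resolve_left hs0.ne'))
    · exact hnode i k h3 (by rw [← hΦg]; exact h0)
  refine ⟨Φ, ⟨fun i => ?_, fun i c θ h0 => ?_, fun i => ?_, fun i j hij => ?_, fun i k h0 => ?_,
    fun i b k h0 => ?_⟩, fun i k hk ⟨b, hb⟩ => ?_⟩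
  · rw [hΦA]; exact hne i
  · simp only [hΦA] at h0 ⊢
    have h0' : a i ⬝ᵥ W.γ c θ + s * H i (W.γ c θ) = 0 := by rw [← hdotΦ]; exact h0
    have h1 := hsae i c θ h0'
    have h2 : HasDerivAt (fun θ => A s i ⬝ᵥ Φ (W.γ c θ)) (A s i ⬝ᵥ deriv ((W.mapHD Φ).γ c) θ) θ :=
      hasDerivAt_dot (γ := (W.mapHD Φ).γ c) _
        (((W.mapHD Φ).γ_smooth c).differentiable (by simp) θ).hasDerivAt
    rw [hdotγ] at h2
    have h3 := ((hfs i c).differentiable (by simp) θ).hasDerivAt.fun_add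
      ((((hHs i c).differentiable (by simp) θ).hasDerivAt).const_mul s)
    rw [h2.unique h3]
    exact h1
  · refine ⟨N i, hN i, fun c => ?_⟩
    simp only [hΦA]
    show ZerosLE (fun θ => A s i ⬝ᵥ Φ (W.γ c θ)) _
    rw [hdotγ]
    exact hclose i c
  · simp only [hΦA]
    by_cases h0 : a i ⨯₃ a j ≠ 0
    · exact hind i j h0
    · intro h1
      obtain ⟨b, hb⟩ := h.distinct i j hij
      have h2 := hyS _ (Or.inr ⟨(i, j, b), hb, rfl⟩)
      have h3 : ∀ x, a j ⬝ᵥ x = 0 → a i ⬝ᵥ x = 0 := by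
        intro x hx
        obtain ⟨c, -, hc⟩ := (pt_eq_iff (h.ne j) (h.ne i)).1
          ((pt_eq_iff_cross (h.ne j) (h.ne i)).2 (by
            rw [← cross_anticomm]; exact neg_eq_zero.2 (not_not.1 h0)))
        simp only [ha] at hx ⊢
        rw [hc, smul_dotProduct, hx, smul_zero]
      have h4 : A s j ⬝ᵥ Φ (P j b) = 0 := by
        rw [← hΦA]
        cases b
        · exact dot_cross_left _ _
        · exact dot_cross_right _ _
      have h5 : A s i ⬝ᵥ Φ (P j b) = 0 := by
        obtain ⟨c, -, hc⟩ := (pt_eq_iff (hne j) (hne i)).1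
          ((pt_eq_iff_cross (hne j) (hne i)).2 (by rw [← cross_anticomm]; exact neg_eq_zero.2 h1))
        rw [hc, smul_dotProduct, h4, smul_zero]
      have h6 : a i ⬝ᵥ P j b = 0 := by
        apply h3
        cases b
        · exact dot_cross_left _ _
        · exact dot_cross_right _ _
      rw [hdotΦ, h6, zero_add] at h5
      exact h2 (LinearMap.mem_ker.2 ((mul_eq_zero.1 h5).resolve_left hs0.ne'))
  · simp only [hΦA] at h0
    obtain ⟨b, hb⟩ := hforced i k h0
    exact ⟨b, (Φ.pt_eq_iff (hP0 i b) (W.ne_zero k 0)).2 hb⟩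
  · exact congrArg Φ (h.lift i b k ((Φ.pt_eq_iff (hP0 i b) (W.ne_zero k 0)).1 h0))
  · rw [hΦA]
    have h1 : A s i ⬝ᵥ Φ (W.F k 0) = 0 := by
      rw [← hΦA, ← hb]
      cases b
      · exact dot_cross_left _ _
      · exact dot_cross_right _ _
    have h2 : HasFDerivAt (fun z => Φ (W.F k z)) (fderiv ℝ (W.F k) 0 +
        (s • (fderiv ℝ y (W.F k 0)).comp (fderiv ℝ (W.F k) 0)).smulRight n) 0 := by
      have h3 := ((W.smooth k).differentiable (by simp) 0).hasFDerivAt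
      have h4 := (homogFun_differentiableAt hy (W.ne_zero k 0)).hasFDerivAt.comp 0 h3
      simp only [hΦ]
      exact h3.add ((h4.const_mul s).smul_const n)
    have h3 : ∀ z, fderiv ℝ (fun z => Φ (W.F k z)) 0 z = dF s k z := fun z => by rw [h2.fderiv]; rfl
    refine ⟨h1, ?_⟩
    show |A s i ⬝ᵥ fderiv ℝ (fun z => Φ (W.F k z)) 0 (0, 1)| <
      |A s i ⬝ᵥ fderiv ℝ (fun z => Φ (W.F k z)) 0 (1, 0)|
    rw [h3, h3]
    exact hsteep i k hk.2

end NodalCurve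

/-! ### Squeezing the strip around a node -/

/-- A monotone function that vanishes on `[-M, M]` and is the identity near infinity. -/
def deadZone (M w : ℝ) : ℝ := w * smoothTransition (w ^ 2 / M ^ 2 - 1)

lemma contDiff_deadZone (M : ℝ) : ContDiff ℝ ∞ (deadZone M) :=
  contDiff_id.mul (Real.smoothTransition.contDiff.comp (((contDiff_id.pow 2).div_const _).sub
    contDiff_const))

lemma deadZone_neg (M w : ℝ) : deadZone M (-w) = -deadZone M w := by simp [deadZone]

lemma deadZone_monotone (M : ℝ) : Monotone (deadZone M) := by
  refine monotone_of_odd_of_monotoneOn_nonneg (deadZone_neg M) fun v hv w hw hvw => ?_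
  refine mul_le_mul hvw (Real.smoothTransition.monotone ?_) (Real.smoothTransition.nonneg _) hw
  gcongr

lemma deadZone_of_le {M w : ℝ} (hM : 0 < M) (h : |w| ≤ M) : deadZone M w = 0 := by
  rw [deadZone, Real.smoothTransition.zero_of_nonpos, mul_zero]
  rw [sub_nonpos, div_le_one (by positivity)]
  exact sq_le_sq.2 (by rwa [abs_of_pos hM])

lemma deadZone_eq_zero_iff {M w : ℝ} (hM : 0 < M) : deadZone M w = 0 ↔ |w| ≤ M := by
  refine ⟨fun h => ?_, deadZone_of_le hM⟩
  rcases mul_eq_zero.1 h with rfl | h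
  · simpa using hM.le
  · rw [Real.smoothTransition.zero_iff_nonpos, sub_nonpos, div_le_one (by positivity)] at h
    simpa [abs_of_pos hM] using sq_le_sq.1 h

lemma deadZone_of_ge {M w : ℝ} (hM : 0 < M) (h : 2 * M ≤ |w|) : deadZone M w = w := by
  rw [deadZone, Real.smoothTransition.one_of_one_le, mul_one]
  rw [le_sub_iff_add_le, le_div_iff₀ (by positivity), ← sq_abs w]
  nlinarith

lemma deadZone_inj {M v w : ℝ} (hM : 0 < M) (h : deadZone M v = deadZone M w) :
    v = w ∨ |v| ≤ M ∧ |w| ≤ M := by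
  by_cases h0 : deadZone M v = 0
  · exact Or.inr ⟨(deadZone_eq_zero_iff hM).1 h0, (deadZone_eq_zero_iff hM).1 (h ▸ h0)⟩
  left
  have key : ∀ v w : ℝ, deadZone M v = deadZone M w → 0 < deadZone M v → v ≤ w := by
    intro v w h h0
    by_contra! hlt
    have hw0 : 0 < deadZone M w := h ▸ h0
    have hw : 0 < w := by
      by_contra! hw
      have : deadZone M w ≤ 0 := mul_nonpos_of_nonpos_of_nonneg hw (Real.smoothTransition.nonneg _)
      linarith
    have h1 : 0 < smoothTransition (w ^ 2 / M ^ 2 - 1) := (mul_pos_iff_of_pos_left hw).1 hw0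
    have h2 : smoothTransition (w ^ 2 / M ^ 2 - 1) ≤ smoothTransition (v ^ 2 / M ^ 2 - 1) :=
      Real.smoothTransition.monotone (by gcongr)
    unfold deadZone at h
    nlinarith
  rcases lt_or_gt_of_ne h0 with h1 | h1
  · have e : deadZone M (-v) = deadZone M (-w) := by rw [deadZone_neg, deadZone_neg, h]
    have h2 : 0 < deadZone M (-v) := by rw [deadZone_neg]; linarith
    linarith [key _ _ e h2, key _ _ e.symm (e ▸ h2)]
  · exact le_antisymm (key _ _ h h1) (key _ _ h.symm (h ▸ h1))

/-- A function that is linear with slope `b` on `[-M, M]` and the identity near infinity. -/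
def squeeze (M b w : ℝ) : ℝ := b * w + (1 - b) * deadZone M w

section squeeze

variable {M b : ℝ}

lemma squeeze_neg (w : ℝ) : squeeze M b (-w) = -squeeze M b w := by
  simp only [squeeze, deadZone_neg]; ring

lemma squeeze_strictMono (hb : 0 < b) (hb1 : b ≤ 1) : StrictMono (squeeze M b) := fun v w hvw => by
  have h1 := mul_lt_mul_of_pos_left hvw hb
  have h2 := mul_le_mul_of_nonneg_left (deadZone_monotone M hvw.le) (sub_nonneg.2 hb1)
  simp only [squeeze]; linarith

lemma squeeze_of_le (hM : 0 < M) {w : ℝ} (h : |w| ≤ M) : squeeze M b w = b * w := by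
  simp [squeeze, deadZone_of_le hM h]

lemma squeeze_of_ge (hM : 0 < M) {w : ℝ} (h : 2 * M ≤ |w|) : squeeze M b w = w := by
  simp only [squeeze, deadZone_of_ge hM h]; ring

lemma squeeze_one (w : ℝ) : squeeze M 1 w = w := by simp [squeeze]

lemma abs_squeeze_le_iff (hM : 0 < M) (hb : 0 < b) (hb1 : b ≤ 1) {w : ℝ} :
    |squeeze M b w| ≤ b * M ↔ |w| ≤ M := by
  have h1 : squeeze M b M = b * M := squeeze_of_le hM (abs_of_pos hM).le
  rw [abs_le, abs_le, ← h1, ← squeeze_neg, (squeeze_strictMono hb hb1).le_iff_le,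
    (squeeze_strictMono hb hb1).le_iff_le]

lemma abs_squeeze_eq_iff (hM : 0 < M) (hb : 0 < b) (hb1 : b ≤ 1) {w : ℝ} :
    |squeeze M b w| = b * M ↔ |w| = M := by
  have h1 : squeeze M b M = b * M := squeeze_of_le hM (abs_of_pos hM).le
  rw [abs_eq (by positivity), abs_eq hM.le, ← h1, ← squeeze_neg,
    (squeeze_strictMono hb hb1).injective.eq_iff, (squeeze_strictMono hb hb1).injective.eq_iff]

lemma contDiff_squeeze : ContDiff ℝ ∞ (squeeze M b) :=
  (contDiff_const.mul contDiff_id).add (contDiff_const.mul (contDiff_deadZone M))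

lemma squeeze_surjective (hM : 0 < M) : Function.Surjective (squeeze M b) := by
  refine contDiff_squeeze.continuous.surjective ?_ ?_
  · refine tendsto_id.congr' ?_
    filter_upwards [eventually_ge_atTop (2 * M)] with w hw
    exact (squeeze_of_ge (w := w) hM (hw.trans (le_abs_self w))).symm
  · refine tendsto_id.congr' ?_
    filter_upwards [eventually_le_atBot (-(2 * M))] with w hw
    exact (squeeze_of_ge (w := w) hM (by have := neg_le_abs w; linarith)).symm

lemma deriv_squeeze_pos (hb : 0 < b) (hb1 : b ≤ 1) (w : ℝ) : 0 < deriv (squeeze M b) w := by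
  have h1 := ((hasDerivAt_id w).const_mul b).fun_add
    (((contDiff_deadZone M).differentiable (by simp) w).hasDerivAt.const_mul (1 - b))
  have h2 : deriv (squeeze M b) w = b * 1 + (1 - b) * deriv (deadZone M) w := h1.deriv
  have h3 : 0 ≤ deriv (deadZone M) w := (deadZone_monotone M).deriv_nonneg
  rw [h2]
  have := mul_nonneg (sub_nonneg.2 hb1) h3
  linarith

end squeeze

/-- Fiberwise squeezing of the plane. -/
def squeezeMap (M : ℝ) (β : ℝ → ℝ) (z : ℝ × ℝ) : ℝ × ℝ := (z.1, squeeze M (β z.1) z.2)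

section squeezeMap

variable {M : ℝ} {β : ℝ → ℝ}

lemma contDiff_squeezeMap (hβ : ContDiff ℝ ∞ β) : ContDiff ℝ ∞ (squeezeMap M β) :=
  contDiff_fst.prodMk (((hβ.comp contDiff_fst).mul contDiff_snd).add
    ((contDiff_const.sub (hβ.comp contDiff_fst)).mul ((contDiff_deadZone M).comp contDiff_snd)))

lemma squeezeMap_injective (h0 : ∀ u, 0 < β u) (h1 : ∀ u, β u ≤ 1) :
    Function.Injective (squeezeMap M β) := by
  rintro ⟨u, v⟩ ⟨u', v'⟩ h
  simp only [squeezeMap, Prod.mk.injEq] at h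
  obtain ⟨rfl, h⟩ := h
  rw [(squeeze_strictMono (h0 u) (h1 u)).injective h]

lemma squeezeMap_surjective (hM : 0 < M) : Function.Surjective (squeezeMap M β) := by
  rintro ⟨u, w⟩
  obtain ⟨w', rfl⟩ := squeeze_surjective hM (b := β u) w
  exact ⟨(u, w'), rfl⟩

/-- The inverse of a squeezing of the plane. -/
def unsqueezeMap (M : ℝ) (β : ℝ → ℝ) : ℝ × ℝ → ℝ × ℝ :=
  Function.invFun (squeezeMap M β)

lemma unsqueezeMap_squeezeMap (h0 : ∀ u, 0 < β u) (h1 : ∀ u, β u ≤ 1) (z : ℝ × ℝ) :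
    unsqueezeMap M β (squeezeMap M β z) = z :=
  Function.leftInverse_invFun (squeezeMap_injective h0 h1) z

lemma squeezeMap_unsqueezeMap (hM : 0 < M) (z : ℝ × ℝ) : squeezeMap M β (unsqueezeMap M β z) = z :=
  Function.rightInverse_invFun (squeezeMap_surjective hM) z

lemma unsqueezeMap_fst (hM : 0 < M) (z : ℝ × ℝ) : (unsqueezeMap M β z).1 = z.1 := by
  conv_rhs => rw [← squeezeMap_unsqueezeMap hM (β := β) z]
  rfl

lemma contDiff_unsqueezeMap (hM : 0 < M) (hβ : ContDiff ℝ ∞ β) (h0 : ∀ u, 0 < β u)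
    (h1 : ∀ u, β u ≤ 1) : ContDiff ℝ ∞ (unsqueezeMap M β) := by
  refine contDiff_iff_contDiffAt.2 fun y => ?_
  obtain ⟨z, rfl⟩ := squeezeMap_surjective hM (β := β) y
  have hs := contDiff_squeezeMap (M := M) hβ
  refine contDiffAt_of_leftInverse hs.contDiffAt (fun h hh => ?_) rfl
    (.of_forall (unsqueezeMap_squeezeMap h0 h1))
  have hd := (hs.differentiable (by simp) z).hasFDerivAt
  have e1 : h.1 = 0 := by
    have h2 := (hasFDerivAt_fst (𝕜 := ℝ) (E := ℝ) (F := ℝ) (p := squeezeMap M β z)).comp z hd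
    have h3 := h2.unique (hasFDerivAt_fst (𝕜 := ℝ) (E := ℝ) (F := ℝ) (p := z))
    have h4 := congrArg (fun A => A h) h3
    simp only [ContinuousLinearMap.comp_apply, hh] at h4
    exact h4.symm
  have e2 : h = h.2 • ((0 : ℝ), (1 : ℝ)) := by ext <;> simp [e1]
  have h5 : HasDerivAt (fun w => squeezeMap M β (z.1, w)) (fderiv ℝ (squeezeMap M β) z (0, 1)) z.2 :=
    HasFDerivAt.comp_hasDerivAt (l := squeezeMap M β) z.2 (by exact hd)
      ((hasDerivAt_const z.2 z.1).prodMk (hasDerivAt_id z.2))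
  have h6 : HasDerivAt (squeeze M (β z.1)) (fderiv ℝ (squeezeMap M β) z (0, 1)).2 z.2 := by
    have := (hasFDerivAt_snd (𝕜 := ℝ) (E := ℝ) (F := ℝ)
      (p := squeezeMap M β (z.1, z.2))).comp_hasDerivAt z.2 h5
    exact this
  have h7 := deriv_squeeze_pos (M := M) (h0 z.1) (h1 z.1) z.2
  rw [h6.deriv] at h7
  rw [e2, map_smul] at hh
  have h8 := congrArg Prod.snd hh
  simp only [Prod.smul_snd, smul_eq_mul, Prod.snd_zero, mul_eq_zero] at h8
  rw [e2, h8.resolve_right h7.ne', zero_smul]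

end squeezeMap

/-- The factor by which a strip has to be squeezed, cut off away from the origin. -/
def squeezeFactor (M : ℝ) (h : ℝ → ℝ) (u : ℝ) : ℝ :=
  (1 - smoothTransition ((u ^ 2 - 1) / 3)) * (h u / M) + smoothTransition ((u ^ 2 - 1) / 3)

section squeezeFactor

variable {M : ℝ} {h : ℝ → ℝ}

lemma contDiff_squeezeFactor (hh : ContDiff ℝ ∞ h) : ContDiff ℝ ∞ (squeezeFactor M h) := by
  have h1 : ContDiff ℝ ∞ fun u : ℝ => smoothTransition ((u ^ 2 - 1) / 3) :=
    Real.smoothTransition.contDiff.comp (by fun_prop)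
  exact ((contDiff_const.sub h1).mul (hh.div_const M)).add h1

lemma squeezeFactor_of_le {u : ℝ} (hu : |u| ≤ 1) : squeezeFactor M h u = h u / M := by
  have : u ^ 2 ≤ 1 := by rw [← sq_abs]; nlinarith [abs_nonneg u]
  rw [squeezeFactor, Real.smoothTransition.zero_of_nonpos (by linarith)]; ring

lemma squeezeFactor_of_ge {u : ℝ} (hu : 2 ≤ |u|) : squeezeFactor M h u = 1 := by
  have : 4 ≤ u ^ 2 := by rw [← sq_abs]; nlinarith [abs_nonneg u]
  rw [squeezeFactor, Real.smoothTransition.one_of_one_le (by linarith)]; ring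

lemma squeezeFactor_pos (hM : 0 < M) {u : ℝ} (hu : 0 < h u) : 0 < squeezeFactor M h u := by
  unfold squeezeFactor
  set χ := smoothTransition ((u ^ 2 - 1) / 3)
  have h1 : χ ≤ 1 := Real.smoothTransition.le_one _
  have h2 : 0 ≤ χ := Real.smoothTransition.nonneg _
  have h3 : 0 < h u / M := div_pos hu hM
  rcases eq_or_lt_of_le h2 with h4 | h4
  · rw [← h4]; simpa
  · exact add_pos_of_nonneg_of_pos (mul_nonneg (sub_nonneg.2 h1) h3.le) h4

lemma squeezeFactor_le_one (hM : 0 < M) (hh : ∀ u, |u| ≤ 2 → h u ≤ M) (u : ℝ) :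
    squeezeFactor M h u ≤ 1 := by
  rcases le_total |u| 2 with hu | hu
  · have h1 : smoothTransition ((u ^ 2 - 1) / 3) ≤ 1 := Real.smoothTransition.le_one _
    have h3 : h u / M ≤ 1 := (div_le_one hM).2 (hh u hu)
    have := mul_le_mul_of_nonneg_left h3 (sub_nonneg.2 h1)
    unfold squeezeFactor
    linarith
  · exact (squeezeFactor_of_ge hu).le

lemma squeezeFactor_congr {h h' : ℝ → ℝ} {u : ℝ} (e : h u = h' u) :
    squeezeFactor M h u = squeezeFactor M h' u := by simp only [squeezeFactor, e]

end squeezeFactor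

/-- Profiles of smoothings of a node inside a strip. -/
structure IsStrip (M : ℝ) (h : ℝ → ℝ) : Prop where
  smooth : ContDiff ℝ ∞ h
  pos : ∀ u, 0 < h u
  eq : ∀ u, 1 ≤ |u| → h u = |u|
  le : ∀ u, |u| ≤ 2 → h u ≤ M

lemma exists_isStrip {h : ℝ → ℝ} (h1 : ContDiff ℝ ∞ h) (h2 : ∀ u, 0 < h u)
    (h3 : ∀ u, 1 ≤ |u| → h u = |u|) : ∃ M₀, ∀ M, M₀ ≤ M → IsStrip M h := by
  obtain ⟨M₀, hM⟩ := (isCompact_Icc (a := (-2 : ℝ)) (b := 2)).exists_bound_of_continuousOn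
    h1.continuous.continuousOn
  exact ⟨M₀, fun M hMM => ⟨h1, h2, h3, fun u hu =>
    (le_abs_self _).trans ((hM u (abs_le.1 hu)).trans hMM)⟩⟩

section transfer

variable {M : ℝ} {g h : ℝ → ℝ}

/-- The map of the plane that takes the smoothing with one profile to the one with another. -/
def transfer (M : ℝ) (g h : ℝ → ℝ) (z : ℝ × ℝ) : ℝ × ℝ :=
  squeezeMap M (squeezeFactor M h) (unsqueezeMap M (squeezeFactor M g) z)

lemma transfer_fst (hM : 0 < M) (z : ℝ × ℝ) : (transfer M g h z).1 = z.1 := unsqueezeMap_fst hM z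

lemma IsStrip.factor_pos (hM : 0 < M) (hg : IsStrip M g) (u : ℝ) : 0 < squeezeFactor M g u :=
  squeezeFactor_pos hM (hg.pos u)

lemma IsStrip.factor_le (hM : 0 < M) (hg : IsStrip M g) (u : ℝ) : squeezeFactor M g u ≤ 1 :=
  squeezeFactor_le_one hM hg.le u

lemma contDiff_transfer (hM : 0 < M) (hg : IsStrip M g) (hh : IsStrip M h) :
    ContDiff ℝ ∞ (transfer M g h) :=
  (contDiff_squeezeMap (contDiff_squeezeFactor hh.smooth)).comp
    (contDiff_unsqueezeMap hM (contDiff_squeezeFactor hg.smooth) (hg.factor_pos hM) (hg.factor_le hM))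

lemma transfer_transfer (hM : 0 < M) (hh : IsStrip M h) (z : ℝ × ℝ) :
    transfer M h g (transfer M g h z) = z := by
  rw [transfer, transfer, unsqueezeMap_squeezeMap (hh.factor_pos hM) (hh.factor_le hM),
    squeezeMap_unsqueezeMap hM]

lemma transfer_eq_self (hM : 0 < M) (hg : IsStrip M g) {z : ℝ × ℝ} (e : g z.1 = h z.1) :
    transfer M g h z = z := by
  obtain ⟨z, rfl⟩ := squeezeMap_surjective hM (β := squeezeFactor M g) z
  rw [transfer, unsqueezeMap_squeezeMap (hg.factor_pos hM) (hg.factor_le hM)]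
  simp only [squeezeMap] at e ⊢
  rw [squeezeFactor_congr e]

lemma transfer_of_not_mem (hM : 0 < M) (hg : IsStrip M g) (hh : IsStrip M h) {z : ℝ × ℝ}
    (hz : z ∉ Icc (-1) 1 ×ˢ Icc (-(2 * M)) (2 * M)) : transfer M g h z = z := by
  rcases le_total 1 |z.1| with h1 | h1
  · exact transfer_eq_self hM hg (by rw [hg.eq _ h1, hh.eq _ h1])
  · have h2 : 2 * M ≤ |z.2| := by
      by_contra! h3
      exact hz ⟨abs_le.1 h1, abs_le.1 h3.le⟩
    have h4 : ∀ β, squeezeMap M β z = z := fun β => Prod.ext rfl (squeeze_of_ge hM h2)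
    rw [transfer]
    conv_lhs => rw [← h4 (squeezeFactor M g)]
    rw [unsqueezeMap_squeezeMap (hg.factor_pos hM) (hg.factor_le hM), h4]

lemma abs_transfer_eq_iff (hM : 0 < M) (hg : IsStrip M g) (hh : IsStrip M h) {z : ℝ × ℝ} :
    |(transfer M g h z).2| = h z.1 ↔ |z.2| = g z.1 := by
  rcases le_total 1 |z.1| with h1 | h1
  · have e : g z.1 = h z.1 := by rw [hg.eq _ h1, hh.eq _ h1]
    rw [transfer_eq_self hM hg e, e]
  · obtain ⟨z, rfl⟩ := squeezeMap_surjective hM (β := squeezeFactor M g) z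
    rw [transfer, unsqueezeMap_squeezeMap (hg.factor_pos hM) (hg.factor_le hM)]
    simp only [squeezeMap] at h1 ⊢
    have e1 : g z.1 = squeezeFactor M g z.1 * M := by rw [squeezeFactor_of_le h1]; field_simp
    have e2 : h z.1 = squeezeFactor M h z.1 * M := by rw [squeezeFactor_of_le h1]; field_simp
    rw [e1, e2, abs_squeeze_eq_iff hM (hg.factor_pos hM _) (hg.factor_le hM _),
      abs_squeeze_eq_iff hM (hh.factor_pos hM _) (hh.factor_le hM _)]

lemma abs_transfer_le_iff (hM : 0 < M) (hg : IsStrip M g) (hh : IsStrip M h) {z : ℝ × ℝ}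
    (hz : z.1 = 0) : |(transfer M g h z).2| ≤ h 0 ↔ |z.2| ≤ g 0 := by
  obtain ⟨z, rfl⟩ := squeezeMap_surjective hM (β := squeezeFactor M g) z
  rw [transfer, unsqueezeMap_squeezeMap (hg.factor_pos hM) (hg.factor_le hM)]
  simp only [squeezeMap] at hz ⊢
  have e1 : g 0 = squeezeFactor M g 0 * M := by rw [squeezeFactor_of_le (by simp)]; field_simp
  have e2 : h 0 = squeezeFactor M h 0 * M := by rw [squeezeFactor_of_le (by simp)]; field_simp
  rw [hz, e1, e2, abs_squeeze_le_iff hM (hg.factor_pos hM _) (hg.factor_le hM _),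
    abs_squeeze_le_iff hM (hh.factor_pos hM _) (hh.factor_le hM _)]

lemma transfer_of_le (hM : 0 < M) (hg : IsStrip M g) {w : ℝ} (hw : |w| ≤ g 0) :
    transfer M g h (0, w) = (0, w / g 0 * h 0) := by
  have h1 : squeezeMap M (squeezeFactor M g) (0, w / g 0 * M) = (0, w) := by
    have h2 : |w / g 0 * M| ≤ M := by
      rw [abs_mul, abs_div, abs_of_pos hM, abs_of_pos (hg.pos 0)]
      exact mul_le_of_le_one_left hM.le ((div_le_one (hg.pos 0)).2 hw)
    have := hg.pos 0
    simp only [squeezeMap]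
    rw [squeeze_of_le hM h2, squeezeFactor_of_le (by simp)]
    field_simp
  have h2 : |w / g 0 * M| ≤ M := by
    rw [abs_mul, abs_div, abs_of_pos hM, abs_of_pos (hg.pos 0)]
    exact mul_le_of_le_one_left hM.le ((div_le_one (hg.pos 0)).2 hw)
  rw [← h1, transfer, unsqueezeMap_squeezeMap (hg.factor_pos hM) (hg.factor_le hM)]
  simp only [squeezeMap]
  rw [squeeze_of_le hM h2, squeezeFactor_of_le (by simp)]
  have := hg.pos 0
  field_simp

/-- The map of the plane that collapses the vertical interval at the origin. -/
def collapse (M : ℝ) (g : ℝ → ℝ) : ℝ × ℝ → ℝ × ℝ := transfer M g fun u => |u|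

lemma collapse_eq_zero_iff (hM : 2 ≤ M) (hg : IsStrip M g) {z : ℝ × ℝ} :
    collapse M g z = 0 ↔ z.1 = 0 ∧ |z.2| ≤ g 0 := by
  have hM0 : 0 < M := by linarith
  have h1 : (collapse M g z).1 = z.1 := transfer_fst hM0 z
  by_cases h2 : z.1 = 0
  swap
  · exact ⟨fun h => absurd (by rw [← h1, h]; rfl) h2, fun h => absurd h.1 h2⟩
  obtain ⟨z, rfl⟩ := squeezeMap_surjective hM0 (β := squeezeFactor M g) z
  rw [collapse, transfer, unsqueezeMap_squeezeMap (hg.factor_pos hM0) (hg.factor_le hM0)]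
  simp only [squeezeMap] at h2 ⊢
  have e1 : g 0 = squeezeFactor M g 0 * M := by rw [squeezeFactor_of_le (by simp)]; field_simp
  rw [h2, e1, abs_squeeze_le_iff hM0 (hg.factor_pos hM0 _) (hg.factor_le hM0 _),
    squeezeFactor_of_le (by simp), ← deadZone_eq_zero_iff hM0]
  simp [squeeze]

lemma collapse_eq_iff (hM : 2 ≤ M) (hg : IsStrip M g) {z z' : ℝ × ℝ}
    (h : collapse M g z = collapse M g z') : z = z' ∨ collapse M g z = 0 := by
  have hM0 : 0 < M := by linarith
  have h1 : z.1 = z'.1 := by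
    have := congrArg Prod.fst h
    rwa [collapse, transfer_fst hM0, transfer_fst hM0] at this
  obtain ⟨z, rfl⟩ := squeezeMap_surjective hM0 (β := squeezeFactor M g) z
  obtain ⟨z', rfl⟩ := squeezeMap_surjective hM0 (β := squeezeFactor M g) z'
  simp only [collapse, transfer,
    unsqueezeMap_squeezeMap (hg.factor_pos hM0) (hg.factor_le hM0)] at h ⊢
  obtain ⟨u, w⟩ := z
  obtain ⟨u', w'⟩ := z'
  simp only [squeezeMap] at h1 h ⊢
  subst h1
  have h2 : squeeze M (squeezeFactor M (fun u => |u|) u) w =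
    squeeze M (squeezeFactor M (fun u => |u|) u) w' := congrArg Prod.snd h
  by_cases hu : u = 0
  · subst hu
    rw [squeezeFactor_of_le (by simp)] at h2 ⊢
    simp only [squeeze, abs_zero, zero_div, zero_mul, zero_add, sub_zero, one_mul] at h2 ⊢
    rcases deadZone_inj hM0 h2 with h3 | h3
    · exact Or.inl (by rw [h3])
    · right
      refine Prod.ext rfl ?_
      simp [squeezeFactor_of_le, deadZone_of_le hM0 h3.1]
  · left
    have h4 := squeeze_strictMono (M := M) (squeezeFactor_pos hM0 (h := fun u => |u|) (abs_pos.2 hu))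
      (squeezeFactor_le_one hM0 (fun u hu => hu.trans hM) u)
    rw [h4.injective h2]

lemma tendsto_transfer (hM : 0 < M) (hg : IsStrip M g) {G : ℝ → ℝ → ℝ}
    (hG : ∀ u, Tendsto (fun δ => G δ u) (𝓝[>] 0) (𝓝 |u|)) (z : ℝ × ℝ) :
    Tendsto (fun δ => transfer M g (G δ) z) (𝓝[>] 0) (𝓝 (collapse M g z)) := by
  obtain ⟨z, rfl⟩ := squeezeMap_surjective hM (β := squeezeFactor M g) z
  have e : ∀ h, transfer M g h (squeezeMap M (squeezeFactor M g) z) =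
      (z.1, squeeze M (squeezeFactor M h z.1) z.2) := fun h => by
    rw [transfer, unsqueezeMap_squeezeMap (hg.factor_pos hM) (hg.factor_le hM)]; rfl
  simp only [collapse, e, squeeze, squeezeFactor]
  have h1 := hG z.1
  have h2 := ((h1.div_const M).const_mul (1 - smoothTransition ((z.1 ^ 2 - 1) / 3))).add_const
    (smoothTransition ((z.1 ^ 2 - 1) / 3))
  exact tendsto_const_nhds.prodMk_nhds
    ((h2.mul_const z.2).add ((tendsto_const_nhds.sub h2).mul_const _))

end transfer

/-! ### Quasilines of a nodal curve that satisfies a Bezout bound -/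

lemma exists_injective_choice {α : Type*} {n : ℕ} (A : Fin n → Set α) (hA : ∀ i, (A i).Infinite) :
    ∃ f : Fin n → α, Function.Injective f ∧ ∀ i, f i ∈ A i := by
  classical
  choose T hT hTc using fun i => (hA i).exists_subset_card_eq n
  obtain ⟨f, hf, hfT⟩ := (Finset.all_card_le_biUnion_card_iff_exists_injective T).1 fun s => by
    rcases s.eq_empty_or_nonempty with rfl | ⟨i, hi⟩
    · simp
    · calc s.card ≤ n := by simpa using s.card_le_univ
        _ = (T i).card := (hTc i).symm
        _ ≤ _ := Finset.card_le_card (Finset.subset_biUnion_of_mem T hi)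
  exact ⟨f, hf, fun i => hT i (hfT i)⟩

instance : Infinite RP2 := by
  obtain ⟨ψ, hψ, -⟩ := exists_chart_at (pt ![1, 0, 0])
  exact Infinite.of_injective ψ hψ.1

lemma HD.trans_map (Φ Ψ : HD) : (Φ.trans Ψ).map = Ψ.map ∘ Φ.map := by
  funext x
  obtain ⟨v, hv, rfl⟩ := exists_pt x
  rw [Function.comp_apply, Φ.map_pt hv, Ψ.map_pt (Φ.ne_zero hv), (Φ.trans Ψ).map_pt hv]
  rfl

lemma Diagram.map_comp {ι : Type} (Δ : Diagram ι) (f g : RP2 → RP2) :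
    Δ.map (g ∘ f) = (Δ.map f).map g := by
  simp only [Diagram.map, image_comp]

lemma Diagram.map_symm {ι : Type} (Δ : Diagram ι) (Φ : HD) : (Δ.map Φ.map).map Φ.symm.map = Δ := by
  rw [← Diagram.map_comp]
  have : Φ.symm.map ∘ Φ.map = id := funext Φ.map_symm_map
  rw [this]
  simp [Diagram.map]

namespace NodalCurve

variable {ι κ : Type} (W : NodalCurve ι κ)

/-- After a diffeomorphism that fixes the charts, finitely many lines have at most five
intersection points with the curve each, stably. -/
def Bezout [Fintype κ] : Prop :=
  ∀ (n : ℕ) (P : Fin n → Bool → R3), (∀ i, P i false ⨯₃ P i true ≠ 0) →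
    ∃ Θ : HD, (∀ k z, Θ (W.F k z) = W.F k z) ∧ ∀ i, ∃ N : κ → ℕ, ∑ c, N c ≤ 5 ∧
      ∀ c, StableZeros (fun θ => (Θ (P i false) ⨯₃ Θ (P i true)) ⬝ᵥ Θ (W.γ c θ)) (N c)

/-- The lift of a point that is compatible with the charts. -/
def IsLift (v : R3) : Prop := v ≠ 0 ∧ ∀ k z, pt v = pt (W.F k z) → v = W.F k z

lemma exists_isLift (x : RP2) : ∃ v, W.IsLift v ∧ pt v = x := by
  by_cases h : ∃ k z, x = pt (W.F k z)
  · obtain ⟨k, z, rfl⟩ := h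
    refine ⟨W.F k z, ⟨W.ne_zero k z, fun l w h => ?_⟩, rfl⟩
    obtain ⟨rfl, rfl⟩ := W.inj _ _ _ _ h
    rfl
  · push Not at h
    obtain ⟨v, hv, rfl⟩ := exists_pt x
    exact ⟨v, ⟨hv, fun k z h1 => absurd h1 (h k z)⟩, rfl⟩

lemma move_apply (η : ι → ℝ × ℝ → ℝ × ℝ) (k : ι) (z : ℝ × ℝ) :
    W.move η (W.F k z) = W.F k (η k z) := by
  simpa using W.move_smul η k one_ne_zero z

lemma move_off (η : ι → ℝ × ℝ → ℝ × ℝ) {v : R3} (h : ∀ k z, pt v ≠ pt (W.F k z)) : W.move η v = v :=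
  W.move_of_not η fun k c z hc e => h k z (by rw [e, pt_smul hc])

/-- The diffeomorphism that changes the profiles of the smoothings. -/
def transferHD [Finite ι] {M : ℝ} (hM : 0 < M) {g h : ι → ℝ → ℝ}
    (hg : ∀ k, IsStrip M (g k)) (hh : ∀ k, IsStrip M (h k)) : HD :=
  W.hd (fun k => transfer M (g k) (h k)) (fun k => transfer M (h k) (g k))
    (fun _ => Icc (-1) 1 ×ˢ Icc (-(2 * M)) (2 * M))
    (fun k => contDiff_transfer hM (hg k) (hh k)) (fun k => contDiff_transfer hM (hh k) (hg k))
    (fun _ => isCompact_Icc.prod isCompact_Icc)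
    (fun k _ hz => transfer_of_not_mem hM (hg k) (hh k) hz)
    (fun k z => transfer_transfer hM (hh k) z) (fun k z => transfer_transfer hM (hg k) z)

lemma smoothed_transferHD [Finite ι] {M : ℝ} (hM : 0 < M) {g h : ι → ℝ → ℝ}
    (hg : ∀ k, IsStrip M (g k)) (hh : ∀ k, IsStrip M (h k)) :
    (W.smoothed g).map (W.transferHD hM hg hh).map = W.smoothed h := by
  set Ψ := W.transferHD hM hg hh with hΨ
  have h0 : ∀ v, Ψ v = W.move (fun k => transfer M (g k) (h k)) v := fun _ => rfl
  have h1 : ∀ k z, Ψ.map (pt (W.F k z)) = pt (W.F k (transfer M (g k) (h k) z)) := fun k z => by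
    rw [Ψ.map_pt (W.ne_zero k z), h0, W.move_apply]
  have h2 : ∀ x ∉ ⋃ k, range fun z => pt (W.F k z), Ψ.map x = x := by
    intro x hx
    obtain ⟨v, hv, rfl⟩ := exists_pt x
    rw [Ψ.map_pt hv, h0, W.move_off _ fun k z e => hx (mem_iUnion.2 ⟨k, z, e.symm⟩)]
  have h3 : ∀ k (A B : Set (ℝ × ℝ)), (∀ z, transfer M (g k) (h k) z ∈ B ↔ z ∈ A) →
      Ψ.map '' ((fun z => pt (W.F k z)) '' A) = (fun z => pt (W.F k z)) '' B := by
    intro k A B hAB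
    ext x
    constructor
    · rintro ⟨_, ⟨z, hz, rfl⟩, rfl⟩
      exact ⟨_, (hAB z).2 hz, (h1 k z).symm⟩
    · rintro ⟨z, hz, rfl⟩
      have e := transfer_transfer hM (hg k) (g := h k) z
      refine ⟨_, ⟨transfer M (h k) (g k) z, (hAB _).1 (by rwa [e]), rfl⟩, ?_⟩
      simp only [h1, e]
  have hc : Ψ.map '' (W.smoothed g).curve = (W.smoothed h).curve := by
    simp only [smoothed, image_union, image_iUnion]
    congr 1
    · refine (image_congr fun x hx => h2 x hx.2).trans (image_id' _)
    · exact iUnion_congr fun k => h3 k _ _ fun z => by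
        show |_| = h k _ ↔ |_| = g k _
        rw [transfer_fst hM]
        exact abs_transfer_eq_iff hM (hg k) (hh k)
  have hi : ∀ k, Ψ.map '' (W.smoothed g).interval k = (W.smoothed h).interval k := fun k =>
    h3 k _ _ fun z => by
      show _ = 0 ∧ |_| ≤ h k 0 ↔ _ = 0 ∧ |_| ≤ g k 0
      rw [transfer_fst hM]
      exact and_congr_right fun hz => abs_transfer_le_iff hM (hg k) (hh k) hz
  simp only [Diagram.map, hc, hi]

section collapse

variable {W} {M : ℝ} {g : ι → ℝ → ℝ}

lemma isLift_cases {v : R3} (hv : W.IsLift v) : (∃ k z, v = W.F k z) ∨ ∀ k z, pt v ≠ pt (W.F k z) := by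
  by_cases h : ∃ k z, pt v = pt (W.F k z)
  · obtain ⟨k, z, h⟩ := h
    exact Or.inl ⟨k, z, hv.2 k z h⟩
  · push Not at h; exact Or.inr h

lemma collapsed_of_eq (hM : 2 ≤ M) (hg : ∀ k, IsStrip M (g k)) {v w : R3} (hv : W.IsLift v)
    (hw : W.IsLift w) (h : pt (W.move (fun k => collapse M (g k)) v) =
      pt (W.move (fun k => collapse M (g k)) w)) : (W.smoothed g).Collapsed (pt v) (pt w) := by
  rcases isLift_cases hv with ⟨k, z, rfl⟩ | h1 <;> rcases isLift_cases hw with ⟨l, z', rfl⟩ | h2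
  · rw [W.move_apply, W.move_apply] at h
    obtain ⟨rfl, h3⟩ := W.inj _ _ _ _ h
    rcases collapse_eq_iff hM (hg k) h3 with rfl | h4
    · exact Or.inl rfl
    · have h5 := (collapse_eq_zero_iff hM (hg k)).1 h4
      have h6 := (collapse_eq_zero_iff hM (hg k)).1 (h3 ▸ h4)
      exact Or.inr ⟨k, ⟨z, h5, rfl⟩, ⟨z', h6, rfl⟩⟩
  · rw [W.move_apply, W.move_off _ h2] at h
    exact absurd h.symm (h2 _ _)
  · rw [W.move_apply, W.move_off _ h1] at h
    exact absurd h (h1 _ _)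
  · rw [W.move_off _ h1, W.move_off _ h2] at h
    exact Or.inl h

lemma collapse_eq_node (hM : 2 ≤ M) (hg : ∀ k, IsStrip M (g k)) {v : R3} (hv : W.IsLift v) {k : ι}
    (h : pt (W.move (fun k => collapse M (g k)) v) = pt (W.F k 0)) :
    W.move (fun k => collapse M (g k)) v = W.F k 0 ∧ ∃ w, v = W.F k (0, w) ∧ |w| ≤ g k 0 := by
  rcases isLift_cases hv with ⟨l, z, rfl⟩ | h1
  · rw [W.move_apply] at h ⊢
    obtain ⟨rfl, h3⟩ := W.inj _ _ _ _ h
    have h5 := (collapse_eq_zero_iff hM (hg l)).1 h3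
    exact ⟨by rw [h3], z.2, by rw [← h5.1], h5.2⟩
  · rw [W.move_off _ h1] at h
    exact absurd h (h1 _ _)

lemma move_interval {v : R3} (hM : 2 ≤ M) (hg : ∀ k, IsStrip M (g k)) (hv : W.IsLift v) {k : ι}
    (h : pt v ∈ (W.smoothed g).interval k) : W.move (fun k => collapse M (g k)) v = W.F k 0 := by
  obtain ⟨z, hz, h1⟩ := h
  rw [hv.2 k z h1.symm, W.move_apply, (collapse_eq_zero_iff hM (hg k)).2 hz]

lemma move_ne_zero {v : R3} (hv : W.IsLift v) (η : ι → ℝ × ℝ → ℝ × ℝ) : W.move η v ≠ 0 := by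
  rcases isLift_cases hv with ⟨l, z, rfl⟩ | h1
  · rw [W.move_apply]; exact W.ne_zero _ _
  · rw [W.move_off _ h1]; exact hv.1

lemma tendsto_move {v : R3} (hv : W.IsLift v) {η : ℝ → ι → ℝ × ℝ → ℝ × ℝ} {ζ : ι → ℝ × ℝ → ℝ × ℝ}
    {l : Filter ℝ} (h : ∀ k z, Tendsto (fun δ => η δ k z) l (𝓝 (ζ k z))) :
    Tendsto (fun δ => W.move (η δ) v) l (𝓝 (W.move ζ v)) := by
  rcases isLift_cases hv with ⟨k, z, rfl⟩ | h1
  · simp only [W.move_apply]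
    exact ((W.smooth k).continuous.tendsto _).comp (h k z)
  · simp only [W.move_off _ h1]
    exact tendsto_const_nhds

end collapse

lemma cross_vertical_ne (k : ι) : W.F k 0 ⨯₃ fderiv ℝ (W.F k) 0 (0, 1) ≠ 0 := fun h0 =>
  W.imm k 0 (by
    rw [trip, triple_product_permutation, ← cross_anticomm, h0, neg_zero, dotProduct_zero])

lemma vertical_ne_zero (k : ι) (t : ℝ) : W.F k 0 + t • fderiv ℝ (W.F k) 0 (0, 1) ≠ 0 :=
  fun h0 => W.cross_vertical_ne k (by
    have : W.F k 0 = -(t • fderiv ℝ (W.F k) 0 (0, 1)) := eq_neg_of_add_eq_zero_left h0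
    rw [this]; simp)

/-- Points on the tangent line of the vanishing cycle at the node, near the node. -/
lemma infinite_vertical (k : ι) : {x | ∃ t : ℝ, t ≠ 0 ∧
    x = pt (W.F k 0 + t • fderiv ℝ (W.F k) 0 (0, 1)) ∧ ∃ z, x = pt (W.F k z)}.Infinite := by
  have hcr := W.cross_vertical_ne k
  have hne := W.vertical_ne_zero k
  set d := fderiv ℝ (W.F k) 0 (0, 1)
  have hc : Continuous fun t : ℝ => pt (W.F k 0 + t • d) := continuous_pt_comp (by fun_prop) hne
  have ho : ∀ᶠ t in 𝓝 (0 : ℝ), ∃ z, pt (W.F k 0 + t • d) = pt (W.F k z) := by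
    have h1 := W.isOpen_image k isOpen_univ
    have h2 := (hc.tendsto 0).eventually (h1.mem_nhds ⟨0, mem_univ _, by simp⟩)
    exact h2.mono fun t ⟨z, _, hz⟩ => ⟨z, hz.symm⟩
  obtain ⟨ρ, hρ, hball⟩ := Metric.eventually_nhds_iff.1 ho
  have hinj : InjOn (fun t : ℝ => pt (W.F k 0 + t • d)) (Ioo 0 ρ) := by
    intro s _ t _ hst
    have h1 := (pt_eq_iff_cross (hne s) (hne t)).1 hst
    have h2 : (W.F k 0 + s • d) ⨯₃ (W.F k 0 + t • d) = (t - s) • (W.F k 0 ⨯₃ d) := by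
      ext i; fin_cases i <;> simp [cross_apply] <;> ring
    rw [h2] at h1
    linarith [(smul_eq_zero.1 h1).resolve_right hcr]
  refine ((Ioo_infinite hρ).image hinj).mono ?_
  rintro _ ⟨t, ht, rfl⟩
  exact ⟨t, ht.1.ne', rfl, hball (by rw [Real.dist_eq, sub_zero, abs_of_pos ht.1]; exact ht.2)⟩

variable {W} in
set_option maxHeartbeats 1000000 in
lemma Bezout.hasQuasilines [Finite ι] [Fintype κ] (hW : W.Bezout) {g : ι → ℝ → ℝ}
    (hg1 : ∀ k, ContDiff ℝ ∞ (g k)) (hg2 : ∀ k u, 0 < g k u) (hg3 : ∀ k u, 1 ≤ |u| → g k u = |u|) :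
    (W.smoothed g).HasQuasilines := by
  classical
  intro n p q hp hq hpq
  obtain ⟨M, hM3, hg⟩ : ∃ M : ℝ, 3 ≤ M ∧ ∀ k, IsStrip M (g k) := by
    choose M₀ hM₀ using fun k => exists_isStrip (hg1 k) (hg2 k) (hg3 k)
    obtain ⟨B, hB⟩ := (finite_range M₀).bddAbove
    exact ⟨max B 3, le_max_right _ _, fun k =>
      hM₀ k _ ((hB (mem_range_self k)).trans (le_max_left _ _))⟩
  have hM : 0 < M := by linarith
  have hM2 : 2 ≤ M := by linarith
  set Δ := W.smoothed g with hΔ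
  set x : Fin n → Bool → RP2 := fun i b => cond b (q i) (p i) with hx
  have hxe : ∀ i b k, x i b ∉ Δ.endpoints k := fun i b k => by cases b; exacts [hp i k, hq i k]
  choose v hv hvx using fun i b => W.exists_isLift (x i b)
  set Q : Fin n → Bool → R3 := fun i b => W.move (fun k => collapse M (g k)) (v i b) with hQ
  have hQ0 : ∀ i b, Q i b ≠ 0 := fun i b => move_ne_zero (hv i b) _
  have hQc : ∀ i b j b', pt (Q i b) = pt (Q j b') → Δ.Collapsed (x i b) (x j b') := by
    intro i b j b' h
    have := collapsed_of_eq hM2 hg (hv i b) (hv j b') h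
    rwa [hvx, hvx] at this
  have hQn : ∀ i b k, pt (Q i b) = pt (W.F k 0) →
      Q i b = W.F k 0 ∧ ∃ w, v i b = W.F k (0, w) ∧ |w| < g k 0 := by
    intro i b k h
    obtain ⟨h1, w, h2, h3⟩ := collapse_eq_node hM2 hg (hv i b) h
    refine ⟨h1, w, h2, lt_of_le_of_ne h3 fun h4 => hxe i b k ?_⟩
    rw [← hvx, h2]
    exact ⟨(W.mem_interval_chart).2 ⟨rfl, rfl, h3⟩, (W.mem_smoothed_chart).2 h4⟩
  -- auxiliary points for the pairs that collapse
  obtain ⟨f, hfinj, hf⟩ : ∃ f : Fin n → RP2, Function.Injective f ∧ ∀ i,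
      (∀ j b, f i ≠ pt (Q j b)) ∧ (∀ k, f i ≠ pt (W.F k 0)) ∧
      (p i ≠ q i → ∀ k, p i ∈ Δ.interval k → q i ∈ Δ.interval k → ∃ t : ℝ, t ≠ 0 ∧
        f i = pt (W.F k 0 + t • fderiv ℝ (W.F k) 0 (0, 1)) ∧ ∃ z, f i = pt (W.F k z)) := by
    have hD : ∀ i, ∃ D : Set RP2, D.Infinite ∧ ∀ y ∈ D,
        (p i ≠ q i → ∀ k, p i ∈ Δ.interval k → q i ∈ Δ.interval k → ∃ t : ℝ, t ≠ 0 ∧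
        y = pt (W.F k 0 + t • fderiv ℝ (W.F k) 0 (0, 1)) ∧ ∃ z, y = pt (W.F k z)) := by
      intro i
      by_cases h : ∃ k, p i ∈ Δ.interval k
      · obtain ⟨k, hk⟩ := h
        refine ⟨_, W.infinite_vertical k, fun y hy _ l hl _ => ?_⟩
        obtain ⟨z, -, hz⟩ := hk
        rw [← hz] at hl
        obtain ⟨rfl, -⟩ := (W.mem_interval_chart).1 hl
        exact hy
      · push Not at h
        exact ⟨univ, infinite_univ, fun y _ _ k hk => absurd hk (h k)⟩
    choose D hDi hD using hD
    set B : Set RP2 := range (fun jb : Fin n × Bool => pt (Q jb.1 jb.2)) ∪ range fun k => pt (W.F k 0)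
      with hB
    have hBf : B.Finite := (finite_range _).union (finite_range _)
    obtain ⟨f, h1, h2⟩ := exists_injective_choice (fun i => D i \ B) fun i => (hDi i).sdiff hBf
    exact ⟨f, h1, fun i => ⟨fun j b e => (h2 i).2 (Or.inl ⟨(j, b), e.symm⟩),
      fun k e => (h2 i).2 (Or.inr ⟨k, e.symm⟩), hD i _ (h2 i).1⟩⟩
  choose r hr0 hr using fun i => exists_pt (f i)
  set Col : Fin n → Prop := fun i => Δ.Collapsed (p i) (q i) with hCol
  set aux : Fin n → Bool → Prop := fun i b => b = true ∧ Col i with haux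
  set P : Fin n → Bool → R3 := fun i b => if aux i b then r i else Q i b with hPdef
  have hPr : ∀ i b, aux i b → P i b = r i := fun i b h => if_pos h
  have hPQ : ∀ i b, ¬ aux i b → P i b = Q i b := fun i b h => if_neg h
  have hPf : ∀ i, P i false = Q i false := fun i => hPQ i _ (by simp [haux])
  have hP0 : ∀ i b, P i b ≠ 0 := fun i b => by
    by_cases h : aux i b
    · rw [hPr i b h]; exact hr0 i
    · rw [hPQ i b h]; exact hQ0 i b
  have hPne : ∀ i, pt (P i false) ≠ pt (P i true) := by
    intro i h
    rw [hPf] at h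
    by_cases hc : Col i
    · rw [hPr i true ⟨rfl, hc⟩, hr] at h
      exact (hf i).1 i false h.symm
    · rw [hPQ i true fun h => hc h.2] at h
      exact hc (hQc i false i true h)
  have hPcr : ∀ i, P i false ⨯₃ P i true ≠ 0 := fun i h =>
    hPne i ((pt_eq_iff_cross (hP0 i false) (hP0 i true)).2 h)
  have hPrne : ∀ i j b, Col i → i ≠ j → pt (r i) ≠ pt (P j b) := by
    intro i j b _ hij h
    rw [hr] at h
    by_cases hc : aux j b
    · rw [hPr j b hc, hr] at h
      exact hij (hfinj h)
    · rw [hPQ j b hc] at h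
      exact (hf i).1 j b h
  have hPd : ∀ i j, i ≠ j → ∃ b, ∀ b', pt (P j b) ≠ pt (P i b') := by
    intro i j hij
    by_cases hcj : Col j
    · refine ⟨true, fun b' h => ?_⟩
      rw [hPr j true ⟨rfl, hcj⟩] at h
      exact hPrne j i b' hcj hij.symm h
    by_contra! hcon
    obtain ⟨b₀, h0⟩ := hcon false
    obtain ⟨b₁, h1⟩ := hcon true
    by_cases hci : Col i
    · have key : ∀ b b', pt (P j b) = pt (P i b') → b' = false := by
        intro b b' h
        cases b'
        · rfl
        · rw [hPr i true ⟨rfl, hci⟩] at h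
          exact absurd h.symm (hPrne i j b hci hij)
      rw [key _ _ h0] at h0
      rw [key _ _ h1] at h1
      exact hPne j (h0.trans h1.symm)
    · have e : ∀ b b', pt (P j b) = pt (P i b') → Δ.Collapsed (x i b') (x j b) := fun b b' h => by
        rw [hPQ j b fun h => hcj h.2, hPQ i b' fun h => hci h.2] at h
        exact hQc i b' j b h.symm
      have h2 := hpq i j hij hci
      have h3 := e _ _ h0
      have h4 := e _ _ h1
      cases b₀ <;> cases b₁
      · exact hPne j (h0.trans h1.symm)
      · exact h2.1 ⟨h3, h4⟩
      · exact h2.2 ⟨h4, h3⟩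
      · exact hPne j (h0.trans h1.symm)
  have hPn : ∀ i b k, pt (P i b) = pt (W.F k 0) → ¬ aux i b ∧ P i b = W.F k 0 ∧
      ∃ w, v i b = W.F k (0, w) ∧ |w| < g k 0 := by
    intro i b k h
    by_cases hc : aux i b
    · rw [hPr i b hc, hr] at h
      exact absurd h ((hf i).2.1 k)
    · refine ⟨hc, ?_⟩
      rw [hPQ i b hc] at h ⊢
      exact hQn i b k h
  -- general position
  obtain ⟨Θ, hΘ, hΘN⟩ := hW n P hPcr
  have hF : (W.mapHD Θ).F = W.F := funext fun k => funext fun z => hΘ k z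
  have hpos : (W.mapHD Θ).PairPosition (fun i b => Θ (P i b)) := by
    refine ⟨fun i h => hPne i ?_, fun i j hij => ?_, hΘN, fun i b k h => ?_⟩
    · exact (Θ.pt_eq_iff (hP0 _ _) (hP0 _ _)).1
        ((pt_eq_iff_cross (Θ.ne_zero (hP0 _ _)) (Θ.ne_zero (hP0 _ _))).2 h)
    · obtain ⟨b, hb⟩ := hPd i j hij
      exact ⟨b, fun b' h => hb b' ((Θ.pt_eq_iff (hP0 _ _) (hP0 _ _)).1 h)⟩
    · exact congrArg Θ (hPn i b k ((Θ.pt_eq_iff (hP0 _ _) (W.ne_zero _ _)).1 h)).2.1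
  obtain ⟨Φ, hΦ, hΦs⟩ := hpos.exists_linePosition
  obtain ⟨lam, hl, hl1, hmain⟩ := hΦ.eventually_quasilines
  obtain ⟨G, hG, hG0, hGτ⟩ := exists_profiles hl hl1
  have ht : ∀ i b, ∃ t : ℝ, |t| < 1 ∧ ∀ k, P i b = W.F k 0 →
      ∃ w, v i b = W.F k (0, w) ∧ |w| < g k 0 ∧ t = w / g k 0 := by
    intro i b
    by_cases h : ∃ k, P i b = W.F k 0
    · obtain ⟨k, hk⟩ := h
      obtain ⟨-, -, w, hw1, hw2⟩ := hPn i b k (by rw [hk])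
      refine ⟨w / g k 0, ?_, fun l hl => ⟨w, ?_⟩⟩
      · rw [abs_div, abs_of_pos (hg2 k 0)]
        exact (div_lt_one (hg2 k 0)).2 hw2
      · obtain ⟨rfl, -⟩ := W.inj k l 0 0 (by rw [← hk, hl])
        exact ⟨hw1, hw2, rfl⟩
    · push Not at h
      exact ⟨0, by simp, fun k hk => absurd hk (h k)⟩
  choose t ht1 ht2 using ht
  set y : Fin n → Bool → ℝ → R3 := fun i b δ =>
    Φ (Θ (if aux i b then r i else W.move (fun k => transfer M (g k) (G δ)) (v i b))) with hy
  have hGu : ∀ u, Tendsto (fun δ => G δ u) (𝓝[>] 0) (𝓝 |u|) := by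
    intro u
    rcases eq_or_ne u 0 with rfl | hu
    · simpa using hG0
    · refine tendsto_const_nhds.congr' ?_
      have h1 : ∀ᶠ δ in 𝓝[>] (0 : ℝ), δ < min |u| 1 :=
        nhdsWithin_le_nhds (eventually_lt_nhds (lt_min (abs_pos.2 hu) one_pos))
      filter_upwards [h1, self_mem_nhdsWithin] with δ h2 h3
      exact ((hG δ h3 (h2.trans_le (min_le_right _ _))).2.2.1 u
        (h2.le.trans (min_le_left _ _))).symm
  have hquasi := hmain G t y hG hG0 hGτ ht1 (by
    intro i b k hk δ
    have hk' : Φ (Θ (P i b)) = Φ (Θ (W.F k 0)) := hk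
    have h1 : P i b = W.F k 0 := by
      have h2 := congrArg Φ.symm hk'
      have h3 := (Φ.left_inv (Θ (P i b))).symm.trans (h2.trans (Φ.left_inv _))
      exact (Θ.left_inv (P i b)).symm.trans ((congrArg Θ.symm h3).trans (Θ.left_inv _))
    obtain ⟨h2, -, -⟩ := hPn i b k (by rw [h1])
    obtain ⟨w, hw1, hw2, hw3⟩ := ht2 i b k h1
    simp only [hy, if_neg h2, hw1, W.move_apply, transfer_of_le hM (hg k) hw2.le, hw3]
    rfl) (by
    intro i b
    have hc : ∀ u : R3, u ≠ 0 → ContinuousAt (fun u => Φ (Θ u)) u := fun u hu =>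
      ContinuousAt.comp (g := Φ) ((Φ.smooth _ (Θ.ne_zero hu)).continuousAt) (Θ.smooth _ hu).continuousAt
    have h1 : Tendsto (fun δ => if aux i b then r i else
        W.move (fun k => transfer M (g k) (G δ)) (v i b)) (𝓝[>] 0) (𝓝 (P i b)) := by
      by_cases h : aux i b
      · simp only [hPr i b h, if_pos h]; exact tendsto_const_nhds
      · simp only [hPQ i b h, if_neg h]
        exact tendsto_move (hv i b) fun k z => tendsto_transfer hM (hg k) hGu z
    exact (hc _ (hP0 i b)).tendsto.comp h1)
  have hstrip : ∀ᶠ δ in 𝓝[>] (0 : ℝ), IsStrip M (G δ) := by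
    have h1 : ∀ᶠ δ in 𝓝[>] (0 : ℝ), δ < 1 := nhdsWithin_le_nhds (eventually_lt_nhds one_pos)
    filter_upwards [h1, self_mem_nhdsWithin, hG0.eventually (eventually_lt_nhds one_pos)]
      with δ h2 h3 h4
    obtain ⟨h5, h6, h7, h8⟩ := hG δ h3 h2
    exact ⟨h5, h6, fun u hu => h7 u (h2.le.trans hu), fun u hu => by linarith [h8 u]⟩
  obtain ⟨δ, ⟨L, hL1, hL2, hL3⟩, hδ⟩ := (hquasi.and hstrip).exists
  -- transport
  set Λ := W.transferHD hM hg (fun _ => hδ) with hΛ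
  set Ψ := Λ.trans (Θ.trans Φ) with hΨ
  have hmap : Δ.map Ψ.map = ((W.mapHD Θ).mapHD Φ).smoothed fun _ => G δ := by
    rw [hΨ, HD.trans_map, HD.trans_map, Diagram.map_comp, Diagram.map_comp,
      W.smoothed_transferHD hM hg, smoothed_mapHD, smoothed_mapHD]
  have hback : (((W.mapHD Θ).mapHD Φ).smoothed fun _ => G δ).map Ψ.symm.map = Δ := by
    rw [← hmap, Diagram.map_symm]
  have hmem : ∀ {i u}, Ψ.map u ∈ L i → u ∈ Ψ.symm.map '' L i := fun {i u} h =>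
    ⟨_, h, Ψ.map_symm_map u⟩
  have hdiff := Ψ.symm.isDiffeo
  have hxL : ∀ i b, ¬ aux i b → x i b ∈ Ψ.symm.map '' L i := by
    intro i b hb
    apply hmem
    have h1 := (hL1 i).2 b
    rw [← hvx, Ψ.map_pt (hv i b).1]
    simp only [hy, if_neg hb] at h1
    exact h1
  refine ⟨fun i => Ψ.symm.map '' L i, fun i => ⟨?_, hxL i false (by simp [haux]), ?_⟩,
    fun i j hij => ?_⟩
  · have := (hL1 i).1.image hdiff
    rwa [hback] at this
  · by_cases hc : Col i
    · by_cases hpqi : p i = q i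
      · rw [← hpqi]
        exact hxL i false (by simp [haux])
      · obtain ⟨k, hk1, hk2⟩ := hc.resolve_left hpqi
        obtain ⟨s, hs, hs1, z, hs2⟩ := (hf i).2.2 hpqi k hk1 hk2
        apply hmem
        have h1 : k ∈ ((W.mapHD Θ).mapHD Φ).steepOn (Φ (Θ (P i false)) ⨯₃ Φ (Θ (P i true))) := by
          have hPF : P i false = W.F k 0 := by
            rw [hPf]
            exact move_interval hM2 hg (hv i false) (by rw [hvx]; exact hk1)
          have himm := W.imm k 0
          obtain ⟨c, hc0, hrc⟩ := (pt_eq_iff (W.vertical_ne_zero k s) (hr0 i)).1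
            (hs1.symm.trans (hr i).symm)
          obtain ⟨c', -, hrc'⟩ := (pt_eq_iff (W.ne_zero k z) (hr0 i)).1 (hs2.symm.trans (hr i).symm)
          have hΘr : Θ (r i) = r i := by rw [hrc', Θ.homog, hΘ]
          refine hΦs i k ?_ ⟨false, by rw [hF, hPF, hΘ]⟩
          rw [hPF, hPr i true ⟨rfl, hc⟩, hΘ, hΘr, hrc]
          have e : W.F k 0 ⨯₃ (c • (W.F k 0 + s • fderiv ℝ (W.F k) 0 (0, 1))) =
              (c * s) • (W.F k 0 ⨯₃ fderiv ℝ (W.F k) 0 (0, 1)) := by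
            rw [map_smul, map_add, map_smul, cross_self, zero_add, smul_smul]
          rw [e]
          refine ⟨?_, ?_⟩
          · rw [hF, smul_dotProduct, dot_cross_left, smul_zero]
          · rw [slopeU, slopeW, hF, smul_dotProduct, dot_cross_right, smul_zero, abs_zero, abs_pos,
              smul_dotProduct]
            refine smul_ne_zero (mul_ne_zero hc0 hs) fun h0 => himm ?_
            rw [trip, triple_product_permutation, ← cross_anticomm, dotProduct_neg, dotProduct_comm,
              h0, neg_zero]
        have h2 := hL2 i k h1
        apply h2
        rw [← hmap]
        exact mem_image_of_mem _ hk2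
    · exact hxL i true fun h => hc h.2
  · rcases hL3 i j hij with ⟨u, hu, htr⟩ | ⟨k, hk⟩
    · exact Or.inl ⟨Ψ.symm.map u, by rw [← image_inter hdiff.1.1, hu, image_singleton],
        htr.image hdiff⟩
    · refine Or.inr ⟨k, ?_⟩
      rw [← image_inter hdiff.1.1, hk, ← hback]
      rfl

end NodalCurve

/-! ### Stable bounds for the number of zeros -/

lemma continuous_iteratedDeriv_param {E : Type*} [NormedAddCommGroup E] [NormedSpace ℝ E] (j : ℕ) :
    ∀ {h : E × ℝ → ℝ}, ContDiff ℝ ∞ h →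
      Continuous fun p : E × ℝ => iteratedDeriv j (fun θ => h (p.1, θ)) p.2 := by
  induction j with
  | zero => intro h hh; simpa using hh.continuous
  | succ j ih =>
    intro h hh
    have h1 : ∀ e : E, deriv (fun θ => h (e, θ)) = fun θ => fderiv ℝ h (e, θ) (0, 1) := fun e =>
      funext fun θ => ((hh.differentiable (by simp) (e, θ)).hasFDerivAt.comp_hasDerivAt (l := h) θ
        ((hasDerivAt_const θ e).prodMk (hasDerivAt_id θ))).deriv
    have h2 : ContDiff ℝ ∞ fun p : E × ℝ => fderiv ℝ h p (0, 1) :=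
      (hh.fderiv_right (m := ∞) (by simp)).clm_apply contDiff_const
    simpa only [iteratedDeriv_succ', h1] using ih h2

namespace StableZeros

lemma eventually {E : Type*} [NormedAddCommGroup E] [NormedSpace ℝ E] {h : E × ℝ → ℝ}
    (hh : ContDiff ℝ ∞ h) {e₀ : E} {N : ℕ} (hs : StableZeros (fun θ => h (e₀, θ)) N) :
    ∀ᶠ e in 𝓝 e₀, StableZeros (fun θ => h (e, θ)) N := by
  obtain ⟨η, hη, M, a, b, hs⟩ := hs
  have h1 : ∀ j : Fin (M + 1), ∀ᶠ e in 𝓝 e₀, ∀ x ∈ Icc a b,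
      |iteratedDeriv j (fun θ => h (e, θ)) x - iteratedDeriv j (fun θ => h (e₀, θ)) x| < η / 2 := by
    intro j
    refine isCompact_Icc.eventually_forall_of_forall_eventually fun x _ => ?_
    have hc := continuous_iteratedDeriv_param (j : ℕ) hh
    have hc2 : Continuous fun p : E × ℝ => |iteratedDeriv j (fun θ => h (p.1, θ)) p.2 -
        iteratedDeriv j (fun θ => h (e₀, θ)) p.2| :=
      (hc.sub (hc.comp (continuous_const.prodMk continuous_snd))).abs
    exact (hc2.tendsto (e₀, x)).eventually (gt_mem_nhds (by simpa using half_pos hη))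
  filter_upwards [eventually_all.2 h1] with e he
  refine ⟨η / 2, half_pos hη, M, a, b, fun g hg hq hc => hs g hg hq ?_⟩
  have := hc.add (η' := η / 2) (h := fun θ => h (e₀, θ)) fun j hj x hx =>
    he ⟨j, Nat.lt_succ_of_le hj⟩ x hx
  rwa [add_halves] at this

lemma const_mul {f : ℝ → ℝ} {N : ℕ} (h : StableZeros f N) {c : ℝ} (hc : c ≠ 0) :
    StableZeros (fun θ => c * f θ) N := by
  obtain ⟨η, hη, M, a, b, h⟩ := h
  refine ⟨|c| * η, by positivity, M, a, b, fun g hg ⟨ς, hς, hq⟩ hcl => ?_⟩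
  have h1 := h (fun θ => c⁻¹ * g θ) (contDiff_const.mul hg)
    ⟨ς, hς, fun x => by rw [hq]; ring⟩ fun j hj x hx => by
      have h2 := hcl j hj x hx
      rw [iteratedDeriv_const_mul_field] at h2 ⊢
      have h3 : c⁻¹ * iteratedDeriv j g x - iteratedDeriv j f x =
        c⁻¹ * (iteratedDeriv j g x - c * iteratedDeriv j f x) := by field_simp
      rw [h3, abs_mul, abs_inv, inv_mul_lt_iff₀ (abs_pos.2 hc)]
      exact h2
  exact fun d T hT => h1 d T fun x hx => ⟨(hT x hx).1, by simp [(hT x hx).2]⟩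

lemma of_deriv {f : ℝ → ℝ} {N : ℕ} (h : StableZeros (deriv f) N) : StableZeros f N := by
  obtain ⟨η, hη, M, a, b, h⟩ := h
  refine ⟨η, hη, M + 1, a, b, fun g hg ⟨ς, hς, hq⟩ hcl => ?_⟩
  have hgd := hg.differentiable (by simp)
  refine ZerosLE.of_deriv hgd hq (h _ (contDiff_infty_iff_deriv.1 hg).2 ⟨ς, hς, fun x => ?_⟩
    fun j hj x hx => ?_)
  · rw [← deriv_comp_add_const, funext hq, deriv_const_mul _ (hgd x)]
  · rw [← iteratedDeriv_succ', ← iteratedDeriv_succ']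
    exact hcl (j + 1) (by omega) x hx

lemma of_orders {f : ℝ → ℝ} (hf : ContDiff ℝ ∞ f) (s : ℝ) (Z : Finset ℝ) (m : ℝ → ℕ)
    (hZ : ∀ x ∈ Icc s (s + π), f x = 0 → x ∈ Z) (hm : ∀ z ∈ Z, iteratedDeriv (m z) f z ≠ 0) :
    StableZeros f (∑ z ∈ Z, m z) := by
  obtain ⟨η, hη, M, h⟩ := exists_zeros_le hf Z m hZ hm isClosed_univ
  refine ⟨η, hη, M, s, s + π, fun g hg ⟨ς, hς, hq⟩ hcl => zerosLE_of_window hς hq s fun T hT => ?_⟩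
  simpa using h g hg hcl T fun x hx => ⟨Ico_subset_Icc_self (hT x hx).1, mem_univ _, (hT x hx).2⟩

lemma of_ne_zero {f : ℝ → ℝ} (hf : ContDiff ℝ ∞ f) (h : ∀ x, f x ≠ 0) : StableZeros f 0 := by
  simpa using of_orders hf 0 ∅ 0 (fun x _ h0 => absurd h0 (h x)) (by simp)

lemma sinusoid {A B : ℝ} (h : A ≠ 0 ∨ B ≠ 0) :
    StableZeros (fun θ => B * cos (2 * θ) - A * sin (2 * θ)) 2 := by
  set w : ℂ := ⟨B, A⟩ with hw
  have hw0 : w ≠ 0 := fun h0 => by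
    have h1 := congrArg Complex.re h0
    have h2 := congrArg Complex.im h0
    simp only [hw, Complex.zero_re, Complex.zero_im] at h1 h2
    tauto
  set R := ‖w‖
  set s := w.arg / 2 with hs
  have hR : R ≠ 0 := norm_ne_zero_iff.2 hw0
  have hB : B = R * cos (2 * s) := by
    rw [show 2 * s = w.arg by ring]; exact (Complex.norm_mul_cos_arg w).symm
  have hA : A = R * sin (2 * s) := by
    rw [show 2 * s = w.arg by ring]; exact (Complex.norm_mul_sin_arg w).symm
  have e : (fun θ => B * cos (2 * θ) - A * sin (2 * θ)) =
      fun θ => R * cos (2 * (θ + s)) := funext fun θ => by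
    rw [mul_add, Real.cos_add, hA, hB]; ring
  rw [e]
  have hpi := Real.pi_pos
  have hd : ∀ θ, HasDerivAt (fun θ => R * cos (2 * (θ + s)))
      (R * (-sin (2 * (θ + s)) * (2 * 1))) θ := fun θ =>
    (((((hasDerivAt_id θ).add_const s).const_mul 2).cos).const_mul R)
  have h1 := of_orders (f := fun θ => R * cos (2 * (θ + s))) (by fun_prop) (-s)
    {-s + π / 4, -s + 3 * π / 4} (fun _ => 1) (fun x hx h0 => by
      obtain ⟨k, hk⟩ := Real.cos_eq_zero_iff.1 ((mul_eq_zero.1 h0).resolve_left hR)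
      have h2 : (-1 : ℝ) < k := by
        by_contra! h
        nlinarith [hx.1, mul_le_mul_of_nonneg_right h hpi.le]
      have h3 : (k : ℝ) < 2 := by
        by_contra! h
        nlinarith [hx.2, mul_le_mul_of_nonneg_right h hpi.le]
      have h4 : -1 < k := by exact_mod_cast h2
      have h5 : k < 2 := by exact_mod_cast h3
      simp only [Finset.mem_insert, Finset.mem_singleton]
      interval_cases k
      · left; push_cast at hk; linarith
      · right; push_cast at hk; linarith) (fun z hz => by
      rw [iteratedDeriv_one, (hd z).deriv]
      refine mul_ne_zero hR (mul_ne_zero (neg_ne_zero.2 fun h0 => ?_) (by norm_num))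
      have h2 : cos (2 * (z + s)) = 0 := by
        simp only [Finset.mem_insert, Finset.mem_singleton] at hz
        rcases hz with rfl | rfl
        · rw [show 2 * (-s + π / 4 + s) = π / 2 by ring, Real.cos_pi_div_two]
        · rw [show 2 * (-s + 3 * π / 4 + s) = π / 2 + π by ring, Real.cos_add_pi,
            Real.cos_pi_div_two, neg_zero]
      have := Real.sin_sq_add_cos_sq (2 * (z + s))
      rw [h0, h2] at this
      norm_num at this)
  rwa [Finset.sum_const, Finset.card_pair (by linarith), smul_eq_mul, mul_one] at h1

end StableZeros

/-- Covectors that depend on a small parameter accumulate, up to scaling. -/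
lemma exists_of_eventually_covector {n : ℕ} {a : ℝ → Fin n → R3}
    (ha : ∀ ε, 0 < ε → ε ≤ 1 → ∀ i, a ε i ≠ 0) {Q : R3 → ℝ → Prop}
    (hQ : ∀ a₀ : R3, a₀ ≠ 0 → ∀ᶠ p : R3 × ℝ in 𝓝 (a₀, 0), 0 < p.2 → Q p.1 p.2) :
    ∃ ε : ℝ, 0 < ε ∧ ε ≤ 1 ∧ ∀ i, ∃ c : ℝ, c ≠ 0 ∧ Q (c • a ε i) ε := by
  set A : ℝ → Fin n → R3 := fun ε i => ‖a ε i‖⁻¹ • a ε i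
  have hs : ∀ᶠ ε in 𝓝[>] (0 : ℝ), 0 < ε ∧ ε ≤ 1 := by
    filter_upwards [self_mem_nhdsWithin, nhdsWithin_le_nhds (eventually_le_nhds one_pos)]
      with ε h1 h2 using ⟨h1, h2⟩
  have hK : IsCompact (univ.pi fun _ : Fin n => Metric.sphere (0 : R3) 1) :=
    isCompact_univ_pi fun _ => isCompact_sphere _ _
  obtain ⟨A₀, hA₀, hcl⟩ := hK.exists_mapClusterPt_of_frequently (l := 𝓝[>] (0 : ℝ)) (f := A) (by
    refine Eventually.frequently ?_
    filter_upwards [hs] with ε hε i _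
    simp [A, norm_smul, inv_mul_cancel₀ (norm_ne_zero_iff.2 (ha ε hε.1 hε.2 i))])
  have h1 : ∀ᶠ p : (Fin n → R3) × ℝ in 𝓝 A₀ ×ˢ 𝓝 0, 0 < p.2 → ∀ i, Q (p.1 i) p.2 := by
    rw [← nhds_prod_eq]
    have h2 : ∀ i, ∀ᶠ p : (Fin n → R3) × ℝ in 𝓝 (A₀, 0), 0 < p.2 → Q (p.1 i) p.2 := fun i => by
      have hne : A₀ i ≠ 0 := fun h0 => by
        have := hA₀ i (mem_univ i)
        simp [h0] at this
      have hc : Continuous fun p : (Fin n → R3) × ℝ => (p.1 i, p.2) := by fun_prop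
      exact (hc.tendsto (A₀, 0)).eventually (hQ (A₀ i) hne)
    filter_upwards [eventually_all.2 h2] with p hp h0 i using hp i h0
  obtain ⟨pa, hpa, pb, hpb, h2⟩ := eventually_prod_iff.1 h1
  obtain ⟨ε, h3, ⟨h4, h5⟩, h6⟩ := ((hcl.frequently hpa).and_eventually
    (hs.and (nhdsWithin_le_nhds hpb))).exists
  exact ⟨ε, h4, h5, fun i => ⟨‖a ε i‖⁻¹, inv_ne_zero (norm_ne_zero_iff.2 (ha ε h4 h5 i)),
    h2 h3 h6 h4 i⟩⟩

/-- Shrinking of the unit disks of the charts. -/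
lemma ChartFamily.exists_shrink {ι : Type} (Ch : ChartFamily ι) [Finite ι] {ε : ℝ} (h0 : 0 < ε)
    (h1 : ε ≤ 1) : ∃ Θ : HD, (∀ k z, |z.1| ≤ 1 → |z.2| ≤ 1 → Θ (Ch.F k z) = Ch.F k (ε • z)) ∧
      ∀ v, (∀ k z, pt v ≠ pt (Ch.F k z)) → Θ v = v := by
  set β := squeezeFactor 1 fun _ => ε with hβdef
  have hβ : ContDiff ℝ ∞ β := contDiff_squeezeFactor contDiff_const
  have hβ0 : ∀ u, 0 < β u := fun u => squeezeFactor_pos one_pos h0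
  have hβ1 : ∀ u, β u ≤ 1 := squeezeFactor_le_one one_pos fun _ _ => h1
  have hβε : ∀ u, |u| ≤ 1 → β u = ε := fun u hu => by rw [hβdef, squeezeFactor_of_le hu, div_one]
  set η : ℝ × ℝ → ℝ × ℝ := fun z => (squeezeMap 1 β (squeezeMap 1 β z).swap).swap with hη
  set ζ : ℝ × ℝ → ℝ × ℝ := fun z => unsqueezeMap 1 β (unsqueezeMap 1 β z.swap).swap with hζ
  have hsw : ContDiff ℝ ∞ (Prod.swap : ℝ × ℝ → ℝ × ℝ) := contDiff_snd.prodMk contDiff_fst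
  have hid : ∀ z ∉ Icc (-2 : ℝ) 2 ×ˢ Icc (-2 : ℝ) 2, squeezeMap 1 β z = z := by
    intro z hz
    by_cases h2 : 2 ≤ |z.1|
    · rw [squeezeMap, hβdef, squeezeFactor_of_ge h2, squeeze_one]
    · have h3 : 2 * 1 ≤ |z.2| := by
        by_contra! h3
        exact hz ⟨abs_le.1 (not_le.1 h2).le, abs_le.1 (by linarith)⟩
      rw [squeezeMap, squeeze_of_ge one_pos h3]
  have hs := contDiff_squeezeMap (M := 1) hβ
  have hu := contDiff_unsqueezeMap one_pos hβ hβ0 hβ1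
  set Θ := Ch.hd (fun _ => η) (fun _ => ζ) (fun _ => Icc (-2) 2 ×ˢ Icc (-2) 2)
    (fun _ => hsw.comp (hs.comp (hsw.comp hs))) (fun _ => hu.comp (hsw.comp (hu.comp hsw)))
    (fun _ => isCompact_Icc.prod isCompact_Icc)
    (fun _ z hz => by
      have hz2 : z.swap ∉ Icc (-2 : ℝ) 2 ×ˢ Icc (-2 : ℝ) 2 := fun h => hz ⟨h.2, h.1⟩
      simp only [hη, hid z hz, hid _ hz2, Prod.swap_swap])
    (fun _ z => by simp only [hη, hζ, Prod.swap_swap, unsqueezeMap_squeezeMap hβ0 hβ1])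
    (fun _ z => by simp only [hη, hζ, Prod.swap_swap, squeezeMap_unsqueezeMap one_pos]) with hΘ
  refine ⟨Θ, fun k z h2 h3 => ?_, fun v hv => ?_⟩
  · have h4 : η z = ε • z := by
      have h5 : |ε * z.2| ≤ 1 := by
        rw [abs_mul, abs_of_pos h0]
        exact mul_le_one₀ h1 (abs_nonneg _) h3
      simp only [hη, squeezeMap, hβε _ h2, squeeze_of_le one_pos h3, Prod.swap, hβε _ h5,
        squeeze_of_le one_pos h2]
      rfl
    have := Ch.move_smul (fun _ => η) k one_ne_zero z
    rw [one_smul, one_smul, h4] at this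
    exact this
  · exact Ch.move_of_not (fun _ => η) fun k c z hc e => hv k z (by rw [e, pt_smul hc])

/-! ### Binary forms -/

namespace BinaryForm

open MvPolynomial

variable {𝕜 : Type*} [RCLike 𝕜] {p : MvPolynomial (Fin 2) ℝ} {n : ℕ}

lemma aeval_smul (hp : p.IsHomogeneous n) (c : 𝕜) (z : Fin 2 → 𝕜) :
    aeval (c • z) p = c ^ n * aeval z p := by
  rw [aeval_def, aeval_def, eval₂_eq', eval₂_eq', Finset.mul_sum]
  refine Finset.sum_congr rfl fun d hd => ?_
  have h1 := hp (mem_support_iff.1 hd)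
  rw [Finsupp.weight_apply, Finsupp.sum_fintype _ _ (by simp)] at h1
  simp only [Fin.sum_univ_two, Pi.one_apply, smul_eq_mul, mul_one] at h1
  simp only [Fin.prod_univ_two, Pi.smul_apply, smul_eq_mul, mul_pow, ← h1, pow_add]
  ring

lemma aeval_ofReal (x : Fin 2 → ℝ) : aeval (fun j => (x j : ℂ)) p = ((aeval x p : ℝ) : ℂ) := by
  have := MvPolynomial.aeval_algebraMap_apply ℂ x p
  exact this

lemma aeval_conj (z : Fin 2 → ℂ) : aeval (fun j => conj (z j)) p = conj (aeval z p) := by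
  have h : (Complex.conjAe.toAlgHom.comp (aeval z) : MvPolynomial (Fin 2) ℝ →ₐ[ℝ] ℂ) =
      aeval (fun j => conj (z j)) := by
    ext j; simp
  exact (congrArg (fun f => f p) h).symm

lemma hasStrictFDerivAt (p : MvPolynomial (Fin 2) ℝ) (z : Fin 2 → 𝕜) :
    HasStrictFDerivAt (fun z : Fin 2 → 𝕜 => aeval z p)
      (∑ j, aeval z (pderiv j p) • (ContinuousLinearMap.proj j : (Fin 2 → 𝕜) →L[𝕜] 𝕜)) z := by
  induction p using MvPolynomial.induction_on with
  | C a =>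
    simp only [aeval_C]
    refine (hasStrictFDerivAt_const (𝕜 := 𝕜) (algebraMap ℝ 𝕜 a) z).congr_fderiv
      (ContinuousLinearMap.ext fun v => ?_)
    simp
  | add p q hp hq =>
    simp only [map_add]
    refine (hp.fun_add hq).congr_fderiv (ContinuousLinearMap.ext fun v => ?_)
    simp [Fin.sum_univ_two]; ring
  | mul_X p i hp =>
    have h1 := hp.fun_mul (ContinuousLinearMap.proj i : (Fin 2 → 𝕜) →L[𝕜] 𝕜).hasStrictFDerivAt
    simp only [map_mul, aeval_X]
    refine h1.congr_fderiv (ContinuousLinearMap.ext fun v => ?_)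
    simp only [Fin.sum_univ_two, Derivation.leibniz, pderiv_X, smul_eq_mul]
    fin_cases i <;> simp <;> ring

lemma euler (hp : p.IsHomogeneous n) (z : Fin 2 → 𝕜) :
    ∑ j, z j * aeval z (pderiv j p) = n * aeval z p := by
  have := congrArg (aeval z) hp.sum_X_mul_pderiv
  simpa using this

/-- A binary form of positive degree has a nontrivial complex zero. -/
lemma exists_zero (hp : p.IsHomogeneous n) (hn : n ≠ 0) : ∃ z : Fin 2 → ℂ, z ≠ 0 ∧ aeval z p = 0 := by
  set q : Polynomial ℂ := aeval ![1, Polynomial.X] p with hq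
  have hqe : ∀ T : ℂ, q.eval T = aeval ![1, T] p := fun T => by
    have h : ((Polynomial.aeval T).restrictScalars ℝ).comp
        (aeval ![(1 : Polynomial ℂ), Polynomial.X] : MvPolynomial (Fin 2) ℝ →ₐ[ℝ] Polynomial ℂ) =
        aeval ![(1 : ℂ), T] := by
      ext j; fin_cases j <;> simp
    have := congrArg (fun f => f p) h
    simpa using this
  by_cases hd : q.degree = 0
  · refine ⟨![0, 1], fun h => one_ne_zero (congrFun h 1), ?_⟩
    have hc : ∀ T, q.eval T = q.coeff 0 := fun T => by
      conv_lhs => rw [Polynomial.eq_C_of_degree_eq_zero hd]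
      simp
    have h1 : Continuous fun t : ℂ => aeval ![t, 1] p := by
      have : ∀ z : Fin 2 → ℂ, ContinuousAt (fun z : Fin 2 → ℂ => aeval z p) z := fun z =>
        (hasStrictFDerivAt p z).hasFDerivAt.continuousAt
      exact (continuous_iff_continuousAt.2 this).comp (by fun_prop)
    have h2 : ∀ t : ℂ, t ≠ 0 → aeval ![t, 1] p = t ^ n * q.coeff 0 := fun t ht => by
      rw [← hc t⁻¹, hqe, ← aeval_smul hp]
      congr 1; ext j; fin_cases j <;> simp [ht]
    have h3 : Tendsto (fun t : ℂ => aeval ![t, 1] p) (𝓝[≠] 0) (𝓝 (0 ^ n * q.coeff 0)) := by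
      have h4 : Continuous fun t : ℂ => t ^ n * q.coeff 0 := by fun_prop
      refine ((h4.tendsto 0).mono_left nhdsWithin_le_nhds).congr' ?_
      filter_upwards [self_mem_nhdsWithin] with t ht using (h2 t ht).symm
    have h5 := tendsto_nhds_unique ((h1.tendsto 0).mono_left nhdsWithin_le_nhds) h3
    rwa [zero_pow hn, zero_mul] at h5
  · obtain ⟨T, hT⟩ := IsAlgClosed.exists_root q hd
    exact ⟨![1, T], fun h => one_ne_zero (congrFun h 0), by rw [← hqe]; exact hT⟩

end BinaryForm

/-! ### The points of a nodal rational quintic -/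

lemma linearIndependent_pair_iff {z w : Fin 2 → ℂ} :
    LinearIndependent ℂ ![z, w] ↔ z 0 * w 1 - z 1 * w 0 ≠ 0 := by
  have : LinearIndependent ℂ ![z, w] ↔ IsUnit (Matrix.of ![z, w]) :=
    Matrix.linearIndependent_rows_iff_isUnit (A := Matrix.of ![z, w])
  rw [this, Matrix.isUnit_iff_isUnit_det, Matrix.det_fin_two, isUnit_iff_ne_zero]
  rfl

lemma exists_circle (x : Fin 2 → ℝ) : ∃ r θ : ℝ, x = r • ![cos θ, sin θ] := by
  set w : ℂ := ⟨x 0, x 1⟩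
  refine ⟨‖w‖, w.arg, ?_⟩
  ext j; fin_cases j
  · exact (Complex.norm_mul_cos_arg w).symm
  · exact (Complex.norm_mul_sin_arg w).symm

/-- A point of the complex projective line that agrees with its conjugate is real. -/
lemma exists_real_of_dependent {z : Fin 2 → ℂ} (h : z 0 * conj (z 1) - z 1 * conj (z 0) = 0) :
    ∃ (c : ℂ) (θ : ℝ), z = c • NodalRationalQuintic.circlePoint θ := by
  by_cases hz : z = 0
  · exact ⟨0, 0, by simp [hz]⟩
  obtain ⟨j, hj⟩ : ∃ j, z j ≠ 0 := by by_contra! h; exact hz (funext h)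
  have hreal : ∀ i, z i * conj (z j) = ((z i * conj (z j)).re : ℂ) := by
    intro i
    refine (Complex.conj_eq_iff_re.1 ?_).symm
    fin_cases i <;> fin_cases j <;> simp only [Fin.zero_eta, Fin.mk_one, map_mul, Complex.conj_conj] <;>
      first | ring1 | linear_combination h | linear_combination -h
  obtain ⟨r, θ, hr⟩ := exists_circle fun i => (z i * conj (z j)).re
  have hj' : conj (z j) ≠ 0 := (map_ne_zero _).2 hj
  refine ⟨r / conj (z j), θ, funext fun i => ?_⟩
  have h1 := congrFun hr i
  have h2 := hreal i
  rw [h1] at h2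
  rw [Pi.smul_apply, smul_eq_mul, div_mul_eq_mul_div, eq_div_iff hj', h2]
  fin_cases i <;> simp [NodalRationalQuintic.circlePoint]

namespace NodalRationalQuintic

variable (C : NodalRationalQuintic)

/-- The values of the forms. -/
def val {𝕜 : Type*} [RCLike 𝕜] (z : Fin 2 → 𝕜) (i : Fin 3) : 𝕜 :=
  MvPolynomial.aeval z (C.form i)

/-- The parametrization of the real part of the curve. -/
def loop (θ : ℝ) : R3 := C.val ![cos θ, sin θ]

lemma val_smul {𝕜 : Type*} [RCLike 𝕜] (c : 𝕜) (z : Fin 2 → 𝕜) : C.val (c • z) = c ^ 5 • C.val z :=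
  funext fun i => BinaryForm.aeval_smul (C.homogeneous i) c z

lemma val_circlePoint (θ : ℝ) (i : Fin 3) : C.val (circlePoint θ) i = (C.loop θ i : ℂ) := by
  have h : circlePoint θ = fun j => ((![cos θ, sin θ] j : ℝ) : ℂ) := by ext j; fin_cases j <;> rfl
  rw [h]
  exact BinaryForm.aeval_ofReal _

lemma val_conj (z : Fin 2 → ℂ) (i : Fin 3) : C.val (fun j => conj (z j)) i = conj (C.val z i) :=
  BinaryForm.aeval_conj z

lemma val_ne_zero {z : Fin 2 → ℂ} (hz : z ≠ 0) : C.val z ≠ 0 := fun h =>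
  hz (C.no_base_point z (congrFun h))

lemma circlePoint_ne_zero (θ : ℝ) : circlePoint θ ≠ 0 := fun h => by
  have h0 : (cos θ : ℂ) = 0 := congrFun h 0
  have h1 : (sin θ : ℂ) = 0 := congrFun h 1
  norm_cast at h0 h1
  have := Real.sin_sq_add_cos_sq θ
  rw [h0, h1] at this
  norm_num at this

lemma loop_ne_zero (θ : ℝ) : C.loop θ ≠ 0 := fun h =>
  C.val_ne_zero (circlePoint_ne_zero θ) (funext fun i => by simp [val_circlePoint, h])

lemma loop_add_pi (θ : ℝ) : C.loop (θ + π) = (-1 : ℝ) • C.loop θ := by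
  have h : ![cos (θ + π), sin (θ + π)] = (-1 : ℝ) • ![cos θ, sin θ] := by
    ext j; fin_cases j <;> simp [Real.cos_add_pi, Real.sin_add_pi]
  rw [loop, h, val_smul]
  norm_num [loop]

variable {C}

lemma mapsTo_pt {z : Fin 2 → ℂ} {v : R3} (hv : v ≠ 0) :
    C.MapsTo z (pt v) ↔ z ≠ 0 ∧ ∃ c : ℂ, ∀ i, C.val z i = c * (v i : ℂ) := by
  obtain ⟨d, hd, h⟩ := (pt_eq_iff hv (pt v).coords_ne_zero).1 (pt_coords (pt v)).symm
  have hd' : (d : ℂ) ≠ 0 := by exact_mod_cast hd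
  refine and_congr_right fun _ => ⟨?_, ?_⟩
  · rintro ⟨c, hc⟩
    exact ⟨c * d, fun i => (hc i).trans (by rw [h]; simp [mul_assoc])⟩
  · rintro ⟨c, hc⟩
    refine ⟨c / d, fun i => (hc i).trans ?_⟩
    rw [h]
    simp only [Pi.smul_apply, smul_eq_mul, Complex.ofReal_mul]
    field_simp

lemma mapsTo_unique {z : Fin 2 → ℂ} {x y : RP2} (hx : C.MapsTo z x) (hy : C.MapsTo z y) : x = y := by
  obtain ⟨v, hv, rfl⟩ := exists_pt x
  obtain ⟨w, hw, rfl⟩ := exists_pt y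
  obtain ⟨hz, c, hc⟩ := (mapsTo_pt hv).1 hx
  obtain ⟨-, d, hd⟩ := (mapsTo_pt hw).1 hy
  rw [pt_eq_iff_cross hv hw]
  have hc0 : c ≠ 0 := by rintro rfl; exact C.val_ne_zero hz (funext fun i => by simp [hc])
  have hd0 : d ≠ 0 := by rintro rfl; exact C.val_ne_zero hz (funext fun i => by simp [hd])
  have key : ∀ i j, v i * w j - v j * w i = 0 := fun i j => by
    have : (c * d) * ((v i : ℂ) * w j - v j * w i) = 0 := by
      linear_combination (d * w j) * ((hc i).symm.trans (hd i)) - (d * w i) * ((hc j).symm.trans (hd j))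
    have := (mul_eq_zero.1 this).resolve_left (mul_ne_zero hc0 hd0)
    exact_mod_cast this
  ext i; fin_cases i <;> simp [cross_apply, key]

lemma mapsTo_smul {z : Fin 2 → ℂ} {x : RP2} {c : ℂ} (hc : c ≠ 0) (h : C.MapsTo z x) :
    C.MapsTo (c • z) x := by
  obtain ⟨v, hv, rfl⟩ := exists_pt x
  obtain ⟨hz, d, hd⟩ := (mapsTo_pt hv).1 h
  exact (mapsTo_pt hv).2 ⟨smul_ne_zero hc hz, c ^ 5 * d, fun i => by
    rw [val_smul, Pi.smul_apply, hd, smul_eq_mul, mul_assoc]⟩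

lemma mapsTo_conj {z : Fin 2 → ℂ} {x : RP2} (h : C.MapsTo z x) :
    C.MapsTo (fun j => conj (z j)) x := by
  obtain ⟨v, hv, rfl⟩ := exists_pt x
  obtain ⟨hz, d, hd⟩ := (mapsTo_pt hv).1 h
  refine (mapsTo_pt hv).2 ⟨fun h0 => hz (funext fun j => ?_), conj d, fun i => ?_⟩
  · simpa using congrFun h0 j
  · rw [val_conj, hd, map_mul, Complex.conj_ofReal]

lemma mapsTo_circle {θ : ℝ} {x : RP2} : C.MapsTo (circlePoint θ) x ↔ pt (C.loop θ) = x := by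
  have h : C.MapsTo (circlePoint θ) (pt (C.loop θ)) :=
    (mapsTo_pt (C.loop_ne_zero θ)).2 ⟨circlePoint_ne_zero θ, 1, fun i => by
      rw [val_circlePoint, one_mul]⟩
  exact ⟨fun h1 => mapsTo_unique h h1, fun h1 => h1 ▸ h⟩

lemma not_mapsTo_three {z : Fin 3 → Fin 2 → ℂ} {x : RP2}
    (hz : ∀ a b, a ≠ b → LinearIndependent ℂ ![z a, z b]) (h : ∀ a, C.MapsTo (z a) x) : False := by
  obtain ⟨a, b, hab⟩ := C.no_triple_point z hz
  obtain ⟨v, hv, rfl⟩ := exists_pt x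
  obtain ⟨-, c, hc⟩ := (mapsTo_pt hv).1 (h a)
  obtain ⟨h0, d, hd⟩ := (mapsTo_pt hv).1 (h b)
  have h1 := (LinearIndependent.pair_iff.1 hab d (-c) (funext fun i => by
    have e1 : MvPolynomial.aeval (z a) (C.form i) = c * (v i : ℂ) := hc i
    have e2 : MvPolynomial.aeval (z b) (C.form i) = d * (v i : ℂ) := hd i
    simp only [Pi.add_apply, Pi.smul_apply, smul_eq_mul, e1, e2, Pi.zero_apply]; ring)).1
  exact C.val_ne_zero h0 (funext fun i => by rw [hd, h1]; simp)

lemma linearIndependent_circle {s t : ℝ} :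
    LinearIndependent ℂ ![circlePoint s, circlePoint t] ↔ sin (t - s) ≠ 0 := by
  rw [linearIndependent_pair_iff, Real.sin_sub]
  simp only [circlePoint, Matrix.cons_val_zero, Matrix.cons_val_one]
  norm_cast
  rw [show sin t * cos s - cos t * sin s = cos s * sin t - sin s * cos t by ring]

lemma linearIndependent_conj_circle {z : Fin 2 → ℂ}
    (hz : LinearIndependent ℂ ![z, fun j => conj (z j)]) (θ : ℝ) :
    LinearIndependent ℂ ![z, circlePoint θ] := by
  rw [linearIndependent_pair_iff] at hz ⊢
  simp only [circlePoint, Matrix.cons_val_zero, Matrix.cons_val_one]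
  intro h
  have h2 := congrArg conj h
  simp only [map_sub, map_mul, Complex.conj_ofReal, map_zero] at h2
  have h0 : (cos θ : ℂ) ≠ 0 ∨ (sin θ : ℂ) ≠ 0 := by
    by_contra! h3
    exact circlePoint_ne_zero θ (funext fun j => by fin_cases j; exacts [h3.1, h3.2])
  apply hz
  rcases h0 with h0 | h0 <;> apply mul_left_cancel₀ h0
  · linear_combination (z 0) * -h2 + conj (z 0) * h
  · linear_combination (z 1) * -h2 + conj (z 1) * h

/-- The real points are the points of the real branches and the elliptic nodes. -/
lemma mem_realPoints {x : RP2} :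
    x ∈ C.realPoints ↔ (∃ θ, pt (C.loop θ) = x) ∨ ∃ e : C.EllipticNode, e.1 = x := by
  constructor
  · rintro ⟨z, hz⟩
    by_cases h : LinearIndependent ℂ ![z, fun j => conj (z j)]
    · exact Or.inr ⟨⟨x, z, h, hz⟩, rfl⟩
    · rw [linearIndependent_pair_iff, not_not] at h
      obtain ⟨c, θ, rfl⟩ := exists_real_of_dependent h
      have hc : c ≠ 0 := by rintro rfl; exact hz.1 (zero_smul _ _)
      refine Or.inl ⟨θ, mapsTo_circle.1 ?_⟩
      have := mapsTo_smul (inv_ne_zero hc) hz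
      rwa [smul_smul, inv_mul_cancel₀ hc, one_smul] at this
  · rintro (⟨θ, rfl⟩ | ⟨⟨_, z, -, hz⟩, rfl⟩)
    · exact ⟨_, mapsTo_circle.2 rfl⟩
    · exact ⟨z, hz⟩

lemma loop_ne_elliptic (θ : ℝ) (e : C.EllipticNode) : pt (C.loop θ) ≠ e.1 := by
  obtain ⟨x, z, hz, hx⟩ := e
  intro h
  have h1 := linearIndependent_conj_circle hz θ
  have h2 : LinearIndependent ℂ ![fun j => conj (z j), circlePoint θ] :=
    linearIndependent_conj_circle (by
      rw [linearIndependent_pair_iff] at hz ⊢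
      simp only [Complex.conj_conj]
      exact fun h => hz (by linear_combination -h)) θ
  have symm : ∀ {u v : Fin 2 → ℂ}, LinearIndependent ℂ ![u, v] → LinearIndependent ℂ ![v, u] :=
    fun {u v} h => by
      rw [linearIndependent_pair_iff] at h ⊢
      exact fun h' => h (by linear_combination -h')
  refine not_mapsTo_three (C := C) (x := x)
    (z := ![z, fun j => conj (z j), circlePoint θ]) (fun a b hab => ?_) (fun a => ?_)
  · fin_cases a <;> fin_cases b
    · exact absurd rfl hab
    · exact hz
    · exact h1
    · exact symm hz
    · exact absurd rfl hab
    · exact h2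
    · exact symm h1
    · exact symm h2
    · exact absurd rfl hab
  · fin_cases a
    · exact hx
    · exact mapsTo_conj hx
    · exact mapsTo_circle.2 h

/-- Two parameters of the same point either agree or belong to a hyperbolic node. -/
lemma loop_inj {s t : ℝ} (h : pt (C.loop s) = pt (C.loop t)) :
    (∃ n : ℤ, t = s + n * π) ∨ ∃ k : C.HyperbolicNode, pt (C.loop s) = k.1 := by
  by_cases h1 : sin (t - s) = 0
  · obtain ⟨n, hn⟩ := Real.sin_eq_zero_iff.1 h1
    exact Or.inl ⟨n, by linarith⟩
  · exact Or.inr ⟨⟨_, s, t, linearIndependent_circle.2 h1, mapsTo_circle.2 rfl,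
      mapsTo_circle.2 h.symm⟩, rfl⟩

end NodalRationalQuintic

/-! ### Immersion and finiteness of nodes -/

namespace NodalRationalQuintic

variable {C : NodalRationalQuintic}

lemma eq_zero_of_deriv {z : Fin 2 → ℂ} (hz : z ≠ 0) {h : Fin 2 → ℂ}
    (h0 : ∀ i, ∑ j, MvPolynomial.aeval z (MvPolynomial.pderiv j (C.form i)) * h j = 0) : h = 0 :=
  funext (Fintype.linearIndependent_iff.1 (C.immersed z hz) h (funext fun i => by
    simpa [Fin.sum_univ_two, mul_comm] using h0 i))

lemma analyticAt_loop (i : Fin 3) (θ : ℝ) : AnalyticAt ℝ (fun θ => C.loop θ i) θ := by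
  refine AnalyticAt.aeval_mvPolynomial (f := fun θ : ℝ => ![cos θ, sin θ]) (fun j => ?_) _
  fin_cases j
  · exact Real.analyticAt_cos
  · exact Real.analyticAt_sin

lemma contDiff_loop : ContDiff ℝ ∞ C.loop :=
  contDiff_pi.2 fun i => contDiff_iff_contDiffAt.2 fun θ => (analyticAt_loop i θ).contDiffAt

lemma hasDerivAt_loop (i : Fin 3) (θ : ℝ) : HasDerivAt (fun θ => C.loop θ i)
    (-(MvPolynomial.aeval ![cos θ, sin θ] (MvPolynomial.pderiv 0 (C.form i)) * sin θ) +
      MvPolynomial.aeval ![cos θ, sin θ] (MvPolynomial.pderiv 1 (C.form i)) * cos θ) θ := by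
  have h1 : HasDerivAt (fun θ : ℝ => ![cos θ, sin θ]) ![-sin θ, cos θ] θ := by
    refine hasDerivAt_pi.2 fun j => ?_
    fin_cases j
    · exact Real.hasDerivAt_cos θ
    · exact Real.hasDerivAt_sin θ
  have h2 := (BinaryForm.hasStrictFDerivAt (C.form i) ![cos θ, sin θ]).hasFDerivAt.comp_hasDerivAt
      (l := fun z : Fin 2 → ℝ => MvPolynomial.aeval z (C.form i)) θ h1
  refine HasDerivAt.congr_deriv h2 ?_
  simp [Fin.sum_univ_two]

lemma eq_smul_of_cross {u v : R3} (hu : u ≠ 0) (h : u ⨯₃ v = 0) : ∃ c : ℝ, v = c • u := by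
  by_cases hv : v = 0
  · exact ⟨0, by simp [hv]⟩
  · obtain ⟨c, -, hc⟩ := (pt_eq_iff hu hv).1 ((pt_eq_iff_cross hu hv).2 h)
    exact ⟨c, hc⟩

lemma loop_imm (θ : ℝ) : C.loop θ ⨯₃ deriv C.loop θ ≠ 0 := by
  intro h
  obtain ⟨c, hc⟩ := eq_smul_of_cross (C.loop_ne_zero θ) h
  set D : Fin 2 → Fin 3 → ℝ := fun j i =>
    MvPolynomial.aeval ![cos θ, sin θ] (MvPolynomial.pderiv j (C.form i))
  have h1 : ∀ i, D 1 i * cos θ - D 0 i * sin θ = c * C.loop θ i := fun i => by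
    have e1 : deriv C.loop θ i = deriv (fun θ => C.loop θ i) θ :=
      (hasDerivAt_pi.1 ((contDiff_loop.differentiable (by simp) θ).hasDerivAt) i).deriv.symm
    have e2 := congrFun hc i
    rw [e1, (hasDerivAt_loop i θ).deriv] at e2
    simp only [Pi.smul_apply, smul_eq_mul] at e2
    simp only [D]
    linarith
  have h2 : ∀ i, cos θ * D 0 i + sin θ * D 1 i = 5 * C.loop θ i := fun i => by
    have := BinaryForm.euler (C.homogeneous i) ![cos θ, sin θ]
    simp only [Fin.sum_univ_two, Matrix.cons_val_zero, Matrix.cons_val_one] at this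
    exact_mod_cast this
  have h3 := eq_zero_of_deriv (C := C) (circlePoint_ne_zero θ)
    (h := ![((-sin θ - c / 5 * cos θ : ℝ) : ℂ), ((cos θ - c / 5 * sin θ : ℝ) : ℂ)])
    fun i => by
      have e : ∀ j, MvPolynomial.aeval (circlePoint θ) (MvPolynomial.pderiv j (C.form i)) =
          ((D j i : ℝ) : ℂ) := fun j => by
        have h : circlePoint θ = fun j => ((![cos θ, sin θ] j : ℝ) : ℂ) := by
          ext j; fin_cases j <;> rfl
        rw [h]
        exact BinaryForm.aeval_ofReal _
      simp only [Fin.sum_univ_two, e, Matrix.cons_val_zero, Matrix.cons_val_one]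
      norm_cast
      linear_combination h1 i - c / 5 * h2 i
  have h4 : (((-sin θ - c / 5 * cos θ : ℝ)) : ℂ) = 0 := congrFun h3 0
  have h5 : (((cos θ - c / 5 * sin θ : ℝ)) : ℂ) = 0 := congrFun h3 1
  rw [Complex.ofReal_eq_zero] at h4 h5
  have := Real.sin_sq_add_cos_sq θ
  have : (1 : ℝ) = 0 := by linear_combination -this - sin θ * h4 + cos θ * h5
  norm_num at this

lemma continuous_val : Continuous (C.val : (Fin 2 → ℂ) → Fin 3 → ℂ) :=
  continuous_pi fun i => continuous_iff_continuousAt.2 fun z =>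
    (BinaryForm.hasStrictFDerivAt (C.form i) z).hasFDerivAt.continuousAt

lemma val_locally_injective {z₀ : Fin 2 → ℂ} (hz : z₀ ≠ 0) :
    ∀ᶠ p : (Fin 2 → ℂ) × (Fin 2 → ℂ) in 𝓝 (z₀, z₀), C.val p.1 = C.val p.2 → p.1 = p.2 := by
  have h1 := hasStrictFDerivAt_pi'' (Φ := fun z : Fin 2 → ℂ => C.val z)
    (Φ' := ContinuousLinearMap.pi fun i => ∑ j, MvPolynomial.aeval z₀ (MvPolynomial.pderiv j (C.form i)) •
      (ContinuousLinearMap.proj j : (Fin 2 → ℂ) →L[ℂ] ℂ))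
    fun i => BinaryForm.hasStrictFDerivAt (C.form i) z₀
  set D : (Fin 2 → ℂ) →L[ℂ] (Fin 3 → ℂ) := ContinuousLinearMap.pi fun i =>
    ∑ j, MvPolynomial.aeval z₀ (MvPolynomial.pderiv j (C.form i)) •
      (ContinuousLinearMap.proj j : (Fin 2 → ℂ) →L[ℂ] ℂ) with hD
  obtain ⟨K, hK, hanti⟩ := (D : (Fin 2 → ℂ) →ₗ[ℂ] (Fin 3 → ℂ)).exists_antilipschitzWith
    (LinearMap.ker_eq_bot'.2 fun h h0 => eq_zero_of_deriv (C := C) hz fun i => by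
      have := congrFun h0 i
      simpa [hD, Fin.sum_univ_two] using this)
  have h2 := h1.isLittleO.def (c := (K : ℝ)⁻¹ / 2) (by positivity)
  filter_upwards [h2] with p hp heq
  have h3 := hanti.le_mul_dist p.1 p.2
  simp only [heq, sub_self, zero_sub, norm_neg] at hp
  rw [dist_eq_norm, dist_eq_norm, ← map_sub] at h3
  have h4 : ‖p.1 - p.2‖ ≤ 2⁻¹ * ‖p.1 - p.2‖ := by
    have key : ∀ k t : ℝ, k ≠ 0 → k * (k⁻¹ / 2 * t) = 2⁻¹ * t := fun k t hk => by field_simp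
    exact h3.trans ((mul_le_mul_of_nonneg_left hp K.coe_nonneg).trans
      (key _ _ (NNReal.coe_ne_zero.2 hK.ne')).le)
  have h5 := norm_nonneg (p.1 - p.2)
  exact sub_eq_zero.1 (norm_eq_zero.1 (by linarith))

/-- Nearby parameters never belong to the same point. -/
lemma eventually_dependent {z₀ : Fin 2 → ℂ} (hz : z₀ ≠ 0) {c₀ : ℂ} (hc₀ : c₀ ≠ 0) :
    ∀ᶠ p : (Fin 2 → ℂ) × (Fin 2 → ℂ) in 𝓝 (z₀, c₀ • z₀), ∀ x, C.MapsTo p.1 x → C.MapsTo p.2 x →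
      ¬ LinearIndependent ℂ ![p.1, p.2] := by
  obtain ⟨i, hi⟩ : ∃ i, C.val z₀ i ≠ 0 := by by_contra! h; exact C.val_ne_zero hz (funext h)
  have hv : ∀ i, Continuous fun z : Fin 2 → ℂ => C.val z i := fun i =>
    (continuous_apply i).comp continuous_val
  have hvc : C.val (c₀ • z₀) i ≠ 0 := by rw [val_smul]; exact mul_ne_zero (pow_ne_zero _ hc₀) hi
  set r : (Fin 2 → ℂ) × (Fin 2 → ℂ) → ℂ := fun p =>
    c₀⁻¹ * (C.val p.1 i / C.val p.2 i * c₀ ^ 5) ^ (5⁻¹ : ℂ) with hr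
  have h1' : C.val z₀ i / C.val (c₀ • z₀) i * c₀ ^ 5 = 1 := by
    rw [val_smul, Pi.smul_apply, smul_eq_mul, mul_comm (c₀ ^ 5), div_mul_eq_mul_div,
      div_self (mul_ne_zero hi (pow_ne_zero _ hc₀))]
  have hr0 : r (z₀, c₀ • z₀) = c₀⁻¹ := by simp only [hr, h1', Complex.one_cpow, mul_one]
  have hrc : ContinuousAt r (z₀, c₀ • z₀) := by
    have hd : ContinuousAt (fun p : (Fin 2 → ℂ) × (Fin 2 → ℂ) => C.val p.1 i / C.val p.2 i)
        (z₀, c₀ • z₀) :=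
      ContinuousAt.div (((hv i).comp continuous_fst).continuousAt)
        (((hv i).comp continuous_snd).continuousAt) hvc
    have hd2 : ContinuousAt (fun p : (Fin 2 → ℂ) × (Fin 2 → ℂ) =>
        C.val p.1 i / C.val p.2 i * c₀ ^ 5) (z₀, c₀ • z₀) := hd.mul continuousAt_const
    have hs : C.val z₀ i / C.val (c₀ • z₀) i * c₀ ^ 5 ∈ Complex.slitPlane := by
      rw [h1']; exact Complex.one_mem_slitPlane
    have hd3 : ContinuousAt (fun p : (Fin 2 → ℂ) × (Fin 2 → ℂ) =>
        (C.val p.1 i / C.val p.2 i * c₀ ^ 5) ^ (5⁻¹ : ℂ)) (z₀, c₀ • z₀) :=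
      hd2.cpow continuousAt_const hs
    exact continuousAt_const.mul hd3
  have ht : Tendsto (fun p : (Fin 2 → ℂ) × (Fin 2 → ℂ) => (p.1, r p • p.2)) (𝓝 (z₀, c₀ • z₀))
      (𝓝 (z₀, z₀)) := by
    have h1 : ContinuousAt (fun p : (Fin 2 → ℂ) × (Fin 2 → ℂ) => (p.1, r p • p.2)) (z₀, c₀ • z₀) :=
      continuousAt_fst.prodMk (hrc.smul continuousAt_snd)
    have h2 := h1.tendsto
    simp only [hr0] at h2
    rwa [smul_smul, inv_mul_cancel₀ hc₀, one_smul] at h2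
  filter_upwards [ht.eventually (val_locally_injective (C := C) hz),
    ((hv i).comp continuous_snd).continuousAt.eventually_ne hvc,
    ((hv i).comp continuous_fst).continuousAt.eventually_ne hi] with p h1 h2 h3 x hx1 hx2 hli
  obtain ⟨v, hv0, rfl⟩ := exists_pt x
  obtain ⟨-, c, hc⟩ := (mapsTo_pt hv0).1 hx1
  obtain ⟨-, d, hd⟩ := (mapsTo_pt hv0).1 hx2
  have h2' : C.val p.2 i ≠ 0 := h2
  have h3' : C.val p.1 i ≠ 0 := h3
  have hr5 : r p ^ 5 = C.val p.1 i / C.val p.2 i := by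
    have h5 : (C.val p.1 i / C.val p.2 i * c₀ ^ 5) ≠ 0 :=
      mul_ne_zero (div_ne_zero h3' h2') (pow_ne_zero _ hc₀)
    have h6 : ((C.val p.1 i / C.val p.2 i * c₀ ^ 5) ^ (5⁻¹ : ℂ)) ^ 5 =
        C.val p.1 i / C.val p.2 i * c₀ ^ 5 := Complex.cpow_nat_inv_pow _ (n := 5) (by norm_num)
    simp only [hr, mul_pow, h6]
    field_simp
  have h4 : C.val p.1 = C.val (r p • p.2) := by
    rw [val_smul, hr5]
    funext j
    simp only [Pi.smul_apply, smul_eq_mul]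
    rw [hc i, hd i] at *
    rw [hc j, hd j]
    have hdn : d ≠ 0 := left_ne_zero_of_mul h2'
    have hvn : (v i : ℂ) ≠ 0 := right_ne_zero_of_mul h2'
    field_simp
  have h7 := congrFun (h1 h4)
  rw [linearIndependent_pair_iff] at hli
  simp only [Pi.smul_apply, smul_eq_mul] at h7
  exact hli (by rw [h7 0, h7 1]; ring)

/-- Nodes that are isolated from each other are finite in number. -/
lemma finite_of_isolated {N : Type} {x : N → RP2} (hx : Function.Injective x)
    {R : Set ((Fin 2 → ℂ) × (Fin 2 → ℂ))} (hR : IsClosed R)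
    (hN : ∀ n, ∃ p ∈ R, ‖p.1‖ = 1 ∧ ‖p.2‖ = 1 ∧ LinearIndependent ℂ ![p.1, p.2] ∧
      C.MapsTo p.1 (x n) ∧ C.MapsTo p.2 (x n))
    (hiso : ∀ p ∈ R, LinearIndependent ℂ ![p.1, p.2] → ∀ y, C.MapsTo p.1 y → C.MapsTo p.2 y →
      ∃ U ∈ 𝓝 y, ∀ n, x n ∈ U → x n = y) : Finite N := by
  by_contra hfin
  have : Infinite N := not_finite_iff_infinite.1 hfin
  choose p hpR hp1 hp2 hpi hpx1 hpx2 using hN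
  have hunit : ∀ n, ∃ v : R3, ‖v‖ = 1 ∧ pt v = x n := fun n => by
    obtain ⟨v, hv, h⟩ := exists_pt (x n)
    refine ⟨‖v‖⁻¹ • v, ?_, by rw [pt_smul (inv_ne_zero (norm_ne_zero_iff.2 hv)), h]⟩
    rw [norm_smul, norm_inv, norm_norm, inv_mul_cancel₀ (norm_ne_zero_iff.2 hv)]
  choose v hv1 hvx using hunit
  have hne : ∀ {w : R3}, ‖w‖ = 1 → w ≠ 0 := fun h h0 => by simp [h0] at h
  set Par : (Fin 2 → ℂ) → R3 → Prop := fun z w => ∀ i j, C.val z i * (w j : ℂ) = C.val z j * (w i : ℂ)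
  set K : Set (((Fin 2 → ℂ) × (Fin 2 → ℂ)) × R3) :=
    ((Metric.sphere 0 1 ×ˢ Metric.sphere 0 1) ×ˢ Metric.sphere 0 1) ∩
      {q | q.1 ∈ R ∧ Par q.1.1 q.2 ∧ Par q.1.2 q.2} with hK
  have hv : ∀ i, Continuous fun z : Fin 2 → ℂ => C.val z i := fun i =>
    (continuous_apply i).comp continuous_val
  have hPc : ∀ f : ((Fin 2 → ℂ) × (Fin 2 → ℂ)) × R3 → Fin 2 → ℂ, Continuous f →
      IsClosed {q | Par (f q) q.2} := fun f hf => by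
    simp only [Par, ofPred_forall]
    refine isClosed_iInter fun i => isClosed_iInter fun j => ?_
    have hw : ∀ j, Continuous fun q : ((Fin 2 → ℂ) × (Fin 2 → ℂ)) × R3 => ((q.2 j : ℝ) : ℂ) := fun j =>
      Complex.continuous_ofReal.comp ((continuous_apply j).comp continuous_snd)
    exact isClosed_eq (((hv i).comp hf).mul (hw j)) (((hv j).comp hf).mul (hw i))
  have hKc : IsCompact K := by
    refine (((isCompact_sphere _ _).prod (isCompact_sphere _ _)).prod (isCompact_sphere _ _)).inter_right ?_
    exact (hR.preimage continuous_fst).inter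
      ((hPc _ (continuous_fst.comp continuous_fst)).inter (hPc _ (continuous_snd.comp continuous_fst)))
  have hPar : ∀ {z : Fin 2 → ℂ} {w : R3}, ‖w‖ = 1 → z ≠ 0 → (Par z w ↔ C.MapsTo z (pt w)) := by
    intro z w hw hz
    rw [mapsTo_pt (hne hw)]
    constructor
    · intro h
      obtain ⟨j, hj⟩ : ∃ j, w j ≠ 0 := by by_contra! h; exact hne hw (funext h)
      have hj' : (w j : ℂ) ≠ 0 := by exact_mod_cast hj
      exact ⟨hz, C.val z j / w j, fun i => by rw [div_mul_eq_mul_div, eq_div_iff hj', h i j]⟩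
    · rintro ⟨-, c, hc⟩ i j
      rw [hc, hc]; ring
  have hzne : ∀ {z : Fin 2 → ℂ}, ‖z‖ = 1 → z ≠ 0 := fun h h0 => by simp [h0] at h
  obtain ⟨⟨⟨z₀, w₀⟩, v₀⟩, ⟨⟨⟨hz1, hw1⟩, hv01⟩, hR0, hz2, hw2⟩, hcl⟩ :=
    hKc.exists_mapClusterPt_of_frequently (l := cofinite) (f := fun n => (p n, v n))
      (Eventually.frequently (.of_forall fun n => ⟨⟨⟨by simp [hp1], by simp [hp2]⟩,
        by simp [hv1]⟩, hpR n, (hPar (hv1 n) (hzne (hp1 n))).2 (by rw [hvx]; exact hpx1 n),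
        (hPar (hv1 n) (hzne (hp2 n))).2 (by rw [hvx]; exact hpx2 n)⟩))
  simp only [mem_sphere_zero_iff_norm] at hz1 hw1 hv01
  have hz0 := hzne hz1
  have hw0 := hzne hw1
  have hmz := (hPar hv01 hz0).1 hz2
  have hmw := (hPar hv01 hw0).1 hw2
  by_cases hli : LinearIndependent ℂ ![z₀, w₀]
  · obtain ⟨U, hU, hUx⟩ := hiso _ hR0 hli _ hmz hmw
    have h1 : ∀ᶠ q : ((Fin 2 → ℂ) × (Fin 2 → ℂ)) × R3 in 𝓝 ((z₀, w₀), v₀), pt q.2 ∈ U :=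
      (ContinuousAt.comp (g := pt) (f := Prod.snd) (x := ((z₀, w₀), v₀)) (continuousAt_pt (hne hv01))
        continuousAt_snd) hU
    have h2 := hcl.frequently h1
    refine h2 ?_
    have h3 : {n | x n = pt v₀}.Finite := Set.Subsingleton.finite fun n hn m hm => hx (hn.trans hm.symm)
    filter_upwards [h3.compl_mem_cofinite] with n hn h4
    simp only [hvx] at h4
    exact hn (hUx n h4)
  · obtain ⟨c, hc, rfl⟩ : ∃ c : ℂ, c ≠ 0 ∧ w₀ = c • z₀ := by
      rw [linearIndependent_pair_iff, not_not] at hli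
      obtain ⟨j, hj⟩ : ∃ j, z₀ j ≠ 0 := by by_contra! h; exact hz0 (funext h)
      have e : w₀ = (w₀ j / z₀ j) • z₀ := by
        funext i
        rw [Pi.smul_apply, smul_eq_mul, div_mul_eq_mul_div, eq_div_iff hj]
        fin_cases i <;> fin_cases j <;> simp only [Fin.zero_eta, Fin.mk_one] <;>
          first | ring1 | linear_combination hli | linear_combination -hli
      exact ⟨_, fun h0 => hw0 (by rw [e, h0, zero_smul]), e⟩
    have h1 := (continuous_fst.tendsto ((z₀, c • z₀), v₀)).eventually
      (eventually_dependent (C := C) hz0 hc)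
    obtain ⟨n, hn⟩ := (hcl.frequently h1).exists
    exact hn (x n) (hpx1 n) (hpx2 n) (hpi n)

lemma Smoothing.isolated (S : C.Smoothing) (q : C.HyperbolicNode ⊕ C.EllipticNode) :
    ∃ U ∈ 𝓝 (C.nodePoint q), ∀ q', C.nodePoint q' ∈ U → q' = q := by
  refine ⟨range (S.chart q), ?_, fun q' hq' => ?_⟩
  · rw [← S.center q, ← (S.isChart q).map_nhds]
    exact range_mem_map
  · by_contra h
    refine Set.disjoint_left.1 (S.disjoint q' q h) ⟨0, S.center q'⟩ hq'

lemma norm_conj (u : Fin 2 → ℂ) : ‖fun j => conj (u j)‖ = ‖u‖ := by simp [Pi.norm_def]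

lemma norm_smul_inv {z : Fin 2 → ℂ} (hz : z ≠ 0) : ‖((‖z‖⁻¹ : ℝ) : ℂ) • z‖ = 1 := by
  rw [norm_smul, Complex.norm_real, norm_inv, norm_norm, inv_mul_cancel₀ (norm_ne_zero_iff.2 hz)]

lemma Smoothing.finite_hyperbolicNode (S : C.Smoothing) : Finite C.HyperbolicNode := by
  refine finite_of_isolated (C := C) (x := fun k : C.HyperbolicNode => k.1) Subtype.val_injective
    (R := {p | ∀ j, (p.1 j).im = 0 ∧ (p.2 j).im = 0}) ?_ ?_ ?_
  · simp only [ofPred_forall]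
    refine isClosed_iInter fun j => IsClosed.inter ?_ ?_
    · exact isClosed_eq (by fun_prop) continuous_const
    · exact isClosed_eq (by fun_prop) continuous_const
  · rintro ⟨x, s, t, hst, hs, ht⟩
    have hn : ∀ θ, ((‖circlePoint θ‖⁻¹ : ℝ) : ℂ) ≠ 0 := fun θ => by
      exact_mod_cast inv_ne_zero (norm_ne_zero_iff.2 (circlePoint_ne_zero θ))
    refine ⟨(((‖circlePoint s‖⁻¹ : ℝ) : ℂ) • circlePoint s, ((‖circlePoint t‖⁻¹ : ℝ) : ℂ) • circlePoint t),
      fun j => ?_, norm_smul_inv (circlePoint_ne_zero s), norm_smul_inv (circlePoint_ne_zero t), ?_,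
      mapsTo_smul (hn s) hs, mapsTo_smul (hn t) ht⟩
    · simp only [Pi.smul_apply, smul_eq_mul]
      fin_cases j <;> simp [circlePoint, -Complex.ofReal_cos, -Complex.ofReal_sin, -Complex.ofReal_inv]
    · rw [linearIndependent_pair_iff] at hst ⊢
      simp only [Pi.smul_apply, smul_eq_mul]
      intro h
      exact mul_ne_zero (mul_ne_zero (hn s) (hn t)) hst (by linear_combination h)
  · rintro ⟨z, w⟩ hp hli y hz hw
    have key : ∀ u : Fin 2 → ℂ, (∀ j, (u j).im = 0) → ∃ (r : ℂ) (θ : ℝ), u = r • circlePoint θ := by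
      intro u hu
      refine exists_real_of_dependent ?_
      rw [Complex.conj_eq_iff_im.2 (hu 0), Complex.conj_eq_iff_im.2 (hu 1)]; ring
    obtain ⟨r, s, rfl⟩ := key z fun j => (hp j).1
    obtain ⟨r', t, rfl⟩ := key w fun j => (hp j).2
    rw [linearIndependent_pair_iff] at hli
    simp only [Pi.smul_apply, smul_eq_mul] at hli
    have hr : r ≠ 0 := by rintro rfl; simp at hli
    have hr' : r' ≠ 0 := by rintro rfl; simp at hli
    have hz' := mapsTo_smul (inv_ne_zero hr) hz
    have hw' := mapsTo_smul (inv_ne_zero hr') hw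
    rw [smul_smul, inv_mul_cancel₀ hr, one_smul] at hz'
    rw [smul_smul, inv_mul_cancel₀ hr', one_smul] at hw'
    have hst : LinearIndependent ℂ ![circlePoint s, circlePoint t] := by
      rw [linearIndependent_pair_iff]
      exact fun h => hli (by linear_combination r * r' * h)
    obtain ⟨U, hU, h⟩ := S.isolated (Sum.inl ⟨y, s, t, hst, hz', hw'⟩)
    exact ⟨U, hU, fun n hn => congrArg Subtype.val (Sum.inl_injective (h (Sum.inl n) hn))⟩

lemma Smoothing.finite_ellipticNode (S : C.Smoothing) : Finite C.EllipticNode := by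
  refine finite_of_isolated (C := C) (x := fun k : C.EllipticNode => k.1) Subtype.val_injective
    (R := {p | ∀ j, p.2 j = conj (p.1 j)}) ?_ ?_ ?_
  · simp only [ofPred_forall]
    refine isClosed_iInter fun j => ?_
    exact isClosed_eq (by fun_prop) (Complex.continuous_conj.comp (by fun_prop))
  · rintro ⟨x, z, hli, hz⟩
    have hn : ((‖z‖⁻¹ : ℝ) : ℂ) ≠ 0 := by exact_mod_cast inv_ne_zero (norm_ne_zero_iff.2 hz.1)
    have h1 := mapsTo_smul hn hz
    refine ⟨(((‖z‖⁻¹ : ℝ) : ℂ) • z, fun j => conj ((((‖z‖⁻¹ : ℝ) : ℂ) • z) j)),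
      fun j => rfl, norm_smul_inv hz.1, ?_, ?_, h1, mapsTo_conj h1⟩
    · rw [← norm_smul_inv hz.1]
      exact norm_conj _
    · rw [linearIndependent_pair_iff] at hli ⊢
      simp only [Pi.smul_apply, smul_eq_mul, map_mul, Complex.conj_ofReal]
      intro h
      exact mul_ne_zero (mul_ne_zero hn hn) hli (by linear_combination h)
  · rintro ⟨z, w⟩ hp hli y hz hw
    obtain rfl : w = fun j => conj (z j) := funext hp
    obtain ⟨U, hU, h⟩ := S.isolated (Sum.inr ⟨y, z, hli, hz⟩)
    exact ⟨U, hU, fun n hn => congrArg Subtype.val (Sum.inr_injective (h (Sum.inr n) hn))⟩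

end NodalRationalQuintic

/-! ### The intersection of a nodal rational quintic with a line -/

namespace NodalRationalQuintic

variable {C : NodalRationalQuintic}

/-- The restriction of a linear form to the curve. -/
def lineForm (C : NodalRationalQuintic) (a : R3) : MvPolynomial (Fin 2) ℝ :=
  ∑ i, MvPolynomial.C (a i) * C.form i

lemma isHomogeneous_lineForm (a : R3) : (C.lineForm a).IsHomogeneous 5 :=
  MvPolynomial.IsHomogeneous.sum _ _ _ fun i _ => by
    simpa using (MvPolynomial.isHomogeneous_C (Fin 2) (a i)).mul (C.homogeneous i)

lemma aeval_lineForm {𝕜 : Type*} [RCLike 𝕜] (a : R3) (z : Fin 2 → 𝕜) :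
    MvPolynomial.aeval z (C.lineForm a) = ∑ i, (a i : 𝕜) * C.val z i := by
  simp [lineForm, val]

lemma dot_loop (a : R3) (θ : ℝ) :
    a ⬝ᵥ C.loop θ = MvPolynomial.aeval ![cos θ, sin θ] (C.lineForm a) := by
  rw [aeval_lineForm]; rfl

/-- The real curve does not lie on a line. -/
lemma exists_dot_loop_ne_zero {a : R3} (ha : a ≠ 0) : ∃ θ, a ⬝ᵥ C.loop θ ≠ 0 := by
  by_contra! h
  have hG : C.lineForm a = 0 := by
    refine (isHomogeneous_lineForm a).eq_zero_of_forall_eval_eq_zero fun x => ?_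
    obtain ⟨r, θ, rfl⟩ := exists_circle x
    have := BinaryForm.aeval_smul (isHomogeneous_lineForm (C := C) a) r ![cos θ, sin θ]
    rw [← dot_loop, h, mul_zero] at this
    exact this
  obtain ⟨i, hi⟩ : ∃ i, a i ≠ 0 := by by_contra! h; exact ha (funext h)
  set D : Fin 2 → Fin 3 → MvPolynomial (Fin 2) ℝ := fun j i => MvPolynomial.pderiv j (C.form i) with hD
  have hDh : ∀ j i, (D j i).IsHomogeneous 4 := fun j i => (C.homogeneous i).pderiv
  have hDs : ∀ j, ∑ i, MvPolynomial.C (a i) * D j i = 0 := fun j => by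
    have := congrArg (MvPolynomial.pderiv j) hG
    simpa [lineForm, hD, MvPolynomial.pderiv_C_mul] using this
  have hhom : (D 0 (i + 1) * D 1 (i + 2) - D 1 (i + 1) * D 0 (i + 2)).IsHomogeneous 8 :=
    ((hDh _ _).mul (hDh _ _)).sub ((hDh _ _).mul (hDh _ _))
  obtain ⟨z, hz, hz0⟩ := BinaryForm.exists_zero hhom (by norm_num)
  obtain ⟨v, hv, hMv⟩ := Matrix.exists_mulVec_eq_zero_iff.2
    (show (!![MvPolynomial.aeval z (D 0 (i + 1)), MvPolynomial.aeval z (D 1 (i + 1));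
      MvPolynomial.aeval z (D 0 (i + 2)), MvPolynomial.aeval z (D 1 (i + 2))] :
        Matrix (Fin 2) (Fin 2) ℂ).det = 0 by
      rw [Matrix.det_fin_two_of, ← hz0]; simp)
  have h1 := congrFun hMv 0
  have h2 := congrFun hMv 1
  simp only [Matrix.mulVec, dotProduct, Fin.sum_univ_two, Matrix.of_apply, Matrix.cons_val_zero,
    Matrix.cons_val_one, Pi.zero_apply] at h1 h2
  have h3 : ∀ j, (a i : ℂ) * MvPolynomial.aeval z (D j i) +
      (a (i + 1) : ℂ) * MvPolynomial.aeval z (D j (i + 1)) +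
      (a (i + 2) : ℂ) * MvPolynomial.aeval z (D j (i + 2)) = 0 := fun j => by
    have := congrArg (MvPolynomial.aeval z) (hDs j)
    simp only [Fin.sum_univ_three, map_add, map_mul, MvPolynomial.aeval_C, map_zero] at this
    refine Eq.trans ?_ this
    fin_cases i <;> simp <;> ring
  have h0 : MvPolynomial.aeval z (D 0 i) * v 0 + MvPolynomial.aeval z (D 1 i) * v 1 = 0 := by
    have hi' : (a i : ℂ) ≠ 0 := by exact_mod_cast hi
    refine (mul_eq_zero.1 (?_ : (a i : ℂ) * _ = 0)).resolve_left hi'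
    linear_combination v 0 * h3 0 + v 1 * h3 1 - (a (i + 1) : ℂ) * h1 - (a (i + 2) : ℂ) * h2
  refine hv (eq_zero_of_deriv (C := C) hz fun l => ?_)
  rw [Fin.sum_univ_two]
  have hl : l = i ∨ l = i + 1 ∨ l = i + 2 := by clear * -; revert i l; decide
  rcases hl with rfl | rfl | rfl
  exacts [h0, h1, h2]

/-- The points of an affine chart of the projective line that misses the point of angle `s`. -/
def affinePoint {𝕜 : Type*} [RCLike 𝕜] (s : ℝ) (T : 𝕜) : Fin 2 → 𝕜 :=
  ![(cos s : 𝕜) * T - (sin s : 𝕜), (sin s : 𝕜) * T + (cos s : 𝕜)]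

lemma exists_affinePoint (s : ℝ) (e : C.EllipticNode) :
    ∃ T : ℂ, T.im ≠ 0 ∧ C.MapsTo (affinePoint s T) e.1 := by
  obtain ⟨x, z, hli, hz⟩ := e
  rw [linearIndependent_pair_iff] at hli
  have hcs : (cos s : ℂ) ^ 2 + (sin s : ℂ) ^ 2 = 1 := by exact_mod_cast Real.cos_sq_add_sin_sq s
  set α : ℂ := cos s * z 0 + sin s * z 1 with hα
  set β : ℂ := -sin s * z 0 + cos s * z 1 with hβ
  have e0 : z 0 = α * cos s - β * sin s := by rw [hα, hβ]; linear_combination -(z 0) * hcs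
  have e1 : z 1 = α * sin s + β * cos s := by rw [hα, hβ]; linear_combination -(z 1) * hcs
  have hli' : α * conj β - β * conj α ≠ 0 := fun h => hli (by
    rw [e0, e1]
    simp only [map_add, map_sub, map_mul, Complex.conj_ofReal]
    linear_combination ((cos s : ℂ) ^ 2 + (sin s : ℂ) ^ 2) * h)
  have hβ0 : β ≠ 0 := fun h => hli' (by rw [h]; simp)
  refine ⟨α / β, fun h => hli' ?_, ?_⟩
  · have h1 : conj (α / β) = α / β := Complex.conj_eq_iff_im.2 h
    rw [map_div₀, div_eq_div_iff ((map_ne_zero _).2 hβ0) hβ0] at h1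
    linear_combination -h1
  · have h1 := mapsTo_smul (inv_ne_zero hβ0) hz
    have h2 : β⁻¹ • z = affinePoint s (α / β) := by
      funext j
      fin_cases j
      · simp only [affinePoint, Fin.zero_eta, Pi.smul_apply, smul_eq_mul, Matrix.cons_val_zero, e0]
        field_simp
        norm_cast
      · simp only [affinePoint, Fin.mk_one, Pi.smul_apply, smul_eq_mul, Matrix.cons_val_one,
          Matrix.cons_val_zero, e1]
        field_simp
        norm_cast
    rwa [h2] at h1

/-- The equation of the intersection with a line in an affine chart of the projective line. -/
def linePolynomial (C : NodalRationalQuintic) (a : R3) (s : ℝ) : Polynomial ℝ :=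
  MvPolynomial.aeval ![Polynomial.C (cos s) * Polynomial.X - Polynomial.C (sin s),
    Polynomial.C (sin s) * Polynomial.X + Polynomial.C (cos s)] (C.lineForm a)

lemma natDegree_linePolynomial_le (a : R3) (s : ℝ) : (C.linePolynomial a s).natDegree ≤ 5 := by
  have := MvPolynomial.aeval_natDegree_le (m := 5) (n := 1) (C.lineForm a)
    (isHomogeneous_lineForm a).totalDegree_le
    ![Polynomial.C (cos s) * Polynomial.X - Polynomial.C (sin s),
    Polynomial.C (sin s) * Polynomial.X + Polynomial.C (cos s)] (fun j => by
      fin_cases j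
      · rw [sub_eq_add_neg, ← Polynomial.C_neg]; exact Polynomial.natDegree_linear_le
      · exact Polynomial.natDegree_linear_le)
  exact this

lemma aeval_linePolynomial {𝕜 : Type*} [RCLike 𝕜] (a : R3) (s : ℝ) (T : 𝕜) :
    Polynomial.aeval T (C.linePolynomial a s) = ∑ i, (a i : 𝕜) * C.val (affinePoint s T) i := by
  have h : (Polynomial.aeval T).comp
      (MvPolynomial.aeval ![Polynomial.C (cos s) * Polynomial.X - Polynomial.C (sin s),
      Polynomial.C (sin s) * Polynomial.X + Polynomial.C (cos s)] :
        MvPolynomial (Fin 2) ℝ →ₐ[ℝ] Polynomial ℝ) = MvPolynomial.aeval (affinePoint s T) := by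
    ext j; fin_cases j <;> simp [affinePoint]
  rw [← aeval_lineForm, ← h]
  rfl

lemma dot_loop_eq (a : R3) {s φ : ℝ} (h : cos φ ≠ 0) : a ⬝ᵥ C.loop (s + π / 2 - φ) =
      cos φ ^ 5 * (C.linePolynomial a s).eval (Real.tan φ) := by
  have h1 : ![cos (s + π / 2 - φ), sin (s + π / 2 - φ)] = cos φ • affinePoint s (Real.tan φ) := by
    rw [show s + π / 2 - φ = (s - φ) + π / 2 by ring, Real.cos_add_pi_div_two,
      Real.sin_add_pi_div_two, Real.cos_sub, Real.sin_sub, Real.tan_eq_sin_div_cos]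
    ext j; fin_cases j <;> (simp [affinePoint]; field_simp; try ring)
  rw [← Polynomial.coe_aeval_eq_eval, aeval_linePolynomial, loop, h1, val_smul, dotProduct,
    Finset.mul_sum]
  exact Finset.sum_congr rfl fun i _ => by
    simp only [Pi.smul_apply, smul_eq_mul, RCLike.ofReal_real_eq_id, id]; ring

lemma card_roots_le [Fintype C.EllipticNode] {a : R3} {s : ℝ} (hP : C.linePolynomial a s ≠ 0) :
    open Classical in
    ∑ T ∈ (C.linePolynomial a s).roots.toFinset, (C.linePolynomial a s).rootMultiplicity T +
      2 * (Finset.univ.filter fun e : C.EllipticNode => a ⬝ᵥ e.1.coords = 0).card ≤ 5 := by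
  classical
  set P := C.linePolynomial a s with hPdef
  have hinj : Function.Injective (algebraMap ℝ ℂ) := (algebraMap ℝ ℂ).injective
  set Q := P.map (algebraMap ℝ ℂ) with hQ
  have hQ0 : Q ≠ 0 := (Polynomial.map_ne_zero_iff hinj).2 hP
  set R := Q.roots.toFinset with hR
  have hRc : ∑ T ∈ R, Q.rootMultiplicity T ≤ 5 := by
    have h1 := Q.roots.toFinset_sum_count_eq
    simp only [Polynomial.count_roots] at h1
    rw [h1]
    exact (Polynomial.card_roots' Q).trans
      (Polynomial.natDegree_map_le.trans (natDegree_linePolynomial_le a s))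
  have hmem : ∀ T : ℂ, T ∈ R ↔ Polynomial.aeval T P = 0 := fun T => by
    rw [hR, Multiset.mem_toFinset, Polynomial.mem_roots hQ0, Polynomial.IsRoot.def, hQ,
      Polynomial.eval_map_algebraMap]
  have hreal : ∑ T ∈ P.roots.toFinset, P.rootMultiplicity T ≤
      ∑ T ∈ R.filter (fun T => T.im = 0), Q.rootMultiplicity T := by
    rw [Finset.sum_congr rfl fun T _ => Polynomial.eq_rootMultiplicity_map hinj T,
      ← Finset.sum_image (s := P.roots.toFinset) (g := algebraMap ℝ ℂ)
        (f := fun T => Q.rootMultiplicity T) hinj.injOn]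
    refine Finset.sum_le_sum_of_subset fun T hT => ?_
    obtain ⟨t, ht, rfl⟩ := Finset.mem_image.1 hT
    rw [Multiset.mem_toFinset, Polynomial.mem_roots hP, Polynomial.IsRoot.def] at ht
    refine Finset.mem_filter.2 ⟨(hmem _).2 ?_, by simp⟩
    rw [Polynomial.aeval_algebraMap_apply, Polynomial.coe_aeval_eq_eval, ht, map_zero]
  choose τ hτ hτm using fun e : C.EllipticNode => exists_affinePoint s e
  have hconj : ∀ e, C.MapsTo (affinePoint s (conj (τ e))) e.1 := fun e => by
    have := mapsTo_conj (hτm e)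
    convert this using 2 with j
    fin_cases j <;> simp [affinePoint, -Complex.ofReal_cos, -Complex.ofReal_sin]
  have hroot : ∀ {e : C.EllipticNode} {T : ℂ}, a ⬝ᵥ e.1.coords = 0 → C.MapsTo (affinePoint s T) e.1 →
      T ∈ R := fun {e T} he hT => by
    obtain ⟨-, c, hc⟩ := hT
    rw [hmem, aeval_linePolynomial]
    calc ∑ i, (a i : ℂ) * C.val (affinePoint s T) i = c * ((a ⬝ᵥ e.1.coords : ℝ) : ℂ) := by
          rw [dotProduct, Complex.ofReal_sum, Finset.mul_sum]
          exact Finset.sum_congr rfl fun i _ => by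
            rw [show C.val (affinePoint s T) i = _ from hc i, Complex.ofReal_mul]; ring
      _ = 0 := by rw [he]; simp
  set g : C.EllipticNode × Bool → ℂ := fun p => cond p.2 (τ p.1) (conj (τ p.1)) with hg
  have hgm : ∀ p, C.MapsTo (affinePoint s (g p)) p.1.1 := by
    rintro ⟨e, _ | _⟩
    exacts [hconj e, hτm e]
  have hgi : Function.Injective g := by
    rintro ⟨e, b⟩ ⟨e', b'⟩ h
    have h1 : e = e' := Subtype.ext (mapsTo_unique (hgm (e, b)) (h ▸ hgm (e', b')))
    subst h1
    have h2 : (τ e) ≠ conj (τ e) := fun h => hτ e (Complex.conj_eq_iff_im.1 h.symm)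
    rcases b with _ | _ <;> rcases b' with _ | _
    · rfl
    · exact absurd h.symm h2
    · exact absurd h h2
    · rfl
  set E₀ := Finset.univ.filter fun e : C.EllipticNode => a ⬝ᵥ e.1.coords = 0
  have himag : 2 * E₀.card ≤ ∑ T ∈ R.filter (fun T => ¬ T.im = 0), Q.rootMultiplicity T := by
    calc 2 * E₀.card = ((E₀ ×ˢ (Finset.univ : Finset Bool)).image g).card := by
          rw [Finset.card_image_of_injective _ hgi, Finset.card_product]; simp [mul_comm]
      _ ≤ (R.filter (fun T => ¬ T.im = 0)).card := Finset.card_le_card fun T hT => by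
          obtain ⟨p, hp, rfl⟩ := Finset.mem_image.1 hT
          have hp1 := (Finset.mem_filter.1 (Finset.mem_product.1 hp).1).2
          refine Finset.mem_filter.2 ⟨hroot hp1 (hgm p), ?_⟩
          obtain ⟨e, _ | _⟩ := p
          · simpa [hg] using hτ e
          · exact hτ e
      _ = ∑ T ∈ R.filter (fun T => ¬ T.im = 0), 1 := Finset.card_eq_sum_ones _
      _ ≤ _ := Finset.sum_le_sum fun T hT => by
          have h1 := (Finset.mem_filter.1 hT).1
          rw [hR, Multiset.mem_toFinset, Polynomial.mem_roots hQ0] at h1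
          exact (Polynomial.rootMultiplicity_pos hQ0).2 h1
  have := Finset.sum_filter_add_sum_filter_not R (fun T => T.im = 0) fun T => Q.rootMultiplicity T
  omega

lemma iteratedDeriv_ne_zero_of_root {a : R3} {s : ℝ} (hP : C.linePolynomial a s ≠ 0) (T : ℝ) :
    iteratedDeriv ((C.linePolynomial a s).rootMultiplicity T) (fun θ => a ⬝ᵥ C.loop θ)
      (s + π / 2 - Real.arctan T) ≠ 0 := by
  obtain ⟨Q, hQ, hQT⟩ := Polynomial.exists_eq_pow_rootMultiplicity_mul_and_not_dvd _ hP T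
  set n := (C.linePolynomial a s).rootMultiplicity T
  set θ₀ := s + π / 2 - Real.arctan T with hθ₀
  set f := fun θ => a ⬝ᵥ C.loop θ with hf
  have hfa : AnalyticAt ℝ f θ₀ := by
    have : f = fun θ => ∑ i, a i * C.loop θ i := rfl
    rw [this]
    exact Finset.univ.analyticAt_fun_sum fun i _ => analyticAt_const.mul (analyticAt_loop i θ₀)
  set φ : ℝ → ℝ := fun θ => s + π / 2 - θ with hφ
  have hφ0 : φ θ₀ = Real.arctan T := by simp [hφ, hθ₀]
  have hφa : AnalyticAt ℝ φ θ₀ := by fun_prop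
  have hcos : cos (φ θ₀) ≠ 0 := by rw [hφ0]; exact (Real.cos_arctan_pos T).ne'
  have hcosa : AnalyticAt ℝ (fun θ => cos (φ θ)) θ₀ := Real.analyticAt_cos.comp hφa
  set g : ℝ → ℝ := fun θ => Real.tan (φ θ) with hg
  have hg0 : g θ₀ = T := by simp [hg, hφ0]
  have hga : AnalyticAt ℝ g θ₀ := by
    have : g = fun θ => sin (φ θ) / cos (φ θ) := funext fun θ => Real.tan_eq_sin_div_cos _
    rw [this]
    exact (Real.analyticAt_sin.comp hφa).div hcosa hcos
  have hgd : deriv g θ₀ ≠ 0 := by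
    have h1 : HasDerivAt φ (-1) θ₀ := by simpa using (hasDerivAt_id θ₀).const_sub (s + π / 2)
    have h2 : HasDerivAt g _ θ₀ := (Real.hasDerivAt_tan hcos).comp θ₀ h1
    rw [h2.deriv]
    simp [hcos]
  have h1 : analyticOrderAt (fun θ => g θ - T) θ₀ = (1 : ℕ) := by
    have := hga.analyticOrderAt_sub_eq_one_of_deriv_ne_zero hgd
    rwa [hg0] at this
  obtain ⟨h, hh, hh0, he⟩ := ((hga.fun_sub analyticAt_const).analyticOrderAt_eq_natCast).1 h1
  have hev : ∀ᶠ θ in 𝓝 θ₀, f θ = (θ - θ₀) ^ n • (cos (φ θ) ^ 5 * h θ ^ n * Q.eval (g θ)) := by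
    filter_upwards [he, hcosa.continuousAt.eventually_ne hcos] with θ h2 h3
    have h4 := dot_loop_eq (C := C) a (s := s) h3
    simp only [hφ, sub_sub_cancel] at h4
    simp only [hf, h4, smul_eq_mul]
    rw [hQ]
    simp only [pow_one, smul_eq_mul] at h2
    simp only [Polynomial.eval_mul, Polynomial.eval_pow, Polynomial.eval_sub, Polynomial.eval_X,
      Polynomial.eval_C]
    change cos (φ θ) ^ 5 * ((g θ - T) ^ n * Q.eval (g θ)) = _
    rw [h2, mul_pow]; ring
  have hord : analyticOrderAt f θ₀ = n := by
    refine hfa.analyticOrderAt_eq_natCast.2 ⟨_, ?_, ?_, hev⟩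
    · exact ((hcosa.fun_pow 5).fun_mul (hh.fun_pow n)).fun_mul (AnalyticAt.aeval_polynomial hga Q)
    · rw [hg0]
      refine mul_ne_zero (mul_ne_zero (pow_ne_zero _ hcos) (pow_ne_zero _ hh0)) fun h0 => hQT ?_
      exact Polynomial.dvd_iff_isRoot.2 h0
  exact ((analyticOrderAt_eq_nat_iff_iteratedDeriv_eq_zero hfa).1 hord).2

/-- The orders of contact of a line with the real branches, and twice the number of elliptic nodes
on the line, sum up to at most five. -/
lemma exists_orders [Fintype C.EllipticNode] {a : R3} (ha : a ≠ 0) : open Classical in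
    ∃ (s : ℝ) (Z : Finset ℝ) (m : ℝ → ℕ), (∀ x ∈ Icc s (s + π), a ⬝ᵥ C.loop x = 0 → x ∈ Z) ∧
      (∀ z ∈ Z, iteratedDeriv (m z) (fun θ => a ⬝ᵥ C.loop θ) z ≠ 0) ∧
      ∑ z ∈ Z, m z + 2 * (Finset.univ.filter fun e : C.EllipticNode => a ⬝ᵥ e.1.coords = 0).card ≤ 5 := by
  classical
  obtain ⟨s, hs⟩ := exists_dot_loop_ne_zero (C := C) ha
  have hc : Continuous fun θ => a ⬝ᵥ C.loop θ := ((contDiff_dot a).comp contDiff_loop).continuous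
  have hne : ∀ φ ∈ Ioo (-(π / 2)) (π / 2), cos φ ≠ 0 := fun φ h => (Real.cos_pos_of_mem_Ioo h).ne'
  have hpi := Real.pi_pos
  have hP : C.linePolynomial a s ≠ 0 := fun h0 => by
    have h1 : ∀ᶠ θ in 𝓝[>] s, a ⬝ᵥ C.loop θ ≠ 0 :=
      (hc.continuousAt.eventually_ne hs).filter_mono nhdsWithin_le_nhds
    have h2 : Ioo s (s + π) ∈ 𝓝[>] s := Ioo_mem_nhdsGT (by linarith)
    obtain ⟨θ, h3, h4⟩ := (h1.and h2).exists
    have h5 := dot_loop_eq (C := C) a (s := s) (φ := s + π / 2 - θ)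
      (hne _ ⟨by linarith [h4.2], by linarith [h4.1]⟩)
    rw [h0, sub_sub_cancel] at h5
    exact h3 (by rw [h5]; simp)
  set j : ℝ → ℝ := fun T => s + π / 2 - Real.arctan T with hj
  have hji : Function.Injective j := fun T T' h => Real.arctan_injective (by
    simp only [hj] at h; linarith)
  refine ⟨s, (C.linePolynomial a s).roots.toFinset.image j, fun z => (C.linePolynomial a s).rootMultiplicity
    (Real.tan (s + π / 2 - z)), fun x hx h0 => ?_, fun z hz => ?_, ?_⟩
  · have hx1 : x ≠ s := fun h => hs (h ▸ h0)
    have hx2 : x ≠ s + π := fun h => hs (by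
      rw [h, loop_add_pi, dotProduct_smul] at h0
      simpa using h0)
    have h3 : s + π / 2 - x ∈ Ioo (-(π / 2)) (π / 2) :=
      ⟨by linarith [lt_of_le_of_ne hx.2 hx2], by linarith [lt_of_le_of_ne hx.1 hx1.symm]⟩
    have h4 := dot_loop_eq (C := C) a (s := s) (hne _ h3)
    rw [sub_sub_cancel, h0] at h4
    refine Finset.mem_image.2 ⟨Real.tan (s + π / 2 - x), ?_, ?_⟩
    · rw [Multiset.mem_toFinset, Polynomial.mem_roots hP]
      exact (mul_eq_zero.1 h4.symm).resolve_left (pow_ne_zero _ (hne _ h3))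
    · simp only [hj]
      rw [Real.arctan_tan h3.1 h3.2, sub_sub_cancel]
  · obtain ⟨T, -, rfl⟩ := Finset.mem_image.1 hz
    simp only [hj, sub_sub_cancel, Real.tan_arctan]
    exact iteratedDeriv_ne_zero_of_root hP T
  · rw [Finset.sum_image hji.injOn]
    simp only [hj, sub_sub_cancel, Real.tan_arctan]
    exact card_roots_le hP

end NodalRationalQuintic

/-! ### The nodal curve of a smoothing -/

lemma exists_two_mul_angle {z : ℝ × ℝ} (h : z.1 ^ 2 + z.2 ^ 2 = 1) :
    ∃ θ, (cos (2 * θ), sin (2 * θ)) = z := by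
  obtain ⟨r, φ, hr⟩ := exists_circle ![z.1, z.2]
  have h1 : z.1 = r * cos φ := congrFun hr 0
  have h2 : z.2 = r * sin φ := congrFun hr 1
  have h3 : r ^ 2 = 1 := by rw [← h, h1, h2]; linear_combination -r ^ 2 * Real.sin_sq_add_cos_sq φ
  rcases mul_self_eq_one_iff.1 (sq r ▸ h3) with rfl | rfl
  · exact ⟨φ / 2, by rw [mul_div_cancel₀ φ two_ne_zero]; ext <;> simp [h1, h2]⟩
  · exact ⟨(φ + π) / 2, by
      rw [mul_div_cancel₀ _ two_ne_zero]; ext <;> simp [h1, h2, Real.cos_add_pi, Real.sin_add_pi]⟩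

lemma eq_add_int_of_two_mul {s t : ℝ} (hc : cos (2 * s) = cos (2 * t))
    (hs : sin (2 * s) = sin (2 * t)) : ∃ n : ℤ, t = s + n * π := by
  have h : cos (2 * t - 2 * s) = 1 := by
    rw [Real.cos_sub, hc, hs]; linear_combination Real.sin_sq_add_cos_sq (2 * t)
  obtain ⟨n, hn⟩ := (Real.cos_eq_one_iff _).1 h
  exact ⟨n, by linarith⟩

lemma cross_combination_ne_zero {u v w : R3} (h : trip u v w ≠ 0) {x y : ℝ} (hxy : x ≠ 0 ∨ y ≠ 0) :
    u ⨯₃ (x • v + y • w) ≠ 0 := by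
  intro h0
  have e0 := congrFun h0 0
  have e1 := congrFun h0 1
  have e2 := congrFun h0 2
  rw [trip_eq] at h
  simp [cross_apply] at e0 e1 e2
  rcases hxy with hx | hy
  · exact mul_ne_zero hx h (by linear_combination w 0 * e0 + w 1 * e1 + w 2 * e2)
  · exact mul_ne_zero hy h (by linear_combination -v 0 * e0 - v 1 * e1 - v 2 * e2)

lemma exists_dot_ne_zero_of_trip {u v w a : R3} (h : trip u v w ≠ 0) (ha : a ≠ 0)
    (hu : a ⬝ᵥ u = 0) : a ⬝ᵥ v ≠ 0 ∨ a ⬝ᵥ w ≠ 0 := by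
  by_contra! h0
  obtain ⟨hv, hw⟩ := h0
  rw [trip_eq] at h
  simp only [dotProduct, Fin.sum_univ_three] at hu hv hw
  refine ha (funext fun i => (mul_eq_zero.1 (?_ : a i * _ = 0)).resolve_right h)
  fin_cases i <;> simp only [Fin.zero_eta, Fin.mk_one, Fin.reduceFinMk]
  · linear_combination (v 1 * w 2 - v 2 * w 1) * hu + (w 1 * u 2 - w 2 * u 1) * hv +
      (u 1 * v 2 - u 2 * v 1) * hw
  · linear_combination (v 2 * w 0 - v 0 * w 2) * hu + (w 2 * u 0 - w 0 * u 2) * hv +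
      (u 2 * v 0 - u 0 * v 2) * hw
  · linear_combination (v 0 * w 1 - v 1 * w 0) * hu + (w 0 * u 1 - w 1 * u 0) * hv +
      (u 0 * v 1 - u 1 * v 0) * hw

namespace NodalRationalQuintic

namespace Smoothing

variable {C : NodalRationalQuintic} (S : C.Smoothing)

/-- Homogeneous coordinates of the charts. -/
def lift (p : C.HyperbolicNode ⊕ C.EllipticNode) : ℝ × ℝ → R3 :=
  (isChart_iff.1 (S.isChart p)).2.choose

lemma contDiff_lift (p) : ContDiff ℝ ∞ (S.lift p) := (isChart_iff.1 (S.isChart p)).2.choose_spec.1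

lemma pt_lift (p z) : pt (S.lift p z) = S.chart p z :=
  ((isChart_iff.1 (S.isChart p)).2.choose_spec.2.1 z).symm

lemma immAt_lift (p z) : ImmAt (S.lift p) z := (isChart_iff.1 (S.isChart p)).2.choose_spec.2.2 z

lemma lift_inj {p q z w} (h : pt (S.lift p z) = pt (S.lift q w)) : p = q ∧ z = w := by
  rw [pt_lift, pt_lift] at h
  by_cases hpq : p = q
  · subst hpq
    exact ⟨rfl, (S.isChart p).1 h⟩
  · exact absurd ⟨w, h.symm⟩ (Set.disjoint_left.1 (S.disjoint p q hpq) ⟨z, rfl⟩)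

/-- Some of the charts, as a family. -/
def family {ι : Type} (f : ι → C.HyperbolicNode ⊕ C.EllipticNode)
    (hf : Function.Injective f) : ChartFamily ι where
  F k := S.lift (f k)
  smooth _ := S.contDiff_lift _
  imm _ := S.immAt_lift _
  inj _ _ _ _ h := ⟨hf (S.lift_inj h).1, (S.lift_inj h).2⟩

lemma pt_lift_inr_zero (e : C.EllipticNode) : pt (S.lift (Sum.inr e) 0) = e.1 :=
  (S.pt_lift _ _).trans (S.center _)

lemma pt_lift_inl_zero (k : C.HyperbolicNode) : pt (S.lift (Sum.inl k) 0) = k.1 :=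
  (S.pt_lift _ _).trans (S.center _)

lemma loop_ne_lift (θ : ℝ) (e : C.EllipticNode) (z : ℝ × ℝ) :
    pt (C.loop θ) ≠ pt (S.lift (Sum.inr e) z) := by
  intro h
  have h1 : S.chart (Sum.inr e) z ∈ C.realPoints := by
    rw [← S.pt_lift, ← h]; exact mem_realPoints.2 (Or.inl ⟨θ, rfl⟩)
  rw [(S.elliptic e z).1 h1, pt_lift_inr_zero] at h
  exact loop_ne_elliptic θ e h

lemma loop_eq_lift_iff (k : C.HyperbolicNode) (z : ℝ × ℝ) :
    (∃ θ, pt (C.loop θ) = pt (S.lift (Sum.inl k) z)) ↔ z.2 ^ 2 = z.1 ^ 2 := by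
  rw [← S.hyperbolic k z, mem_realPoints, ← S.pt_lift]
  refine ⟨Or.inl, fun h => h.resolve_right ?_⟩
  rintro ⟨e, he⟩
  rw [← S.pt_lift_inr_zero] at he
  exact Sum.inr_ne_inl (S.lift_inj he).1

/-- The oval that replaces an elliptic node, with its size as a parameter. -/
def oval (e : C.EllipticNode) (ε θ : ℝ) : R3 :=
  S.lift (Sum.inr e) (ε * cos (2 * θ), ε * sin (2 * θ))

lemma contDiff_oval (e : C.EllipticNode) : ContDiff ℝ ∞ fun p : ℝ × ℝ => S.oval e p.1 p.2 :=
  (S.contDiff_lift _).comp (f := fun p : ℝ × ℝ => (p.1 * cos (2 * p.2), p.1 * sin (2 * p.2)))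
    (by fun_prop)

/-- The velocity of the ovals, divided by their size. -/
def ovalVelocity (e : C.EllipticNode) (ε θ : ℝ) : R3 :=
  fderiv ℝ (S.lift (Sum.inr e)) (ε * cos (2 * θ), ε * sin (2 * θ))
    (-(2 * sin (2 * θ)), 2 * cos (2 * θ))

lemma hasDerivAt_oval (e : C.EllipticNode) (ε θ : ℝ) :
    HasDerivAt (S.oval e ε) (ε • S.ovalVelocity e ε θ) θ := by
  have h2 : HasDerivAt (fun θ : ℝ => 2 * θ) 2 θ := by simpa using (hasDerivAt_id θ).const_mul 2
  have h1 : HasDerivAt (fun θ : ℝ => (ε * cos (2 * θ), ε * sin (2 * θ)))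
      (ε • (-(2 * sin (2 * θ)), 2 * cos (2 * θ))) θ := by
    refine (((h2.cos).const_mul ε).prodMk ((h2.sin).const_mul ε)).congr_deriv ?_
    ext <;> simp only [Prod.smul_mk, smul_eq_mul] <;> ring
  have h := ((S.contDiff_lift (Sum.inr e)).differentiable (by simp) _).hasFDerivAt.comp_hasDerivAt
    (l := S.lift (Sum.inr e)) θ h1
  rw [map_smul] at h
  exact h

lemma ovalVelocity_eq (e : C.EllipticNode) (ε θ : ℝ) : S.ovalVelocity e ε θ =
    (-(2 * sin (2 * θ))) • fderiv ℝ (S.lift (Sum.inr e)) (ε * cos (2 * θ), ε * sin (2 * θ)) (1, 0) +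
    (2 * cos (2 * θ)) • fderiv ℝ (S.lift (Sum.inr e))
      (ε * cos (2 * θ), ε * sin (2 * θ)) (0, 1) := by
  rw [ovalVelocity, clm_prod_apply]

lemma contDiff_ovalVelocity (e : C.EllipticNode) :
    ContDiff ℝ ∞ fun p : ℝ × ℝ => S.ovalVelocity e p.1 p.2 := by
  have h1 : ContDiff ℝ ∞ fun p : ℝ × ℝ => fderiv ℝ (S.lift (Sum.inr e))
      (p.1 * cos (2 * p.2), p.1 * sin (2 * p.2)) :=
    ((S.contDiff_lift _).fderiv_right (m := ∞) (by simp)).comp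
      (f := fun p : ℝ × ℝ => (p.1 * cos (2 * p.2), p.1 * sin (2 * p.2))) (by fun_prop)
  exact h1.clm_apply (by fun_prop)

lemma oval_imm (e : C.EllipticNode) (θ : ℝ) : S.oval e 1 θ ⨯₃ deriv (S.oval e 1) θ ≠ 0 := by
  rw [(S.hasDerivAt_oval e 1 θ).deriv, one_smul, ovalVelocity_eq]
  refine cross_combination_ne_zero (S.immAt_lift _ _) ?_
  by_contra! h
  have := Real.sin_sq_add_cos_sq (2 * θ)
  have h1 : sin (2 * θ) = 0 := by linarith [h.1]
  have h2 : cos (2 * θ) = 0 := by linarith [h.2]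
  rw [h1, h2] at this
  norm_num at this

/-- The branches of the curve, with the elliptic nodes replaced by ovals. -/
def branch : Option C.EllipticNode → ℝ → R3
  | none => C.loop
  | some e => S.oval e 1

lemma branch_some_ne_lift_inl (e : C.EllipticNode) (θ : ℝ) (k : C.HyperbolicNode) (z : ℝ × ℝ) :
    pt (S.branch (some e) θ) ≠ pt (S.lift (Sum.inl k) z) := fun h =>
  Sum.inr_ne_inl (S.lift_inj h).1

lemma eventually_branch {k : C.HyperbolicNode} {a : ℝ → ℝ} {ℓ : ℝ → ℝ × ℝ} (hc : Continuous a)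
    (hm : StrictMono a) (ha : ∀ u, C.MapsTo (circlePoint (a u)) (S.chart (Sum.inl k) (ℓ u)))
    (h0 : ℓ 0 = 0) :
    ∃ c θ, pt (S.branch c θ) = pt (S.lift (Sum.inl k) 0) ∧
      ∀ᶠ t in 𝓝 θ, ∃ u : ℝ, pt (S.branch c t) = pt (S.lift (Sum.inl k) (ℓ u)) := by
  have h : ∀ u, pt (C.loop (a u)) = pt (S.lift (Sum.inl k) (ℓ u)) := fun u => by
    rw [S.pt_lift]; exact mapsTo_circle.1 (ha u)
  refine ⟨none, a 0, h0 ▸ h 0, ?_⟩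
  filter_upwards [Ioo_mem_nhds (hm (show (-1 : ℝ) < 0 by norm_num)) (hm one_pos)] with t ht
  obtain ⟨u, -, rfl⟩ := intermediate_value_Icc (by norm_num : (-1 : ℝ) ≤ 1) hc.continuousOn
    (Ioo_subset_Icc_self ht)
  exact ⟨u, h u⟩

/-- The nodal curve that consists of the real branches and of the ovals. -/
def nodalCurve : NodalCurve C.HyperbolicNode (Option C.EllipticNode) where
  toChartFamily := S.family Sum.inl Sum.inl_injective
  γ := S.branch
  γ_smooth
    | none => contDiff_loop
    | some e => (S.contDiff_oval e).comp (f := fun θ : ℝ => ((1 : ℝ), θ)) (by fun_prop)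
  period c := c.elim (-1) fun _ => 1
  period_ne
    | none => by simp
    | some e => by simp
  γ_add_pi
    | none, θ => C.loop_add_pi θ
    | some e, θ => by
      simp only [branch, oval, mul_add, Real.cos_add_two_pi, Real.sin_add_two_pi]
      simp
  γ_imm
    | none, θ => loop_imm θ
    | some e, θ => S.oval_imm e θ
  cross k z := by
    refine Iff.trans ⟨?_, fun ⟨θ, h⟩ => ⟨none, θ, h⟩⟩ (S.loop_eq_lift_iff k z)
    rintro ⟨_ | e, θ, h⟩
    · exact ⟨θ, h⟩
    · exact absurd h (S.branch_some_ne_lift_inl e θ k z)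
  γ_inj := by
    rintro (_ | e) θ (_ | e') θ' h
    · rcases loop_inj h with h | ⟨k, h⟩
      · exact Or.inl ⟨rfl, h⟩
      · exact Or.inr ⟨k, h.trans (S.pt_lift_inl_zero k).symm⟩
    · exact absurd h (S.loop_ne_lift _ _ _)
    · exact absurd h.symm (S.loop_ne_lift _ _ _)
    · obtain ⟨h1, h2⟩ := S.lift_inj h
      simp only [one_mul, Prod.mk.injEq] at h2
      exact Or.inl ⟨congrArg some (Sum.inr_injective h1), eq_add_int_of_two_mul h2.1 h2.2⟩
  diag k := by
    obtain ⟨a, b, ha, hm, h, -⟩ := S.oriented k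
    exact S.eventually_branch (ℓ := fun u => (u, u)) ha hm h rfl
  antidiag k := by
    obtain ⟨a, b, -, -, -, hb, hm, h⟩ := S.oriented k
    exact S.eventually_branch (ℓ := fun u => (u, -u)) hb hm h (by simp)

lemma diagram_eq : S.diagram = S.nodalCurve.smoothed S.profile := by
  have hF : ∀ k, (fun z => pt (S.nodalCurve.F k z)) = S.chart (Sum.inl k) := fun k =>
    funext fun z => S.pt_lift _ z
  have hcurve : S.diagram.curve = (S.nodalCurve.smoothed S.profile).curve := by
    simp only [diagram, NodalCurve.smoothed, hF]
    rw [union_right_comm]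
    congr 1
    ext x
    simp only [mem_union, Set.mem_sdiff, mem_iUnion, NodalCurve.points, mem_ofPred_eq, not_exists,
      mem_image]
    constructor
    · rintro (⟨hx, hn⟩ | ⟨e, z, hz, rfl⟩)
      · refine ⟨?_, fun k => hn (Sum.inl k)⟩
        rcases mem_realPoints.1 hx with ⟨θ, h⟩ | ⟨e, rfl⟩
        · exact ⟨none, θ, h⟩
        · exact absurd ⟨0, S.center (Sum.inr e)⟩ (hn (Sum.inr e))
      · obtain ⟨θ, rfl⟩ := exists_two_mul_angle hz
        refine ⟨⟨some e, θ, ?_⟩, fun k hk => ?_⟩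
        · rw [← S.pt_lift]
          change pt (S.oval e 1 θ) = _
          simp [oval]
        · exact Set.disjoint_left.1 (S.disjoint (Sum.inl k) (Sum.inr e) Sum.inl_ne_inr) hk ⟨_, rfl⟩
    · rintro ⟨⟨_ | e, θ, rfl⟩, hn⟩
      · refine Or.inl ⟨mem_realPoints.2 (Or.inl ⟨θ, rfl⟩), ?_⟩
        rintro (k | e)
        · exact hn k
        · rintro ⟨z, hz⟩
          exact S.loop_ne_lift θ e z ((S.pt_lift _ _).trans hz).symm
      · refine Or.inr ⟨e, (cos (2 * θ), sin (2 * θ)), Real.cos_sq_add_sin_sq _, ?_⟩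
        rw [← S.pt_lift]
        change _ = pt (S.oval e 1 θ)
        simp [oval]
  have hint : S.diagram.interval = (S.nodalCurve.smoothed S.profile).interval := by
    simp only [diagram, NodalCurve.smoothed, hF]
  calc S.diagram = ⟨S.diagram.curve, S.diagram.interval⟩ := rfl
    _ = _ := by rw [hcurve, hint]

/-! ### Lines and the curve with small ovals -/

/-- The line `a` has at most five intersection points, stably, with the real branches and the ovals
of size `ε`. -/
def LineBound [Fintype C.EllipticNode] (a : R3) (ε : ℝ) : Prop :=
  ∃ N : Option C.EllipticNode → ℕ, ∑ c, N c ≤ 5 ∧ StableZeros (fun θ => a ⬝ᵥ C.loop θ) (N none) ∧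
    ∀ e, StableZeros (fun θ => a ⬝ᵥ S.oval e ε θ) (N (some e))

lemma eventually_stableZeros_oval (e : C.EllipticNode) {a₀ : R3} (ha : a₀ ≠ 0) : open Classical in
    ∀ᶠ p : R3 × ℝ in 𝓝 (a₀, 0), 0 < p.2 →
      StableZeros (fun θ => p.1 ⬝ᵥ S.oval e p.2 θ) (if a₀ ⬝ᵥ e.1.coords = 0 then 2 else 0) := by
  have hdot : ∀ {f : (R3 × ℝ) × ℝ → R3}, ContDiff ℝ ∞ f →
      ContDiff ℝ ∞ fun q : (R3 × ℝ) × ℝ => q.1.1 ⬝ᵥ f q := fun {f} hf => by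
    simp only [dotProduct, Fin.sum_univ_three]; fun_prop
  have hzero : a₀ ⬝ᵥ e.1.coords = 0 ↔ a₀ ⬝ᵥ S.lift (Sum.inr e) 0 = 0 := by
    obtain ⟨c, hc, h⟩ := (pt_eq_iff (S.immAt_lift (Sum.inr e) 0).ne_zero e.1.coords_ne_zero).1
      ((S.pt_lift_inr_zero e).trans (pt_coords _).symm)
    rw [h, dotProduct_smul, smul_eq_mul, mul_eq_zero, or_iff_right hc]
  split_ifs with h0 <;> rw [hzero] at h0
  · have h1 : StableZeros (fun θ => a₀ ⬝ᵥ S.ovalVelocity e 0 θ) 2 := by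
      have h2 := StableZeros.sinusoid
        (exists_dot_ne_zero_of_trip (S.immAt_lift (Sum.inr e) 0) ha h0)
      have h3 := h2.const_mul (two_ne_zero (α := ℝ))
      convert h3 using 2 with θ
      rw [ovalVelocity_eq, dotProduct_add, dotProduct_smul, dotProduct_smul]
      simp only [zero_mul, smul_eq_mul, Prod.mk_zero_zero]
      ring
    have h2 := StableZeros.eventually (E := R3 × ℝ) (e₀ := (a₀, (0 : ℝ)))
      (h := fun q => q.1.1 ⬝ᵥ S.ovalVelocity e q.1.2 q.2)
      (hdot ((S.contDiff_ovalVelocity e).comp (f := fun q : (R3 × ℝ) × ℝ => (q.1.2, q.2))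
        (by fun_prop))) h1
    filter_upwards [h2] with p hp hpos
    refine StableZeros.of_deriv ?_
    convert hp.const_mul hpos.ne' using 2 with θ
    rw [(hasDerivAt_dot p.1 (S.hasDerivAt_oval e p.2 θ)).deriv, dotProduct_smul, smul_eq_mul]
  · have h1 : StableZeros (fun θ => a₀ ⬝ᵥ S.oval e 0 θ) 0 := by
      refine StableZeros.of_ne_zero ?_ fun θ => ?_
      · exact (contDiff_dot a₀).comp ((S.contDiff_oval e).comp (f := fun θ : ℝ => ((0 : ℝ), θ))
          (by fun_prop))
      · simpa [oval, Prod.mk_zero_zero] using h0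
    filter_upwards [StableZeros.eventually (E := R3 × ℝ) (e₀ := (a₀, (0 : ℝ)))
      (h := fun q => q.1.1 ⬝ᵥ S.oval e q.1.2 q.2)
      (hdot ((S.contDiff_oval e).comp (f := fun q : (R3 × ℝ) × ℝ => (q.1.2, q.2))
        (by fun_prop))) h1] with p hp _ using hp

lemma eventually_lineBound [Fintype C.EllipticNode] {a₀ : R3} (ha : a₀ ≠ 0) :
    ∀ᶠ p : R3 × ℝ in 𝓝 (a₀, 0), 0 < p.2 → S.LineBound p.1 p.2 := by
  classical
  obtain ⟨s, Z, m, hZ, hm, hN⟩ := exists_orders (C := C) ha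
  have hl : ContDiff ℝ ∞ C.loop := contDiff_loop
  have h1 := StableZeros.of_orders ((contDiff_dot a₀).comp hl) s Z m hZ hm
  have h2 := StableZeros.eventually (E := R3) (e₀ := a₀) (h := fun q => q.1 ⬝ᵥ C.loop q.2) (by
    simp only [dotProduct, Fin.sum_univ_three]; fun_prop) h1
  filter_upwards [(continuous_fst.tendsto (a₀, (0 : ℝ))).eventually h2,
    eventually_all.2 fun e => S.eventually_stableZeros_oval e ha] with p hp1 hp2 hpos
  refine ⟨fun c => c.elim (∑ z ∈ Z, m z) fun e => if a₀ ⬝ᵥ e.1.coords = 0 then 2 else 0, ?_, hp1,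
    fun e => hp2 e hpos⟩
  rw [Fintype.sum_option]
  simp only [Option.elim_none, Option.elim_some]
  rw [← Finset.sum_filter, Finset.sum_const, smul_eq_mul, mul_comm]
  exact hN

lemma bezout [Fintype C.EllipticNode] : S.nodalCurve.Bezout := by
  intro n P hP
  set Ce := S.family Sum.inr Sum.inr_injective with hCe
  have : Nonempty HD := ⟨(Ce.exists_shrink one_pos le_rfl).choose⟩
  choose! Θ hΘ hfix using fun (ε : ℝ) (h : 0 < ε ∧ ε ≤ 1) => Ce.exists_shrink h.1 h.2
  obtain ⟨ε, h0, h1, h⟩ := exists_of_eventually_covector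
    (a := fun ε i => Θ ε (P i false) ⨯₃ Θ ε (P i true)) (fun ε _ _ i h => by
      have h0 : P i false ≠ 0 := fun h => hP i (by rw [h]; simp)
      have h1 : P i true ≠ 0 := fun h => hP i (by rw [h]; simp)
      rw [← pt_eq_iff_cross ((Θ ε).ne_zero h0) ((Θ ε).ne_zero h1), (Θ ε).pt_eq_iff h0 h1,
        pt_eq_iff_cross h0 h1] at h
      exact hP i h) fun a₀ ha₀ => S.eventually_lineBound ha₀
  refine ⟨Θ ε, fun k z => hfix ε ⟨h0, h1⟩ _ fun e w hw => Sum.inl_ne_inr (S.lift_inj hw).1, fun i => ?_⟩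
  obtain ⟨c, hc, N, hN, hloop, hoval⟩ := h i
  have key : ∀ {v : R3} (w : ℝ → R3) {M : ℕ}, StableZeros (fun θ => (c • v) ⬝ᵥ w θ) M →
      StableZeros (fun θ => v ⬝ᵥ w θ) M := fun {v} w {M} h => by
    convert h.const_mul (inv_ne_zero hc) using 2 with θ
    rw [smul_dotProduct, smul_eq_mul, inv_mul_cancel_left₀ hc]
  refine ⟨N, hN, ?_⟩
  rintro (_ | e)
  · convert key _ hloop using 3 with θ
    exact hfix ε ⟨h0, h1⟩ _ fun e z => S.loop_ne_lift θ e z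
  · convert key _ (hoval e) using 3 with θ
    have := hΘ ε ⟨h0, h1⟩ e (cos (2 * θ), sin (2 * θ)) (Real.abs_cos_le_one _)
      (Real.abs_sin_le_one _)
    change Θ ε (S.lift (Sum.inr e) (1 * _, 1 * _)) = _
    rw [one_mul, one_mul]
    exact this

theorem hasQuasilines : S.diagram.HasQuasilines := by
  have := S.finite_hyperbolicNode
  have := S.finite_ellipticNode
  have := Fintype.ofFinite C.EllipticNode
  rw [diagram_eq]
  exact S.bezout.hasQuasilines S.profile_smooth S.profile_pos S.profile_eq

end Smoothing

end NodalRationalQuintic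

end

theorem mainTheorem11 (C : NodalRationalQuintic) (Δ : Diagram C.HyperbolicNode)
    (hΔ : C.IsSmoothingDiagram Δ) :
    (∀ p q : RP2, (∀ k, p ∉ Δ.endpoints k) → (∀ k, q ∉ Δ.endpoints k) →
      ∃ L : Set RP2, Δ.IsQuasiline L ∧ p ∈ L ∧ q ∈ L) ∧
    (∀ (n : ℕ) (p q : Fin n → RP2), (∀ i k, p i ∉ Δ.endpoints k) → (∀ i k, q i ∉ Δ.endpoints k) →
      (∀ i j, i ≠ j → ¬ Δ.Collapsed (p i) (q i) →
        ¬ (Δ.Collapsed (p i) (p j) ∧ Δ.Collapsed (q i) (q j)) ∧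
        ¬ (Δ.Collapsed (p i) (q j) ∧ Δ.Collapsed (q i) (p j))) →
      ∃ L : Fin n → Set RP2, (∀ i, Δ.IsQuasiline (L i) ∧ p i ∈ L i ∧ q i ∈ L i) ∧ ∀ i j, i ≠ j →
          (∃ x, L i ∩ L j = {x} ∧ TransverseAt (L i) (L j) x) ∨
          (∃ k, L i ∩ L j = Δ.interval k)) := by
  obtain ⟨S, Φ, hΦ, rfl⟩ := hΔ
  have h : (S.diagram.map Φ).HasQuasilines := S.hasQuasilines.map hΦ
  refine ⟨fun p q hp hq => ?_, h⟩
  obtain ⟨L, hL, -⟩ := h 1 (fun _ => p) (fun _ => q) (fun _ => hp) (fun _ => hq)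
    fun i j hij => absurd (Subsingleton.elim i j) hij
  exact ⟨L 0, hL 0⟩
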